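/- **Setting.** Let $\kappa=-1$ (defocusing) or $\kappa=+1$ (focusing) and consider the Kundu--Eckhaus equation $iu_t+u_{xx}+2\kappa|u|^2u+4T^2|u|^4u-4iT\kappa(|u|^2)_xu=0$ with real parameter $T$ and non-zero boundary values $u\sim q_\pm e^{i\Upsilon(x,t)}$ as $x\to\pm\infty$, where $q_\pm=q_0e^{i\theta_\pm}$, $q_0>0$, and $e^{i\Upsilon}$, $\Upsilon=\alpha x+ct$, is the background plane wave. Put $q=ue^{-i\Upsilon}$, fix a time $t$ and write $q(x)=q(x,t)$. All that is used of $q$ is that it is continuous with $q(x)\to q_\pm$ as $x\to\pm\infty$, and that $q-q_\pm\in L^{1,m}(\mathbb R^\pm)$, i.e. $\int_{\mathbb R^\pm}(1+|x|)^m|q-q_\pm|\,dx<\infty$, with $m=2$ for $\kappa=-1$ and $m=1$ for $\kappa=1$. For $\zeta\in\mathbb C\setminus\{0\}$ put $k=\frac12(\zeta-\kappa q_0^2\zeta^{-1})$, $\lambda=\frac12(\zeta+\kappa q_0^2\zeta^{-1})$, $z=k+\kappa Tq_0^2-\frac\alpha2$ and $\Theta=\lambda\,(x+2(z+\kappa Tq_0^2-\frac\alpha2)t)$.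 The Jost solutions $\psi_\pm$ are the solutions, column by column, of $$\psi_x=\begin{pmatrix}-i(z-\kappa T|q|^2+\frac\alpha2)&q\\-\kappa\bar q&i(z-\kappa T|q|^2+\frac\alpha2)\end{pmatrix}\psi,\qquad \psi_\pm\sim\begin{pmatrix}1&-iq_\pm\zeta^{-1}\\-i\kappa\bar q_\pm\zeta^{-1}&1\end{pmatrix}e^{-i\Theta\sigma_3}\quad(x\to\pm\infty).$$ With columns $\psi_{\pm1},\psi_{\pm2}$ and $\Delta=1+\kappa q_0^2\zeta^{-2}$, the scattering matrix $s=\begin{pmatrix}a&\tilde b\\b&\tilde a\end{pmatrix}$ in $\psi_-=\psi_+s$ is given by $a=\det(\psi_{-1},\psi_{+2})/\Delta$, $\tilde a=\det(\psi_{+1},\psi_{-2})/\Delta$, $b=\det(\psi_{+1},\psi_{-1})/\Delta$; $a$ extends to $\{\operatorname{Im}\lambda>0\}$, $\tilde a$ to $\{\operatorname{Im}\lambda<0\}$. Let $r=b/a$ and $\omega_0=T\int_{\mathbb R}\kappa(|q|^2-q_0^2)\,dx$; this integral converges absolutely. **(1) Defocusing case, $\kappa=-1$.** Let $\zeta_1,\dots,\zeta_N$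 (distinct, $N\ge0$) be all the zeros of $a$ in the open upper half-plane. Then, with absolutely convergent integrals, $$a(\zeta)=\exp\Big[-\frac1{2\pi i}\int_{\mathbb R}\frac{\log(1-|r(\eta)|^2)}{\eta-\zeta}d\eta\Big]\prod_{j=1}^N\frac{\zeta-\zeta_j}{\zeta-\bar\zeta_j}\;e^{i\omega_0}\qquad(\operatorname{Im}\zeta>0),$$ $$\tilde a(\zeta)=\exp\Big[\frac1{2\pi i}\int_{\mathbb R}\frac{\log(1-|r(\eta)|^2)}{\eta-\zeta}d\eta\Big]\prod_{j=1}^N\frac{\zeta-\bar\zeta_j}{\zeta-\zeta_j}\;e^{-i\omega_0}\qquad(\operatorname{Im}\zeta<0),$$ $$\arg\frac{q_+}{q_-}-2\omega_0\equiv2\sum_{j=1}^N\arg\zeta_j+\frac1{2\pi}\int_{\mathbb R}\frac{\log(1-|r(\eta)|^2)}{\eta}d\eta\pmod{2\pi}.$$ **(2) Focusing case, $\kappa=1$.** Let $D_1=\{(|\zeta|^2-q_0^2)\operatorname{Im}\zeta>0\}$, $D_2=\{(|\zeta|^2-q_0^2)\operatorname{Im}\zeta<0\}$, and let $\Sigma=\mathbb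 R\cup\{|\zeta|=q_0\}$ be oriented with $D_1$ on its left. Assume that there are no spectral singularities: $0$ is not a limit value of $a|_{D_1}$ at any point of $\Sigma$ (including the branch points $\pm iq_0$). Let $\zeta_1,\dots,\zeta_N$ (distinct, $N\ge0$) be all the zeros of $a$ with $|\zeta|>q_0$, $\operatorname{Im}\zeta>0$, and assume that all of them are simple ($p=1$), or that all of them are double ($p=2$). Then there is a continuous function $\ell(\eta)=\log[1+r(\eta)\overline{r(\bar\eta)}]$ on $\Sigma\setminus\{0,\pm iq_0\}$ (a logarithm of $1+r(\eta)\overline{r(\bar\eta)}$) that is real on the real axis and, with absolutely convergent integrals, $$a(\zeta)=\exp\Big[-\frac1{2\pi i}\int_\Sigma\frac{\ell(\eta)}{\eta-\zeta}d\eta\Big]\prod_{j=1}^N\frac{(\zeta-\zeta_j)^p(\zeta+q_0^2\bar\zeta_j^{-1})^p}{(\zeta-\bar\zeta_j)^p(\zeta+q_0^2\zeta_j^{-1})^p}\;e^{i\omega_0}\qquad(\zeta\in D_1),$$ $$\tilde a(\zeta)=\exp\Big[\frac1{2\pi i}\int_\Sigma\frac{\ell(\eta)}{\eta-\zeta}d\eta\Big]\prod_{j=1}^N\frac{(\zeta-\bar\zeta_j)^p(\zeta+q_0^2\zeta_j^{-1})^p}{(\zeta-\zeta_j)^p(\zeta+q_0^2\bar\zeta_j^{-1})^p}\;e^{-i\omega_0}\qquad(\zeta\in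 D_2),$$ $$\arg\frac{q_+}{q_-}-2\omega_0\equiv4p\sum_{j=1}^N\arg\zeta_j+\frac1{2\pi}\int_\Sigma\frac{\ell(\eta)}{\eta}d\eta\pmod{2\pi}$$ (so the weights of $\arg\zeta_j$ are $4$ for simple and $8$ for double zeros). -/

import Mathlib

open scoped Matrix ComplexConjugate Topology
open MeasureTheory Filter

noncomputable section

namespace KE

/-- The profile `x ↦ q(x,t)` at a time `t` of the (gauge transformed) field of a Kundu-Eckhaus
equation with parameters `T`, `α` and non-zero boundary values: `q` is continuous and
`q(x,t) → q₋, q₊` as `x → -∞, +∞`, with `|q₋| = |q₊| = q₀ > 0`. If `u` is the field itself, then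
`q = u exp(-iΥ)` with `Υ = α x + c t` (`c` real) the phase of the background plane wave. -/
structure NZProfile where
  T : ℝ
  α : ℝ
  t : ℝ
  q₀ : ℝ
  q : ℝ → ℂ
  qp : ℂ
  qm : ℂ
  q₀_pos : 0 < q₀
  norm_qp : ‖qp‖ = q₀
  norm_qm : ‖qm‖ = q₀
  continuous_q : Continuous q
  tendsto_qp : Tendsto q atTop (𝓝 qp)
  tendsto_qm : Tendsto q atBot (𝓝 qm)

/-- `ψ` solves `ψ_x = X ψ` on the line and `exp(-Φ(x)) ψ(x) → e` along `l`. -/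
def IsJostColumn (X : ℝ → Matrix (Fin 2) (Fin 2) ℂ) (l : Filter ℝ) (Φ : ℝ → ℂ) (e : Fin 2 → ℂ)
    (ψ : ℝ → Fin 2 → ℂ) : Prop :=
  (∀ x, HasDerivAt ψ (X x *ᵥ ψ x) x) ∧ Tendsto (fun x => Complex.exp (-Φ x) • ψ x) l (𝓝 e)

/-- The solution of `ψ_x = X ψ` with the asymptotics `exp(Φ(x)) e` along `l`. -/
def jostColumn (X : ℝ → Matrix (Fin 2) (Fin 2) ℂ) (l : Filter ℝ) (Φ : ℝ → ℂ) (e : Fin 2 → ℂ) :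
    ℝ → Fin 2 → ℂ :=
  Classical.epsilon (IsJostColumn X l Φ e)

/-- The Wronskian `W[v, w] = det (v, w)`. -/
def wr (v w : Fin 2 → ℂ) : ℂ := v 0 * w 1 - v 1 * w 0

namespace NZProfile

variable (κ : ℝ) (D : NZProfile)

/-- `q - q_± ∈ L^{1,m}(ℝ^±)`: integrability with the weight `(1+|x|)^m`. -/
def Decays (m : ℕ) : Prop :=
  IntegrableOn (fun x : ℝ => (1 + |x|) ^ m * ‖D.q x - D.qp‖) (Set.Ici 0) ∧
  IntegrableOn (fun x : ℝ => (1 + |x|) ^ m * ‖D.q x - D.qm‖) (Set.Iic 0)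

/-! Throughout, `κ = -1` is the defocusing case and `κ = 1` the focusing case.
The uniformization variable is `ζ`. -/

/-- The shifted spectral parameter `(ζ - κ q₀²/ζ)/2`. -/
def k (ζ : ℂ) : ℂ := (ζ - κ * D.q₀ ^ 2 * ζ⁻¹) / 2

/-- `λ = (ζ + κ q₀²/ζ)/2`, so that `λ² = k² + κ q₀²`. -/
def lam (ζ : ℂ) : ℂ := (ζ + κ * D.q₀ ^ 2 * ζ⁻¹) / 2

/-- The spectral parameter `z`, from `k = z - κ T q₀² + α/2`. -/
def z (ζ : ℂ) : ℂ := D.k κ ζ + κ * D.T * D.q₀ ^ 2 - D.α / 2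

/-- `Θ(x,t,ζ) = λ (x + 2 (z + κ T q₀² - α/2) t)`. -/
def Theta (ζ : ℂ) (x : ℝ) : ℂ :=
  D.lam κ ζ * (x + 2 * (D.z κ ζ + κ * D.T * D.q₀ ^ 2 - D.α / 2) * D.t)

/-- The matrix of the `x`-part of the Lax pair, `X = Q - i (z - κ T |q|² + α/2) σ₃` with
`Q = (0, q; -κ q̄, 0)`. -/
def X (ζ : ℂ) (x : ℝ) : Matrix (Fin 2) (Fin 2) ℂ :=
  !![-Complex.I * (D.z κ ζ - κ * D.T * ‖D.q x‖ ^ 2 + D.α / 2), D.q x;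
     -κ * conj (D.q x), Complex.I * (D.z κ ζ - κ * D.T * ‖D.q x‖ ^ 2 + D.α / 2)]

/-! The Jost solutions `ψ_± ∼ E_± exp(-iΘσ₃)` as `x → ±∞`, column by column, where
`E_± = (1, -i q_±/ζ; -i κ q̄_±/ζ, 1)`. -/

/-- First column of `ψ₋`. -/
def psiM1 (ζ : ℂ) : ℝ → Fin 2 → ℂ :=
  jostColumn (D.X κ ζ) atBot (fun x => -Complex.I * D.Theta κ ζ x)
    ![1, -Complex.I * κ * conj D.qm * ζ⁻¹]

/-- Second column of `ψ₋`. -/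
def psiM2 (ζ : ℂ) : ℝ → Fin 2 → ℂ :=
  jostColumn (D.X κ ζ) atBot (fun x => Complex.I * D.Theta κ ζ x)
    ![-Complex.I * D.qm * ζ⁻¹, 1]

/-- First column of `ψ₊`. -/
def psiP1 (ζ : ℂ) : ℝ → Fin 2 → ℂ :=
  jostColumn (D.X κ ζ) atTop (fun x => -Complex.I * D.Theta κ ζ x)
    ![1, -Complex.I * κ * conj D.qp * ζ⁻¹]

/-- Second column of `ψ₊`. -/
def psiP2 (ζ : ℂ) : ℝ → Fin 2 → ℂ :=
  jostColumn (D.X κ ζ) atTop (fun x => Complex.I * D.Theta κ ζ x)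
    ![-Complex.I * D.qp * ζ⁻¹, 1]

/-- `det E_± = det ψ_±`. -/
def detE (ζ : ℂ) : ℂ := 1 + κ * D.q₀ ^ 2 * ζ⁻¹ ^ 2

/-! The scattering matrix `s = (a, b̃; b, ã)`, `ψ₋ = ψ₊ s`, in its Wronskian representation (Cramer's
rule; the Wronskians do not depend on `x` because `X` is traceless). The representation of `a`
(resp. `ã`) is the analytic extension off the continuous spectrum to `Im λ > 0` (resp. `< 0`). -/

/-- The coefficient `a(ζ)`. -/
def a (ζ : ℂ) : ℂ := wr (D.psiM1 κ ζ 0) (D.psiP2 κ ζ 0) / D.detE κ ζ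

/-- The coefficient `ã(ζ)`. -/
def aTilde (ζ : ℂ) : ℂ := wr (D.psiP1 κ ζ 0) (D.psiM2 κ ζ 0) / D.detE κ ζ

/-- The coefficient `b(ζ)`. -/
def b (ζ : ℂ) : ℂ := wr (D.psiP1 κ ζ 0) (D.psiM1 κ ζ 0) / D.detE κ ζ

/-- The reflection coefficient `r = b / a`. -/
def r (ζ : ℂ) : ℂ := D.b κ ζ / D.a κ ζ

/-- `ω₀ = T ∫ (q₀² - |q|²) dx` for `κ = -1` and `ω₀ = T ∫ (|q|² - q₀²) dx` for `κ = 1`. -/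
def omega0 : ℝ := D.T * ∫ x : ℝ, κ * (‖D.q x‖ ^ 2 - D.q₀ ^ 2)

/-! The focusing case (`κ = 1`): regions, contour, logarithm. -/

/-- `D₁ = {ζ : (|ζ|² - q₀²) Im ζ > 0}`. -/
def D₁ : Set ℂ := {ζ | 0 < (‖ζ‖ ^ 2 - D.q₀ ^ 2) * ζ.im}

/-- `D₂ = {ζ : (|ζ|² - q₀²) Im ζ < 0}`. -/
def D₂ : Set ℂ := {ζ | (‖ζ‖ ^ 2 - D.q₀ ^ 2) * ζ.im < 0}

/-- `Σ`, the union of the real line and the circle of radius `q₀`. -/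
def contour : Set ℂ := {ζ | ζ.im = 0 ∨ ‖ζ‖ = D.q₀}

/-- The contour without the origin and the branch points `±i q₀`. -/
def puncturedContour : Set ℂ :=
  D.contour \ {0, Complex.I * D.q₀, -(Complex.I * D.q₀)}

/-- `∫_Σ f(η) dη`, where `Σ` is oriented so that `D₁` lies on its left: the two outer rays from left
to right, the segment `[-q₀, q₀]` from right to left, and both semicircles from `-q₀` to `q₀`. -/
def contourIntegral (f : ℂ → ℂ) : ℂ :=
  (∫ x in Set.Iic (-D.q₀), f (x : ℂ)) + (∫ x in Set.Ici D.q₀, f (x : ℂ))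
    - (∫ x in (-D.q₀)..D.q₀, f (x : ℂ))
    - (∫ φ in (0 : ℝ)..Real.pi, f (circleMap 0 D.q₀ φ) * (Complex.I * circleMap 0 D.q₀ φ))
    + (∫ φ in (-Real.pi)..(0 : ℝ), f (circleMap 0 D.q₀ φ) * (Complex.I * circleMap 0 D.q₀ φ))

/-- Absolute convergence of `∫_Σ f(η) dη`. -/
def ContourIntegrable (f : ℂ → ℂ) : Prop :=
  Integrable (fun x : ℝ => f (x : ℂ)) ∧
  IntervalIntegrable (fun φ : ℝ => f (circleMap 0 D.q₀ φ)) volume (-Real.pi) Real.pi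

/-- `ℓ = log[1 + r(η) conj(r(η̄))]` along `Σ`: the continuous logarithm that is real on the real
axis. These conditions determine `ℓ` on the punctured contour. -/
def IsContourLog (ℓ : ℂ → ℂ) : Prop :=
  ContinuousOn ℓ D.puncturedContour ∧
  (∀ η ∈ D.puncturedContour,
    Complex.exp (ℓ η) = 1 + D.r 1 η * conj (D.r 1 (conj η))) ∧
  ∀ x : ℝ, x ≠ 0 → (ℓ x).im = 0

/-- No spectral singularities: `0` is not a limit value of `a` at any point of `Σ`. -/
def NoSpectralSingularity : Prop :=
  ∀ σ ∈ D.contour, ¬ MapClusterPt 0 (𝓝[D.D₁] σ) (D.a 1)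

/-- `ζs` enumerates without repetition the zeros of `a` with `|ζ| > q₀` and `Im ζ > 0`. -/
def EnumeratesZeros {N : ℕ} (ζs : Fin N → ℂ) : Prop :=
  Function.Injective ζs ∧
  Set.range ζs = {ζ | D.q₀ < ‖ζ‖ ∧ 0 < ζ.im ∧ D.a 1 ζ = 0}

end NZProfile

end KE

end

noncomputable section

namespace KE

open Complex (I I_ne_zero I_sq add_conj add_im add_re arg conjCLE conj_I conj_conj conj_im
  conj_mul' conj_ofReal continuous_conj continuous_exp continuous_im differentiable_exp dist_eq
  div_I div_ofNat_im exp exp_add exp_conj exp_im exp_log exp_nat_mul exp_ne_zero exp_neg exp_sub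
  exp_sum exp_zero ext im imLm im_ofReal_mul inv_im log_im log_re mem_reProdIm mem_slitPlane_iff
  mul_conj mul_im mul_re neg_im normSq normSq_eq_norm_sq norm_I norm_exp norm_real ofReal_exp
  ofReal_im ofReal_re ofReal_sub ofReal_zero re reCLM reLm re_mul_ofReal real_smul slitPlane
  sub_im zero_im)
open Real (abs_exp exp_pos log log_exp norm_eq_abs norm_of_nonneg pi_pos tendsto_exp_atBot
  tendsto_exp_atTop)
open Set (Icc Ici Iic Iio Ioi Ioo Ioo_subset_Icc_self indicator_of_mem mem_insert_iff
  mem_singleton_iff range uIcc uIcc_of_le uIoc_of_le)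
open Finset (mem_insert mem_singleton mem_univ prod_congr prod_eq_zero prod_mul_distrib
  prod_ne_zero_iff prod_pow univ)
open intervalIntegral (integral_Iic_add_Ioi integral_Iic_sub_Iic integral_add_adjacent_intervals)
open Metric (ball ball_mem_nhds mem_ball)
open RCLike (norm_conj norm_ofNat)
open scoped Real

theorem ae_Iic {x : ℝ} {p : ℝ → Prop} (h : ∀ s ≤ x, p s) : ∀ᵐ s ∂volume.restrict (Iic x), p s :=
  (ae_restrict_iff' measurableSet_Iic).2 (Eventually.of_forall h)

theorem integrableOn_Iic_of_continuous {E : Type*} [NormedAddCommGroup E] {f : ℝ → E}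
    (hc : Continuous f) (h : IntegrableOn f (Iic 0)) (b : ℝ) : IntegrableOn f (Iic b) :=
  (h.union (hc.integrableOn_Icc (a := 0) (b := b))).mono_set fun x hx =>
    (le_total x 0).imp id fun h => ⟨h, hx⟩

/-! ### Volterra equations with a holomorphic parameter -/

theorem differentiableOn_integral_of_dominated {α E : Type*} [MeasurableSpace α]
    [NormedAddCommGroup E] [NormedSpace ℂ E] [CompleteSpace E] {μ : Measure α} {U : Set ℂ}
    (hU : IsOpen U)
    {F : ℂ → α → E} {bound : α → ℝ} (hmeas : ∀ ζ ∈ U, AEStronglyMeasurable (F ζ) μ)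
    (hb : Integrable bound μ) (hF : ∀ᵐ a ∂μ, ∀ ζ ∈ U, ‖F ζ a‖ ≤ bound a)
    (hd : ∀ᵐ a ∂μ, DifferentiableOn ℂ (fun ζ => F ζ a) U) :
    DifferentiableOn ℂ (fun ζ => ∫ a, F ζ a ∂μ) U := fun z hz => by
  obtain ⟨r, hr, hball⟩ := Metric.isOpen_iff.1 hU z hz
  have hr2 : 0 < r / 2 := by linarith
  have hder : ∀ᵐ a ∂μ, ∀ w ∈ ball z (r / 2), HasDerivAt (fun ζ => F ζ a)
      (deriv (fun ζ => F ζ a) w) w := by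
    filter_upwards [hd] with a ha w hw
    have hwU : w ∈ U := hball (Metric.ball_subset_ball (by linarith) hw)
    exact ((ha w hwU).differentiableAt (hU.mem_nhds hwU)).hasDerivAt
  have hmeas' : AEStronglyMeasurable (fun a => deriv (fun ζ => F ζ a) z) μ := by
    have hlim : ∀ᵐ a ∂μ, Tendsto (fun n : ℕ => ((r / 2 / (n + 2) : ℝ) : ℂ)⁻¹ •
        (F (z + (r / 2 / (n + 2) : ℝ)) a - F z a)) atTop (𝓝 (deriv (fun ζ => F ζ a) z)) := by
      filter_upwards [hder] with a ha
      have h1 := (ha z (Metric.mem_ball_self hr2)).tendsto_slope_zero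
      refine h1.comp (tendsto_nhdsWithin_iff.2 ⟨?_, ?_⟩)
      · have h2 : Tendsto (fun n : ℕ => (r / 2 / (n + 2) : ℝ)) atTop (𝓝 0) := by
          refine Tendsto.div_atTop (a := r / 2) tendsto_const_nhds ?_
          exact tendsto_atTop_add_const_right _ _ tendsto_natCast_atTop_atTop
        have := (Complex.continuous_ofReal.tendsto 0).comp h2
        simpa [Function.comp_def] using this
      · refine Eventually.of_forall fun n => ?_
        have : (0 : ℝ) < r / 2 / (n + 2) := by positivity
        simp only [Set.mem_compl_iff, mem_singleton_iff, Complex.ofReal_eq_zero]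
        exact this.ne'
    refine aestronglyMeasurable_of_tendsto_ae atTop (fun n => ?_) hlim
    refine AEStronglyMeasurable.const_smul (AEStronglyMeasurable.sub (hmeas _ (hball ?_))
      (hmeas z hz)) _
    have h3 : (0 : ℝ) < r / 2 / (n + 2) := by positivity
    have h4 : r / 2 / ((n : ℝ) + 2) < r := by
      rw [div_lt_iff₀ (by positivity)]
      nlinarith [(Nat.cast_nonneg n : (0 : ℝ) ≤ n)]
    simp only [mem_ball, dist_self_add_left, norm_real, norm_eq_abs]
    rwa [abs_of_pos h3]
  have key := hasDerivAt_integral_of_dominated_loc_of_deriv_le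
    (F := F) (μ := μ) (x₀ := z) (s := ball z (r / 2)) (bound := fun a => bound a / (r / 2))
    (F' := fun ζ a => deriv (fun ζ => F ζ a) ζ)
    (ball_mem_nhds z hr2)
    (by filter_upwards [hU.mem_nhds hz] with w hw using hmeas w hw)
    (hb.mono' (hmeas z hz) (by filter_upwards [hF] with a ha using ha z hz))
    hmeas'
    (by
      filter_upwards [hF, hd] with a ha hda w hw
      refine Complex.norm_deriv_le_of_forall_mem_sphere_norm_le hr2 ?_ ?_
      · refine DifferentiableOn.diffContOnCl ?_
        rw [closure_ball _ hr2.ne']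
        refine hda.mono fun u hu => hball ?_
        rw [mem_ball] at *
        rw [Metric.mem_closedBall] at hu
        linarith [dist_triangle u w z]
      · intro u hu
        refine ha u (hball ?_)
        rw [mem_ball] at *
        rw [Metric.mem_sphere] at hu
        linarith [dist_triangle u w z])
    (hb.div_const _) hder
  exact key.2.differentiableAt.differentiableWithinAt

section Volterra

variable {E : Type*} [NormedAddCommGroup E] [NormedSpace ℂ E]

/-- The terms of the Neumann series of `u(x) = e + ∫_{-∞}^x K(x,s) u(s) ds`. -/
def volterraTerm (K : ℂ → ℝ → ℝ → E →L[ℂ] E) (e : ℂ → E) : ℕ → ℂ → ℝ → E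
  | 0 => fun ζ _ => e ζ
  | n + 1 => fun ζ x => ∫ s in Iic x, K ζ x s (volterraTerm K e n ζ s)

/-- The Neumann series of `u(x) = e + ∫_{-∞}^x K(x,s) u(s) ds`. -/
def volterraSol (K : ℂ → ℝ → ℝ → E →L[ℂ] E) (e : ℂ → E) (ζ : ℂ) (x : ℝ) : E :=
  ∑' n, volterraTerm K e n ζ x

/-- The primitive of a weight that vanishes at `-∞`. -/
def tailMass (ρ : ℝ → ℝ) (x : ℝ) : ℝ := ∫ s in Iic x, ρ s

variable {ρ : ℝ → ℝ} (hρc : Continuous ρ) (hρ0 : ∀ x, 0 ≤ ρ x) (hρi : ∀ b, IntegrableOn ρ (Iic b))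

theorem tendsto_integral_Iic_atBot {F : Type*} [NormedAddCommGroup F] [NormedSpace ℝ F]
    [CompleteSpace F] {f : ℝ → F} {b : ℝ} (hf : IntegrableOn f (Iic b)) :
    Tendsto (fun x => ∫ s in Iic x, f s) atBot (𝓝 0) := by
  have h := intervalIntegral_tendsto_integral_Iic b hf tendsto_id
  have h2 : Tendsto (fun x => (∫ s in Iic b, f s) - ∫ s in x..b, f s) atBot (𝓝 0) := by
    simpa using h.const_sub (∫ s in Iic b, f s)
  refine h2.congr' ?_
  filter_upwards [eventually_le_atBot b] with x hx
  rw [← integral_Iic_sub_Iic (hf.mono_set (Set.Iic_subset_Iic.2 hx)) hf]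
  abel

theorem hasDerivAt_integral_Iic {F : Type*} [NormedAddCommGroup F] [NormedSpace ℝ F]
    [CompleteSpace F] {f : ℝ → F} (hc : Continuous f) (hf : ∀ b, IntegrableOn f (Iic b))
    (x : ℝ) : HasDerivAt (fun x => ∫ s in Iic x, f s) (f x) x := by
  have h := (intervalIntegral.integral_hasDerivAt_right (hc.intervalIntegrable 0 x)
    (hc.stronglyMeasurableAtFilter _ _) hc.continuousAt).const_add (∫ s in Iic (0 : ℝ), f s)
  refine h.congr_of_eventuallyEq (Eventually.of_forall fun y => ?_)
  simp only
  rw [← integral_Iic_sub_Iic (hf 0) (hf y)]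
  abel

include hρ0 in
theorem tailMass_nonneg (x : ℝ) : 0 ≤ tailMass ρ x := integral_nonneg fun s => hρ0 s

include hρ0 hρi in
theorem tailMass_mono : Monotone (tailMass ρ) := fun _ y hxy =>
  setIntegral_mono_set (hρi y) (Eventually.of_forall hρ0) (Set.Iic_subset_Iic.2 hxy).eventuallyLE

include hρc hρ0 hρi in
theorem integrableOn_mul_exp_tailMass {M : ℝ} (hM : 0 < M) (x : ℝ) :
    IntegrableOn (fun s => ρ s * Real.exp (M * tailMass ρ s)) (Iic x) := by
  have hβc : Continuous (tailMass ρ) :=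
    continuous_iff_continuousAt.2 fun y => (hasDerivAt_integral_Iic hρc hρi y).continuousAt
  refine Integrable.mono' ((hρi x).mul_const (Real.exp (M * tailMass ρ x))) ?_ ?_
  · exact (hρc.mul (Real.continuous_exp.comp (hβc.const_mul M))).aestronglyMeasurable
  · refine ae_Iic fun s hs => ?_
    rw [norm_of_nonneg (mul_nonneg (hρ0 s) (exp_pos _).le)]
    gcongr
    · exact hρ0 s
    · exact tailMass_mono hρ0 hρi hs

include hρc hρ0 hρi in
theorem integral_mul_exp_tailMass_le {M : ℝ} (hM : 0 < M) (x : ℝ) :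
    ∫ s in Iic x, ρ s * Real.exp (M * tailMass ρ s) ≤ Real.exp (M * tailMass ρ x) / M := by
  have hd : ∀ s, HasDerivAt (fun s => Real.exp (M * tailMass ρ s) / M)
      (ρ s * Real.exp (M * tailMass ρ s)) s := fun s => by
    have := (((hasDerivAt_integral_Iic hρc hρi s).const_mul M).exp).div_const M
    refine this.congr_deriv ?_
    change Real.exp (M * tailMass ρ s) * (M * ρ s) / M = _
    field_simp
  have hlim : Tendsto (fun s => Real.exp (M * tailMass ρ s) / M) atBot (𝓝 (1 / M)) := by
    have := (tendsto_integral_Iic_atBot (hρi 0)).const_mul M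
    have h2 := (Real.continuous_exp.tendsto _).comp this
    simpa [tailMass, Function.comp_def] using h2.div_const M
  rw [integral_Iic_of_hasDerivAt_of_tendsto' (fun s _ => hd s)
    (integrableOn_mul_exp_tailMass hρc hρ0 hρi hM x) hlim]
  have : 0 < 1 / M := by positivity
  linarith

/-- A kernel that is dominated by a weight, and bounded data, on a set of parameters. -/
structure IsVolterra (ρ : ℝ → ℝ) (K : ℂ → ℝ → ℝ → E →L[ℂ] E) (e : ℂ → E) (Z : Set ℂ) (C : ℝ → ℝ)
    (M : ℝ) : Prop where
  ρc : Continuous ρ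
  ρ0 : ∀ x, 0 ≤ ρ x
  ρi : ∀ b, IntegrableOn ρ (Iic b)
  hK : ∀ b, ∀ ζ ∈ Z, ∀ x s, s ≤ x → x ≤ b → ‖K ζ x s‖ ≤ C b * ρ s
  hC : ∀ b, 0 < C b
  he : ∀ ζ ∈ Z, ‖e ζ‖ ≤ M
  hM : 0 ≤ M
  hKc : ∀ ζ ∈ Z, Continuous fun p : ℝ × ℝ => K ζ p.1 p.2

/-- The weight `exp (2 C β)`. -/
def volterraWeight (ρ : ℝ → ℝ) (C x : ℝ) : ℝ := Real.exp (2 * C * tailMass ρ x)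

theorem volterraWeight_pos (C x : ℝ) : 0 < volterraWeight ρ C x := exp_pos _

include hρ0 hρi in
theorem volterraWeight_le {b x : ℝ} {C : ℝ} (hC : 0 < C) (hx : x ≤ b) :
    volterraWeight ρ C x ≤ volterraWeight ρ C b := by
  rw [volterraWeight, volterraWeight]
  gcongr
  exact tailMass_mono hρ0 hρi hx

theorem summable_volterraBound (M : ℝ) (w : ℝ) : Summable fun n : ℕ => M * (1 / 2 : ℝ) ^ n * w :=
  (summable_geometric_two.mul_left M).mul_right w

variable {K : ℂ → ℝ → ℝ → E →L[ℂ] E} {e : ℂ → E} {Z : Set ℂ} {C : ℝ → ℝ} {M : ℝ}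
  (V : IsVolterra ρ K e Z C M)

include V

theorem IsVolterra.bound_nonneg (n : ℕ) : 0 ≤ M * (1 / 2 : ℝ) ^ n := mul_nonneg V.hM (by positivity)

theorem norm_volterraTerm_succ_le {v : ℝ → E} {L : ℝ → E →L[ℂ] E} {b A : ℝ} (hA : 0 ≤ A)
    (hv : ∀ s ≤ b, ‖v s‖ ≤ A * volterraWeight ρ (C b) s) {x : ℝ} (hx : x ≤ b)
    (hL : ∀ s ≤ x, ‖L s‖ ≤ C b * ρ s) :
    ‖∫ s in Iic x, L s (v s)‖ ≤ A / 2 * volterraWeight ρ (C b) x := by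
  have h1 : ∀ s ∈ Iic x, ‖L s (v s)‖ ≤ C b * A * (ρ s * Real.exp (2 * C b * tailMass ρ s)) := by
    intro s hs
    calc ‖L s (v s)‖ ≤ ‖L s‖ * ‖v s‖ := (L s).le_opNorm _
      _ ≤ (C b * ρ s) * (A * volterraWeight ρ (C b) s) := by
          gcongr
          · exact mul_nonneg (V.hC b).le (V.ρ0 s)
          · exact hL s hs
          · exact hv s (le_trans hs hx)
      _ = _ := by rw [volterraWeight]; ring
  have h2C : 0 < 2 * C b := by linarith [V.hC b]
  refine (norm_integral_le_of_norm_le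
    ((integrableOn_mul_exp_tailMass V.ρc V.ρ0 V.ρi h2C x).const_mul (C b * A)) (ae_Iic h1)).trans ?_
  rw [integral_const_mul]
  calc C b * A * _ ≤ C b * A * (Real.exp (2 * C b * tailMass ρ x) / (2 * C b)) := by
        gcongr
        · exact mul_nonneg (V.hC b).le hA
        · exact integral_mul_exp_tailMass_le V.ρc V.ρ0 V.ρi h2C x
    _ = _ := by
        rw [volterraWeight]
        have := (V.hC b).ne'
        field_simp

theorem norm_volterraTerm_le (n : ℕ) {b : ℝ} {ζ : ℂ} (hζ : ζ ∈ Z) {x : ℝ} (hx : x ≤ b) :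
    ‖volterraTerm K e n ζ x‖ ≤ M * (1 / 2) ^ n * volterraWeight ρ (C b) x := by
  induction n generalizing x with
  | zero =>
    have h1 : 1 ≤ volterraWeight ρ (C b) x := by
      rw [volterraWeight]
      refine Real.one_le_exp (mul_nonneg ?_ (tailMass_nonneg V.ρ0 x))
      linarith [V.hC b]
    simp only [volterraTerm, pow_zero, mul_one]
    exact (V.he ζ hζ).trans (le_mul_of_one_le_right V.hM h1)
  | succ n ih =>
    simp only [volterraTerm]
    refine (norm_volterraTerm_succ_le V (A := M * (1 / 2) ^ n) (V.bound_nonneg n)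
      (fun s hs => ih hs) hx (fun s hs => V.hK b ζ hζ x s hs hx)).trans (le_of_eq ?_)
    rw [pow_succ]; ring

theorem norm_kernel_apply_le {v : ℝ → E} {b A : ℝ} (hA : 0 ≤ A) {ζ : ℂ} (hζ : ζ ∈ Z)
    (hv : ∀ s ≤ b, ‖v s‖ ≤ A * volterraWeight ρ (C b) s) {x s : ℝ} (hs : s ≤ x) (hx : x ≤ b) :
    ‖K ζ x s (v s)‖ ≤ C b * A * volterraWeight ρ (C b) b * ρ s := by
  calc ‖K ζ x s (v s)‖ ≤ ‖K ζ x s‖ * ‖v s‖ := (K ζ x s).le_opNorm _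
      _ ≤ (C b * ρ s) * (A * volterraWeight ρ (C b) b) := by
          gcongr
          · exact mul_nonneg (V.hC b).le (V.ρ0 s)
          · exact V.hK b ζ hζ x s hs hx
          · refine (hv s (hs.trans hx)).trans ?_
            gcongr
            exact volterraWeight_le V.ρ0 V.ρi (V.hC b) (hs.trans hx)
      _ = _ := by ring

theorem continuous_integral_kernel {ζ : ℂ} (hζ : ζ ∈ Z) {v : ℝ → E} (hvc : Continuous v)
    (hv : ∀ b, ∃ A, 0 ≤ A ∧ ∀ s ≤ b, ‖v s‖ ≤ A * volterraWeight ρ (C b) s) :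
    Continuous fun x => ∫ s in Iic x, K ζ x s (v s) := by
  have hcont : Continuous fun p : ℝ × ℝ => K ζ p.1 p.2 (v p.2) :=
    (V.hKc ζ hζ).clm_apply (hvc.comp continuous_snd)
  rw [continuous_iff_continuousAt]
  intro x₀
  obtain ⟨A, hA, hvA⟩ := hv (x₀ + 1)
  have heq : (fun x => ∫ s in Iic x, K ζ x s (v s)) =
      fun x => ∫ s, (Iic x).indicator (fun s => K ζ x s (v s)) s := by
    ext x
    rw [integral_indicator measurableSet_Iic]
  rw [heq]
  refine continuousAt_of_dominated (bound := (Iic (x₀ + 1)).indicator fun s =>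
    C (x₀ + 1) * A * volterraWeight ρ (C (x₀ + 1)) (x₀ + 1) * ρ s) ?_ ?_ ?_ ?_
  · refine Eventually.of_forall fun x => ?_
    refine AEStronglyMeasurable.indicator ?_ measurableSet_Iic
    exact (hcont.comp (Continuous.prodMk_right x)).aestronglyMeasurable
  · filter_upwards [Iic_mem_nhds (lt_add_one x₀)] with x hx
    refine Eventually.of_forall fun s => ?_
    by_cases hs : s ≤ x
    · rw [indicator_of_mem (show s ∈ Iic x from hs),
        indicator_of_mem (show s ∈ Iic (x₀ + 1) from hs.trans hx)]
      exact norm_kernel_apply_le V hA hζ hvA hs hx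
    · rw [Set.indicator_of_notMem (show s ∉ Iic x from hs), norm_zero]
      refine Set.indicator_nonneg (fun s _ => ?_) _
      have := V.hC (x₀ + 1)
      have := V.ρ0 s
      have := (volterraWeight_pos (ρ := ρ) (C (x₀ + 1)) (x₀ + 1)).le
      positivity
  · rw [integrable_indicator_iff measurableSet_Iic]
    exact (V.ρi _).const_mul _
  · have : ∀ᵐ s : ℝ, s ≠ x₀ := by simp [ae_iff]
    filter_upwards [this] with s hs
    rcases lt_or_gt_of_ne hs with h | h
    · have hev : (fun x => K ζ x s (v s)) =ᶠ[𝓝 x₀]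
          fun x => (Iic x).indicator (fun s => K ζ x s (v s)) s := by
        filter_upwards [Ioi_mem_nhds h] with x hx
        rw [indicator_of_mem (Set.mem_Iic.2 (le_of_lt (Set.mem_Ioi.1 hx)))]
      exact ContinuousAt.congr (hcont.comp (Continuous.prodMk_left s)).continuousAt hev
    · have hev : (fun x => (0 : E)) =ᶠ[𝓝 x₀]
          fun x => (Iic x).indicator (fun s => K ζ x s (v s)) s := by
        filter_upwards [Iio_mem_nhds h] with x hx
        rw [Set.indicator_of_notMem (fun h' => not_le.2 (Set.mem_Iio.1 hx) (Set.mem_Iic.1 h'))]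
      exact ContinuousAt.congr continuousAt_const hev

theorem continuous_volterraTerm (n : ℕ) {ζ : ℂ} (hζ : ζ ∈ Z) :
    Continuous (volterraTerm K e n ζ) := by
  induction n with
  | zero => exact continuous_const
  | succ n ih =>
    exact continuous_integral_kernel V hζ ih
      fun b => ⟨M * (1 / 2) ^ n, V.bound_nonneg n, fun s hs => norm_volterraTerm_le V n hζ hs⟩

theorem continuousOn_volterraTerm (n : ℕ) (hec : ContinuousOn e Z)
    (hKz : ∀ x s, s ≤ x → ContinuousOn (fun ζ => K ζ x s) Z) (x : ℝ) :
    ContinuousOn (fun ζ => volterraTerm K e n ζ x) Z := by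
  induction n generalizing x with
  | zero => exact hec
  | succ n ih =>
    intro ζ₀ hζ₀
    refine continuousWithinAt_of_dominated (bound := fun s =>
      C x * (M * (1 / 2) ^ n) * volterraWeight ρ (C x) x * ρ s) ?_ ?_ ((V.ρi x).const_mul _) ?_
    · filter_upwards [self_mem_nhdsWithin] with ζ hζ
      exact (((V.hKc ζ hζ).comp (Continuous.prodMk_right x)).clm_apply
        (continuous_volterraTerm V n hζ)).aestronglyMeasurable
    · filter_upwards [self_mem_nhdsWithin] with ζ hζ
      exact ae_Iic fun s hs => norm_kernel_apply_le V (V.bound_nonneg n) hζ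
        (fun s hs => norm_volterraTerm_le V n hζ hs) hs le_rfl
    · exact ae_Iic fun s hs => (hKz x s hs ζ₀ hζ₀).clm_apply (ih s ζ₀ hζ₀)

theorem differentiableOn_volterraTerm [CompleteSpace E] (n : ℕ) {U : Set ℂ} (hU : IsOpen U)
    (hUZ : U ⊆ Z) (hec : DifferentiableOn ℂ e U)
    (hKz : ∀ x s, s ≤ x → DifferentiableOn ℂ (fun ζ => K ζ x s) U) (x : ℝ) :
    DifferentiableOn ℂ (fun ζ => volterraTerm K e n ζ x) U := by
  induction n generalizing x with
  | zero => exact hec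
  | succ n ih =>
    refine differentiableOn_integral_of_dominated hU (bound := fun s =>
      C x * (M * (1 / 2) ^ n) * volterraWeight ρ (C x) x * ρ s) ?_ ((V.ρi x).const_mul _) ?_ ?_
    · intro ζ hζ
      exact (((V.hKc ζ (hUZ hζ)).comp (Continuous.prodMk_right x)).clm_apply
        (continuous_volterraTerm V n (hUZ hζ))).aestronglyMeasurable
    · exact ae_Iic fun s hs ζ hζ => norm_kernel_apply_le V (V.bound_nonneg n) (hUZ hζ)
        (fun s hs => norm_volterraTerm_le V n (hUZ hζ) hs) hs le_rfl
    · exact ae_Iic fun s hs => (hKz x s hs).clm_apply (ih s)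

theorem hasSum_volterraSol [CompleteSpace E] {ζ : ℂ} (hζ : ζ ∈ Z) (x : ℝ) :
    HasSum (fun n => volterraTerm K e n ζ x) (volterraSol K e ζ x) :=
  (Summable.of_norm_bounded (summable_volterraBound M (volterraWeight ρ (C x) x))
    fun n => norm_volterraTerm_le V n hζ le_rfl).hasSum

theorem norm_volterraSol_le {b : ℝ} {ζ : ℂ} (hζ : ζ ∈ Z) {x : ℝ} (hx : x ≤ b) :
    ‖volterraSol K e ζ x‖ ≤ 2 * M * volterraWeight ρ (C b) x := by
  refine tsum_of_norm_bounded (g := fun n => M * (1 / 2 : ℝ) ^ n * volterraWeight ρ (C b) x) ?_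
    fun n => norm_volterraTerm_le V n hζ hx
  have := (hasSum_geometric_two.mul_left M).mul_right (volterraWeight ρ (C b) x)
  rwa [mul_comm M 2] at this

theorem norm_volterraSol_bound_nonneg (b : ℝ) : 0 ≤ 2 * M * volterraWeight ρ (C b) b := by
  have := (volterraWeight_pos (ρ := ρ) (C b) b).le
  have := V.hM
  positivity

theorem norm_volterraSol_le_bound [CompleteSpace E] {b : ℝ} {ζ : ℂ} (hζ : ζ ∈ Z) {x : ℝ}
    (hx : x ≤ b) : ‖volterraSol K e ζ x‖ ≤ 2 * M * volterraWeight ρ (C b) b := by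
  refine (norm_volterraSol_le V hζ hx).trans ?_
  have := V.hM
  gcongr
  exact volterraWeight_le V.ρ0 V.ρi (V.hC b) hx

theorem continuous_volterraSol [CompleteSpace E] {ζ : ℂ} (hζ : ζ ∈ Z) : Continuous (volterraSol K e ζ) := by
  rw [continuous_iff_continuousAt]
  intro x₀
  have : ContinuousOn (volterraSol K e ζ) (Iic (x₀ + 1)) := by
    refine continuousOn_tsum (u := fun n => M * (1 / 2 : ℝ) ^ n *
      volterraWeight ρ (C (x₀ + 1)) (x₀ + 1))
      (fun n => (continuous_volterraTerm V n hζ).continuousOn)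
      (summable_volterraBound _ _) fun n x hx => (norm_volterraTerm_le V n hζ hx).trans ?_
    exact mul_le_mul_of_nonneg_left (volterraWeight_le V.ρ0 V.ρi (V.hC _) hx) (V.bound_nonneg n)
  exact this.continuousAt (Iic_mem_nhds (lt_add_one x₀))

theorem continuousOn_volterraSol [CompleteSpace E] (hec : ContinuousOn e Z)
    (hKz : ∀ x s, s ≤ x → ContinuousOn (fun ζ => K ζ x s) Z) (x : ℝ) :
    ContinuousOn (fun ζ => volterraSol K e ζ x) Z :=
  continuousOn_tsum (fun n => continuousOn_volterraTerm V n hec hKz x)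
    (summable_volterraBound M (volterraWeight ρ (C x) x)) fun n _ hζ =>
      norm_volterraTerm_le V n hζ le_rfl

theorem differentiableOn_volterraSol [CompleteSpace E] {U : Set ℂ} (hU : IsOpen U)
    (hUZ : U ⊆ Z) (hec : DifferentiableOn ℂ e U)
    (hKz : ∀ x s, s ≤ x → DifferentiableOn ℂ (fun ζ => K ζ x s) U) (x : ℝ) :
    DifferentiableOn ℂ (fun ζ => volterraSol K e ζ x) U :=
  Complex.differentiableOn_tsum_of_summable_norm
    (summable_volterraBound M (volterraWeight ρ (C x) x))
    (fun n => differentiableOn_volterraTerm V n hU hUZ hec hKz x) hU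
    fun n _ hζ => norm_volterraTerm_le V n (hUZ hζ) le_rfl

theorem volterraSol_eq [CompleteSpace E] {ζ : ℂ} (hζ : ζ ∈ Z) (x : ℝ) :
    volterraSol K e ζ x = e ζ + ∫ s in Iic x, K ζ x s (volterraSol K e ζ s) := by
  have h1 : HasSum (fun n => ∫ s in Iic x, K ζ x s (volterraTerm K e n ζ s))
      (∫ s in Iic x, K ζ x s (volterraSol K e ζ s)) := by
    refine hasSum_integral_of_dominated_convergence (bound := fun n s =>
      C x * (M * (1 / 2) ^ n) * volterraWeight ρ (C x) x * ρ s) ?_ ?_ ?_ ?_ ?_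
    · intro n
      exact (((V.hKc ζ hζ).comp (Continuous.prodMk_right x)).clm_apply
        (continuous_volterraTerm V n hζ)).aestronglyMeasurable
    · intro n
      exact ae_Iic fun s hs => norm_kernel_apply_le V (V.bound_nonneg n) hζ
        (fun s hs => norm_volterraTerm_le V n hζ hs) hs le_rfl
    · refine Eventually.of_forall fun s => ?_
      exact (((summable_geometric_two.mul_left M).mul_left (C x)).mul_right _).mul_right _
    · have : (fun s => ∑' n : ℕ, C x * (M * (1 / 2) ^ n) * volterraWeight ρ (C x) x * ρ s) =
          fun s => (∑' n : ℕ, C x * (M * (1 / 2) ^ n) * volterraWeight ρ (C x) x) * ρ s := by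
        ext s; rw [tsum_mul_right]
      rw [this]
      exact (V.ρi x).const_mul _
    · exact ae_Iic fun s _ => (hasSum_volterraSol V hζ s).mapL (K ζ x s)
  have h2 := (hasSum_nat_add_iff' 1).2 (hasSum_volterraSol V hζ x)
  simp only [Finset.range_one, Finset.sum_singleton] at h2
  have h3 := h2.unique h1
  rw [← h3]
  simp [volterraTerm]

end Volterra

/-! ### The Jost solution normalized at `-∞` -/

/-- A `2 × 2` matrix as an operator on `ℂ²`, linearly in the matrix. -/
def mcl : Matrix (Fin 2) (Fin 2) ℂ →ₗ[ℂ] ((Fin 2 → ℂ) →L[ℂ] (Fin 2 → ℂ)) :=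
  (LinearMap.toContinuousLinearMap :
    ((Fin 2 → ℂ) →ₗ[ℂ] (Fin 2 → ℂ)) ≃ₗ[ℂ] ((Fin 2 → ℂ) →L[ℂ] (Fin 2 → ℂ))).toLinearMap ∘ₗ
  (Matrix.toLin' : Matrix (Fin 2) (Fin 2) ℂ ≃ₗ[ℂ] _).toLinearMap

@[simp] theorem mcl_apply (A : Matrix (Fin 2) (Fin 2) ℂ) (v : Fin 2 → ℂ) : mcl A v = A *ᵥ v := by
  simp [mcl]

theorem continuous_mcl : Continuous mcl := mcl.continuous_of_finiteDimensional

theorem norm_mcl_le {A : Matrix (Fin 2) (Fin 2) ℂ} {B : ℝ} (h : ∀ i j, ‖A i j‖ ≤ B) :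
    ‖mcl A‖ ≤ 2 * B := by
  have hB : 0 ≤ B := (norm_nonneg _).trans (h 0 0)
  refine ContinuousLinearMap.opNorm_le_bound _ (by positivity) fun v => ?_
  rw [mcl_apply, pi_norm_le_iff_of_nonneg (by positivity)]
  intro i
  rw [Matrix.mulVec, dotProduct, Fin.sum_univ_two]
  refine (norm_add_le _ _).trans ?_
  rw [norm_mul, norm_mul]
  linarith [mul_le_mul (h i 0) (norm_le_pi_norm v 0) (norm_nonneg _) hB,
    mul_le_mul (h i 1) (norm_le_pi_norm v 1) (norm_nonneg _) hB]

notation "osc(" l "," t ")" => exp (2 * I * l * ((t : ℝ) : ℂ))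

/-- `∫_0^y exp(2iλτ) dτ`. -/
def expInt (l : ℂ) (y : ℝ) : ℂ := ∫ τ in (0 : ℝ)..y, osc(l,τ)

theorem expInt_zero (l : ℂ) : expInt l 0 = 0 := by simp [expInt]

theorem continuous_expInt : Continuous fun p : ℂ × ℝ => expInt p.1 p.2 := by
  have : Continuous fun p : (ℂ × ℝ) × ℝ => osc(p.1.1,p.2) := by fun_prop
  exact intervalIntegral.continuous_parametric_intervalIntegral_of_continuous
    (f := fun (p : ℂ × ℝ) τ => osc(p.1,τ)) this continuous_snd

theorem hasDerivAt_expInt (l : ℂ) (y : ℝ) : HasDerivAt (expInt l) (osc(l,y)) y := by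
  have hc : Continuous fun τ : ℝ => osc(l,τ) := by fun_prop
  exact intervalIntegral.integral_hasDerivAt_right (hc.intervalIntegrable 0 y)
    (hc.stronglyMeasurableAtFilter _ _) hc.continuousAt

theorem hasDerivAt_cexp_mul (c : ℂ) (y : ℝ) :
    HasDerivAt (fun y : ℝ => exp (c * y)) (c * exp (c * y)) y := by
  have := ((Complex.ofRealCLM.hasDerivAt (x := y)).const_mul c).cexp
  simpa [mul_comm] using this

theorem two_mul_expInt (l : ℂ) (y : ℝ) : 2 * I * l * expInt l y = osc(l,y) - 1 := by
  have h := intervalIntegral.integral_eq_sub_of_hasDerivAt (a := 0) (b := y)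
    (fun τ _ => hasDerivAt_cexp_mul (2 * I * l) τ)
    (Continuous.intervalIntegrable (by fun_prop) _ _)
  rw [intervalIntegral.integral_const_mul] at h
  simpa [expInt] using h

theorem expInt_add (l : ℂ) (x u : ℝ) : expInt l (x + u) = expInt l x + osc(l,x) * expInt l u := by
  have hc : Continuous fun τ : ℝ => osc(l,τ) := by fun_prop
  have h1 : expInt l (x + u) - expInt l x = ∫ τ in x..(x + u), osc(l,τ) :=
    intervalIntegral.integral_interval_sub_left (hc.intervalIntegrable _ _)
      (hc.intervalIntegrable _ _)
  have h2 := intervalIntegral.integral_comp_add_left (a := 0) (b := u) (fun τ : ℝ => osc(l,τ)) x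
  rw [add_zero] at h2
  rw [← h2] at h1
  rw [← sub_eq_iff_eq_add', h1, expInt, ← intervalIntegral.integral_const_mul]
  congr 1
  ext τ
  rw [← exp_add]
  congr 1
  push_cast; ring

theorem norm_cexp_le_one {l : ℂ} (hl : 0 ≤ l.im) {y : ℝ} (hy : 0 ≤ y) : ‖osc(l,y)‖ ≤ 1 := by
  rw [norm_exp]
  refine Real.exp_le_one_iff.2 ?_
  simp; positivity

theorem norm_expInt_le {l : ℂ} (hl : 0 ≤ l.im) {y : ℝ} (hy : 0 ≤ y) : ‖expInt l y‖ ≤ y := by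
  have := intervalIntegral.norm_integral_le_of_norm_le_const (a := 0) (b := y) (C := 1)
    (f := fun τ : ℝ => osc(l,τ)) fun τ hτ => by
      rw [uIoc_of_le hy] at hτ
      exact norm_cexp_le_one hl hτ.1.le
  rw [expInt]
  simpa [abs_of_nonneg hy] using this

theorem norm_expInt_le_inv {l : ℂ} (hl : 0 ≤ l.im) (hl0 : l ≠ 0) {y : ℝ} (hy : 0 ≤ y) :
    ‖expInt l y‖ ≤ ‖l‖⁻¹ := by
  have h := two_mul_expInt l y
  have h2 : ‖osc(l,y) - 1‖ ≤ 2 := by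
    refine (norm_sub_le _ _).trans ?_
    have := norm_cexp_le_one hl hy
    rw [norm_one]; linarith
  rw [← h] at h2
  simp only [norm_mul, norm_I, norm_ofNat, mul_one] at h2
  rw [← one_div, le_div_iff₀ (norm_pos_iff.2 hl0)]
  linarith

theorem differentiableOn_expInt (y : ℝ) : DifferentiableOn ℂ (fun l => expInt l y) {0}ᶜ := by
  have : ∀ l ∈ ({0}ᶜ : Set ℂ), expInt l y = (osc(l,y) - 1) / (2 * I * l) := by
    intro l hl
    rw [eq_div_iff (by simpa using hl), mul_comm, two_mul_expInt]
  exact DifferentiableOn.congr (fun l (hl : l ≠ 0) => (DifferentiableAt.div (by fun_prop)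
    (by fun_prop) (by simpa using hl)).differentiableWithinAt) this

namespace NZProfile

variable (κ : ℝ) (D : NZProfile)

/-- `X₋ + iλ`. -/
def nil (ζ : ℂ) : Matrix (Fin 2) (Fin 2) ℂ :=
  !![I * κ * D.q₀ ^ 2 * ζ⁻¹, D.qm; -κ * conj D.qm, I * ζ]

/-- `X - X₋`. -/
def pert (s : ℝ) : Matrix (Fin 2) (Fin 2) ℂ :=
  !![I * κ * D.T * (‖D.q s‖ ^ 2 - D.q₀ ^ 2), D.q s - D.qm;
     -κ * conj (D.q s - D.qm), -(I * κ * D.T * (‖D.q s‖ ^ 2 - D.q₀ ^ 2))]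

/-- The first column of `E₋`. -/
def jvec (ζ : ℂ) : Fin 2 → ℂ := ![1, -I * κ * conj D.qm * ζ⁻¹]

/-- The Volterra kernel of the Jost solution. -/
def ker (ζ : ℂ) (x s : ℝ) : (Fin 2 → ℂ) →L[ℂ] (Fin 2 → ℂ) :=
  (1 + expInt (D.lam κ ζ) (x - s) • mcl (D.nil κ ζ)) ∘L mcl (D.pert κ s)

/-- `exp(iλx)` times the Jost solution normalized at `-∞`. -/
def mu (ζ : ℂ) (x : ℝ) : Fin 2 → ℂ := volterraSol (D.ker κ) (D.jvec κ) ζ x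

/-- The weight `(1+|x|) |q - q₋|`. -/
def wt (x : ℝ) : ℝ := (1 + |x|) * ‖D.q x - D.qm‖

/-- The closed half plane `Im λ ≥ 0` without `ζ = 0`. -/
def upper : Set ℂ := {ζ | ζ ≠ 0 ∧ 0 ≤ (D.lam κ ζ).im}

/-- The part `1/R ≤ |ζ| ≤ R` of `Im λ ≥ 0`. -/
def shell (R : ℝ) : Set ℂ := {ζ | R⁻¹ ≤ ‖ζ‖ ∧ ‖ζ‖ ≤ R ∧ 0 ≤ (D.lam κ ζ).im}

theorem continuous_wt : Continuous D.wt := by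
  have := D.continuous_q
  unfold wt
  fun_prop

theorem wt_nonneg (x : ℝ) : 0 ≤ D.wt x := by unfold wt; positivity

variable {D}

theorem integrableOn_wt (h : D.Decays 1) (b : ℝ) : IntegrableOn D.wt (Iic b) := by
  refine integrableOn_Iic_of_continuous D.continuous_wt ?_ b
  have := h.2
  simp only [pow_one] at this
  exact this

theorem integrableOn_norm_sub (h : D.Decays 1) (b : ℝ) :
    IntegrableOn (fun s => ‖D.q s - D.qm‖) (Iic b) := by
  refine (integrableOn_wt h b).mono' ?_ (Eventually.of_forall fun s => ?_)
  · have := D.continuous_q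
    exact Continuous.aestronglyMeasurable (by fun_prop)
  · rw [norm_norm, wt]
    refine le_mul_of_one_le_left (norm_nonneg _) ?_
    linarith [abs_nonneg s]

variable (D)

theorem exists_norm_q_le : ∃ B, 0 < B ∧ ∀ x, ‖D.q x‖ ≤ B := by
  have h1 := D.tendsto_qp.norm.eventually (eventually_le_nhds (lt_add_one ‖D.qp‖))
  have h2 := D.tendsto_qm.norm.eventually (eventually_le_nhds (lt_add_one ‖D.qm‖))
  obtain ⟨b, hb⟩ := eventually_atTop.1 h1
  obtain ⟨a, ha⟩ := eventually_atBot.1 h2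
  obtain ⟨B, hB⟩ := (isCompact_Icc (a := a) (b := b)).exists_bound_of_continuousOn
    D.continuous_q.continuousOn
  refine ⟨max (|B|) (D.q₀ + 1), lt_max_of_lt_right (by linarith [D.q₀_pos]), fun x => ?_⟩
  rcases le_total x a with h | h
  · exact (ha x h).trans (by rw [D.norm_qm]; exact le_max_right _ _)
  rcases le_total b x with h' | h'
  · exact (hb x h').trans (by rw [D.norm_qp]; exact le_max_right _ _)
  · exact (hB x ⟨h, h'⟩).trans ((le_abs_self B).trans (le_max_left _ _))

theorem exists_abs_normSq_sub_le : ∃ B, 0 < B ∧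
    (∀ s, |‖D.q s‖ ^ 2 - D.q₀ ^ 2| ≤ B * ‖D.q s - D.qm‖) ∧
    ∀ s, |‖D.q s‖ ^ 2 - D.q₀ ^ 2| ≤ B * ‖D.q s - D.qp‖ := by
  obtain ⟨B, hB, hq⟩ := D.exists_norm_q_le
  have key : ∀ (w : ℂ), ‖w‖ = D.q₀ → ∀ s,
      |‖D.q s‖ ^ 2 - D.q₀ ^ 2| ≤ (B + D.q₀) * ‖D.q s - w‖ := fun w hw s => by
    have h1 : |‖D.q s‖ - D.q₀| ≤ ‖D.q s - w‖ := by rw [← hw]; exact abs_norm_sub_norm_le _ _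
    have h2 : ‖D.q s‖ ^ 2 - D.q₀ ^ 2 = (‖D.q s‖ + D.q₀) * (‖D.q s‖ - D.q₀) := by ring
    rw [h2, abs_mul, abs_of_nonneg (by linarith [norm_nonneg (D.q s), D.q₀_pos])]
    gcongr
    · linarith [norm_nonneg (D.q s), D.q₀_pos]
    · exact hq s
  exact ⟨B + D.q₀, by linarith [D.q₀_pos], key _ D.norm_qm, key _ D.norm_qp⟩

theorem exists_norm_pert_le : ∃ B, 0 < B ∧ ∀ s, ‖mcl (D.pert κ s)‖ ≤ B * ‖D.q s - D.qm‖ := by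
  obtain ⟨B, hB, hq, -⟩ := D.exists_abs_normSq_sub_le
  refine ⟨2 * (|κ| * |D.T| * B + 1 + |κ|), by positivity, fun s => ?_⟩
  rw [mul_assoc]
  refine norm_mcl_le fun i j => ?_
  have h1 : ‖I * κ * D.T * (‖D.q s‖ ^ 2 - D.q₀ ^ 2 : ℂ)‖ ≤
      |κ| * |D.T| * B * ‖D.q s - D.qm‖ := by
    have : (‖D.q s‖ ^ 2 - D.q₀ ^ 2 : ℂ) = ((‖D.q s‖ ^ 2 - D.q₀ ^ 2 : ℝ) : ℂ) := by push_cast; rfl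
    rw [this]
    simp only [norm_mul, norm_I, one_mul, norm_real, norm_eq_abs]
    rw [mul_assoc _ B]
    gcongr
    exact hq s
  have h0 := norm_nonneg (D.q s - D.qm)
  have h2 : 0 ≤ |κ| * |D.T| * B * ‖D.q s - D.qm‖ := by positivity
  have h3 : 0 ≤ |κ| * ‖D.q s - D.qm‖ := by positivity
  have h4 : ‖(-κ : ℂ) * conj (D.q s - D.qm)‖ = |κ| * ‖D.q s - D.qm‖ := by
    rw [norm_mul, norm_neg, norm_real, norm_conj, norm_eq_abs]
  rw [add_mul, add_mul, one_mul]
  fin_cases i <;> fin_cases j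
  all_goals simp only [pert, Fin.zero_eta, Fin.mk_one, Matrix.of_apply, Matrix.cons_val, norm_neg]
  all_goals linarith

theorem continuous_pert : Continuous (D.pert κ) := by
  have := D.continuous_q
  unfold pert
  refine continuous_matrix fun i j => ?_
  fin_cases i <;> fin_cases j <;> simp <;> fun_prop

theorem continuous_ker (ζ : ℂ) : Continuous fun p : ℝ × ℝ => D.ker κ ζ p.1 p.2 := by
  unfold ker
  have h1 : Continuous fun p : ℝ × ℝ => expInt (D.lam κ ζ) (p.1 - p.2) :=
    continuous_expInt.comp (f := fun p : ℝ × ℝ => (D.lam κ ζ, p.1 - p.2)) (by fun_prop)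
  have h2 : Continuous fun p : ℝ × ℝ => mcl (D.pert κ p.2) :=
    continuous_mcl.comp ((D.continuous_pert κ).comp continuous_snd)
  exact (continuous_const.add (h1.smul continuous_const)).clm_comp h2

theorem lam_mul {ζ : ℂ} (h : ζ ≠ 0) : 2 * D.lam κ ζ * ζ = ζ ^ 2 + κ * D.q₀ ^ 2 := by
  unfold lam; field_simp

theorem conj_qm_mul : conj D.qm * D.qm = D.q₀ ^ 2 := by rw [conj_mul', D.norm_qm]

theorem q₀_ne : (D.q₀ : ℂ) ≠ 0 := by exact_mod_cast D.q₀_pos.ne'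

theorem qp_ne : D.qp ≠ 0 := norm_pos_iff.1 (D.norm_qp ▸ D.q₀_pos)

theorem qm_ne : D.qm ≠ 0 := norm_pos_iff.1 (D.norm_qm ▸ D.q₀_pos)

theorem conj_qp_mul : conj D.qp * D.qp = D.q₀ ^ 2 := by rw [conj_mul', D.norm_qp]

theorem nil_mul_nil {ζ : ℂ} (h : ζ ≠ 0) :
    D.nil κ ζ * D.nil κ ζ = (2 * I * D.lam κ ζ) • D.nil κ ζ := by
  have hq := D.conj_qm_mul
  ext i j
  fin_cases i <;> fin_cases j <;>
    simp [nil, Matrix.mul_apply, Fin.sum_univ_two, lam] <;> field_simp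
  · linear_combination (-(κ : ℂ) * ζ ^ 2) * hq - ((κ : ℂ) * D.q₀ ^ 2 * ζ ^ 2) * I_sq
  · ring
  · ring
  · linear_combination (-(κ : ℂ)) * hq - ((κ : ℂ) * D.q₀ ^ 2) * I_sq

theorem mcl_nil_mcl_nil {ζ : ℂ} (h : ζ ≠ 0) (v : Fin 2 → ℂ) :
    mcl (D.nil κ ζ) (mcl (D.nil κ ζ) v) = (2 * I * D.lam κ ζ) • mcl (D.nil κ ζ) v := by
  have := congrArg (fun A => A *ᵥ v) (D.nil_mul_nil κ h)
  simpa only [mcl_apply, ← Matrix.mulVec_mulVec, Matrix.smul_mulVec] using this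

theorem nil_mulVec_jvec {ζ : ℂ} (h : ζ ≠ 0) : D.nil κ ζ *ᵥ D.jvec κ ζ = 0 := by
  have hq := D.conj_qm_mul
  ext i
  fin_cases i <;> simp [nil, jvec, Matrix.mulVec, dotProduct, Fin.sum_univ_two]
  · linear_combination (-(I * κ * ζ⁻¹)) * hq
  · field_simp
    linear_combination (-(κ : ℂ) * conj D.qm) * I_sq

theorem exists_norm_nil_le {R : ℝ} (hR : 0 < R) :
    ∃ B, 0 < B ∧ ∀ ζ : ℂ, R⁻¹ ≤ ‖ζ‖ → ‖mcl (D.nil κ ζ)‖ ≤ B * (1 + ‖ζ‖) := by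
  have hq := D.q₀_pos
  refine ⟨2 * (|κ| * D.q₀ ^ 2 * R + D.q₀ + |κ| * D.q₀ + 1), by positivity, fun ζ hζ => ?_⟩
  rw [mul_assoc]
  refine norm_mcl_le fun i j => ?_
  have h1 : ‖I * κ * D.q₀ ^ 2 * ζ⁻¹‖ ≤ |κ| * D.q₀ ^ 2 * R := by
    simp only [norm_mul, norm_I, one_mul, norm_real, norm_eq_abs, norm_pow, norm_inv, sq_abs]
    gcongr
    exact inv_le_of_inv_le₀ hR hζ
  have h2 : ‖(-κ : ℂ) * conj D.qm‖ = |κ| * D.q₀ := by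
    rw [norm_mul, norm_neg, norm_real, norm_conj, norm_eq_abs, D.norm_qm]
  have h3 : ‖I * ζ‖ = ‖ζ‖ := by rw [norm_mul, norm_I, one_mul]
  have hz := norm_nonneg ζ
  have hA : |κ| * D.q₀ ^ 2 * R + D.q₀ + |κ| * D.q₀ + 1 + ‖ζ‖ ≤
      (|κ| * D.q₀ ^ 2 * R + D.q₀ + |κ| * D.q₀ + 1) * (1 + ‖ζ‖) := by
    have : 0 ≤ (|κ| * D.q₀ ^ 2 * R + D.q₀ + |κ| * D.q₀) * ‖ζ‖ := by positivity
    nlinarith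
  have e1 : 0 ≤ |κ| * D.q₀ ^ 2 * R := by positivity
  have e2 : 0 ≤ |κ| * D.q₀ := by positivity
  refine le_trans ?_ hA
  have h4 := D.norm_qm
  fin_cases i <;> fin_cases j
  all_goals simp only [nil, Fin.zero_eta, Fin.mk_one, Matrix.of_apply, Matrix.cons_val]; linarith

theorem ker_bound {R : ℝ} (hR : 0 < R) : ∃ C : ℝ → ℝ, (∀ b, 0 < C b) ∧
    ∀ b, ∀ ζ ∈ D.shell κ R, ∀ x s, s ≤ x → x ≤ b → ‖D.ker κ ζ x s‖ ≤ C b * D.wt s := by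
  obtain ⟨B, hB, hN⟩ := D.exists_norm_nil_le κ hR
  obtain ⟨A, hA, hV⟩ := D.exists_norm_pert_le κ
  refine ⟨fun b => (1 + B * (1 + R)) * (1 + |b|) * A, fun b => by positivity,
    fun b ζ hζ x s hs hx => ?_⟩
  have h1 : ‖expInt (D.lam κ ζ) (x - s)‖ ≤ x - s := norm_expInt_le hζ.2.2 (by linarith)
  have h2 : ‖mcl (D.nil κ ζ)‖ ≤ B * (1 + R) := (hN ζ hζ.1).trans (by gcongr; exact hζ.2.1)
  have h3 : ‖(1 : (Fin 2 → ℂ) →L[ℂ] (Fin 2 → ℂ)) +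
      expInt (D.lam κ ζ) (x - s) • mcl (D.nil κ ζ)‖ ≤ 1 + (x - s) * (B * (1 + R)) := by
    refine (norm_add_le _ _).trans (add_le_add ContinuousLinearMap.norm_id_le ?_)
    rw [norm_smul]
    gcongr
  have h4 : 1 + (x - s) * (B * (1 + R)) ≤ (1 + B * (1 + R)) * ((1 + |b|) * (1 + |s|)) := by
    have hb := le_abs_self b
    have hs' := neg_abs_le s
    have h5 : 1 + (x - s) ≤ (1 + |b|) * (1 + |s|) := by
      nlinarith [mul_nonneg (abs_nonneg b) (abs_nonneg s)]
    have h6 : 0 ≤ B * (1 + R) := by positivity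
    nlinarith
  calc ‖D.ker κ ζ x s‖ ≤ _ * _ := ContinuousLinearMap.opNorm_comp_le _ _
    _ ≤ ((1 + B * (1 + R)) * ((1 + |b|) * (1 + |s|))) * (A * ‖D.q s - D.qm‖) := by
        gcongr
        · exact h3.trans h4
        · exact hV s
    _ = _ := by rw [wt]; ring

theorem jvec_bound {R : ℝ} (hR : 0 < R) : ∃ M, 0 ≤ M ∧ ∀ ζ : ℂ, R⁻¹ ≤ ‖ζ‖ → ‖D.jvec κ ζ‖ ≤ M := by
  have hq := D.q₀_pos
  refine ⟨1 + |κ| * D.q₀ * R, by positivity, fun ζ hζ => ?_⟩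
  rw [pi_norm_le_iff_of_nonneg (by positivity)]
  intro i
  fin_cases i
  · simp only [jvec, Fin.zero_eta, Matrix.cons_val, norm_one]
    have : 0 ≤ |κ| * D.q₀ * R := by positivity
    linarith
  · simp only [jvec, Fin.mk_one, Matrix.cons_val]
    simp only [norm_mul, norm_neg, norm_I, one_mul, norm_real, norm_eq_abs,
      norm_conj, D.norm_qm, norm_inv]
    have : |κ| * D.q₀ * ‖ζ‖⁻¹ ≤ |κ| * D.q₀ * R := by
      gcongr
      exact inv_le_of_inv_le₀ hR hζ
    linarith

theorem shell_ne_zero {R : ℝ} (hR : 0 < R) {ζ : ℂ} (h : R⁻¹ ≤ ‖ζ‖) : ζ ≠ 0 := by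
  rintro rfl
  rw [norm_zero] at h
  have : 0 < R⁻¹ := by positivity
  linarith

theorem continuousOn_lam : ContinuousOn (D.lam κ) {0}ᶜ := by
  unfold lam
  refine ContinuousOn.div_const ?_ _
  refine continuousOn_id.add (continuousOn_const.mul (continuousOn_inv₀))

theorem differentiableOn_lam : DifferentiableOn ℂ (D.lam κ) {0}ᶜ := by
  unfold lam
  intro z hz
  have : z ≠ 0 := hz
  refine DifferentiableAt.differentiableWithinAt ?_
  fun_prop (disch := assumption)

theorem continuousOn_nil : ContinuousOn (fun ζ => mcl (D.nil κ ζ)) {0}ᶜ := by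
  refine continuous_mcl.comp_continuousOn ?_
  unfold nil
  refine continuousOn_pi.2 fun i => continuousOn_pi.2 fun j => ?_
  have h : ContinuousOn (fun z : ℂ => z⁻¹) {0}ᶜ := continuousOn_inv₀
  fin_cases i <;> fin_cases j <;> simp <;> fun_prop

theorem differentiableOn_nil : DifferentiableOn ℂ (fun ζ => mcl (D.nil κ ζ)) {0}ᶜ := by
  have h0 : ∀ ζ, mcl (D.nil κ ζ) = ζ⁻¹ • mcl !![I * κ * D.q₀ ^ 2, 0; 0, 0] +
      mcl !![0, D.qm; -κ * conj D.qm, 0] + ζ • mcl !![0, 0; 0, I] := fun ζ => by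
    have h1 : D.nil κ ζ = ζ⁻¹ • !![I * κ * D.q₀ ^ 2, 0; 0, 0] +
        !![0, D.qm; -κ * conj D.qm, 0] + ζ • !![0, 0; 0, I] := by
      ext i j
      fin_cases i <;> fin_cases j <;> simp [nil, mul_comm]
    rw [h1, mcl.map_add, mcl.map_add, mcl.map_smul, mcl.map_smul]
  simp_rw [h0]
  have h : DifferentiableOn ℂ (fun z : ℂ => z⁻¹) {0}ᶜ := differentiableOn_inv
  exact ((h.smul_const _).add_const _).add (differentiableOn_id.smul_const _)

theorem continuousOn_ker (x s : ℝ) : ContinuousOn (fun ζ => D.ker κ ζ x s) {0}ᶜ := by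
  have h1 : ContinuousOn (fun ζ => expInt (D.lam κ ζ) (x - s)) {0}ᶜ :=
    Continuous.comp_continuousOn (g := fun p : ℂ × ℝ => expInt p.1 p.2)
      (f := fun ζ => (D.lam κ ζ, x - s)) continuous_expInt
      ((D.continuousOn_lam κ).prodMk continuousOn_const)
  have h2 : ContinuousOn (fun ζ => (1 : (Fin 2 → ℂ) →L[ℂ] (Fin 2 → ℂ)) +
      expInt (D.lam κ ζ) (x - s) • mcl (D.nil κ ζ)) {0}ᶜ :=
    continuousOn_const.add (h1.fun_smul (D.continuousOn_nil κ))
  exact h2.clm_comp (continuousOn_const (c := mcl (D.pert κ s)))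

theorem ne_zero_of_im_lam {ζ : ℂ} (h : 0 < (D.lam κ ζ).im) : ζ ≠ 0 := by
  rintro rfl
  simp [lam] at h

theorem differentiableOn_ker (x s : ℝ) :
    DifferentiableOn ℂ (fun ζ => D.ker κ ζ x s) {ζ | 0 < (D.lam κ ζ).im} := by
  unfold ker
  have hsub : {ζ | 0 < (D.lam κ ζ).im} ⊆ {0}ᶜ := fun ζ h => D.ne_zero_of_im_lam κ h
  refine DifferentiableOn.clm_comp (DifferentiableOn.const_add _ (DifferentiableOn.fun_smul ?_
    ((D.differentiableOn_nil κ).mono hsub))) (differentiableOn_const _)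
  refine (differentiableOn_expInt (x - s)).comp ((D.differentiableOn_lam κ).mono hsub) ?_
  intro ζ hζ h0
  have h1 : D.lam κ ζ = 0 := h0
  simp [h1] at hζ

theorem continuousOn_jvec : ContinuousOn (D.jvec κ) {0}ᶜ := by
  unfold jvec
  refine continuousOn_pi.2 fun i => ?_
  have h : ContinuousOn (fun z : ℂ => z⁻¹) {0}ᶜ := continuousOn_inv₀
  fin_cases i <;> simp <;> fun_prop

theorem differentiableOn_jvec : DifferentiableOn ℂ (D.jvec κ) {0}ᶜ := by
  unfold jvec
  refine differentiableOn_pi.2 fun i => ?_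
  have h : DifferentiableOn ℂ (fun z : ℂ => z⁻¹) {0}ᶜ := differentiableOn_inv
  fin_cases i
  · exact differentiableOn_const _
  · exact h.const_mul _

theorem shell_subset {R : ℝ} (hR : 0 < R) : D.shell κ R ⊆ {0}ᶜ := fun _ h => shell_ne_zero hR h.1

theorem isOpen_upper : IsOpen {ζ | 0 < (D.lam κ ζ).im} := by
  have h : {ζ | 0 < (D.lam κ ζ).im} = {0}ᶜ ∩ (fun ζ => (D.lam κ ζ).im) ⁻¹' Ioi 0 := by
    ext ζ
    exact ⟨fun h => ⟨D.ne_zero_of_im_lam κ h, h⟩, fun h => h.2⟩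
  rw [h]
  exact (continuous_im.comp_continuousOn (D.continuousOn_lam κ)).isOpen_inter_preimage
    isOpen_compl_singleton isOpen_Ioi

theorem exists_shell {ζ : ℂ} (h : ζ ≠ 0) : ∃ R, 0 < R ∧ ∀ᶠ w in 𝓝 ζ, R⁻¹ ≤ ‖w‖ ∧ ‖w‖ ≤ R := by
  have hn := norm_pos_iff.2 h
  refine ⟨max (‖ζ‖ + 1) (2 * ‖ζ‖⁻¹), lt_max_of_lt_left (by linarith), ?_⟩
  have h1 : ∀ᶠ w : ℂ in 𝓝 ζ, ‖ζ‖ / 2 < ‖w‖ :=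
    continuous_norm.continuousAt.eventually (lt_mem_nhds (by linarith))
  have h2 : ∀ᶠ w : ℂ in 𝓝 ζ, ‖w‖ < ‖ζ‖ + 1 :=
    continuous_norm.continuousAt.eventually (gt_mem_nhds (by linarith))
  filter_upwards [h1, h2] with w hw1 hw2
  refine ⟨?_, hw2.le.trans (le_max_left _ _)⟩
  refine le_trans ?_ hw1.le
  rw [inv_le_comm₀ (lt_max_of_lt_left (by linarith)) (by positivity)]
  refine le_trans (le_of_eq ?_) (le_max_right _ _)
  field_simp

theorem exists_mem_shell {ζ : ℂ} (h : ζ ∈ D.upper κ) : ∃ R, 0 < R ∧ ζ ∈ D.shell κ R := by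
  obtain ⟨R, hR, hw⟩ := exists_shell h.1
  exact ⟨R, hR, hw.self_of_nhds.1, hw.self_of_nhds.2, h.2⟩

variable {D} {κ}

theorem exists_isVolterra (h : D.Decays 1) {R : ℝ} (hR : 0 < R) :
    ∃ C M, IsVolterra D.wt (D.ker κ) (D.jvec κ) (D.shell κ R) C M := by
  obtain ⟨C, hC, hK⟩ := D.ker_bound κ hR
  obtain ⟨M, hM, he⟩ := D.jvec_bound κ hR
  exact ⟨C, M, D.continuous_wt, D.wt_nonneg, integrableOn_wt h, hK, hC, fun ζ hζ => he ζ hζ.1, hM,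
    fun ζ _ => D.continuous_ker κ ζ⟩

theorem continuous_mu (h : D.Decays 1) {ζ : ℂ} (hζ : ζ ∈ D.upper κ) : Continuous (D.mu κ ζ) := by
  obtain ⟨R, hR, hs⟩ := D.exists_mem_shell κ hζ
  obtain ⟨C, M, V⟩ := exists_isVolterra (κ := κ) h hR
  exact continuous_volterraSol V hs

theorem mu_eq (h : D.Decays 1) {ζ : ℂ} (hζ : ζ ∈ D.upper κ) (x : ℝ) :
    D.mu κ ζ x = D.jvec κ ζ + ∫ s in Iic x, D.ker κ ζ x s (D.mu κ ζ s) := by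
  obtain ⟨R, hR, hs⟩ := D.exists_mem_shell κ hζ
  obtain ⟨C, M, V⟩ := exists_isVolterra (κ := κ) h hR
  exact volterraSol_eq V hs x

theorem exists_norm_mu_le (h : D.Decays 1) {R : ℝ} (hR : 0 < R) (b : ℝ) :
    ∃ A, 0 ≤ A ∧ ∀ ζ ∈ D.shell κ R, ∀ x ≤ b, ‖D.mu κ ζ x‖ ≤ A := by
  obtain ⟨C, M, V⟩ := exists_isVolterra (κ := κ) h hR
  exact ⟨_, norm_volterraSol_bound_nonneg V b, fun ζ hζ x hx => norm_volterraSol_le_bound V hζ hx⟩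

theorem continuousOn_mu (h : D.Decays 1) (x : ℝ) :
    ContinuousOn (fun ζ => D.mu κ ζ x) (D.upper κ) := fun ζ hζ => by
  obtain ⟨R, hR, hw⟩ := exists_shell hζ.1
  obtain ⟨C, M, V⟩ := exists_isVolterra (κ := κ) h hR
  have key := continuousOn_volterraSol V ((D.continuousOn_jvec κ).mono (D.shell_subset κ hR))
    (fun x s _ => (D.continuousOn_ker κ x s).mono (D.shell_subset κ hR)) x
  refine (key ζ ⟨hw.self_of_nhds.1, hw.self_of_nhds.2, hζ.2⟩).mono_of_mem_nhdsWithin ?_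
  filter_upwards [self_mem_nhdsWithin, mem_nhdsWithin_of_mem_nhds hw] with w h1 h2
  exact ⟨h2.1, h2.2, h1.2⟩

theorem differentiableOn_mu (h : D.Decays 1) (x : ℝ) :
    DifferentiableOn ℂ (fun ζ => D.mu κ ζ x) {ζ | 0 < (D.lam κ ζ).im} := fun ζ hζ => by
  obtain ⟨R, hR, hw⟩ := exists_shell (D.ne_zero_of_im_lam κ hζ)
  obtain ⟨U, hU, hUo, hζU⟩ := eventually_nhds_iff.1 hw
  obtain ⟨C, M, V⟩ := exists_isVolterra (κ := κ) h hR
  have hsub : {ζ | 0 < (D.lam κ ζ).im} ∩ U ⊆ {0}ᶜ := fun w hw => D.ne_zero_of_im_lam κ hw.1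
  have ho := (D.isOpen_upper κ).inter hUo
  have key := differentiableOn_volterraSol V ho
    (fun w hw => ⟨(hU w hw.2).1, (hU w hw.2).2, le_of_lt hw.1⟩)
    ((D.differentiableOn_jvec κ).mono hsub)
    (fun x s _ => (D.differentiableOn_ker κ x s).mono Set.inter_subset_left) x
  exact (key.differentiableAt (ho.mem_nhds ⟨hζ, hζU⟩)).differentiableWithinAt

theorem integrableOn_pert_mu (h : D.Decays 1) {ζ : ℂ} (hζ : ζ ∈ D.upper κ) (b : ℝ) :
    ∃ A, 0 ≤ A ∧ (∀ s ≤ b, ‖D.pert κ s *ᵥ D.mu κ ζ s‖ ≤ A * ‖D.q s - D.qm‖) ∧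
    IntegrableOn (fun s => D.pert κ s *ᵥ D.mu κ ζ s) (Iic b) := by
  obtain ⟨R, hR, hs⟩ := D.exists_mem_shell κ hζ
  obtain ⟨A, hA, hmu⟩ := exists_norm_mu_le h hR b
  obtain ⟨B, hB, hV⟩ := D.exists_norm_pert_le κ
  have h1 : ∀ s ≤ b, ‖D.pert κ s *ᵥ D.mu κ ζ s‖ ≤ B * A * ‖D.q s - D.qm‖ := fun s hs' => by
    rw [← mcl_apply]
    calc _ ≤ ‖mcl (D.pert κ s)‖ * ‖D.mu κ ζ s‖ := ContinuousLinearMap.le_opNorm _ _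
      _ ≤ (B * ‖D.q s - D.qm‖) * A := by
        gcongr
        · exact hV s
        · exact hmu ζ hs s hs'
      _ = _ := by ring
  refine ⟨B * A, by positivity, h1, ?_⟩
  refine ((integrableOn_norm_sub h b).const_mul (B * A)).mono' ?_ (ae_Iic h1)
  exact (Continuous.matrix_mulVec (D.continuous_pert κ) (continuous_mu h hζ)).aestronglyMeasurable

theorem hasDerivAt_mu (h : D.Decays 1) {ζ : ℂ} (hζ : ζ ∈ D.upper κ) (x : ℝ) :
    HasDerivAt (D.mu κ ζ) (D.nil κ ζ *ᵥ D.mu κ ζ x + D.pert κ x *ᵥ D.mu κ ζ x) x := by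
  set l := D.lam κ ζ with hl
  set f : ℝ → Fin 2 → ℂ := fun s => D.pert κ s *ᵥ D.mu κ ζ s with hf
  set N := mcl (D.nil κ ζ) with hN
  have hfc : Continuous f := Continuous.matrix_mulVec (D.continuous_pert κ) (continuous_mu h hζ)
  have hfi : ∀ b, IntegrableOn f (Iic b) := fun b => (integrableOn_pert_mu h hζ b).choose_spec.2.2
  have hec : Continuous (expInt l) :=
    continuous_expInt.comp (f := fun y : ℝ => (l, y)) (by fun_prop)
  have hgc : Continuous fun s => expInt l (-s) • f s := (hec.comp continuous_neg).smul hfc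
  have hgi : ∀ b, IntegrableOn (fun s => expInt l (-s) • f s) (Iic b) := by
    refine integrableOn_Iic_of_continuous hgc ?_
    obtain ⟨A, hA, hb, -⟩ := integrableOn_pert_mu h hζ 0
    refine ((integrableOn_wt h 0).const_mul A).mono' hgc.aestronglyMeasurable
      (ae_Iic fun s hs => ?_)
    rw [norm_smul]
    calc _ ≤ |s| * (A * ‖D.q s - D.qm‖) := by
          gcongr
          · rw [abs_of_nonpos hs]
            exact norm_expInt_le hζ.2 (by linarith)
          · exact hb s hs
      _ ≤ A * D.wt s := by
          rw [wt]
          have : 0 ≤ A * ‖D.q s - D.qm‖ := by positivity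
          nlinarith
  set F : ℝ → Fin 2 → ℂ := fun x => ∫ s in Iic x, f s with hF
  set G : ℝ → Fin 2 → ℂ := fun x => ∫ s in Iic x, expInt l (-s) • f s with hG
  have hmu : ∀ x, D.mu κ ζ x = D.jvec κ ζ + (F x + N (expInt l x • F x +
      osc(l,x) • G x)) := fun x => by
    rw [mu_eq h hζ x]
    congr 1
    have h1 : ∀ s, D.ker κ ζ x s (D.mu κ ζ s) = f s + N (expInt l x • f s +
        osc(l,x) • (expInt l (-s) • f s)) := fun s => by
      simp only [ker, ContinuousLinearMap.comp_apply, _root_.add_apply, mcl_apply,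
        _root_.smul_apply, one_apply_eq_self, hN]
      rw [sub_eq_add_neg, expInt_add, ← hl, smul_smul, ← add_smul, Matrix.mulVec_smul]
    simp_rw [h1]
    have i1 : IntegrableOn (fun s => expInt l x • f s) (Iic x) := (hfi x).fun_smul _
    have i2 : IntegrableOn (fun s => osc(l,x) • (expInt l (-s) • f s)) (Iic x) := (hgi x).fun_smul _
    rw [integral_add (hfi x) (N.integrable_comp (i1.fun_add i2)), N.integral_comp_comm (i1.fun_add i2)]
    congr 2
    rw [integral_add i1 i2, integral_smul, integral_smul]
  have hdF : HasDerivAt F (f x) x := hasDerivAt_integral_Iic hfc hfi x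
  have hdG : HasDerivAt G (expInt l (-x) • f x) x := hasDerivAt_integral_Iic hgc hgi x
  have hdE := hasDerivAt_cexp_mul (2 * I * l) x
  have hd := ((hdF.add (((N.restrictScalars ℝ).hasFDerivAt).comp_hasDerivAt x
    (((hasDerivAt_expInt l x).smul hdF).add (hdE.smul hdG)))).const_add (D.jvec κ ζ))
  have hfun : D.mu κ ζ = _ := funext hmu
  rw [hfun] at ⊢
  refine HasDerivAt.congr_deriv (f := fun x => D.jvec κ ζ + (F x + N (expInt l x • F x +
      osc(l,x) • G x))) hd ?_
  have hNN : ∀ v, N (N v) = (2 * I * l) • N v := D.mcl_nil_mcl_nil κ hζ.1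
  have hNe : N (D.jvec κ ζ) = 0 := by rw [hN, mcl_apply, D.nil_mulVec_jvec κ hζ.1]
  have h0 : expInt l x + osc(l,x) * expInt l (-x) = 0 := by
    rw [← expInt_add, add_neg_cancel, expInt_zero]
  have hE : osc(l,x) = 1 + 2 * I * l * expInt l x := by rw [two_mul_expInt]; ring
  have hfx : D.pert κ x *ᵥ (D.jvec κ ζ + (F x + N (expInt l x • F x +
      osc(l,x) • G x))) = f x := by rw [← hmu]
  beta_reduce
  rw [hfx, ← mcl_apply, ← hN, map_add N, map_add N, hNe, hNN]
  simp only [ContinuousLinearMap.coe_restrictScalars', map_add, map_smul, smul_add, smul_smul]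
  have h0' : (osc(l,x) * expInt l (-x)) • N (f x) =
      (-expInt l x) • N (f x) := by rw [← eq_neg_of_add_eq_zero_right h0]
  rw [h0']
  have hE' : osc(l,x) • N (F x) = N (F x) + (2 * I * l * expInt l x) • N (F x) := by
    rw [hE, add_smul, one_smul]
  rw [hE']
  module

theorem exists_norm_ker_mu_le (h : D.Decays 1) {R : ℝ} (hR : 0 < R) : ∃ A, 0 ≤ A ∧
    ∀ ζ ∈ D.shell κ R, ∀ x ≤ 0, ∀ s ≤ x, ‖D.ker κ ζ x s (D.mu κ ζ s)‖ ≤ A * D.wt s := by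
  obtain ⟨C, hC, hK⟩ := D.ker_bound κ hR
  obtain ⟨A, hA, hmu⟩ := exists_norm_mu_le (κ := κ) h hR 0
  have hC0 := (hC 0).le
  refine ⟨C 0 * A, by positivity, fun ζ hζ x hx s hs => ?_⟩
  calc _ ≤ ‖D.ker κ ζ x s‖ * ‖D.mu κ ζ s‖ := ContinuousLinearMap.le_opNorm _ _
    _ ≤ (C 0 * D.wt s) * A := by
      gcongr
      · exact mul_nonneg hC0 (D.wt_nonneg s)
      · exact hK 0 ζ hζ x s hs hx
      · exact hmu ζ hζ s (hs.trans hx)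
    _ = _ := by ring

theorem integrableOn_ker_mu (h : D.Decays 1) {ζ : ℂ} (hζ : ζ ∈ D.upper κ) {x : ℝ} (hx : x ≤ 0) :
    IntegrableOn (fun s => D.ker κ ζ x s (D.mu κ ζ s)) (Iic x) := by
  obtain ⟨R, hR, hs⟩ := D.exists_mem_shell κ hζ
  obtain ⟨A, -, hA⟩ := exists_norm_ker_mu_le (κ := κ) h hR
  have hc : Continuous fun s => D.ker κ ζ x s (D.mu κ ζ s) :=
    ((D.continuous_ker κ ζ).comp (continuous_const.prodMk continuous_id)).clm_apply
      (continuous_mu h hζ)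
  exact ((integrableOn_wt h x).const_mul A).mono' hc.aestronglyMeasurable (ae_Iic (hA ζ hs x hx))

theorem tendsto_mu (h : D.Decays 1) {ζ : ℂ} (hζ : ζ ∈ D.upper κ) :
    Tendsto (D.mu κ ζ) atBot (𝓝 (D.jvec κ ζ)) := by
  obtain ⟨R, hR, hs⟩ := D.exists_mem_shell κ hζ
  obtain ⟨A, -, hA⟩ := exists_norm_ker_mu_le (κ := κ) h hR
  have h1 : Tendsto (fun x => A * ∫ s in Iic x, D.wt s) atBot (𝓝 0) := by
    simpa using (tendsto_integral_Iic_atBot (integrableOn_wt h 0)).const_mul A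
  rw [tendsto_iff_norm_sub_tendsto_zero]
  refine squeeze_zero' (Eventually.of_forall fun _ => norm_nonneg _) ?_ h1
  filter_upwards [eventually_le_atBot 0] with x hx
  rw [mu_eq h hζ x, add_sub_cancel_left, ← integral_const_mul]
  exact norm_integral_le_of_norm_le ((integrableOn_wt h x).const_mul _) (ae_Iic (hA ζ hs x hx))

end NZProfile

/-! ### Jost columns and their symmetries -/

theorem wr_smul_smul (a b : ℂ) (u v : Fin 2 → ℂ) : wr (a • u) (b • v) = a * b * wr u v := by
  simp [wr]; ring

theorem tendsto_wr {l : Filter ℝ} {u v : ℝ → Fin 2 → ℂ} {a b : Fin 2 → ℂ}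
    (hu : Tendsto u l (𝓝 a)) (hv : Tendsto v l (𝓝 b)) :
    Tendsto (fun x => wr (u x) (v x)) l (𝓝 (wr a b)) := by
  have hu' := tendsto_pi_nhds.1 hu
  have hv' := tendsto_pi_nhds.1 hv
  exact ((hu' 0).mul (hv' 1)).sub ((hu' 1).mul (hv' 0))

theorem mulVec_fin_two (A : Matrix (Fin 2) (Fin 2) ℂ) (v : Fin 2 → ℂ) (i : Fin 2) :
    (A *ᵥ v) i = A i 0 * v 0 + A i 1 * v 1 := by
  rw [Matrix.mulVec, dotProduct, Fin.sum_univ_two]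

theorem wr_eq_wr_zero {X : ℝ → Matrix (Fin 2) (Fin 2) ℂ} (hX : ∀ x, X x 0 0 + X x 1 1 = 0)
    {u v : ℝ → Fin 2 → ℂ} (hu : ∀ x, HasDerivAt u (X x *ᵥ u x) x)
    (hv : ∀ x, HasDerivAt v (X x *ᵥ v x) x) (x : ℝ) : wr (u x) (v x) = wr (u 0) (v 0) := by
  have hd : ∀ x, HasDerivAt (fun x => wr (u x) (v x)) 0 x := fun x => by
    have hu' := hasDerivAt_pi.1 (hu x)
    have hv' := hasDerivAt_pi.1 (hv x)
    have := ((hu' 0).fun_mul (hv' 1)).fun_sub ((hu' 1).fun_mul (hv' 0))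
    refine this.congr_deriv ?_
    simp only [mulVec_fin_two]
    linear_combination (u x 0 * v x 1 - u x 1 * v x 0) * hX x
  exact is_const_of_deriv_eq_zero (fun x => (hd x).differentiableAt) (fun x => (hd x).deriv) x 0

theorem eq_of_solution {X : ℝ → Matrix (Fin 2) (Fin 2) ℂ} {C : ℝ} (hC : ∀ x, ‖mcl (X x)‖ ≤ C)
    {u v : ℝ → Fin 2 → ℂ} (hu : ∀ x, HasDerivAt u (X x *ᵥ u x) x)
    (hv : ∀ x, HasDerivAt v (X x *ᵥ v x) x) (h0 : u 0 = v 0) : u = v := by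
  refine ODE_solution_unique_univ (v := fun x w => X x *ᵥ w) (s := fun _ => Set.univ) (t₀ := 0)
    (K := C.toNNReal) (fun t => ?_) (fun t => ⟨hu t, trivial⟩) (fun t => ⟨hv t, trivial⟩) h0
  refine LipschitzWith.lipschitzOnWith ?_
  have h1 : LipschitzWith ‖mcl (X t)‖₊ (mcl (X t)) := (mcl (X t)).lipschitz
  have h2 : (fun w => X t *ᵥ w) = mcl (X t) := by ext1 w; rw [mcl_apply]
  rw [h2]
  refine h1.weaken ?_
  rw [← NNReal.coe_le_coe, coe_nnnorm]
  exact (hC t).trans (Real.le_coe_toNNReal C)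

theorem IsJostColumn.unique {X : ℝ → Matrix (Fin 2) (Fin 2) ℂ} {C : ℝ} (hC : ∀ x, ‖mcl (X x)‖ ≤ C)
    (hX : ∀ x, X x 0 0 + X x 1 1 = 0) {l : Filter ℝ} [l.NeBot] {Φ : ℝ → ℂ} {e : Fin 2 → ℂ}
    (he : e ≠ 0) {B : ℝ} (hΦ : ∀ᶠ x in l, ‖exp (Φ x)‖ ≤ B) {u v : ℝ → Fin 2 → ℂ}
    (hu : IsJostColumn X l Φ e u) (hv : IsJostColumn X l Φ e v) : u = v := by
  have hw0 : ∀ w : ℝ → Fin 2 → ℂ, (∀ x, HasDerivAt w (X x *ᵥ w x) x) →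
      Tendsto (fun x => exp (-Φ x) • w x) l (𝓝 0) → wr (w 0) (u 0) = 0 := fun w hw hlim => by
    have h1 : Tendsto (fun x => wr (exp (-Φ x) • w x) (exp (-Φ x) • u x)) l
        (𝓝 (wr 0 e)) := tendsto_wr hlim hu.2
    have h2 : wr 0 e = 0 := by simp [wr]
    rw [h2] at h1
    have h3 : Tendsto (fun x => exp (Φ x) * exp (Φ x) *
        wr (exp (-Φ x) • w x) (exp (-Φ x) • u x)) l (𝓝 0) := by
      refine squeeze_zero_norm' ?_ (by simpa using h1.norm.const_mul (B * B))
      filter_upwards [hΦ] with x hx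
      rw [norm_mul, norm_mul]
      gcongr
      exact (norm_nonneg _).trans hx
    have h4 : ∀ x, exp (Φ x) * exp (Φ x) *
        wr (exp (-Φ x) • w x) (exp (-Φ x) • u x) = wr (w 0) (u 0) := fun x => by
      rw [wr_smul_smul, wr_eq_wr_zero hX hw hu.1, exp_neg]
      have := exp_ne_zero (Φ x)
      field_simp
    simp_rw [h4] at h3
    exact tendsto_nhds_unique tendsto_const_nhds h3
  have hu0 : u 0 ≠ 0 := fun h => by
    have : u = fun _ => 0 := eq_of_solution hC hu.1 (fun x => by
      rw [Matrix.mulVec_zero]; exact hasDerivAt_const x 0) h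
    have h2 := hu.2
    rw [this] at h2
    simp only [smul_zero] at h2
    exact he (tendsto_nhds_unique h2 tendsto_const_nhds)
  have hsub : ∀ c : ℂ, ∀ x, HasDerivAt (fun x => v x - c • u x) (X x *ᵥ (v x - c • u x)) x := by
    intro c x
    rw [Matrix.mulVec_sub, Matrix.mulVec_smul]
    exact (hv.1 x).fun_sub ((hu.1 x).fun_const_smul c)
  have hwr := hw0 (fun x => v x - (1 : ℂ) • u x) (hsub 1) (by
    have := hv.2.sub hu.2
    rw [sub_self] at this
    refine this.congr fun x => ?_
    rw [one_smul, smul_sub])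
  obtain ⟨c, hc⟩ : ∃ c : ℂ, v 0 = c • u 0 := by
    have hz : v 0 0 * u 0 1 = v 0 1 * u 0 0 := by
      simp only [wr, Pi.sub_apply, one_smul] at hwr
      linear_combination hwr
    by_cases h : u 0 0 = 0
    · have h1 : u 0 1 ≠ 0 := fun h1 => by
        refine hu0 (funext fun i => ?_)
        fin_cases i <;> simpa
      refine ⟨v 0 1 / u 0 1, funext fun i => ?_⟩
      fin_cases i
      · simp only [Fin.zero_eta, Pi.smul_apply, smul_eq_mul, h, mul_zero] at hz ⊢
        exact (mul_eq_zero.1 hz).resolve_right h1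
      · simp only [Fin.mk_one, Pi.smul_apply, smul_eq_mul]
        field_simp
    · refine ⟨v 0 0 / u 0 0, funext fun i => ?_⟩
      fin_cases i
      · simp only [Fin.zero_eta, Pi.smul_apply, smul_eq_mul]
        field_simp
      · simp only [Fin.mk_one, Pi.smul_apply, smul_eq_mul]
        field_simp
        linear_combination -hz
  have hvc : v = fun x => c • u x := by
    refine eq_of_solution hC hv.1 (fun x => ?_) hc
    rw [Matrix.mulVec_smul]
    exact (hu.1 x).fun_const_smul c
  have hlim : Tendsto (fun x => exp (-Φ x) • v x) l (𝓝 (c • e)) := by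
    rw [hvc]
    refine (hu.2.const_smul c).congr fun x => ?_
    rw [smul_comm]
  have hce : c • e = e := tendsto_nhds_unique hlim hv.2
  have hc1 : c = 1 := by
    by_contra hne
    have : (c - 1) • e = 0 := by rw [sub_smul, one_smul, hce, sub_self]
    rcases smul_eq_zero.1 this with h | h
    · exact hne (sub_eq_zero.1 h)
    · exact he h
  rw [hvc, hc1]
  simp

theorem IsJostColumn.jostColumn_eq {X : ℝ → Matrix (Fin 2) (Fin 2) ℂ} {C : ℝ}
    (hC : ∀ x, ‖mcl (X x)‖ ≤ C)
    (hX : ∀ x, X x 0 0 + X x 1 1 = 0) {l : Filter ℝ} [l.NeBot] {Φ : ℝ → ℂ} {e : Fin 2 → ℂ}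
    (he : e ≠ 0) {B : ℝ} (hΦ : ∀ᶠ x in l, ‖exp (Φ x)‖ ≤ B) {u : ℝ → Fin 2 → ℂ}
    (hu : IsJostColumn X l Φ e u) : jostColumn X l Φ e = u :=
  IsJostColumn.unique hC hX he hΦ (Classical.epsilon_spec ⟨u, hu⟩) hu

namespace NZProfile

variable (κ : ℝ) (D : NZProfile)

theorem X_eq (ζ : ℂ) (x : ℝ) : D.X κ ζ x = D.nil κ ζ + D.pert κ x - (I * D.lam κ ζ) • 1 := by
  ext i j
  fin_cases i <;> fin_cases j <;> simp [X, nil, pert, z, k, lam] <;> ring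

theorem X_trace (ζ : ℂ) (x : ℝ) : D.X κ ζ x 0 0 + D.X κ ζ x 1 1 = 0 := by simp [X]

theorem exists_norm_X_le (ζ : ℂ) : ∃ C, ∀ x, ‖mcl (D.X κ ζ x)‖ ≤ C := by
  obtain ⟨B, hB, hV⟩ := D.exists_norm_pert_le κ
  obtain ⟨A, hA, hq⟩ := D.exists_norm_q_le
  refine ⟨‖mcl (D.nil κ ζ)‖ + B * (A + D.q₀) + ‖mcl ((I * D.lam κ ζ) • 1)‖, fun x => ?_⟩
  rw [X_eq, mcl.map_sub, mcl.map_add]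
  refine (norm_sub_le _ _).trans ?_
  gcongr
  refine (norm_add_le _ _).trans ?_
  gcongr
  refine (hV x).trans ?_
  gcongr
  refine (norm_sub_le _ _).trans ?_
  rw [D.norm_qm]
  gcongr
  exact hq x

/-- The Jost solution normalized at `-∞`, first column. -/
def jost (ζ : ℂ) (x : ℝ) : Fin 2 → ℂ := exp (-I * D.Theta κ ζ x) • D.mu κ ζ x

theorem hasDerivAt_exp_Theta (c ζ : ℂ) (x : ℝ) : HasDerivAt (fun x : ℝ => exp (c * D.Theta κ ζ x))
      (c * D.lam κ ζ * exp (c * D.Theta κ ζ x)) x := by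
  have h : HasDerivAt (fun x : ℝ => c * D.Theta κ ζ x) (c * D.lam κ ζ) x := by
    unfold Theta
    have := ((((Complex.ofRealCLM.hasDerivAt (x := x)).add_const (2 * (D.z κ ζ + κ * D.T * D.q₀ ^ 2
      - D.α / 2) * D.t)).const_mul (D.lam κ ζ)).const_mul c)
    simpa using this
  refine h.cexp.congr_deriv ?_
  ring

variable {κ D}

theorem hasDerivAt_jost (h : D.Decays 1) {ζ : ℂ} (hζ : ζ ∈ D.upper κ) (x : ℝ) :
    HasDerivAt (D.jost κ ζ) (D.X κ ζ x *ᵥ D.jost κ ζ x) x := by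
  refine ((D.hasDerivAt_exp_Theta κ (-I) ζ x).smul (hasDerivAt_mu h hζ x)).congr_deriv ?_
  rw [X_eq, jost, Matrix.sub_mulVec, Matrix.add_mulVec, Matrix.mulVec_smul, Matrix.mulVec_smul,
    Matrix.smul_mulVec, Matrix.one_mulVec]
  module

theorem isJostColumn_jost (h : D.Decays 1) {ζ : ℂ} (hζ : ζ ∈ D.upper κ) :
    IsJostColumn (D.X κ ζ) atBot (fun x => -I * D.Theta κ ζ x) (D.jvec κ ζ) (D.jost κ ζ) := by
  refine ⟨hasDerivAt_jost h hζ, (tendsto_mu h hζ).congr fun x => ?_⟩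
  rw [jost, smul_smul, ← exp_add, neg_add_cancel, exp_zero, one_smul]

variable (κ D) in
theorem norm_exp_Theta (ζ : ℂ) (x : ℝ) : ‖exp (-I * D.Theta κ ζ x)‖ = Real.exp ((D.lam κ ζ).im * x +
      (D.lam κ ζ * (2 * (D.z κ ζ + κ * D.T * D.q₀ ^ 2 - D.α / 2) * D.t)).im) := by
  rw [norm_exp, Theta, mul_add]
  congr 1
  simp [mul_re, mul_im]

theorem eventually_exp_Theta_le {ζ : ℂ} (hζ : 0 ≤ (D.lam κ ζ).im) : ∃ B, ∀ᶠ x : ℝ in atBot,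
    ‖exp (-I * D.Theta κ ζ x)‖ ≤ B := by
  refine ⟨Real.exp (D.lam κ ζ * (2 * (D.z κ ζ + κ * D.T * D.q₀ ^ 2 - D.α / 2) * D.t)).im, ?_⟩
  filter_upwards [eventually_le_atBot 0] with x hx
  rw [D.norm_exp_Theta]
  gcongr
  linarith [mul_nonpos_of_nonneg_of_nonpos hζ hx]

theorem psiM1_eq (h : D.Decays 1) {ζ : ℂ} (hζ : ζ ∈ D.upper κ) : D.psiM1 κ ζ = D.jost κ ζ := by
  obtain ⟨C, hC⟩ := D.exists_norm_X_le κ ζ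
  obtain ⟨B, hB⟩ := eventually_exp_Theta_le hζ.2
  refine (isJostColumn_jost h hζ).jostColumn_eq hC (D.X_trace κ ζ) ?_ hB
  intro h0
  have := congrFun h0 0
  simp [jvec] at this

variable (κ D)

/-- The reflected profile `x ↦ κ conj q(-x)`. -/
def refl (hκ : |κ| = 1) : NZProfile where
  T := D.T
  α := D.α
  t := -D.t
  q₀ := D.q₀
  q := fun x => κ * conj (D.q (-x))
  qp := κ * conj D.qm
  qm := κ * conj D.qp
  q₀_pos := D.q₀_pos
  norm_qp := by simp [hκ, D.norm_qm]
  norm_qm := by simp [hκ, D.norm_qp]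
  continuous_q := by
    have := D.continuous_q
    have h : Continuous (conj : ℂ → ℂ) := continuous_conj
    fun_prop
  tendsto_qp := by
    refine Tendsto.const_mul _ ?_
    exact (continuous_conj.tendsto _).comp (D.tendsto_qm.comp tendsto_neg_atTop_atBot)
  tendsto_qm := by
    refine Tendsto.const_mul _ ?_
    exact (continuous_conj.tendsto _).comp (D.tendsto_qp.comp tendsto_neg_atBot_atTop)

variable (hκ : |κ| = 1)

theorem norm_refl_q (x : ℝ) : ‖(D.refl κ hκ).q x‖ = ‖D.q (-x)‖ := by simp [refl, hκ]

variable {κ D}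

theorem Decays.refl {m : ℕ} (h : D.Decays m) : (D.refl κ hκ).Decays m := by
  have hn : ∀ (x : ℝ) (w : ℂ), ‖(κ : ℂ) * conj (D.q (-x)) - κ * conj w‖ = ‖D.q (-x) - w‖ := by
    intro x w
    rw [← mul_sub, ← map_sub, norm_mul, norm_conj, norm_real, norm_eq_abs, hκ, one_mul]
  constructor
  · have h2 := h.2
    rw [← neg_zero] at h2
    refine IntegrableOn.congr_fun h2.comp_neg_Ici (fun x _ => ?_) measurableSet_Ici
    simp only [NZProfile.refl, hn, abs_neg]
  · have h2 := h.1
    rw [← neg_zero] at h2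
    refine IntegrableOn.congr_fun h2.comp_neg_Iic (fun x _ => ?_) measurableSet_Iic
    simp only [NZProfile.refl, hn, abs_neg]

theorem kappa_sq (hκ : |κ| = 1) : (κ : ℂ) * κ = 1 := by
  have : κ * κ = 1 := by rw [← abs_mul_abs_self, hκ, one_mul]
  exact_mod_cast this

theorem kappa_ne (hκ : |κ| = 1) : (κ : ℂ) ≠ 0 := fun h => by simpa [h] using kappa_sq hκ

variable (κ D) in
/-- The Jost solution normalized at `+∞`, second column. -/
def jostP (ζ : ℂ) (x : ℝ) : Fin 2 → ℂ :=
  ![(D.refl κ hκ).jost κ ζ (-x) 1, (D.refl κ hκ).jost κ ζ (-x) 0]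

theorem jvecP_ne_zero (a : ℂ) : (![a, 1] : Fin 2 → ℂ) ≠ 0 := fun h0 => by
  have := congrFun h0 1
  simp at this

theorem jvecM_ne_zero (a : ℂ) : (![1, a] : Fin 2 → ℂ) ≠ 0 := fun h0 => by
  have := congrFun h0 0
  simp at this

theorem Theta_refl (ζ : ℂ) (x : ℝ) : (D.refl κ hκ).Theta κ ζ (-x) = -D.Theta κ ζ x := by
  have h1 : (D.refl κ hκ).lam κ ζ = D.lam κ ζ := rfl
  have h2 : (D.refl κ hκ).z κ ζ = D.z κ ζ := rfl
  rw [Theta, Theta, h1, h2]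
  simp only [refl]
  push_cast; ring

theorem isJostColumn_jostP (h : D.Decays 1) {ζ : ℂ} (hζ : ζ ∈ D.upper κ) :
    IsJostColumn (D.X κ ζ) atTop (fun x => I * D.Theta κ ζ x)
      ![-I * D.qp * ζ⁻¹, 1] (D.jostP κ hκ ζ) := by
  have hJ := isJostColumn_jost (h.refl hκ) (ζ := ζ) (κ := κ) hζ
  constructor
  · intro x
    have hd := (hJ.1 (-x)).scomp x (hasDerivAt_neg x)
    have hd' := hasDerivAt_pi.1 hd
    have hz : (D.refl κ hκ).z κ ζ = D.z κ ζ := rfl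
    have hk2 := kappa_sq hκ
    refine hasDerivAt_pi.2 fun i => ?_
    have hn : (‖(D.refl κ hκ).q (-x)‖ : ℂ) = ‖D.q x‖ := by rw [norm_refl_q, neg_neg]
    fin_cases i
    · refine (hd' 1).congr_deriv ?_
      simp only [Pi.smul_apply, mulVec_fin_two, jostP, X, hz, hn, Fin.zero_eta, Matrix.of_apply,
        Matrix.cons_val]
      generalize (D.refl κ hκ).jost κ ζ (-x) = w
      simp only [refl, neg_neg, map_mul, conj_conj, conj_ofReal, neg_smul, one_smul]
      linear_combination (D.q x * w 0) * hk2
    · refine (hd' 0).congr_deriv ?_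
      simp only [Pi.smul_apply, mulVec_fin_two, jostP, X, hz, hn, Fin.mk_one, Matrix.of_apply,
        Matrix.cons_val]
      generalize (D.refl κ hκ).jost κ ζ (-x) = w
      simp only [refl, neg_neg, neg_smul, one_smul]; ring
  · have h2 := tendsto_pi_nhds.1 (hJ.2.comp tendsto_neg_atTop_atBot)
    refine tendsto_pi_nhds.2 fun i => ?_
    have hT : ∀ x, exp (-(-I * (D.refl κ hκ).Theta κ ζ (-x))) = exp (-(I * D.Theta κ ζ x)) := by
      intro x
      rw [Theta_refl]
      congr 1; ring
    fin_cases i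
    · have h3 := h2 1
      have h4 : (D.refl κ hκ).jvec κ ζ 1 = -I * D.qp * ζ⁻¹ := by
        have hk2 := kappa_sq hκ
        simp only [jvec, refl, map_mul, conj_conj, conj_ofReal, Matrix.cons_val]
        linear_combination (-I * D.qp * ζ⁻¹) * hk2
      rw [h4] at h3
      refine h3.congr fun x => ?_
      simp only [jostP, Function.comp_apply, Pi.smul_apply, hT]; rfl
    · refine (h2 0).congr fun x => ?_
      simp only [jostP, Function.comp_apply, Pi.smul_apply, hT]; rfl

include hκ in
theorem eventually_exp_Theta_le' {ζ : ℂ} (hζ : 0 ≤ (D.lam κ ζ).im) : ∃ B, ∀ᶠ x : ℝ in atTop,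
    ‖exp (I * D.Theta κ ζ x)‖ ≤ B := by
  obtain ⟨B, hB⟩ := eventually_exp_Theta_le (D := D.refl κ hκ) (κ := κ) hζ
  refine ⟨B, (tendsto_neg_atTop_atBot.eventually hB).mono fun x hx => ?_⟩
  rw [Theta_refl] at hx
  simpa using hx

theorem psiP2_eq (h : D.Decays 1) {ζ : ℂ} (hζ : ζ ∈ D.upper κ) : D.psiP2 κ ζ = D.jostP κ hκ ζ := by
  obtain ⟨C, hC⟩ := D.exists_norm_X_le κ ζ
  obtain ⟨B, hB⟩ := eventually_exp_Theta_le' hκ (D := D) hζ.2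
  exact (isJostColumn_jostP hκ h hζ).jostColumn_eq hC (D.X_trace κ ζ) (jvecP_ne_zero _) hB

theorem isJostColumn_psiM1 (h : D.Decays 1) {ζ : ℂ} (hζ : ζ ∈ D.upper κ) :
    IsJostColumn (D.X κ ζ) atBot (fun x => -I * D.Theta κ ζ x)
      ![1, -I * κ * conj D.qm * ζ⁻¹] (D.psiM1 κ ζ) := by
  rw [psiM1_eq h hζ]; exact isJostColumn_jost h hζ

include hκ in
theorem isJostColumn_psiP2 (h : D.Decays 1) {ζ : ℂ} (hζ : ζ ∈ D.upper κ) :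
    IsJostColumn (D.X κ ζ) atTop (fun x => I * D.Theta κ ζ x)
      ![-I * D.qp * ζ⁻¹, 1] (D.psiP2 κ ζ) := by
  rw [psiP2_eq hκ h hζ]; exact isJostColumn_jostP hκ h hζ

variable (κ D) in
/-- The involution `ζ ↦ -κ q₀²/ζ`, which fixes `k` and reverses `λ`. -/
def inv (ζ : ℂ) : ℂ := -κ * D.q₀ ^ 2 * ζ⁻¹

section

variable {ζ : ℂ} (hζ : ζ ≠ 0)

include hκ hζ

theorem lam_inv : D.lam κ (D.inv κ ζ) = -D.lam κ ζ := by
  have hk : (κ : ℂ) ≠ 0 := kappa_ne hκ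
  have hq : (D.q₀ : ℂ) ≠ 0 := D.q₀_ne
  unfold lam inv; field_simp; ring

theorem z_inv : D.z κ (D.inv κ ζ) = D.z κ ζ := by
  have hk : (κ : ℂ) ≠ 0 := kappa_ne hκ
  have hq : (D.q₀ : ℂ) ≠ 0 := D.q₀_ne
  unfold z k inv; field_simp; ring

theorem inv_ne_zero : D.inv κ ζ ≠ 0 := by
  have hk : (κ : ℂ) ≠ 0 := kappa_ne hκ
  have hq : (D.q₀ : ℂ) ≠ 0 := D.q₀_ne
  simp [inv, hk, hq, hζ]

theorem Theta_inv (x : ℝ) : D.Theta κ (D.inv κ ζ) x = -D.Theta κ ζ x := by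
  rw [Theta, Theta, lam_inv hκ hζ, z_inv hκ hζ]; ring

theorem X_inv : D.X κ (D.inv κ ζ) = D.X κ ζ := by
  ext1 x
  rw [X, X, z_inv hκ hζ]

variable (hl : (D.lam κ ζ).im ≤ 0)

include hl

theorem inv_mem_upper : D.inv κ ζ ∈ D.upper κ := by
  refine ⟨inv_ne_zero hκ hζ, ?_⟩
  rw [lam_inv hκ hζ, neg_im]
  linarith

theorem eventually_exp_Theta_M2 : ∃ B, ∀ᶠ x : ℝ in atBot, ‖exp (I * D.Theta κ ζ x)‖ ≤ B := by
  obtain ⟨B, hB⟩ := eventually_exp_Theta_le (D := D) (inv_mem_upper hκ hζ hl).2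
  refine ⟨B, hB.mono fun x hx => ?_⟩
  rw [Theta_inv hκ hζ] at hx
  simpa using hx

theorem eventually_exp_Theta_P1 : ∃ B, ∀ᶠ x : ℝ in atTop, ‖exp (-I * D.Theta κ ζ x)‖ ≤ B := by
  obtain ⟨B, hB⟩ := eventually_exp_Theta_le' hκ (D := D) (inv_mem_upper hκ hζ hl).2
  refine ⟨B, hB.mono fun x hx => ?_⟩
  rw [Theta_inv hκ hζ] at hx
  simpa using hx

theorem psiM2_eq {u : ℝ → Fin 2 → ℂ} (hu : IsJostColumn (D.X κ ζ) atBot (fun x => I * D.Theta κ ζ x)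
      ![-I * D.qm * ζ⁻¹, 1] u) : D.psiM2 κ ζ = u := by
  obtain ⟨C, hC⟩ := D.exists_norm_X_le κ ζ
  obtain ⟨B, hB⟩ := eventually_exp_Theta_M2 hκ hζ hl
  exact hu.jostColumn_eq hC (D.X_trace κ ζ) (jvecP_ne_zero _) hB

theorem psiP1_eq
    {u : ℝ → Fin 2 → ℂ} (hu : IsJostColumn (D.X κ ζ) atTop (fun x => -I * D.Theta κ ζ x)
      ![1, -I * κ * conj D.qp * ζ⁻¹] u) : D.psiP1 κ ζ = u := by
  obtain ⟨C, hC⟩ := D.exists_norm_X_le κ ζ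
  obtain ⟨B, hB⟩ := eventually_exp_Theta_P1 hκ hζ hl
  exact hu.jostColumn_eq hC (D.X_trace κ ζ) (jvecM_ne_zero _) hB

end

theorem lam_conj (ζ : ℂ) : D.lam κ (conj ζ) = conj (D.lam κ ζ) := by simp [lam, map_ofNat]

theorem z_conj (ζ : ℂ) : D.z κ (conj ζ) = conj (D.z κ ζ) := by simp [z, k, map_ofNat]

theorem Theta_conj (ζ : ℂ) (x : ℝ) : D.Theta κ (conj ζ) x = conj (D.Theta κ ζ x) := by
  simp [Theta, lam_conj, z_conj, map_ofNat]

theorem conj_mem_upper {ζ : ℂ} (hζ : ζ ≠ 0) (hl : (D.lam κ ζ).im ≤ 0) : conj ζ ∈ D.upper κ := by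
  refine ⟨by simpa using hζ, ?_⟩
  rw [lam_conj, conj_im]
  linarith

theorem isJostColumn_smul {X : ℝ → Matrix (Fin 2) (Fin 2) ℂ} {l : Filter ℝ} {Φ : ℝ → ℂ}
    {e : Fin 2 → ℂ} {u : ℝ → Fin 2 → ℂ} (hu : IsJostColumn X l Φ e u) (c : ℂ) :
    IsJostColumn X l Φ (c • e) fun x => c • u x := by
  refine ⟨fun x => ?_, (hu.2.const_smul c).congr fun x => smul_comm _ _ _⟩
  rw [Matrix.mulVec_smul]
  exact (hu.1 x).fun_const_smul c

theorem wr_eq_of_isJostColumn {X : ℝ → Matrix (Fin 2) (Fin 2) ℂ} {l : Filter ℝ} [l.NeBot]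
    {Φ Ψ : ℝ → ℂ} {e e' : Fin 2 → ℂ} {u v : ℝ → Fin 2 → ℂ} (hu : IsJostColumn X l Φ e u)
    (hv : IsJostColumn X l Ψ e' v) (hX : ∀ x, X x 0 0 + X x 1 1 = 0) (hΦ : ∀ x, Φ x + Ψ x = 0) :
    wr (u 0) (v 0) = wr e e' := by
  refine tendsto_nhds_unique tendsto_const_nhds ((tendsto_wr hu.2 hv.2).congr fun x => ?_)
  rw [wr_smul_smul, ← exp_add, ← neg_add, hΦ, neg_zero, exp_zero, one_mul,
    wr_eq_wr_zero hX hu.1 hv.1]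

variable (κ) in
/-- `v ↦ J v̄` with `J = (0, 1; -κ, 0)`. -/
def jconj (v : Fin 2 → ℂ) : Fin 2 → ℂ := ![conj (v 1), -κ * conj (v 0)]

theorem wr_jconj (u v : Fin 2 → ℂ) : wr (jconj κ u) (jconj κ v) = κ * conj (wr u v) := by
  simp [wr, jconj]; ring

theorem isJostColumn_jconj (hκ : |κ| = 1) {l : Filter ℝ} {Φ : ℝ → ℂ} {e : Fin 2 → ℂ} {ζ : ℂ}
    {u : ℝ → Fin 2 → ℂ} (hu : IsJostColumn (D.X κ (conj ζ)) l Φ e u) :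
    IsJostColumn (D.X κ ζ) l (fun x => conj (Φ x)) (jconj κ e) fun x => jconj κ (u x) := by
  have hk2 := kappa_sq hκ
  constructor
  · intro x
    have h' := hasDerivAt_pi.1 (hu.1 x)
    refine hasDerivAt_pi.2 fun i => ?_
    fin_cases i
    · refine (HasDerivAt.star (h' 1)).congr_deriv ?_
      simp only [mulVec_fin_two, jconj, X, z_conj, Fin.zero_eta, Matrix.of_apply, Matrix.cons_val,
        ← starRingEnd_apply]
      simp [map_ofNat]
      ring
    · refine ((HasDerivAt.star (h' 0)).const_mul (-κ : ℂ)).congr_deriv ?_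
      simp only [mulVec_fin_two, jconj, X, z_conj, Fin.mk_one, Matrix.of_apply, Matrix.cons_val,
        ← starRingEnd_apply]
      simp [map_ofNat]
      ring
  · have h' := tendsto_pi_nhds.1 hu.2
    refine tendsto_pi_nhds.2 fun i => ?_
    have he : ∀ x, exp (-conj (Φ x)) = conj (exp (-Φ x)) := fun x => by
      rw [← exp_conj, map_neg]
    fin_cases i
    · refine ((continuous_conj.tendsto _).comp (h' 1)).congr fun x => ?_
      simp [jconj, he]
    · refine (((continuous_conj.tendsto _).comp (h' 0)).const_mul (-κ : ℂ)).congr fun x => ?_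
      simp [jconj, he]
      ring

theorem detE_eq {ζ : ℂ} (hζ : ζ ≠ 0) : D.detE κ ζ = 2 * D.lam κ ζ / ζ := by
  unfold detE lam; field_simp

theorem detE_conj (ζ : ℂ) : D.detE κ (conj ζ) = conj (D.detE κ ζ) := by simp [detE]

section

variable (h : D.Decays 1) {ζ : ℂ} (hζ : ζ ≠ 0) (hl : (D.lam κ ζ).im ≤ 0)

include hκ h hζ hl

theorem isJostColumn_psiM1_inv : IsJostColumn (D.X κ ζ) atBot (fun x => I * D.Theta κ ζ x)
      ![-I * D.qm * ζ⁻¹, 1] fun x => (-I * D.qm * ζ⁻¹) • D.psiM1 κ (D.inv κ ζ) x := by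
  have := isJostColumn_smul (isJostColumn_psiM1 h (inv_mem_upper hκ hζ hl)) (-I * D.qm * ζ⁻¹)
  rw [X_inv hκ hζ] at this
  simp_rw [Theta_inv hκ hζ] at this
  convert! this using 1
  · ext x; ring
  · have hq := D.q₀_ne
    have hk := kappa_ne hκ
    ext i
    fin_cases i
    · simp
    · simp [inv]
      field_simp
      linear_combination (-(1 : ℂ)) * D.conj_qm_mul + (conj D.qm * D.qm) * I_sq

theorem isJostColumn_psiP2_inv : IsJostColumn (D.X κ ζ) atTop (fun x => -I * D.Theta κ ζ x)
      ![1, -I * κ * conj D.qp * ζ⁻¹]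
      fun x => (-I * κ * conj D.qp * ζ⁻¹) • D.psiP2 κ (D.inv κ ζ) x := by
  have := isJostColumn_smul (isJostColumn_psiP2 hκ h (inv_mem_upper hκ hζ hl))
    (-I * κ * conj D.qp * ζ⁻¹)
  rw [X_inv hκ hζ] at this
  simp_rw [Theta_inv hκ hζ] at this
  convert! this using 1
  · ext x; ring
  · have hq := D.q₀_ne
    have hk := kappa_ne hκ
    ext i
    fin_cases i
    · simp [inv]
      field_simp
      linear_combination (-(1 : ℂ)) * D.conj_qp_mul + (conj D.qp * D.qp) * I_sq
    · simp

theorem psiM2_eq_jconj : D.psiM2 κ ζ = fun x => (-κ : ℂ) • jconj κ (D.psiM1 κ (conj ζ) x) := by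
  refine psiM2_eq hκ hζ hl ?_
  have := isJostColumn_smul (isJostColumn_jconj hκ
    (isJostColumn_psiM1 h (conj_mem_upper hζ hl))) (-κ : ℂ)
  simp_rw [Theta_conj] at this
  have hk2 := kappa_sq hκ
  convert! this using 1
  · ext x; simp
  · ext i
    fin_cases i
    · simp [jconj]
      linear_combination (-(I * D.qm * ζ⁻¹)) * hk2
    · simp [jconj, hk2]

theorem psiP1_eq_jconj : D.psiP1 κ ζ = fun x => jconj κ (D.psiP2 κ (conj ζ) x) := by
  refine psiP1_eq hκ hζ hl ?_
  have := isJostColumn_jconj hκ (isJostColumn_psiP2 hκ h (conj_mem_upper hζ hl))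
  simp_rw [Theta_conj] at this
  convert! this using 1
  · ext x; simp
  · ext i
    fin_cases i
    · simp [jconj]
    · simp [jconj]; ring

/-- `ã(ζ) = conj a(ζ̄)`. -/
theorem aTilde_eq : D.aTilde κ ζ = conj (D.a κ (conj ζ)) := by
  have hk2 := kappa_sq hκ
  rw [aTilde, a, psiM2_eq_jconj hκ h hζ hl, psiP1_eq_jconj hκ h hζ hl, map_div₀, detE_conj,
    conj_conj]
  congr 1
  have h1 := wr_smul_smul 1 (-κ : ℂ) (jconj κ (D.psiP2 κ (conj ζ) 0)) (jconj κ (D.psiM1 κ (conj ζ) 0))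
  rw [one_smul, wr_jconj] at h1
  rw [h1]
  simp only [wr, map_sub, map_mul]
  linear_combination (-(conj (D.psiP2 κ (conj ζ) 0 0) * conj (D.psiM1 κ (conj ζ) 0 1) -
    conj (D.psiP2 κ (conj ζ) 0 1) * conj (D.psiM1 κ (conj ζ) 0 0))) * hk2

theorem aTilde_eq_inv : D.aTilde κ ζ = D.qm / D.qp * D.a κ (D.inv κ ζ) := by
  have hk2 := kappa_sq hκ
  have hk : (κ : ℂ) ≠ 0 := fun h => by simp [h] at hk2
  have hq : (D.q₀ : ℂ) ≠ 0 := D.q₀_ne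
  have hqp : D.qp ≠ 0 := D.qp_ne
  have hqc : conj D.qp = D.q₀ ^ 2 / D.qp := by rw [← D.conj_qp_mul]; field_simp
  rw [aTilde, a, psiM2_eq hκ hζ hl (isJostColumn_psiM1_inv hκ h hζ hl),
    psiP1_eq hκ hζ hl (isJostColumn_psiP2_inv hκ h hζ hl), wr_smul_smul, detE_eq hζ,
    detE_eq (inv_ne_zero hκ hζ), lam_inv hκ hζ, hqc]
  have hw : wr (D.psiP2 κ (D.inv κ ζ) 0) (D.psiM1 κ (D.inv κ ζ) 0) =
      -wr (D.psiM1 κ (D.inv κ ζ) 0) (D.psiP2 κ (D.inv κ ζ) 0) := by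
    simp only [wr]; ring
  rw [hw]
  generalize wr (D.psiM1 κ (D.inv κ ζ) 0) (D.psiP2 κ (D.inv κ ζ) 0) = w
  by_cases hl0 : D.lam κ ζ = 0
  · simp [hl0]
  unfold inv
  field_simp
  linear_combination (-(D.qm * w)) * I_sq

end

/-- `a(-κ q₀²/ζ̄) = (q₊/q₋) conj a(ζ)` in `Im λ ≥ 0`. -/
theorem a_inv_conj (h : D.Decays 1) (hκ : |κ| = 1) {ζ : ℂ} (hζ : ζ ∈ D.upper κ) :
    D.a κ (D.inv κ (conj ζ)) = D.qp / D.qm * conj (D.a κ ζ) := by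
  have hqp : D.qp ≠ 0 := D.qp_ne
  have hqm : D.qm ≠ 0 := D.qm_ne
  have hz : conj ζ ≠ 0 := by simpa using hζ.1
  have hl : (D.lam κ (conj ζ)).im ≤ 0 := by rw [lam_conj, conj_im]; linarith [hζ.2]
  have h1 := aTilde_eq hκ h hz hl
  rw [aTilde_eq_inv hκ h hz hl, conj_conj] at h1
  rw [← h1]
  field_simp

/-- The determinant relation `a ã - b b̃ = 1` on the continuous spectrum. -/
theorem a_mul_add_b_mul (h : D.Decays 1) (hκ : |κ| = 1) {ζ : ℂ} (hζ : ζ ≠ 0)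
    (hl : (D.lam κ ζ).im = 0) (hl0 : D.lam κ ζ ≠ 0) :
    D.a κ ζ * conj (D.a κ (conj ζ)) + κ * (D.b κ ζ * conj (D.b κ (conj ζ))) = 1 := by
  have hk2 := kappa_sq hκ
  have hup : ζ ∈ D.upper κ := ⟨hζ, hl.ge⟩
  have hzc : conj ζ ≠ 0 := by simpa using hζ
  have hlc : (D.lam κ (conj ζ)).im = 0 := by rw [lam_conj, conj_im, hl, neg_zero]
  have hM1 := isJostColumn_psiM1 h hup
  have hP2 := isJostColumn_psiP2 hκ h hup
  have hM2 := isJostColumn_psiM1_inv hκ h hζ hl.le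
  have hP1 := isJostColumn_psiP2_inv hκ h hζ hl.le
  rw [← psiM2_eq hκ hζ hl.le hM2] at hM2
  rw [← psiP1_eq hκ hζ hl.le hP1] at hP1
  have hwM : wr (D.psiM1 κ ζ 0) (D.psiM2 κ ζ 0) = D.detE κ ζ := by
    rw [wr_eq_of_isJostColumn hM1 hM2 (D.X_trace κ ζ) fun x => by ring]
    simp [wr, detE]
    linear_combination (-(κ : ℂ) * (conj D.qm * D.qm) * ζ⁻¹ ^ 2) * I_sq +
      κ * ζ⁻¹ ^ 2 * D.conj_qm_mul
  have hwP : wr (D.psiP1 κ ζ 0) (D.psiP2 κ ζ 0) = D.detE κ ζ := by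
    rw [wr_eq_of_isJostColumn hP1 hP2 (D.X_trace κ ζ) fun x => by ring]
    simp [wr, detE]
    linear_combination (-(κ : ℂ) * (conj D.qp * D.qp) * ζ⁻¹ ^ 2) * I_sq +
      κ * ζ⁻¹ ^ 2 * D.conj_qp_mul
  have hdet : D.detE κ ζ ≠ 0 := by
    rw [detE_eq hζ]
    exact div_ne_zero (mul_ne_zero two_ne_zero hl0) hζ
  have hb : conj (D.b κ (conj ζ)) = -κ * (wr (D.psiM2 κ ζ 0) (D.psiP2 κ ζ 0) / D.detE κ ζ) := by
    rw [psiM2_eq_jconj hκ h hζ hl.le, b, map_div₀, detE_conj, conj_conj,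
      psiP1_eq_jconj hκ h hzc hlc.le, conj_conj]
    simp only [wr, jconj, map_sub, map_mul, Matrix.cons_val, conj_conj, map_neg,
      conj_ofReal, Pi.smul_apply, smul_eq_mul]
    field_simp
    linear_combination (-(κ : ℂ) * D.psiP2 κ ζ 0 0 * conj (D.psiM1 κ (conj ζ) 0 0) -
      conj (D.psiM1 κ (conj ζ) 0 1) * D.psiP2 κ ζ 0 1) * hk2
  rw [← aTilde_eq hκ h hζ hl.le, hb]
  have key : wr (D.psiM1 κ ζ 0) (D.psiP2 κ ζ 0) * wr (D.psiP1 κ ζ 0) (D.psiM2 κ ζ 0) -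
      wr (D.psiP1 κ ζ 0) (D.psiM1 κ ζ 0) * wr (D.psiM2 κ ζ 0) (D.psiP2 κ ζ 0) =
      D.detE κ ζ * D.detE κ ζ := by
    rw [← hwM]
    nth_rewrite 2 [hwM]
    rw [← hwP]
    simp only [wr]; ring
  rw [a, aTilde, b]
  field_simp
  linear_combination key - (wr (D.psiP1 κ ζ 0) (D.psiM1 κ ζ 0) *
    wr (D.psiM2 κ ζ 0) (D.psiP2 κ ζ 0)) * hk2

end NZProfile

/-! ### Behaviour for large spectral parameter -/

theorem le_of_integral_inequality {ρ : ℝ → ℝ} (hρc : Continuous ρ) (hρ0 : ∀ x, 0 ≤ ρ x)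
    (hρi : ∀ b, IntegrableOn ρ (Iic b)) {C δ A b : ℝ} (hC : 0 < C) (hδ : 0 ≤ δ) (hA : 0 ≤ A)
    {u : ℝ → ℝ} (huc : Continuous u) (hu0 : ∀ x, 0 ≤ u x) (huA : ∀ x ≤ b, u x ≤ A)
    (hu : ∀ x ≤ b, u x ≤ δ + ∫ s in Iic x, C * ρ s * u s) {x : ℝ} (hx : x ≤ b) :
    u x ≤ 2 * δ * Real.exp (2 * C * tailMass ρ b) := by
  have hw1 : ∀ x, 1 ≤ Real.exp (2 * C * tailMass ρ x) := fun x =>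
    Real.one_le_exp (by have := tailMass_nonneg hρ0 x; positivity)
  have key : ∀ n : ℕ, ∀ x ≤ b, u x ≤ (2 * δ + A * (1 / 2) ^ n) * Real.exp (2 * C * tailMass ρ x) := by
    intro n
    induction n with
    | zero =>
      intro x hx
      refine (huA x hx).trans ?_
      have := hw1 x
      have h2 : A ≤ 2 * δ + A * (1 / 2) ^ 0 := by simp [hδ]
      nlinarith
    | succ n ih =>
      intro x hx
      have hi : ∫ s in Iic x, C * ρ s * u s ≤ ∫ s in Iic x, C * (2 * δ + A * (1 / 2) ^ n) *
            (ρ s * Real.exp ((2 * C) * tailMass ρ s)) := by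
        have hb : ∀ s ∈ Iic x, C * ρ s * u s ≤ C * (2 * δ + A * (1 / 2) ^ n) *
            (ρ s * Real.exp ((2 * C) * tailMass ρ s)) := fun s hs => by
          have := mul_le_mul_of_nonneg_left (ih s (le_trans hs hx)) (mul_nonneg hC.le (hρ0 s))
          linarith
        have hint := (integrableOn_mul_exp_tailMass hρc hρ0 hρi (M := 2 * C) (by positivity)
          x).const_mul (C * (2 * δ + A * (1 / 2) ^ n))
        refine setIntegral_mono_on (hint.mono' ?_ ?_) hint measurableSet_Iic hb
        · exact ((continuous_const.mul hρc).mul huc).aestronglyMeasurable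
        · refine ae_Iic fun s hs => ?_
          rw [norm_of_nonneg (mul_nonneg (mul_nonneg hC.le (hρ0 s)) (hu0 s))]
          exact hb s hs
      rw [integral_const_mul] at hi
      have h2 := integral_mul_exp_tailMass_le hρc hρ0 hρi (M := 2 * C) (by positivity) x
      have h3 : C * (2 * δ + A * (1 / 2) ^ n) * ∫ s in Iic x,
          ρ s * Real.exp ((2 * C) * tailMass ρ s) ≤
          C * (2 * δ + A * (1 / 2) ^ n) * (Real.exp (2 * C * tailMass ρ x) / (2 * C)) := by
        gcongr
      have h4 : C * (2 * δ + A * (1 / 2) ^ n) * (Real.exp (2 * C * tailMass ρ x) / (2 * C)) =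
          (δ + A * (1 / 2) ^ (n + 1)) * Real.exp (2 * C * tailMass ρ x) := by
        rw [pow_succ]; field_simp
      have := hu x hx
      have := hw1 x
      nlinarith
  have hlim : Tendsto (fun n : ℕ => (2 * δ + A * (1 / 2) ^ n) * Real.exp (2 * C * tailMass ρ x))
      atTop (𝓝 ((2 * δ + A * 0) * Real.exp (2 * C * tailMass ρ x))) :=
    (((tendsto_pow_atTop_nhds_zero_of_lt_one (by norm_num) (by norm_num)).const_mul A).const_add
      _).mul_const _
  have := ge_of_tendsto' hlim fun n => key n x hx
  rw [mul_zero, add_zero] at this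
  refine this.trans ?_
  gcongr
  exact tailMass_mono hρ0 hρi hx

namespace NZProfile

variable {κ : ℝ} {D : NZProfile}

/-- The phase `κ T ∫_{-∞}^x (|q|² - q₀²)`. -/
def nu (κ : ℝ) (D : NZProfile) (x : ℝ) : ℝ := ∫ s in Iic x, κ * D.T * (‖D.q s‖ ^ 2 - D.q₀ ^ 2)

theorem integrableOn_normSq_sub (h : D.Decays 1) (b : ℝ) :
    IntegrableOn (fun s => ‖D.q s‖ ^ 2 - D.q₀ ^ 2) (Iic b) := by
  obtain ⟨B, hB, hq, -⟩ := D.exists_abs_normSq_sub_le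
  refine ((integrableOn_norm_sub h b).const_mul B).mono' ?_ (Eventually.of_forall hq)
  have := D.continuous_q
  exact Continuous.aestronglyMeasurable (by fun_prop)

theorem norm_lam_ge (hκ : |κ| = 1) {ζ : ℂ} (hζ : 1 + 2 * D.q₀ ≤ ‖ζ‖) : ‖ζ‖ / 4 ≤ ‖D.lam κ ζ‖ := by
  have hq := D.q₀_pos
  have hz : 0 < ‖ζ‖ := by linarith
  have h1 : ‖(κ : ℂ) * D.q₀ ^ 2 * ζ⁻¹‖ ≤ ‖ζ‖ / 4 := by
    rw [norm_mul, norm_mul, norm_real, norm_eq_abs, hκ, one_mul, norm_pow,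
      norm_real, norm_of_nonneg hq.le, norm_inv, ← div_eq_mul_inv, div_le_iff₀ hz]
    nlinarith
  have h2 : ‖ζ‖ - ‖(κ : ℂ) * D.q₀ ^ 2 * ζ⁻¹‖ ≤ ‖ζ + κ * D.q₀ ^ 2 * ζ⁻¹‖ := by
    have := norm_sub_norm_le ζ (-((κ : ℂ) * D.q₀ ^ 2 * ζ⁻¹))
    rwa [norm_neg, sub_neg_eq_add] at this
  rw [lam, norm_div, norm_ofNat]
  linarith

/-- Large parameters in the closed half plane `Im λ ≥ 0`. -/
def far (κ : ℝ) (D : NZProfile) : Set ℂ := {ζ | 1 + 2 * D.q₀ ≤ ‖ζ‖ ∧ 0 ≤ (D.lam κ ζ).im}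

theorem far_subset_upper : D.far κ ⊆ D.upper κ := fun ζ h =>
  ⟨norm_pos_iff.1 (by linarith [h.1, D.q₀_pos]), h.2⟩

theorem norm_expInt_far (hκ : |κ| = 1) {ζ : ℂ} (hζ : ζ ∈ D.far κ) {y : ℝ} (hy : 0 ≤ y) :
    ‖expInt (D.lam κ ζ) y‖ ≤ 4 / ‖ζ‖ := by
  have hz : 0 < ‖ζ‖ := by linarith [hζ.1, D.q₀_pos]
  have h1 := norm_lam_ge hκ hζ.1
  have h0 : 0 < ‖D.lam κ ζ‖ := by linarith
  refine (norm_expInt_le_inv hζ.2 (norm_pos_iff.1 h0) hy).trans ?_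
  rw [inv_le_comm₀ h0 (by positivity), inv_div]
  exact h1

theorem exists_norm_mu_far_le (h : D.Decays 1) (hκ : |κ| = 1) :
    ∃ A, 0 ≤ A ∧ ∀ ζ ∈ D.far κ, ∀ x ≤ 0, ‖D.mu κ ζ x‖ ≤ A := by
  obtain ⟨B, hB, hN⟩ := D.exists_norm_nil_le κ one_pos
  obtain ⟨V, hV, hpert⟩ := D.exists_norm_pert_le κ
  obtain ⟨M, hM, he⟩ := D.jvec_bound κ one_pos
  have hq := D.q₀_pos
  have h1 : ∀ ζ ∈ D.far κ, (1 : ℝ)⁻¹ ≤ ‖ζ‖ := fun ζ hζ => by have := hζ.1; rw [inv_one]; linarith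
  have hK : ∀ b : ℝ, ∀ ζ ∈ D.far κ, ∀ x s, s ≤ x → x ≤ b →
      ‖D.ker κ ζ x s‖ ≤ (1 + 8 * B) * V * D.wt s := fun b ζ hζ x s hs _ => by
    have hz := h1 ζ hζ
    rw [inv_one] at hz
    have hφ := norm_expInt_far hκ hζ (sub_nonneg.2 hs)
    have h3 : ‖(1 : (Fin 2 → ℂ) →L[ℂ] (Fin 2 → ℂ)) +
        expInt (D.lam κ ζ) (x - s) • mcl (D.nil κ ζ)‖ ≤ 1 + 8 * B := by
      refine (norm_add_le _ _).trans ?_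
      rw [norm_smul]
      have : ‖expInt (D.lam κ ζ) (x - s)‖ * ‖mcl (D.nil κ ζ)‖ ≤ 4 / ‖ζ‖ * (B * (1 + ‖ζ‖)) := by
        gcongr
        exact hN ζ (h1 ζ hζ)
      have h4 : 4 / ‖ζ‖ * (B * (1 + ‖ζ‖)) ≤ 8 * B := by
        rw [div_mul_eq_mul_div, div_le_iff₀ (by linarith)]
        nlinarith
      have h5 : ‖(1 : (Fin 2 → ℂ) →L[ℂ] (Fin 2 → ℂ))‖ ≤ 1 := ContinuousLinearMap.norm_id_le
      linarith
    have hw : ‖D.q s - D.qm‖ ≤ D.wt s := by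
      rw [wt]
      exact le_mul_of_one_le_left (norm_nonneg _) (by linarith [abs_nonneg s])
    calc _ ≤ _ := ContinuousLinearMap.opNorm_comp_le _ _
      _ ≤ (1 + 8 * B) * (V * D.wt s) := by
        gcongr
        exact (hpert s).trans (by gcongr)
      _ = _ := by ring
  have hC : ∀ b : ℝ, 0 < (1 + 8 * B) * V := fun _ => by positivity
  have V' : IsVolterra D.wt (D.ker κ) (D.jvec κ) (D.far κ) (fun _ => (1 + 8 * B) * V) M :=
    ⟨D.continuous_wt, D.wt_nonneg, integrableOn_wt h, hK, hC, fun ζ hζ => he ζ (h1 ζ hζ), hM,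
      fun ζ _ => D.continuous_ker κ ζ⟩
  exact ⟨_, norm_volterraSol_bound_nonneg V' 0, fun ζ hζ x hx => norm_volterraSol_le_bound V' hζ hx⟩

/-- The part of the integral equation for `μ` that is small for large `ζ`. -/
def smallPart (κ : ℝ) (D : NZProfile) (ζ : ℂ) (x s : ℝ) : Fin 2 → ℂ :=
  expInt (D.lam κ ζ) (x - s) •
    ![I * κ * D.q₀ ^ 2 * ζ⁻¹ * (D.pert κ s *ᵥ D.mu κ ζ s) 0 + D.qm * (D.pert κ s *ᵥ D.mu κ ζ s) 1,
      -κ * conj D.qm * (D.pert κ s *ᵥ D.mu κ ζ s) 0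
        - I * κ * D.q₀ ^ 2 * ζ⁻¹ * (D.pert κ s *ᵥ D.mu κ ζ s) 1]

theorem ker_apply_zero (ζ : ℂ) (x s : ℝ) : D.ker κ ζ x s (D.mu κ ζ s) 0 =
      (D.pert κ s *ᵥ D.mu κ ζ s) 0 + D.smallPart κ ζ x s 0 := by
  simp only [ker, ContinuousLinearMap.comp_apply, _root_.add_apply, mcl_apply,
    _root_.smul_apply, one_apply_eq_self, smallPart, Pi.add_apply, Pi.smul_apply, smul_eq_mul]
  rw [mulVec_fin_two (D.nil κ ζ)]
  simp [nil]

theorem ker_apply_one {ζ : ℂ} (hζ : ζ ≠ 0) (x s : ℝ) : D.ker κ ζ x s (D.mu κ ζ s) 1 =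
      osc(D.lam κ ζ,x - s) * (D.pert κ s *ᵥ D.mu κ ζ s) 1 + D.smallPart κ ζ x s 1 := by
  have h1 := two_mul_expInt (D.lam κ ζ) (x - s)
  have h2 := D.lam_mul κ hζ
  simp only [ker, ContinuousLinearMap.comp_apply, _root_.add_apply, mcl_apply,
    _root_.smul_apply, one_apply_eq_self, smallPart, Pi.add_apply, Pi.smul_apply, smul_eq_mul]
  rw [mulVec_fin_two (D.nil κ ζ)]
  have h3 : osc(D.lam κ ζ,x - s) =
      1 + 2 * I * D.lam κ ζ * expInt (D.lam κ ζ) (x - s) := by rw [h1]; ring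
  rw [h3]
  simp only [nil, Matrix.of_apply, Matrix.cons_val]
  have h4 : 2 * D.lam κ ζ = ζ + κ * D.q₀ ^ 2 * ζ⁻¹ := by rw [lam]; ring
  linear_combination (-I * expInt (D.lam κ ζ) (x - s) * (D.pert κ s *ᵥ D.mu κ ζ s) 1) * h4

/-- `∫_{-∞}^x e^{2iλ(x-s)} conj(q - q₋) μ₁ ds`. -/
def oscInt (κ : ℝ) (D : NZProfile) (ζ : ℂ) (x : ℝ) : ℂ :=
  ∫ s in Iic x, osc(D.lam κ ζ,x - s) * (conj (D.q s - D.qm) * D.mu κ ζ s 0)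

/-- A priori bounds for `μ` and the integrands in its integral equation at large `ζ`. -/
theorem exists_far_bounds (h : D.Decays 1) (hκ : |κ| = 1) : ∃ A, 0 < A ∧
    (∀ ζ ∈ D.far κ, ∀ x ≤ 0, ‖D.mu κ ζ x‖ ≤ A) ∧
    (∀ ζ ∈ D.far κ, ∀ x ≤ 0, ‖D.pert κ x *ᵥ D.mu κ ζ x‖ ≤ A * ‖D.q x - D.qm‖) ∧
    (∀ ζ ∈ D.far κ, ∀ x ≤ 0, ∀ s ≤ x, ∀ i, ‖D.smallPart κ ζ x s i‖ ≤ A / ‖ζ‖ * ‖D.q s - D.qm‖) := by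
  obtain ⟨A, hA, hmu⟩ := exists_norm_mu_far_le h hκ
  obtain ⟨V, hV, hpert⟩ := D.exists_norm_pert_le κ
  have hq := D.q₀_pos
  have hf : ∀ ζ ∈ D.far κ, ∀ x ≤ 0, ‖D.pert κ x *ᵥ D.mu κ ζ x‖ ≤ V * A * ‖D.q x - D.qm‖ := by
    intro ζ hζ x hx
    rw [← mcl_apply]
    calc _ ≤ ‖mcl (D.pert κ x)‖ * ‖D.mu κ ζ x‖ := ContinuousLinearMap.le_opNorm _ _
      _ ≤ (V * ‖D.q x - D.qm‖) * A := by
        gcongr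
        · exact hpert x
        · exact hmu ζ hζ x hx
      _ = _ := by ring
  refine ⟨A + V * A + 4 * (D.q₀ ^ 2 + D.q₀) * (V * A) + 1, by positivity, fun ζ hζ x hx => ?_,
    fun ζ hζ x hx => ?_, fun ζ hζ x hx s hs i => ?_⟩
  · refine (hmu ζ hζ x hx).trans ?_
    have : 0 ≤ V * A + 4 * (D.q₀ ^ 2 + D.q₀) * (V * A) + 1 := by positivity
    linarith
  · refine (hf ζ hζ x hx).trans ?_
    gcongr
    have : 0 ≤ A + 4 * (D.q₀ ^ 2 + D.q₀) * (V * A) + 1 := by positivity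
    linarith
  · have hz : 1 ≤ ‖ζ‖ := by linarith [hζ.1]
    have hφ := norm_expInt_far hκ hζ (sub_nonneg.2 hs)
    have hfs := hf ζ hζ s (hs.trans hx)
    have hf0 := (norm_le_pi_norm (D.pert κ s *ᵥ D.mu κ ζ s) 0).trans hfs
    have hf1 := (norm_le_pi_norm (D.pert κ s *ᵥ D.mu κ ζ s) 1).trans hfs
    set W := V * A * ‖D.q s - D.qm‖ with hW
    have hW0 : 0 ≤ W := by positivity
    have hc1 : ‖I * κ * D.q₀ ^ 2 * ζ⁻¹‖ ≤ D.q₀ ^ 2 := by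
      simp only [norm_mul, norm_I, one_mul, norm_real, norm_eq_abs, norm_pow, norm_inv, sq_abs, hκ]
      exact mul_le_of_le_one_right (by positivity) (inv_le_one_of_one_le₀ hz)
    have hc2 : ‖(-κ : ℂ) * conj D.qm‖ ≤ D.q₀ := by
      rw [norm_mul, norm_neg, norm_real, norm_conj, norm_eq_abs, D.norm_qm, hκ, one_mul]
    have hc3 : ‖D.qm‖ ≤ D.q₀ := D.norm_qm.le
    have key : ∀ a b : ℂ, ∀ u v : ℝ, ‖a‖ ≤ u → ‖b‖ ≤ v → u + v = D.q₀ ^ 2 + D.q₀ →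
        ‖a‖ * ‖(D.pert κ s *ᵥ D.mu κ ζ s) 0‖ + ‖b‖ * ‖(D.pert κ s *ᵥ D.mu κ ζ s) 1‖
          ≤ (D.q₀ ^ 2 + D.q₀) * W := fun a b u v ha hb huv => by
      rw [← huv, add_mul]
      have := norm_nonneg a
      have := norm_nonneg b
      gcongr <;> linarith
    have hfin : 4 / ‖ζ‖ * ((D.q₀ ^ 2 + D.q₀) * W) ≤
        (A + V * A + 4 * (D.q₀ ^ 2 + D.q₀) * (V * A) + 1) / ‖ζ‖ * ‖D.q s - D.qm‖ := by
      have : 4 / ‖ζ‖ * ((D.q₀ ^ 2 + D.q₀) * W) =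
        (4 * (D.q₀ ^ 2 + D.q₀) * (V * A)) / ‖ζ‖ * ‖D.q s - D.qm‖ := by rw [hW]; ring
      rw [this]
      gcongr
      have : 0 ≤ A + V * A + 1 := by positivity
      linarith
    refine le_trans ?_ hfin
    rw [smallPart, Pi.smul_apply, norm_smul]
    gcongr
    fin_cases i
    · simp only [Fin.zero_eta, Matrix.cons_val]
      refine (norm_add_le _ _).trans ?_
      rw [norm_mul, norm_mul D.qm]
      exact key _ _ _ _ hc1 hc3 rfl
    · simp only [Fin.mk_one, Matrix.cons_val]
      refine (norm_sub_le _ _).trans ?_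
      rw [norm_mul, norm_mul (I * κ * D.q₀ ^ 2 * ζ⁻¹)]
      exact key _ _ _ _ hc2 hc1 (by ring)

end NZProfile

namespace NZProfile

variable {κ : ℝ} {D : NZProfile}

theorem norm_exp_kernel_le {ζ : ℂ} (hζ : 0 ≤ (D.lam κ ζ).im) {x s : ℝ} (hs : s ≤ x) :
    ‖osc(D.lam κ ζ,x - s)‖ ≤ 1 :=
  norm_cexp_le_one hζ (sub_nonneg.2 hs)

theorem mu_apply_eq (h : D.Decays 1) {ζ : ℂ} (hζ : ζ ∈ D.far κ) {x : ℝ} (hx : x ≤ 0) (i : Fin 2) :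
    IntegrableOn (fun s => D.ker κ ζ x s (D.mu κ ζ s) i) (Iic x) ∧
    D.mu κ ζ x i = D.jvec κ ζ i + ∫ s in Iic x, D.ker κ ζ x s (D.mu κ ζ s) i := by
  have hi := integrableOn_ker_mu h (far_subset_upper hζ) hx
  refine ⟨(ContinuousLinearMap.proj (R := ℂ) (φ := fun _ : Fin 2 => ℂ) i).integrable_comp hi, ?_⟩
  have := (ContinuousLinearMap.proj (R := ℂ) (φ := fun _ : Fin 2 => ℂ) i).integral_comp_comm hi
  simp only [ContinuousLinearMap.proj_apply] at this
  rw [this]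
  exact congrFun (mu_eq h (far_subset_upper hζ) x) i

theorem continuous_mu_apply (h : D.Decays 1) {ζ : ℂ} (hζ : ζ ∈ D.upper κ) (i : Fin 2) :
    Continuous fun s => D.mu κ ζ s i := (continuous_apply i).comp (continuous_mu h hζ)

theorem norm_jvec_one (hκ : |κ| = 1) (ζ : ℂ) : ‖D.jvec κ ζ 1‖ = D.q₀ / ‖ζ‖ := by
  simp [jvec, D.norm_qm, hκ, div_eq_mul_inv]

theorem integrableOn_osc (h : D.Decays 1) {ζ : ℂ} (hζ : ζ ∈ D.far κ) (hκ : |κ| = 1) {x : ℝ}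
    (hx : x ≤ 0) : IntegrableOn (fun s => osc(D.lam κ ζ,x - s) * (conj (D.q s - D.qm) * D.mu κ ζ s 0)) (Iic x) := by
  obtain ⟨A, hA, hmu, -, -⟩ := exists_far_bounds h hκ
  have hc : Continuous fun s => osc(D.lam κ ζ,x - s) * (conj (D.q s - D.qm) * D.mu κ ζ s 0) := by
    have h1 := continuous_mu_apply h (far_subset_upper hζ) 0
    have h2 := D.continuous_q
    have h3 : Continuous fun s => conj (D.q s - D.qm) :=
      continuous_conj.comp (h2.sub continuous_const)
    fun_prop
  refine ((integrableOn_norm_sub h x).mul_const A).mono' hc.aestronglyMeasurable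
    (ae_Iic fun s hsx => ?_)
  rw [norm_mul, norm_mul, norm_conj]
  refine (mul_le_of_le_one_left (by positivity) (norm_exp_kernel_le hζ.2 hsx)).trans ?_
  gcongr
  exact (norm_le_pi_norm _ 0).trans (hmu ζ hζ s (hsx.trans hx))

theorem add_div_le_mul {a δ z : ℝ} (ha : 0 ≤ a) (hδ : 0 ≤ δ) (hz : 0 < z) :
    δ + a / z ≤ (1 + a) * (δ + 1 / z) := by
  have : 0 ≤ a * δ + 1 / z := by positivity
  rw [div_eq_mul_one_div]; linarith

theorem exists_norm_mu_one_le (h : D.Decays 1) (hκ : |κ| = 1) : ∃ C, 0 < C ∧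
    ∀ ζ ∈ D.far κ, ∀ δ, 0 ≤ δ → (∀ x ≤ 0, ‖D.oscInt κ ζ x‖ ≤ δ) →
      ∀ x ≤ 0, ‖D.mu κ ζ x 1‖ ≤ C * (δ + 1 / ‖ζ‖) := by
  obtain ⟨A, hA, hmu, hf, hs⟩ := exists_far_bounds h hκ
  obtain ⟨B, hB, hq, -⟩ := D.exists_abs_normSq_sub_le
  have hq0 := D.q₀_pos
  set ρ : ℝ → ℝ := fun s => ‖D.q s - D.qm‖ with hρ
  have hρc : Continuous ρ := by have := D.continuous_q; fun_prop
  have hρ0 : ∀ s, 0 ≤ ρ s := fun s => norm_nonneg _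
  have hρi : ∀ b, IntegrableOn ρ (Iic b) := integrableOn_norm_sub h
  set K := tailMass ρ 0 with hK
  have hK0 : 0 ≤ K := tailMass_nonneg hρ0 0
  set P := |D.T| * B + 1 with hP
  have hP0 : 0 < P := by positivity
  refine ⟨2 * (1 + (D.q₀ + A * K)) * Real.exp (2 * P * K), by positivity,
    fun ζ hζ δ hδ hosc x hx => ?_⟩
  have hz : 0 < ‖ζ‖ := by linarith [hζ.1]
  have hc1 := continuous_mu_apply h (far_subset_upper hζ) 1
  have key := le_of_integral_inequality hρc hρ0 hρi (C := P) (δ := δ + (D.q₀ + A * K) / ‖ζ‖)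
    (A := A) (b := 0) hP0 (by positivity) hA.le (u := fun s => ‖D.mu κ ζ s 1‖) hc1.norm
    (fun _ => norm_nonneg _) (fun x hx => (norm_le_pi_norm _ 1).trans (hmu ζ hζ x hx)) ?_ hx
  · refine key.trans ?_
    calc _ ≤ 2 * ((1 + (D.q₀ + A * K)) * (δ + 1 / ‖ζ‖)) * Real.exp (2 * P * K) := by
          gcongr; exact add_div_le_mul (by positivity) hδ hz
      _ = _ := by ring
  · intro x hx
    obtain ⟨hi, he⟩ := mu_apply_eq h hζ hx 1
    have ho := integrableOn_osc h hζ hκ hx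
    have h2 : D.mu κ ζ x 1 = D.jvec κ ζ 1 + -κ * D.oscInt κ ζ x +
        ∫ s in Iic x, (D.ker κ ζ x s (D.mu κ ζ s) 1 - -κ * (osc(D.lam κ ζ,x - s) * (conj (D.q s - D.qm) * D.mu κ ζ s 0))) := by
      rw [integral_sub hi (ho.const_mul (-κ : ℂ)), integral_const_mul, he, oscInt]; ring
    have i1 : IntegrableOn (fun s => P * ρ s * ‖D.mu κ ζ s 1‖) (Iic x) := by
      refine ((hρi x).const_mul (P * A)).mono' ((hρc.const_mul P).mul hc1.norm).aestronglyMeasurable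
        (ae_Iic fun s hsx => ?_)
      rw [norm_of_nonneg (by positivity), mul_assoc, mul_comm (ρ s), ← mul_assoc]
      gcongr
      exact (norm_le_pi_norm _ 1).trans (hmu ζ hζ s (hsx.trans hx))
    have h3 : ‖∫ s in Iic x, (D.ker κ ζ x s (D.mu κ ζ s) 1 - -κ * (osc(D.lam κ ζ,x - s) * (conj (D.q s - D.qm) * D.mu κ ζ s 0)))‖ ≤
        ∫ s in Iic x, (P * ρ s * ‖D.mu κ ζ s 1‖ + A / ‖ζ‖ * ρ s) := by
      refine norm_integral_le_of_norm_le (i1.add ((hρi x).const_mul _)) (ae_Iic fun s hsx => ?_)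
      rw [ker_apply_one (far_subset_upper hζ).1, mulVec_fin_two]
      simp only [pert, Matrix.of_apply, Matrix.cons_val]
      set E := osc(D.lam κ ζ,x - s) with hE
      have hE1 : ‖E‖ ≤ 1 := norm_exp_kernel_le hζ.2 hsx
      have e1 : E * (-κ * conj (D.q s - D.qm) * D.mu κ ζ s 0 +
          -(I * κ * D.T * (‖D.q s‖ ^ 2 - D.q₀ ^ 2)) * D.mu κ ζ s 1) +
          D.smallPart κ ζ x s 1 - -κ * (E * (conj (D.q s - D.qm) * D.mu κ ζ s 0)) =
          -(E * (I * κ * D.T * ((‖D.q s‖ ^ 2 - D.q₀ ^ 2 : ℝ) : ℂ) * D.mu κ ζ s 1)) +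
            D.smallPart κ ζ x s 1 := by push_cast; ring
      rw [e1]
      refine (norm_add_le _ _).trans (add_le_add ?_ (hs ζ hζ x hx s hsx 1))
      rw [norm_neg, norm_mul]
      refine (mul_le_of_le_one_left (norm_nonneg _) hE1).trans ?_
      rw [norm_mul]
      gcongr
      simp only [norm_mul, norm_I, one_mul, norm_real, norm_eq_abs, hκ]
      have : |D.T| * |‖D.q s‖ ^ 2 - D.q₀ ^ 2| ≤ |D.T| * (B * ρ s) := by gcongr; exact hq s
      refine this.trans ?_
      rw [hP]
      nlinarith [hρ0 s]
    rw [integral_add i1 ((hρi x).const_mul _), integral_const_mul] at h3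
    have h4 : ∫ s in Iic x, ρ s ≤ K := tailMass_mono hρ0 hρi hx
    have h5 : ‖D.mu κ ζ x 1‖ ≤ D.q₀ / ‖ζ‖ + δ + ((∫ s in Iic x, P * ρ s * ‖D.mu κ ζ s 1‖) +
        A / ‖ζ‖ * ∫ s in Iic x, ρ s) := by
      rw [h2]
      refine (norm_add_le _ _).trans (add_le_add ((norm_add_le _ _).trans (add_le_add ?_ ?_)) ?_)
      · exact (norm_jvec_one hκ ζ).le
      · rw [norm_mul, norm_neg, norm_real, norm_eq_abs, hκ, one_mul]
        exact hosc x hx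
      · exact h3
    have h6 : A / ‖ζ‖ * ∫ s in Iic x, ρ s ≤ A / ‖ζ‖ * K := by gcongr
    have h7 : (D.q₀ + A * K) / ‖ζ‖ = D.q₀ / ‖ζ‖ + A / ‖ζ‖ * K := by ring
    rw [h7]
    linarith

theorem exists_norm_mu_zero_sub_le (h : D.Decays 1) (hκ : |κ| = 1) : ∃ C, 0 < C ∧
    ∀ ζ ∈ D.far κ, ∀ δ, 0 ≤ δ → (∀ x ≤ 0, ‖D.mu κ ζ x 1‖ ≤ δ) →
      ‖D.mu κ ζ 0 0 - exp (I * nu κ D 0)‖ ≤ C * (δ + 1 / ‖ζ‖) := by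
  obtain ⟨A, hA, hmu, hf, hs⟩ := exists_far_bounds h hκ
  obtain ⟨B, hB, hq, -⟩ := D.exists_abs_normSq_sub_le
  set ρ : ℝ → ℝ := fun s => ‖D.q s - D.qm‖ with hρ
  have hρc : Continuous ρ := by have := D.continuous_q; fun_prop
  have hρ0 : ∀ s, 0 ≤ ρ s := fun s => norm_nonneg _
  have hρi : ∀ b, IntegrableOn ρ (Iic b) := integrableOn_norm_sub h
  set K := tailMass ρ 0 with hK
  have hK0 : 0 ≤ K := tailMass_nonneg hρ0 0
  set g : ℝ → ℝ := fun s => κ * D.T * (‖D.q s‖ ^ 2 - D.q₀ ^ 2) with hg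
  have hgc : Continuous g := by have := D.continuous_q; fun_prop
  have hgi : ∀ b, IntegrableOn g (Iic b) := fun b => (integrableOn_normSq_sub h b).const_mul _
  have hgb : ∀ s, |g s| ≤ |D.T| * B * ρ s := fun s => by
    rw [hg, abs_mul, abs_mul, hκ, one_mul, mul_assoc]
    gcongr; exact hq s
  refine ⟨(1 + |D.T| * B * K) * (1 + A) * K + 1, by positivity, fun ζ hζ δ hδ hm => ?_⟩
  have hz : 0 < ‖ζ‖ := by linarith [hζ.1, D.q₀_pos]
  have hc0 := continuous_mu_apply h (far_subset_upper hζ) 0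
  set G : ℝ → ℂ := fun s => I * g s * D.mu κ ζ s 0 with hG
  have hGc : Continuous G := by fun_prop
  have hcore : ∀ s ≤ 0, ‖G s‖ ≤ |D.T| * B * A * ρ s := fun s hs => by
    rw [hG]
    simp only [norm_mul, norm_I, one_mul, norm_real, norm_eq_abs]
    calc _ ≤ (|D.T| * B * ρ s) * A := by
          gcongr
          · exact hgb s
          · exact (norm_le_pi_norm _ 0).trans (hmu ζ hζ s hs)
      _ = _ := by ring
  have hGi := integrableOn_Iic_of_continuous hGc
    (((hρi 0).const_mul _).mono' hGc.aestronglyMeasurable (ae_Iic hcore))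
  set F : ℝ → ℂ := fun x => 1 + ∫ s in Iic x, G s with hF
  have hF0 : ∀ x ≤ 0, ‖D.mu κ ζ x 0 - F x‖ ≤ (1 + A) * K * (δ + 1 / ‖ζ‖) := fun x hx => by
    obtain ⟨hi, he⟩ := mu_apply_eq h hζ hx 0
    have h1 : D.mu κ ζ x 0 - F x = ∫ s in Iic x, (D.ker κ ζ x s (D.mu κ ζ s) 0 - G s) := by
      rw [integral_sub hi (hGi x), he, hF]; simp [jvec]
    rw [h1]
    have h2 : ‖∫ s in Iic x, (D.ker κ ζ x s (D.mu κ ζ s) 0 - G s)‖ ≤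
        ∫ s in Iic x, ((δ + A / ‖ζ‖) * ρ s) := by
      refine norm_integral_le_of_norm_le ((hρi x).const_mul _) (ae_Iic fun s hsx => ?_)
      rw [ker_apply_zero, mulVec_fin_two]
      simp only [pert, Matrix.of_apply, Matrix.cons_val]
      have e1 : I * κ * D.T * (‖D.q s‖ ^ 2 - D.q₀ ^ 2) * D.mu κ ζ s 0 +
          (D.q s - D.qm) * D.mu κ ζ s 1 + D.smallPart κ ζ x s 0 - G s =
          (D.q s - D.qm) * D.mu κ ζ s 1 + D.smallPart κ ζ x s 0 := by
        simp only [hG, hg]; push_cast; ring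
      rw [e1, add_mul]
      refine (norm_add_le _ _).trans (add_le_add ?_ (hs ζ hζ x hx s hsx 0))
      rw [norm_mul, mul_comm]
      gcongr
      exact hm s (hsx.trans hx)
    refine h2.trans ?_
    rw [integral_const_mul]
    have h4 : ∫ s in Iic x, ρ s ≤ K := tailMass_mono hρ0 hρi hx
    have h5 := add_div_le_mul hA.le hδ hz
    calc _ ≤ (1 + A) * (δ + 1 / ‖ζ‖) * K := by gcongr
      _ = _ := by ring
  have hν : ∀ x, HasDerivAt (fun x => (nu κ D x : ℂ)) (g x) x := fun x =>
    (hasDerivAt_integral_Iic hgc hgi x).ofReal_comp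
  have hdF : ∀ x, HasDerivAt F (G x) x := fun x => (hasDerivAt_integral_Iic hGc hGi x).const_add _
  have hdH : ∀ x, HasDerivAt (fun x => exp (-I * nu κ D x) * F x)
      (exp (-I * nu κ D x) * (I * g x * (D.mu κ ζ x 0 - F x))) x := fun x => by
    refine ((((hν x).const_mul (-I)).cexp).mul (hdF x)).congr_deriv ?_
    simp only [hG]; ring
  have hnorm : ∀ x : ℝ, ‖exp (-I * nu κ D x)‖ = 1 := fun x => by
    rw [norm_exp]; simp
  have hbd : ∀ s ≤ 0, ‖exp (-I * nu κ D s) * (I * g s * (D.mu κ ζ s 0 - F s))‖ ≤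
      (|D.T| * B * ((1 + A) * K * (δ + 1 / ‖ζ‖))) * ρ s := fun s hs => by
    rw [norm_mul, hnorm, one_mul]
    simp only [norm_mul, norm_I, one_mul, norm_real, norm_eq_abs]
    calc _ ≤ (|D.T| * B * ρ s) * ((1 + A) * K * (δ + 1 / ‖ζ‖)) := by
          gcongr
          · exact hgb s
          · exact hF0 s hs
      _ = _ := by ring
  have hlim : Tendsto (fun x => exp (-I * nu κ D x) * F x) atBot (𝓝 1) := by
    have h1 : Tendsto (nu κ D) atBot (𝓝 0) := tendsto_integral_Iic_atBot (hgi 0)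
    have h2 : Tendsto F atBot (𝓝 (1 + 0)) := (tendsto_integral_Iic_atBot (hGi 0)).const_add 1
    have h3 : Tendsto (fun x => exp (-I * nu κ D x)) atBot (𝓝 (exp (-I * (0 : ℝ)))) := by
      refine (continuous_exp.tendsto _).comp ?_
      exact ((Complex.continuous_ofReal.tendsto _).comp h1).const_mul _
    simpa using h3.mul h2
  have hνc : Continuous fun x => (nu κ D x : ℂ) :=
    continuous_iff_continuousAt.2 fun x => (hν x).continuousAt
  have hFc : Continuous F := continuous_iff_continuousAt.2 fun x => (hdF x).continuousAt
  have hi : IntegrableOn (fun x => exp (-I * nu κ D x) *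
      (I * g x * (D.mu κ ζ x 0 - F x))) (Iic 0) := by
    refine ((hρi 0).const_mul _).mono' ?_ (ae_Iic hbd)
    exact Continuous.aestronglyMeasurable (by fun_prop)
  have hint := integral_Iic_of_hasDerivAt_of_tendsto' (a := 0) (fun x _ => hdH x) hi hlim
  have h1 : ‖exp (-I * nu κ D 0) * F 0 - 1‖ ≤ (|D.T| * B * ((1 + A) * K * (δ + 1 / ‖ζ‖))) * K := by
    rw [← hint]
    refine (norm_integral_le_of_norm_le ((hρi 0).const_mul _) (ae_Iic hbd)).trans ?_
    rw [integral_const_mul, hK, tailMass]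
  have h2 : D.mu κ ζ 0 0 - exp (I * nu κ D 0) = (D.mu κ ζ 0 0 - F 0) +
      exp (I * nu κ D 0) * (exp (-I * nu κ D 0) * F 0 - 1) := by
    rw [mul_sub, ← mul_assoc, ← exp_add]
    simp
  have hnorm' : ‖exp (I * nu κ D 0)‖ = 1 := by rw [norm_exp]; simp
  rw [h2]
  refine (norm_add_le _ _).trans ?_
  rw [norm_mul, hnorm', one_mul]
  have h3 := hF0 0 le_rfl
  have h4 : 0 ≤ δ + 1 / ‖ζ‖ := by positivity
  nlinarith

end NZProfile

theorem norm_oscillatory_integral_le {g m m' : ℝ → ℂ} (hg : ContDiff ℝ 1 g)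
    (hgs : HasCompactSupport g) (hm : ∀ s, HasDerivAt m (m' s) s) (hm' : Continuous m')
    {G A B : ℝ} (hG : ∀ s, ‖g s‖ ≤ G) {l : ℂ} (hl : 0 ≤ l.im) (hl0 : l ≠ 0) {x : ℝ}
    (hA : ∀ s ≤ x, ‖m s‖ ≤ A) (hB : ∀ s ≤ x, ‖m' s‖ ≤ B) :
    ‖∫ s in Iic x, osc(l,x - s) * (g s * m s)‖ ≤
      (G * A + ((∫ s, ‖deriv g s‖) * A + (∫ s, ‖g s‖) * B)) / (2 * ‖l‖) := by
  have hA0 : 0 ≤ A := (norm_nonneg _).trans (hA x le_rfl)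
  have hB0 : 0 ≤ B := (norm_nonneg _).trans (hB x le_rfl)
  have hmc : Continuous m := continuous_iff_continuousAt.2 fun s => (hm s).continuousAt
  have hgc : Continuous g := hg.continuous
  have hdc : Continuous (deriv g) := hg.continuous_deriv le_rfl
  set E : ℝ → ℂ := fun s => osc(l,x - s) with hE
  have hEc : Continuous E := by fun_prop
  have hEd : ∀ s, HasDerivAt E (-(2 * I * l) * E s) s := fun s => by
    have h1 : HasDerivAt (fun s : ℝ => ((x - s : ℝ) : ℂ)) (-1 : ℂ) s := by
      have := ((hasDerivAt_id s).const_sub x).ofReal_comp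
      simpa using this
    refine ((h1.const_mul (2 * I * l)).cexp).congr_deriv ?_
    simp only [hE]; ring
  have hd : ∀ s, HasDerivAt (fun s => E s * (g s * m s))
      (E s * (deriv g s * m s + g s * m' s) - 2 * I * l * (E s * (g s * m s))) s := fun s => by
    refine ((hEd s).mul (((hg.differentiable one_ne_zero s).hasDerivAt).mul (hm s))).congr_deriv ?_
    simp only [Pi.mul_apply]; ring
  have i1 : Integrable (fun s => E s * (deriv g s * m s + g s * m' s)) := by
    refine Continuous.integrable_of_hasCompactSupport (by fun_prop) ?_
    refine HasCompactSupport.mul_left (HasCompactSupport.add ?_ ?_)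
    · exact hgs.deriv.mul_right
    · exact hgs.mul_right
  have i2 : Integrable (fun s => E s * (g s * m s)) :=
    Continuous.integrable_of_hasCompactSupport (by fun_prop) (hgs.mul_right.mul_left)
  have hlim : Tendsto (fun s => E s * (g s * m s)) atBot (𝓝 0) := by
    have hs : HasCompactSupport fun s => E s * (g s * m s) := hgs.mul_right.mul_left
    exact hs.is_zero_at_infty.mono_left atBot_le_cocompact
  have hint := integral_Iic_of_hasDerivAt_of_tendsto' (a := x) (fun s _ => hd s)
    (i1.sub (i2.const_mul _)).integrableOn hlim
  rw [integral_sub i1.integrableOn (i2.const_mul _).integrableOn, integral_const_mul] at hint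
  have hEx : E x = 1 := by simp [hE]
  have hE1 : ∀ s ≤ x, ‖E s‖ ≤ 1 := fun s hs => norm_cexp_le_one hl (sub_nonneg.2 hs)
  have h2 : ‖∫ s in Iic x, E s * (deriv g s * m s + g s * m' s)‖ ≤
      (∫ s, ‖deriv g s‖) * A + (∫ s, ‖g s‖) * B := by
    have j1 : Integrable fun s => ‖deriv g s‖ :=
      (hdc.integrable_of_hasCompactSupport hgs.deriv).norm
    have j2 : Integrable fun s => ‖g s‖ := (hgc.integrable_of_hasCompactSupport hgs).norm
    rw [← integral_mul_const, ← integral_mul_const, ← integral_add (j1.mul_const A)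
      (j2.mul_const B)]
    refine (norm_integral_le_of_norm_le ((j1.mul_const A).add (j2.mul_const B)).integrableOn
      (ae_Iic fun s hs => ?_)).trans
      (setIntegral_le_integral ((j1.mul_const A).add (j2.mul_const B)) (Eventually.of_forall
        fun s => ?_))
    · rw [norm_mul]
      refine (mul_le_of_le_one_left (norm_nonneg _) (hE1 s hs)).trans ((norm_add_le _ _).trans ?_)
      rw [norm_mul, norm_mul]
      simp only [Pi.add_apply]
      gcongr
      · exact hA s hs
      · exact hB s hs
    · simp only [Pi.add_apply, Pi.zero_apply]; positivity
  have h3 : 2 * I * l * ∫ s in Iic x, E s * (g s * m s) =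
      (∫ s in Iic x, E s * (deriv g s * m s + g s * m' s)) - g x * m x := by
    rw [hEx] at hint
    linear_combination -hint
  have h4 := congrArg norm h3
  rw [norm_mul, norm_mul, norm_mul, norm_I, norm_ofNat, mul_one] at h4
  rw [le_div_iff₀ (by positivity), mul_comm, h4]
  refine (norm_sub_le _ _).trans ?_
  have h5 : ‖g x * m x‖ ≤ G * A := by
    rw [norm_mul]
    have := (norm_nonneg _).trans (hG x)
    gcongr
    · exact hG x
    · exact hA x le_rfl
  linarith

namespace NZProfile

variable {κ : ℝ} {D : NZProfile}

theorem lam_I_mul (κ : ℝ) (D : NZProfile) (y : ℝ) :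
    D.lam κ (I * y) = I * (((y - κ * D.q₀ ^ 2 * y⁻¹) / 2 : ℝ) : ℂ) := by
  rw [lam, mul_inv, Complex.inv_I]; push_cast; ring

theorem I_mul_mem_far (hκ : |κ| = 1) {y : ℝ} (hy : 1 + 2 * D.q₀ ≤ y) :
    I * y ∈ D.far κ ∧ y / 4 ≤ (D.lam κ (I * y)).im := by
  have hq := D.q₀_pos
  have hy0 : 0 < y := by linarith
  have h1 : y / 4 ≤ (D.lam κ (I * y)).im := by
    rw [lam_I_mul, Complex.I_mul_im, ofReal_re]
    have : κ * D.q₀ ^ 2 * y⁻¹ ≤ y / 2 := by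
      rw [← div_eq_mul_inv, div_le_iff₀ hy0]
      have h2 := le_abs_self κ
      rw [hκ] at h2
      nlinarith [mul_nonneg (sub_nonneg.2 h2) (sq_nonneg D.q₀)]
    linarith
  refine ⟨⟨?_, by linarith⟩, h1⟩
  rw [norm_mul, norm_I, one_mul, norm_real, norm_of_nonneg hy0.le]
  exact hy

variable (κ D) in
/-- The Wronskian `W[ψ₋₁, ψ₊₂]`. -/
def wron (hκ : |κ| = 1) (ζ : ℂ) : ℂ :=
  D.mu κ ζ 0 0 * (D.refl κ hκ).mu κ ζ 0 0 - D.mu κ ζ 0 1 * (D.refl κ hκ).mu κ ζ 0 1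

theorem lam_ne_zero_of_im {ζ : ℂ} (h : 0 < (D.lam κ ζ).im) : D.lam κ ζ ≠ 0 := fun h0 => by
  rw [h0] at h; simp at h

theorem mem_upper_of_im {ζ : ℂ} (h : 0 < (D.lam κ ζ).im) : ζ ∈ D.upper κ :=
  ⟨D.ne_zero_of_im_lam κ h, h.le⟩

theorem integrable_normSq_sub (h : D.Decays 1) :
    Integrable (fun x : ℝ => ‖D.q x‖ ^ 2 - D.q₀ ^ 2) := by
  have h1 := integrableOn_normSq_sub (h.refl (κ := 1) abs_one) 0
  have h2 : IntegrableOn (fun x : ℝ => ‖D.q x‖ ^ 2 - D.q₀ ^ 2) (Ici 0) := by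
    have h3 := h1.comp_neg
    simp only [norm_refl_q, neg_neg] at h3
    simpa [refl] using h3
  rw [← integrableOn_univ, ← Set.Iic_union_Ici (a := (0 : ℝ))]
  exact (integrableOn_normSq_sub h 0).union h2

variable (h : D.Decays 1) (hκ : |κ| = 1)

include h hκ

theorem exists_norm_deriv_mu_zero_le : ∃ B, 0 ≤ B ∧
    ∀ ζ ∈ D.far κ, ∀ x ≤ 0, ‖(D.nil κ ζ *ᵥ D.mu κ ζ x + D.pert κ x *ᵥ D.mu κ ζ x) 0‖ ≤ B := by
  obtain ⟨A, hA, hmu, hf, -⟩ := exists_far_bounds h hκ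
  obtain ⟨Q, hQ, hq⟩ := D.exists_norm_q_le
  have hq0 := D.q₀_pos
  refine ⟨(D.q₀ ^ 2 + D.q₀) * A + A * (Q + D.q₀), by positivity, fun ζ hζ x hx => ?_⟩
  have hz : 1 ≤ ‖ζ‖ := by linarith [hζ.1]
  have h0 := (norm_le_pi_norm _ 0).trans (hmu ζ hζ x hx)
  have h1 := (norm_le_pi_norm _ 1).trans (hmu ζ hζ x hx)
  rw [Pi.add_apply]
  refine (norm_add_le _ _).trans (add_le_add ?_ ?_)
  · rw [mulVec_fin_two]
    simp only [nil, Matrix.of_apply, Matrix.cons_val]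
    refine (norm_add_le _ _).trans ?_
    rw [norm_mul, norm_mul D.qm, D.norm_qm, add_mul]
    gcongr
    simp only [norm_mul, norm_I, one_mul, norm_real, norm_eq_abs, norm_pow, norm_inv, sq_abs, hκ]
    exact mul_le_of_le_one_right (by positivity) (inv_le_one_of_one_le₀ hz)
  · refine (norm_le_pi_norm _ 0).trans ((hf ζ hζ x hx).trans ?_)
    gcongr
    refine (norm_sub_le _ _).trans ?_
    rw [D.norm_qm]
    linarith [hq x]

/-- A Riemann-Lebesgue lemma. -/
theorem exists_norm_oscInt_le {ε : ℝ} (hε : 0 < ε) :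
    ∃ R : ℝ, ∀ ζ ∈ D.far κ, R ≤ ‖ζ‖ → ∀ x ≤ 0, ‖D.oscInt κ ζ x‖ ≤ ε := by
  obtain ⟨A, hA, hmu, -, -⟩ := exists_far_bounds h hκ
  obtain ⟨B, hB, hdmu⟩ := exists_norm_deriv_mu_zero_le h hκ
  have hpc : Continuous fun s => conj (D.q s - D.qm) :=
    continuous_conj.comp (D.continuous_q.sub continuous_const)
  set p : ℝ → ℂ := Set.indicator (Iic 0) fun s => conj (D.q s - D.qm) with hp
  have hpi : Integrable p := by
    rw [hp, integrable_indicator_iff measurableSet_Iic]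
    refine (integrableOn_norm_sub h 0).mono' hpc.aestronglyMeasurable
      (Eventually.of_forall fun s => ?_)
    rw [norm_conj]
  obtain ⟨g, hgs, hg, hpg⟩ := MemLp.exist_eLpNorm_sub_le ENNReal.one_ne_top le_rfl
    (memLp_one_iff_integrable.2 hpi) (ε := ε / (2 * A)) (by positivity)
  have hgi : Integrable g := hg.continuous.integrable_of_hasCompactSupport hgs
  have hd : ∫ s, ‖p s - g s‖ ≤ ε / (2 * A) := by
    rwa [eLpNorm_one_eq_lintegral_enorm, ← ofReal_integral_norm_eq_lintegral_enorm (hpi.sub hgi),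
      ENNReal.ofReal_le_ofReal_iff (by positivity)] at hpg
  obtain ⟨G, hG⟩ := hgs.exists_bound_of_continuous hg.continuous
  set C := G * A + ((∫ s, ‖deriv g s‖) * A + (∫ s, ‖g s‖) * B) with hC
  refine ⟨4 * |C| / ε, fun ζ hζ hR x hx => ?_⟩
  have hz : 0 < ‖ζ‖ := by linarith [hζ.1, D.q₀_pos]
  have hlge := norm_lam_ge hκ hζ.1
  have hl0 : D.lam κ ζ ≠ 0 := norm_pos_iff.1 (by linarith)
  have hup := far_subset_upper hζ
  have hmc := continuous_mu_apply h hup 0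
  have hdm : ∀ s, HasDerivAt (fun s => D.mu κ ζ s 0)
      ((D.nil κ ζ *ᵥ D.mu κ ζ s + D.pert κ s *ᵥ D.mu κ ζ s) 0) s := fun s =>
    hasDerivAt_pi.1 (hasDerivAt_mu h hup s) 0
  have hdc : Continuous fun s => (D.nil κ ζ *ᵥ D.mu κ ζ s + D.pert κ s *ᵥ D.mu κ ζ s) 0 :=
    (continuous_apply 0).comp ((continuous_const.matrix_mulVec (continuous_mu h hup)).add
      ((D.continuous_pert κ).matrix_mulVec (continuous_mu h hup)))
  have h1 := norm_oscillatory_integral_le (hg.of_le (by exact_mod_cast le_top)) hgs hdm hdc hG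
    hζ.2 hl0 (x := x) (fun s hs => (norm_le_pi_norm _ 0).trans (hmu ζ hζ s (hs.trans hx)))
    (fun s hs => hdmu ζ hζ s (hs.trans hx))
  rw [← hC] at h1
  have i1 := integrableOn_osc h hζ hκ hx
  have i2 : IntegrableOn (fun s => osc(D.lam κ ζ,x - s) * (g s * D.mu κ ζ s 0)) (Iic x) := by
    refine (Continuous.integrable_of_hasCompactSupport ?_ ?_).integrableOn
    · have := hg.continuous
      fun_prop
    · exact hgs.mul_right.mul_left
  have h2 : ‖D.oscInt κ ζ x - ∫ s in Iic x, osc(D.lam κ ζ,x - s) * (g s * D.mu κ ζ s 0)‖ ≤ ε / 2 := by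
    rw [oscInt, ← integral_sub i1 i2]
    have h3 := (norm_integral_le_of_norm_le (((hpi.sub hgi).norm.mul_const A).integrableOn
      (s := Iic x)) (f := fun s => osc(D.lam κ ζ,x - s) * (conj (D.q s - D.qm) * D.mu κ ζ s 0) - osc(D.lam κ ζ,x - s) * (g s * D.mu κ ζ s 0)) (ae_Iic fun s hs => ?_)).trans
      (setIntegral_le_integral ((hpi.sub hgi).norm.mul_const A) (Eventually.of_forall
        fun s => ?_))
    · refine h3.trans ?_
      rw [integral_mul_const]
      calc _ ≤ ε / (2 * A) * A := by gcongr; exact hd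
        _ = _ := by field_simp
    · have hs : s ≤ x := hs
      have e1 : p s = conj (D.q s - D.qm) := indicator_of_mem (show s ∈ Iic 0 from hs.trans hx) _
      rw [← mul_sub, ← sub_mul, norm_mul, norm_mul, Pi.sub_apply, e1]
      refine (mul_le_of_le_one_left (by positivity) (norm_exp_kernel_le hζ.2 hs)).trans ?_
      gcongr
      exact (norm_le_pi_norm _ 0).trans (hmu ζ hζ s (hs.trans hx))
    · simp only [Pi.zero_apply]; positivity
  have h4 : C / (2 * ‖D.lam κ ζ‖) ≤ ε / 2 := by
    have : |C| * 4 ≤ ε * ‖ζ‖ := by rw [div_le_iff₀ hε] at hR; linarith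
    rw [div_le_div_iff₀ (by linarith) (by norm_num)]
    nlinarith [le_abs_self C]
  have h5 := norm_le_norm_sub_add (D.oscInt κ ζ x) (∫ s in Iic x, osc(D.lam κ ζ,x - s) * (g s * D.mu κ ζ s 0))
  linarith

theorem exists_norm_oscInt_I_mul_le : ∃ C, 0 < C ∧
    ∀ y : ℝ, 1 + 2 * D.q₀ ≤ y → ∀ x ≤ 0, ‖D.oscInt κ (I * y) x‖ ≤ C / y := by
  obtain ⟨A, hA, hmu, -, -⟩ := exists_far_bounds h hκ
  obtain ⟨Q, hQ, hq⟩ := D.exists_norm_q_le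
  have hq0 := D.q₀_pos
  refine ⟨2 * ((Q + D.q₀) * A), by positivity, fun y hy x hx => ?_⟩
  have hy0 : 0 < y := by linarith
  obtain ⟨hf, hl⟩ := I_mul_mem_far (κ := κ) hκ hy
  set c := 2 * (D.lam κ (I * y)).im with hc
  have hc0 : 0 < c := by linarith
  have h1 : ‖D.oscInt κ (I * y) x‖ ≤ ∫ s in Iic x,
      (Q + D.q₀) * A * Real.exp (-c * x) * Real.exp (c * s) := by
    refine norm_integral_le_of_norm_le ((integrableOn_exp_mul_Iic hc0 x).const_mul _)
      (ae_Iic fun s hs => ?_)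
    rw [norm_mul, norm_mul, norm_conj, norm_exp]
    have e1 : (2 * I * D.lam κ (I * y) * ((x - s : ℝ) : ℂ)).re = -c * x + c * s := by
      rw [re_mul_ofReal, hc]; simp; ring
    rw [e1, Real.exp_add, mul_comm, mul_assoc ((Q + D.q₀) * A)]
    gcongr
    · refine (norm_sub_le _ _).trans ?_
      rw [D.norm_qm]
      linarith [hq s]
    · exact (norm_le_pi_norm _ 0).trans (hmu _ hf s (hs.trans hx))
  refine h1.trans ?_
  rw [integral_const_mul, integral_exp_mul_Iic hc0, mul_div_assoc', mul_assoc, ← Real.exp_add,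
    show -c * x + c * x = 0 by ring, Real.exp_zero, mul_one, div_le_div_iff₀ hc0 hy0]
  nlinarith [mul_pos (add_pos hQ hq0) hA]

theorem wr_psi_eq {ζ : ℂ} (hζ : ζ ∈ D.upper κ) :
    wr (D.psiM1 κ ζ 0) (D.psiP2 κ ζ 0) = D.wron κ hκ ζ := by
  rw [psiM1_eq h hζ, psiP2_eq hκ h hζ]
  have h1 := Theta_refl (D := D) hκ ζ 0
  simp only [wr, jostP, jost, Matrix.cons_val, Pi.smul_apply, smul_eq_mul, neg_zero]
  have h2 : exp (-I * D.Theta κ ζ 0) * exp (-I * -D.Theta κ ζ 0) = 1 := by rw [← exp_add]; simp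
  have h3 : (D.refl κ hκ).Theta κ ζ 0 = -D.Theta κ ζ 0 := by rw [← h1, neg_zero]
  rw [h3, wron]
  linear_combination (D.mu κ ζ 0 0 * (D.refl κ hκ).mu κ ζ 0 0 -
    D.mu κ ζ 0 1 * (D.refl κ hκ).mu κ ζ 0 1) * h2

theorem a_eq {ζ : ℂ} (hζ : ζ ∈ D.upper κ) : D.a κ ζ = D.wron κ hκ ζ * ζ / (2 * D.lam κ ζ) := by
  rw [a, wr_psi_eq h hκ hζ, detE_eq hζ.1, div_div_eq_mul_div]

theorem continuousOn_wron : ContinuousOn (D.wron κ hκ) (D.upper κ) := by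
  have h1 := continuousOn_pi.1 (continuousOn_mu (κ := κ) h 0)
  have h2 := continuousOn_pi.1 (continuousOn_mu (κ := κ) (h.refl hκ) 0)
  exact ((h1 0).mul (h2 0)).sub ((h1 1).mul (h2 1))

theorem differentiableOn_wron : DifferentiableOn ℂ (D.wron κ hκ) {ζ | 0 < (D.lam κ ζ).im} := by
  have h1 := differentiableOn_pi.1 (differentiableOn_mu (κ := κ) h 0)
  have h2 := differentiableOn_pi.1 (differentiableOn_mu (κ := κ) (h.refl hκ) 0)
  exact ((h1 0).mul (h2 0)).sub ((h1 1).mul (h2 1))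

theorem continuousOn_a : ContinuousOn (D.a κ) (D.upper κ ∩ {ζ | D.lam κ ζ ≠ 0}) := by
  have h1 : ContinuousOn (fun ζ => D.wron κ hκ ζ * ζ / (2 * D.lam κ ζ))
      (D.upper κ ∩ {ζ | D.lam κ ζ ≠ 0}) := by
    refine ContinuousOn.div ?_ ?_ fun ζ hζ => mul_ne_zero two_ne_zero hζ.2
    · exact ((continuousOn_wron h hκ).mono Set.inter_subset_left).mul continuousOn_id
    · exact continuousOn_const.mul ((D.continuousOn_lam κ).mono fun ζ hζ => hζ.1.1)
  exact h1.congr fun ζ hζ => a_eq h hκ hζ.1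

theorem differentiableOn_a : DifferentiableOn ℂ (D.a κ) {ζ | 0 < (D.lam κ ζ).im} := by
  have h1 : DifferentiableOn ℂ (fun ζ => D.wron κ hκ ζ * ζ / (2 * D.lam κ ζ))
      {ζ | 0 < (D.lam κ ζ).im} := by
    refine DifferentiableOn.div ?_ ?_ fun ζ hζ => mul_ne_zero two_ne_zero (lam_ne_zero_of_im hζ)
    · exact (differentiableOn_wron h hκ).mul differentiableOn_id
    · exact (differentiableOn_const _).mul ((D.differentiableOn_lam κ).mono
        fun ζ hζ => D.ne_zero_of_im_lam κ hζ)
  exact h1.congr fun ζ hζ => a_eq h hκ (mem_upper_of_im hζ)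

theorem omega0_eq : D.omega0 κ = nu κ D 0 + nu κ (D.refl κ hκ) 0 := by
  have h1 := integrable_normSq_sub h
  have h2 : nu κ (D.refl κ hκ) 0 = ∫ s in Ioi 0, κ * D.T * (‖D.q s‖ ^ 2 - D.q₀ ^ 2) := by
    have := integral_comp_neg_Iic (0 : ℝ) fun s => κ * D.T * (‖D.q s‖ ^ 2 - D.q₀ ^ 2)
    rw [neg_zero] at this
    rw [← this, nu]
    simp only [norm_refl_q]; rfl
  rw [h2, nu, integral_Iic_add_Ioi (h1.const_mul _).integrableOn
    (h1.const_mul _).integrableOn, omega0, integral_const_mul, integral_const_mul]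
  ring

theorem exists_norm_a_sub_le : ∃ C, 0 < C ∧
    ∀ ζ ∈ D.far κ, ∀ δ, 0 ≤ δ → (∀ x ≤ 0, ‖D.oscInt κ ζ x‖ ≤ δ) →
      (∀ x ≤ 0, ‖(D.refl κ hκ).oscInt κ ζ x‖ ≤ δ) →
      ‖D.a κ ζ - exp (I * D.omega0 κ)‖ ≤ C * (δ + 1 / ‖ζ‖) := by
  have hR := h.refl hκ
  obtain ⟨A, hA, hmu, -, -⟩ := exists_far_bounds h hκ
  obtain ⟨A', hA', hmu', -, -⟩ := exists_far_bounds hR hκ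
  obtain ⟨C₁, hC₁, h1⟩ := exists_norm_mu_one_le h hκ
  obtain ⟨C₁', hC₁', h1'⟩ := exists_norm_mu_one_le hR hκ
  obtain ⟨C₂, hC₂, h2⟩ := exists_norm_mu_zero_sub_le h hκ
  obtain ⟨C₂', hC₂', h2'⟩ := exists_norm_mu_zero_sub_le hR hκ
  have hq := D.q₀_pos
  refine ⟨C₂ * (C₁ + 1) * A' + C₂' * (C₁' + 1) + A * C₁' + 4 * (A * A') * D.q₀ ^ 2, by positivity,
    fun ζ hζ δ hδ ho ho' => ?_⟩
  have hz : 1 ≤ ‖ζ‖ := by linarith [hζ.1]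
  have hz0 : 0 < ‖ζ‖ := by linarith
  set τ := δ + 1 / ‖ζ‖ with hτ
  have hz1 : 0 ≤ 1 / ‖ζ‖ := by positivity
  have hzτ : 1 / ‖ζ‖ ≤ τ := by linarith
  have hτ0 : 0 ≤ τ := by linarith
  have hup := far_subset_upper hζ
  have b1 := h1 ζ hζ δ hδ ho
  have b1' := h1' ζ hζ δ hδ ho'
  have b2 := h2 ζ hζ _ (by positivity) b1
  have b2' := h2' ζ hζ _ (by positivity) b1'
  have m0 := (norm_le_pi_norm _ 0).trans (hmu ζ hζ 0 le_rfl)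
  have m1 := (norm_le_pi_norm _ 1).trans (hmu ζ hζ 0 le_rfl)
  have m0' := (norm_le_pi_norm _ 0).trans (hmu' ζ hζ 0 le_rfl)
  have m1' := (norm_le_pi_norm _ 1).trans (hmu' ζ hζ 0 le_rfl)
  have b3 := b1' 0 le_rfl
  set u0 := D.mu κ ζ 0 0
  set u1 := D.mu κ ζ 0 1
  set v0 := (D.refl κ hκ).mu κ ζ 0 0
  set v1 := (D.refl κ hκ).mu κ ζ 0 1
  set E := exp (I * nu κ D 0)
  set E' := exp (I * nu κ (D.refl κ hκ) 0)
  have hE : ‖E‖ = 1 := by simp [E, norm_exp]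
  have hEE : exp (I * D.omega0 κ) = E * E' := by rw [omega0_eq h hκ, ← exp_add]; push_cast; ring_nf
  have hW : D.wron κ hκ ζ = u0 * v0 - u1 * v1 := rfl
  have hlge := norm_lam_ge hκ hζ.1
  have hl0 : D.lam κ ζ ≠ 0 := norm_pos_iff.1 (by linarith)
  have hlam : 2 * D.lam κ ζ = ζ + κ * D.q₀ ^ 2 * ζ⁻¹ := by rw [lam]; ring
  have ha : D.a κ ζ - exp (I * D.omega0 κ) = (u0 - E) * v0 + E * (v0 - E') -
      u1 * v1 - (u0 * v0 - u1 * v1) * (κ * D.q₀ ^ 2 * ζ⁻¹ / (2 * D.lam κ ζ)) := by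
    rw [a_eq h hκ hup, hEE, hW]
    have : ζ = 2 * D.lam κ ζ - κ * D.q₀ ^ 2 * ζ⁻¹ := by rw [hlam]; ring
    have h3 : (u0 * v0 - u1 * v1) * ζ / (2 * D.lam κ ζ) =
        (u0 * v0 - u1 * v1) * ((2 * D.lam κ ζ - κ * D.q₀ ^ 2 * ζ⁻¹) / (2 * D.lam κ ζ)) := by
      rw [← this]; ring
    rw [h3, sub_div, div_self (mul_ne_zero two_ne_zero hl0)]
    ring
  rw [ha]
  have e1 : ‖(u0 - E) * v0‖ ≤ C₂ * (C₁ + 1) * A' * τ := by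
    rw [norm_mul]
    calc _ ≤ (C₂ * (C₁ * τ + 1 / ‖ζ‖)) * A' := by gcongr
      _ ≤ (C₂ * (C₁ * τ + τ)) * A' := by gcongr
      _ = _ := by ring
  have e2 : ‖E * (v0 - E')‖ ≤ C₂' * (C₁' + 1) * τ := by
    rw [norm_mul, hE, one_mul]
    calc _ ≤ C₂' * (C₁' * τ + 1 / ‖ζ‖) := b2'
      _ ≤ C₂' * (C₁' * τ + τ) := by gcongr
      _ = _ := by ring
  have e3 : ‖u1 * v1‖ ≤ A * C₁' * τ := by
    rw [norm_mul, mul_assoc]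
    gcongr
  have e4 : ‖(u0 * v0 - u1 * v1) * (κ * D.q₀ ^ 2 * ζ⁻¹ / (2 * D.lam κ ζ))‖ ≤
      4 * (A * A') * D.q₀ ^ 2 * τ := by
    have f1 : ‖u0 * v0 - u1 * v1‖ ≤ 2 * (A * A') := by
      refine (norm_sub_le _ _).trans ?_
      rw [norm_mul, norm_mul, two_mul]
      gcongr
    have f2 : ‖(κ * D.q₀ ^ 2 * ζ⁻¹ / (2 * D.lam κ ζ) : ℂ)‖ ≤ 2 * D.q₀ ^ 2 * τ := by
      rw [norm_div, norm_mul, norm_mul, norm_mul, norm_inv, norm_pow, norm_real,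
        norm_real, norm_eq_abs, hκ, one_mul, norm_of_nonneg hq.le,
        norm_ofNat, div_le_iff₀ (by linarith)]
      have f3 : 1 ≤ 4 * ‖D.lam κ ζ‖ := by linarith
      have f4 : D.q₀ ^ 2 * ‖ζ‖⁻¹ ≤ D.q₀ ^ 2 * τ := by rw [← one_div]; gcongr
      have f5 : 0 ≤ D.q₀ ^ 2 * τ := by positivity
      nlinarith
    rw [norm_mul]
    calc _ ≤ (2 * (A * A')) * (2 * D.q₀ ^ 2 * τ) := by gcongr
      _ = _ := by ring
  refine (norm_sub_le _ _).trans ?_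
  refine (add_le_add ((norm_sub_le _ _).trans (add_le_add ((norm_add_le _ _).trans
    (add_le_add e1 e2)) e3)) e4).trans (le_of_eq ?_)
  ring

/-- `a → e^{iω₀}` at infinity in the closed half plane `Im λ ≥ 0`. -/
theorem tendsto_a :
    Tendsto (D.a κ) (comap norm atTop ⊓ 𝓟 (D.upper κ)) (𝓝 (exp (I * D.omega0 κ))) := by
  obtain ⟨C, hC, hle⟩ := exists_norm_a_sub_le h hκ
  rw [Metric.tendsto_nhds]
  intro ε hε
  obtain ⟨R₁, hR₁⟩ := exists_norm_oscInt_le h hκ (ε := ε / (4 * C)) (by positivity)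
  obtain ⟨R₂, hR₂⟩ := exists_norm_oscInt_le (h.refl hκ) hκ (ε := ε / (4 * C)) (by positivity)
  have h1 : ∀ᶠ ζ : ℂ in comap norm atTop, max (max R₁ R₂) (max (1 + 2 * D.q₀) (4 * C / ε)) ≤ ‖ζ‖ :=
    tendsto_comap.eventually (eventually_ge_atTop _)
  filter_upwards [h1.filter_mono inf_le_left, mem_inf_of_right (mem_principal_self _)]
    with ζ hζ hup
  simp only [max_le_iff] at hζ
  have hf : ζ ∈ D.far κ := ⟨hζ.2.1, hup.2⟩
  have hz : 0 < ‖ζ‖ := by linarith [hf.1, D.q₀_pos]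
  have h2 := hle ζ hf (ε / (4 * C)) (by positivity) (hR₁ ζ hf hζ.1.1) (hR₂ ζ hf hζ.1.2)
  rw [dist_eq_norm]
  refine h2.trans_lt ?_
  have h3 : C * (ε / (4 * C)) = ε / 4 := by field_simp
  have h4 : C * (1 / ‖ζ‖) ≤ ε / 4 := by
    rw [mul_one_div, div_le_iff₀ hz]
    have := hζ.2.2
    rw [div_le_iff₀ hε] at this
    linarith
  rw [mul_add, h3]
  linarith

/-- On the imaginary axis `a = e^{iω₀} + O(1/y)`. -/
theorem exists_norm_a_I_mul_sub_le : ∃ C, 0 < C ∧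
    ∀ y : ℝ, 1 + 2 * D.q₀ ≤ y → ‖D.a κ (I * y) - exp (I * D.omega0 κ)‖ ≤ C / y := by
  obtain ⟨C, hC, hle⟩ := exists_norm_a_sub_le h hκ
  obtain ⟨C₁, hC₁, h1⟩ := exists_norm_oscInt_I_mul_le h hκ
  obtain ⟨C₂, hC₂, h2⟩ := exists_norm_oscInt_I_mul_le (h.refl hκ) hκ
  refine ⟨C * (max C₁ C₂ + 1), by positivity, fun y hy => ?_⟩
  have hy0 : 0 < y := by linarith [D.q₀_pos]
  have h3 := hle (I * y) (I_mul_mem_far hκ hy).1 (max C₁ C₂ / y) (by positivity)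
    (fun x hx => (h1 y hy x hx).trans (by gcongr; exact le_max_left _ _))
    (fun x hx => (h2 y hy x hx).trans (by gcongr; exact le_max_right _ _))
  refine h3.trans (le_of_eq ?_)
  rw [norm_mul, norm_I, one_mul, norm_real, norm_of_nonneg hy0.le]
  ring

end NZProfile

/-! ### Behaviour at the branch points -/

theorem integrableOn_tailMass {ρ : ℝ → ℝ} (hρc : Continuous ρ) (hρ0 : ∀ x, 0 ≤ ρ x)
    (hρi : ∀ b, IntegrableOn (fun x => (1 + |x|) * ρ x) (Iic b)) :
    IntegrableOn (tailMass ρ) (Iic 0) := by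
  have h1 : ∀ b, IntegrableOn ρ (Iic b) := fun b => (hρi b).mono' hρc.aestronglyMeasurable
    (Eventually.of_forall fun s => by
      rw [norm_of_nonneg (hρ0 s)]
      exact le_mul_of_one_le_left (hρ0 s) (by linarith [abs_nonneg s]))
  have hc2 : Continuous fun x => x * ρ x := by fun_prop
  have h2 : ∀ b, IntegrableOn (fun x => x * ρ x) (Iic b) := fun b =>
    (hρi b).mono' hc2.aestronglyMeasurable (Eventually.of_forall fun s => by
      rw [norm_mul, norm_of_nonneg (hρ0 s), norm_eq_abs]
      exact mul_le_mul_of_nonneg_right (by linarith) (hρ0 s))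
  have hd : ∀ x, HasDerivAt (fun x => x * tailMass ρ x - ∫ s in Iic x, s * ρ s)
      (tailMass ρ x) x := fun x => by
    refine (((hasDerivAt_id x).mul (hasDerivAt_integral_Iic hρc h1 x)).sub
      (hasDerivAt_integral_Iic hc2 h2 x)).congr_deriv ?_
    simp [tailMass]
  have hlim : Tendsto (fun x => x * tailMass ρ x - ∫ s in Iic x, s * ρ s) atBot (𝓝 (0 - 0)) := by
    refine Tendsto.sub ?_ (tendsto_integral_Iic_atBot (h2 0))
    have h3 : Tendsto (fun x => -∫ s in Iic x, s * ρ s) atBot (𝓝 0) := by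
      simpa using (tendsto_integral_Iic_atBot (h2 0)).neg
    refine squeeze_zero_norm' ?_ h3
    filter_upwards [eventually_le_atBot 0] with x hx
    rw [norm_mul, norm_eq_abs, abs_of_nonpos hx, norm_of_nonneg (tailMass_nonneg hρ0 x),
      tailMass, ← integral_const_mul, ← integral_neg]
    refine setIntegral_mono_on ((h1 x).const_mul _) (h2 x).neg measurableSet_Iic fun s hs => ?_
    change -x * ρ s ≤ -(s * ρ s)
    rw [← neg_mul]
    exact mul_le_mul_of_nonneg_right (neg_le_neg hs) (hρ0 s)
  have h4 := integrableOn_Ioi_deriv_of_nonneg' (a := 0) (fun x _ =>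
    ((hd (-x)).scomp x (hasDerivAt_neg x)).neg)
    (fun x _ => by simpa using tailMass_nonneg hρ0 (-x))
    (hlim.comp tendsto_neg_atTop_atBot).neg
  rw [integrableOn_Iic_iff_integrableOn_Iio]
  simpa using h4.comp_neg

namespace NZProfile

variable {κ : ℝ} {D : NZProfile}

theorem mu_zero_ne_zero (h : D.Decays 1) {ζ : ℂ} (hζ : ζ ∈ D.upper κ) : D.mu κ ζ 0 ≠ 0 := by
  intro h0
  obtain ⟨C, hC⟩ := D.exists_norm_X_le κ ζ
  have h1 : D.jost κ ζ = fun _ => 0 := by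
    refine eq_of_solution hC (hasDerivAt_jost h hζ) (fun x => ?_) ?_
    · rw [Matrix.mulVec_zero]; exact hasDerivAt_const _ _
    · rw [jost, h0, smul_zero]
  have h2 : D.mu κ ζ = fun _ => 0 := by
    ext1 x
    have := congrFun h1 x
    rw [jost, smul_eq_zero] at this
    exact this.resolve_left (exp_ne_zero _)
  have h3 := tendsto_mu h hζ
  rw [h2] at h3
  have h4 := tendsto_nhds_unique h3 tendsto_const_nhds
  have := congrFun h4 0
  simp [jvec] at this

theorem exists_norm_pert_mulVec_mu_le (h : D.Decays 1) {R : ℝ} (hR : 0 < R) : ∃ A, 0 ≤ A ∧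
    ∀ ζ ∈ D.shell κ R, ∀ x ≤ 0, ‖D.pert κ x *ᵥ D.mu κ ζ x‖ ≤ A * ‖D.q x - D.qm‖ := by
  obtain ⟨V, hV, hpert⟩ := D.exists_norm_pert_le κ
  obtain ⟨A, hA, hmu⟩ := exists_norm_mu_le (κ := κ) h hR 0
  refine ⟨V * A, by positivity, fun ζ hζ x hx => ?_⟩
  rw [← mcl_apply]
  calc _ ≤ ‖mcl (D.pert κ x)‖ * ‖D.mu κ ζ x‖ := ContinuousLinearMap.le_opNorm _ _
    _ ≤ (V * ‖D.q x - D.qm‖) * A := by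
      gcongr
      · exact hpert x
      · exact hmu ζ hζ x hx
    _ = _ := by ring

theorem exists_norm_nil_mu_le (h : D.Decays 1) {R : ℝ} (hR : 0 < R) : ∃ A, 0 ≤ A ∧
    ∀ ζ ∈ D.shell κ R, ∀ x ≤ 0, ‖D.nil κ ζ *ᵥ D.mu κ ζ x‖ ≤
      A * tailMass (fun s => ‖D.q s - D.qm‖) x := by
  obtain ⟨B, hB, hN⟩ := D.exists_norm_nil_le κ hR
  obtain ⟨V, hV, hpert⟩ := exists_norm_pert_mulVec_mu_le (κ := κ) h hR
  refine ⟨B * (1 + R) * V, by positivity, fun ζ hζ x hx => ?_⟩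
  have hz := shell_ne_zero hR hζ.1
  have hup : ζ ∈ D.upper κ := ⟨hz, hζ.2.2⟩
  have h1 : D.nil κ ζ *ᵥ D.mu κ ζ x = ∫ s in Iic x, osc(D.lam κ ζ,x - s) •
        mcl (D.nil κ ζ) (D.pert κ s *ᵥ D.mu κ ζ s) := by
    rw [mu_eq h hup x, Matrix.mulVec_add, D.nil_mulVec_jvec κ hz, zero_add, ← mcl_apply,
      ← (mcl (D.nil κ ζ)).integral_comp_comm (integrableOn_ker_mu h hup hx)]
    refine integral_congr_ae (Eventually.of_forall fun s => ?_)
    simp only [ker, ContinuousLinearMap.comp_apply, _root_.add_apply,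
      _root_.smul_apply, one_apply_eq_self, map_add, map_smul,
      D.mcl_nil_mcl_nil κ hz]
    have h2 : osc(D.lam κ ζ,x - s) = 1 + expInt (D.lam κ ζ) (x - s) * (2 * I * D.lam κ ζ) := by
      linear_combination -two_mul_expInt (D.lam κ ζ) (x - s)
    rw [h2, mcl_apply (D.pert κ s), add_smul, one_smul, smul_smul]
  rw [h1, tailMass, ← integral_const_mul]
  refine norm_integral_le_of_norm_le ((integrableOn_norm_sub h x).const_mul _)
    (ae_Iic fun s hs => ?_)
  rw [norm_smul]
  refine (mul_le_of_le_one_left (norm_nonneg _) (norm_exp_kernel_le hζ.2.2 hs)).trans ?_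
  refine (ContinuousLinearMap.le_opNorm _ _).trans ?_
  rw [mul_assoc]
  have h3 : ‖mcl (D.nil κ ζ)‖ ≤ B * (1 + R) := (hN ζ hζ.1).trans (by gcongr; exact hζ.2.1)
  have h4 := hpert ζ hζ s (hs.trans hx)
  gcongr

/-- `μ'` is dominated near the branch points. -/
theorem exists_norm_deriv_mu_le (h : D.Decays 1) {R : ℝ} (hR : 0 < R) : ∃ ρ : ℝ → ℝ,
    IntegrableOn ρ (Iic 0) ∧ ∀ ζ ∈ D.shell κ R, ∀ x ≤ 0,
      ‖D.nil κ ζ *ᵥ D.mu κ ζ x + D.pert κ x *ᵥ D.mu κ ζ x‖ ≤ ρ x := by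
  obtain ⟨A, hA, hN⟩ := exists_norm_nil_mu_le (κ := κ) h hR
  obtain ⟨V, hV, hpert⟩ := exists_norm_pert_mulVec_mu_le (κ := κ) h hR
  have hc : Continuous fun s => ‖D.q s - D.qm‖ := by have := D.continuous_q; fun_prop
  exact ⟨fun x => A * tailMass (fun s => ‖D.q s - D.qm‖) x + V * ‖D.q x - D.qm‖,
    ((integrableOn_tailMass hc (fun _ => norm_nonneg _) (integrableOn_wt h)).const_mul _).add
      ((integrableOn_norm_sub h 0).const_mul _), fun ζ hζ x hx =>
    (norm_add_le _ _).trans (add_le_add (hN ζ hζ x hx) (hpert ζ hζ x hx))⟩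

theorem lam_sq {ζ : ℂ} (hζ : ζ ≠ 0) : D.lam κ ζ ^ 2 = D.k κ ζ ^ 2 + κ * D.q₀ ^ 2 := by
  unfold lam k; field_simp; ring

theorem k_ne_zero_of_lam_eq_zero {ζ : ℂ} (hζ : ζ ≠ 0) (h : D.lam κ ζ = 0) : D.k κ ζ ≠ 0 := by
  have : D.k κ ζ = ζ - D.lam κ ζ := by rw [k, lam]; ring
  rwa [this, h, sub_zero]

theorem exists_tendsto_wr_div_lam (h : D.Decays 1) {p : ℂ} (hp0 : p ≠ 0)
    (hp : D.lam κ p = 0) : ∃ c, Tendsto (fun ζ => wr (D.mu κ ζ 0) (D.mu κ p 0) / D.lam κ ζ)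
      (𝓝[{ζ | 0 < (D.lam κ ζ).im}] p) (𝓝 c) := by
  have hpu : p ∈ D.upper κ := ⟨hp0, by simp [hp]⟩
  have hkc : ContinuousAt (D.k κ) p := by
    unfold k
    exact (continuousAt_id.sub (continuousAt_const.mul (continuousAt_id.inv₀ hp0))).div_const _
  have hkp := k_ne_zero_of_lam_eq_zero hp0 hp
  obtain ⟨R, hR, hsh⟩ := exists_shell hp0
  obtain ⟨ρ, hρi, hρ⟩ := exists_norm_deriv_mu_le (κ := κ) h hR
  obtain ⟨A, hA, hmu⟩ := exists_norm_mu_le (κ := κ) h hR 0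
  have hps : p ∈ D.shell κ R := ⟨hsh.self_of_nhds.1, hsh.self_of_nhds.2, hpu.2⟩
  set m : ℂ → ℝ → Fin 2 → ℂ := fun ζ x => D.nil κ ζ *ᵥ D.mu κ ζ x + D.pert κ x *ᵥ D.mu κ ζ x
    with hm
  set f : ℝ → Fin 2 → ℂ := D.mu κ p with hf
  set B : ℂ → ℝ → ℂ := fun ζ x => D.mu κ ζ x 0 * f x 1 + D.mu κ ζ x 1 * f x 0 with hB
  set B' : ℂ → ℝ → ℂ := fun ζ x => m ζ x 0 * f x 1 + D.mu κ ζ x 0 * m p x 1 +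
    (m ζ x 1 * f x 0 + D.mu κ ζ x 1 * m p x 0) with hB'
  have hmd : ∀ ζ ∈ D.upper κ, ∀ x i, HasDerivAt (fun x => D.mu κ ζ x i) (m ζ x i) x :=
    fun ζ hζ x i => hasDerivAt_pi.1 (hasDerivAt_mu h hζ x) i
  have hBd : ∀ ζ ∈ D.upper κ, ∀ x, HasDerivAt (B ζ) (B' ζ x) x := fun ζ hζ x =>
    ((hmd ζ hζ x 0).mul (hmd p hpu x 1)).add ((hmd ζ hζ x 1).mul (hmd p hpu x 0))
  have hmc : ∀ ζ ∈ D.upper κ, Continuous (m ζ) := fun ζ hζ =>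
    (continuous_const.matrix_mulVec (continuous_mu h hζ)).add
      ((D.continuous_pert κ).matrix_mulVec (continuous_mu h hζ))
  have hB'c : ∀ ζ ∈ D.upper κ, Continuous (B' ζ) := fun ζ hζ => by
    have c1 := fun i => continuous_mu_apply h hζ i
    have c2 := fun i => continuous_mu_apply h hpu i
    have c3 := fun i => (continuous_apply i).comp (hmc ζ hζ)
    have c4 := fun i => (continuous_apply i).comp (hmc p hpu)
    exact (((c3 0).mul (c2 1)).add ((c1 0).mul (c4 1))).add
      (((c3 1).mul (c2 0)).add ((c1 1).mul (c4 0)))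
  have hen : ∀ (ζ : ℂ) (x : ℝ), ‖exp (-I * D.lam κ ζ * x)‖ = Real.exp ((D.lam κ ζ).im * x) :=
    fun ζ x => by rw [norm_exp, re_mul_ofReal]; simp
  have hbound : ∀ ζ ∈ D.shell κ R, 0 ≤ (D.lam κ ζ).im → ∀ x : ℝ, x ≤ 0 →
      ‖exp (-I * D.lam κ ζ * x) * B' ζ x‖ ≤ 4 * A * ρ x := fun ζ hζ hl x hx => by
    have he : ‖exp (-I * D.lam κ ζ * x)‖ ≤ 1 := by
      rw [hen, Real.exp_le_one_iff]
      exact mul_nonpos_of_nonneg_of_nonpos hl hx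
    rw [norm_mul]
    refine (mul_le_of_le_one_left (norm_nonneg _) he).trans ?_
    have a1 := fun i => (norm_le_pi_norm _ i).trans (hmu ζ hζ x hx)
    have a2 := fun i => (norm_le_pi_norm _ i).trans (hmu p hps x hx)
    have a3 := fun i => (norm_le_pi_norm _ i).trans (hρ ζ hζ x hx)
    have a4 := fun i => (norm_le_pi_norm _ i).trans (hρ p hps x hx)
    have hρ0 : 0 ≤ ρ x := (norm_nonneg _).trans (hρ p hps x hx)
    have e1 : ∀ i j, ‖m ζ x i * f x j‖ ≤ A * ρ x := fun i j => by
      rw [norm_mul, mul_comm]; exact mul_le_mul (a2 j) (a3 i) (norm_nonneg _) hA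
    have e2 : ∀ i j, ‖D.mu κ ζ x i * m p x j‖ ≤ A * ρ x := fun i j => by
      rw [norm_mul]; exact mul_le_mul (a1 i) (a4 j) (norm_nonneg _) hA
    refine (norm_add_le _ _).trans ?_
    have := (norm_add_le (m ζ x 0 * f x 1) (D.mu κ ζ x 0 * m p x 1))
    have := (norm_add_le (m ζ x 1 * f x 0) (D.mu κ ζ x 1 * m p x 0))
    linarith [e1 0 1, e1 1 0, e2 0 1, e2 1 0]
  set l := 𝓝[{ζ | 0 < (D.lam κ ζ).im}] p with hl
  have hev : ∀ᶠ ζ in l, ζ ∈ D.shell κ R ∧ 0 < (D.lam κ ζ).im := by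
    filter_upwards [self_mem_nhdsWithin, mem_nhdsWithin_of_mem_nhds hsh] with ζ h1 h2
    exact ⟨⟨h2.1, h2.2, le_of_lt h1⟩, h1⟩
  have hk2 : Tendsto (fun ζ => D.k κ ζ + D.k κ p) l (𝓝 (D.k κ p + D.k κ p)) :=
    (hkc.tendsto.mono_left nhdsWithin_le_nhds).add_const _
  have hk0 : D.k κ p + D.k κ p ≠ 0 := by rw [← two_mul]; exact mul_ne_zero two_ne_zero hkp
  -- the identity
  have hid : ∀ᶠ ζ in l, wr (D.mu κ ζ 0) (D.mu κ p 0) / D.lam κ ζ = (B ζ 0 -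
      ∫ x in Iic (0 : ℝ), exp (-I * D.lam κ ζ * x) * B' ζ x) / (D.k κ ζ + D.k κ p) := by
    filter_upwards [hev, hk2.eventually_ne hk0] with ζ hζ hk
    have hlp := hζ.2
    have hζ0 := D.ne_zero_of_im_lam κ hlp
    have hup : ζ ∈ D.upper κ := mem_upper_of_im hlp
    set γ := D.lam κ ζ / (D.k κ ζ + D.k κ p) with hγ
    have hlg : D.lam κ ζ * γ = D.k κ ζ - D.k κ p := by
      rw [hγ, mul_div_assoc', div_eq_iff hk]
      have e1 := lam_sq (D := D) (κ := κ) hζ0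
      have e2 := lam_sq (D := D) (κ := κ) hp0
      rw [hp] at e2
      linear_combination e1 - e2
    have hd : ∀ x : ℝ, HasDerivAt (fun x : ℝ => exp (-I * D.lam κ ζ * x) *
        (wr (D.mu κ ζ x) (f x) - γ * B ζ x))
        (-γ * (exp (-I * D.lam κ ζ * x) * B' ζ x)) x := fun x => by
      have h1 := (hasDerivAt_cexp_mul (-I * D.lam κ ζ) x).mul
        ((((hmd ζ hup x 0).mul (hmd p hpu x 1)).sub ((hmd ζ hup x 1).mul (hmd p hpu x 0))).sub
          ((hBd ζ hup x).const_mul γ))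
      refine h1.congr_deriv ?_
      have hX : ∀ ζ' x', m ζ' x' = D.X κ ζ' x' *ᵥ D.mu κ ζ' x' +
          (I * D.lam κ ζ') • D.mu κ ζ' x' := fun ζ' x' => by
        rw [X_eq, Matrix.sub_mulVec, Matrix.add_mulVec, Matrix.smul_mulVec, Matrix.one_mulVec,
          sub_add_cancel]
      simp only [hX ζ x, hX p x, hp, mul_zero, zero_smul, Pi.zero_apply, add_zero, Pi.add_apply, Pi.smul_apply,
        smul_eq_mul, mulVec_fin_two, Pi.sub_apply, Pi.mul_apply]
      simp only [X, Matrix.of_apply, Matrix.cons_val, z, hf, hB]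
      linear_combination (exp (-I * D.lam κ ζ * x)) * I *
        (D.mu κ ζ x 0 * D.mu κ p x 1 + D.mu κ ζ x 1 * D.mu κ p x 0) * hlg
    have hlim : Tendsto (fun x : ℝ => exp (-I * D.lam κ ζ * x) *
        (wr (D.mu κ ζ x) (f x) - γ * B ζ x)) atBot (𝓝 0) := by
      have t1 := tendsto_mu h hup
      have t2 := tendsto_mu h hpu
      have t1' := tendsto_pi_nhds.1 t1
      have t2' := tendsto_pi_nhds.1 t2
      have t3 := (tendsto_wr t1 t2).sub (((((t1' 0).mul (t2' 1)).add
        ((t1' 1).mul (t2' 0)))).const_mul γ)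
      have t4 : Tendsto (fun x : ℝ => exp (-I * D.lam κ ζ * x)) atBot (𝓝 0) := by
        rw [tendsto_zero_iff_norm_tendsto_zero]
        simp only [hen]
        exact tendsto_exp_atBot.comp (tendsto_id.const_mul_atBot hlp)
      simpa using t4.mul t3
    have hint : IntegrableOn (fun x : ℝ => exp (-I * D.lam κ ζ * x) * B' ζ x) (Iic 0) := by
      refine (hρi.const_mul (4 * A)).mono' ?_ (ae_Iic (hbound ζ hζ.1 hlp.le))
      have := hB'c ζ hup
      exact Continuous.aestronglyMeasurable (by fun_prop)
    have hF := integral_Iic_of_hasDerivAt_of_tendsto' (a := 0) (fun x _ => hd x)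
      (hint.const_mul (-γ)) hlim
    rw [integral_const_mul] at hF
    simp only [ofReal_zero, mul_zero, exp_zero, one_mul, sub_zero] at hF
    have hl0 := lam_ne_zero_of_im hlp
    rw [div_eq_div_iff hl0 hk]
    have hgk : γ * (D.k κ ζ + D.k κ p) = D.lam κ ζ := by rw [hγ, div_mul_cancel₀ _ hk]
    rw [← hf]
    linear_combination (-(D.k κ ζ + D.k κ p)) * hF + (B ζ 0 - ∫ x in Iic (0 : ℝ),
      exp (-I * D.lam κ ζ * x) * B' ζ x) * hgk
  have hcm : ∀ x i, Tendsto (fun ζ => D.mu κ ζ x i) l (𝓝 (D.mu κ p x i)) := fun x i => by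
    have h1 : Tendsto (fun ζ => D.mu κ ζ x) l (𝓝 (D.mu κ p x)) :=
      (continuousOn_mu (κ := κ) h x p hpu).mono_left (nhdsWithin_mono _ fun ζ hζ =>
        mem_upper_of_im hζ)
    exact tendsto_pi_nhds.1 h1 i
  have hcl : Tendsto (D.lam κ) l (𝓝 (D.lam κ p)) :=
    ((D.continuousOn_lam κ).continuousAt (isOpen_compl_singleton.mem_nhds hp0)).tendsto.mono_left
      nhdsWithin_le_nhds
  have hcn : Tendsto (fun ζ => mcl (D.nil κ ζ)) l (𝓝 (mcl (D.nil κ p))) :=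
    ((D.continuousOn_nil κ).continuousAt (isOpen_compl_singleton.mem_nhds hp0)).tendsto.mono_left
      nhdsWithin_le_nhds
  have hcmm : ∀ x i, Tendsto (fun ζ => m ζ x i) l (𝓝 (m p x i)) := fun x i => by
    have h1 : Tendsto (fun ζ => D.mu κ ζ x) l (𝓝 (D.mu κ p x)) := tendsto_pi_nhds.2 (hcm x)
    have h2 : Tendsto (fun ζ => mcl (D.nil κ ζ) (D.mu κ ζ x) + mcl (D.pert κ x) (D.mu κ ζ x)) l
        (𝓝 (mcl (D.nil κ p) (D.mu κ p x) + mcl (D.pert κ x) (D.mu κ p x))) :=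
      ((isBoundedBilinearMap_apply.continuous.tendsto _).comp (hcn.prodMk_nhds h1)).add (((mcl (D.pert κ x)).continuous.tendsto _).comp h1)
    simp only [mcl_apply] at h2
    exact tendsto_pi_nhds.1 h2 i
  have hB0 : Tendsto (fun ζ => B ζ 0) l (𝓝 (B p 0)) :=
    ((hcm 0 0).mul_const _).add ((hcm 0 1).mul_const _)
  have hI : Tendsto (fun ζ => ∫ x in Iic (0 : ℝ),
      exp (-I * D.lam κ ζ * x) * B' ζ x) l (𝓝 (∫ x in Iic (0 : ℝ),
      exp (-I * D.lam κ p * x) * B' p x)) := by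
    refine tendsto_integral_filter_of_dominated_convergence (fun x => 4 * A * ρ x) ?_ ?_
      (hρi.const_mul _) ?_
    · filter_upwards [hev] with ζ hζ
      have := hB'c ζ (mem_upper_of_im hζ.2)
      exact Continuous.aestronglyMeasurable (by fun_prop)
    · filter_upwards [hev] with ζ hζ
      exact ae_Iic (hbound ζ hζ.1 hζ.2.le)
    · refine Eventually.of_forall fun x => ?_
      refine Tendsto.mul ?_ ?_
      · exact (continuous_exp.tendsto _).comp ((hcl.const_mul _).mul_const _)
      · exact (((hcmm x 0).mul_const _).add ((hcm x 0).mul_const _)).add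
          (((hcmm x 1).mul_const _).add ((hcm x 1).mul_const _))
  exact ⟨_, ((hB0.sub hI).div hk2 hk0).congr' (hid.mono fun ζ h => h.symm)⟩

/-- At a branch point either `λ a` has a non-zero limit or `a` has a limit. -/
theorem exists_tendsto_a_branch (h : D.Decays 1) (hκ : |κ| = 1) {p : ℂ} (hp0 : p ≠ 0)
    (hp : D.lam κ p = 0) :
    (∃ c, c ≠ 0 ∧ Tendsto (fun ζ => D.lam κ ζ * D.a κ ζ) (𝓝[{ζ | 0 < (D.lam κ ζ).im}] p) (𝓝 c)) ∨
    ∃ c, Tendsto (D.a κ) (𝓝[{ζ | 0 < (D.lam κ ζ).im}] p) (𝓝 c) := by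
  have hpu : p ∈ D.upper κ := ⟨hp0, by simp [hp]⟩
  set l := 𝓝[{ζ | 0 < (D.lam κ ζ).im}] p with hl
  have hid : Tendsto (fun ζ : ℂ => ζ) l (𝓝 p) := tendsto_id.mono_left nhdsWithin_le_nhds
  have hev : ∀ᶠ ζ in l, D.a κ ζ = D.wron κ hκ ζ * ζ / (2 * D.lam κ ζ) ∧ D.lam κ ζ ≠ 0 := by
    filter_upwards [self_mem_nhdsWithin] with ζ hζ
    exact ⟨a_eq h hκ (mem_upper_of_im hζ), lam_ne_zero_of_im hζ⟩
  have hll : l ≤ 𝓝[D.upper κ] p := nhdsWithin_mono _ fun ζ hζ => mem_upper_of_im hζ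
  by_cases hW : D.wron κ hκ p = 0
  · right
    obtain ⟨c₁, h1⟩ := exists_tendsto_wr_div_lam h hp0 hp
    obtain ⟨c₂, h2⟩ := exists_tendsto_wr_div_lam (h.refl hκ) hp0 (D := D.refl κ hκ) hp
    have hu := mu_zero_ne_zero h hpu
    have hv := mu_zero_ne_zero (h.refl hκ) (D := D.refl κ hκ) hpu
    set u := fun ζ => D.mu κ ζ 0
    set v := fun ζ => (D.refl κ hκ).mu κ ζ 0
    have hcu : ∀ i, Tendsto (fun ζ => u ζ i) l (𝓝 (u p i)) :=
      tendsto_pi_nhds.1 ((continuousOn_mu (κ := κ) h 0 p hpu).mono_left hll)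
    have hcv : ∀ i, Tendsto (fun ζ => v ζ i) l (𝓝 (v p i)) :=
      tendsto_pi_nhds.1 ((continuousOn_mu (κ := κ) (h.refl hκ) 0 p hpu).mono_left hll)
    have hW' : u p 0 * v p 0 = u p 1 * v p 1 := sub_eq_zero.1 hW
    obtain ⟨c₀, e0, e1⟩ : ∃ c₀, u p 0 = c₀ * v p 1 ∧ u p 1 = c₀ * v p 0 := by
      by_cases h0 : v p 1 = 0
      · have h1 : v p 0 ≠ 0 := fun h1 => hv (by ext i; fin_cases i; exacts [h1, h0])
        refine ⟨u p 1 / v p 0, ?_, by field_simp⟩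
        rw [h0, mul_zero] at hW' ⊢
        exact (mul_eq_zero.1 hW').resolve_right h1
      · refine ⟨u p 0 / v p 1, by field_simp, ?_⟩
        field_simp
        linear_combination -hW'
    -- W f_i / λ
    have h4 : ∃ c, Tendsto (fun ζ => D.wron κ hκ ζ / D.lam κ ζ) l (𝓝 c) := by
      have key : ∀ i j : Fin 2, (i = 0 ∧ j = 1 ∨ i = 1 ∧ j = 0) → u p i ≠ 0 →
          ∃ c, Tendsto (fun ζ => D.wron κ hκ ζ / D.lam κ ζ) l (𝓝 c) := fun i j hij hi => by
        refine ⟨_, (((hcv j).mul h1).add ((hcu i).mul (h2.const_mul c₀))).const_mul (u p i)⁻¹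
          |>.congr fun ζ => ?_⟩
        change _ * (v ζ j * ((u ζ 0 * u p 1 - u ζ 1 * u p 0) / D.lam κ ζ) +
          u ζ i * (c₀ * ((v ζ 0 * v p 1 - v ζ 1 * v p 0) / D.lam κ ζ))) =
            (u ζ 0 * v ζ 0 - u ζ 1 * v ζ 1) / D.lam κ ζ
        rw [inv_mul_eq_iff_eq_mul₀ hi, mul_div_assoc', mul_div_assoc', mul_div_assoc',
          mul_div_assoc', ← add_div]
        congr 1
        rcases hij with ⟨rfl, rfl⟩ | ⟨rfl, rfl⟩ <;> · rw [e0, e1]; ring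
      by_cases h0 : u p 0 = 0
      · exact key 1 0 (Or.inr ⟨rfl, rfl⟩) fun h1 => hu (by ext i; fin_cases i; exacts [h0, h1])
      · exact key 0 1 (Or.inl ⟨rfl, rfl⟩) h0
    obtain ⟨c, hc⟩ := h4
    refine ⟨c * p / 2, ((hc.mul hid).div_const 2).congr' ?_⟩
    filter_upwards [hev] with ζ hζ
    rw [hζ.1]
    have := hζ.2
    field_simp
  · left
    have hc : Tendsto (D.wron κ hκ) l (𝓝 (D.wron κ hκ p)) :=
      (continuousOn_wron h hκ p hpu).mono_left hll
    refine ⟨D.wron κ hκ p * p / 2, div_ne_zero (mul_ne_zero hW hp0) two_ne_zero,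
      ((hc.mul hid).div_const 2).congr' ?_⟩
    filter_upwards [hev] with ζ hζ
    rw [hζ.1]
    have := hζ.2
    field_simp

end NZProfile

/-! ### Zeros in the defocusing case -/

namespace NZProfile

variable {D : NZProfile}

theorem lam_im_neg_one (ζ : ℂ) : (D.lam (-1) ζ).im = ζ.im * (1 + D.q₀ ^ 2 / normSq ζ) / 2 := by
  have : D.lam (-1) ζ = (ζ - ((D.q₀ ^ 2 : ℝ) : ℂ) * ζ⁻¹) / 2 := by rw [lam]; push_cast; ring
  rw [this, div_ofNat_im, sub_im, im_ofReal_mul, inv_im]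
  ring

theorem k_im_neg_one (ζ : ℂ) : (D.k (-1) ζ).im = ζ.im * (1 - D.q₀ ^ 2 / normSq ζ) / 2 := by
  have : D.k (-1) ζ = (ζ + ((D.q₀ ^ 2 : ℝ) : ℂ) * ζ⁻¹) / 2 := by rw [k]; push_cast; ring
  rw [this, div_ofNat_im, add_im, im_ofReal_mul, inv_im]
  ring

theorem lam_im_pos_iff {ζ : ℂ} : 0 < (D.lam (-1) ζ).im ↔ 0 < ζ.im := by
  have h : 0 < (1 + D.q₀ ^ 2 / normSq ζ) / 2 := by
    have := Complex.normSq_nonneg ζ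
    positivity
  rw [lam_im_neg_one, mul_div_assoc, mul_pos_iff_of_pos_right h]

/-- The energy estimate for the decaying solution. -/
theorem exists_energy_le (h : D.Decays 1) : ∃ Q, 0 < Q ∧ ∀ ζ : ℂ, 0 < (D.lam (-1) ζ).im →
    0 ≤ (D.k (-1) ζ).im →
    2 * (D.k (-1) ζ).im * Real.exp (-(2 * (D.k (-1) ζ).im + 2 * Q)) *
      (‖D.mu (-1) ζ 0 0‖ ^ 2 + ‖D.mu (-1) ζ 0 1‖ ^ 2) ≤
      ‖D.mu (-1) ζ 0 0‖ ^ 2 - ‖D.mu (-1) ζ 0 1‖ ^ 2 := by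
  obtain ⟨Q, hQ, hq⟩ := D.exists_norm_q_le
  refine ⟨Q, hQ, fun ζ hl hk => ?_⟩
  set κi := (D.k (-1) ζ).im with hκi
  have hup : ζ ∈ D.upper (-1) := mem_upper_of_im hl
  set y : ℝ → Fin 2 → ℂ := fun x => exp (-I * D.lam (-1) ζ * x) • D.mu (-1) ζ x
    with hy
  have hyd : ∀ x, HasDerivAt y (D.X (-1) ζ x *ᵥ y x) x := fun x => by
    refine ((hasDerivAt_cexp_mul (-I * D.lam (-1) ζ) x).smul (hasDerivAt_mu h hup x)).congr_deriv ?_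
    rw [X_eq, hy, Matrix.sub_mulVec, Matrix.add_mulVec, Matrix.mulVec_smul, Matrix.mulVec_smul,
      Matrix.smul_mulVec, Matrix.one_mulVec]
    module
  have hydi := fun x i => hasDerivAt_pi.1 (hyd x) i
  have hy0 : y 0 = D.mu (-1) ζ 0 := by simp [hy]
  set c : ℝ → ℂ := fun x => D.z (-1) ζ - ((-1 : ℝ) : ℂ) * D.T * ‖D.q x‖ ^ 2 + D.α / 2 with hc
  have hcim : ∀ x, (c x).im = κi := fun x => by
    have : c x = D.k (-1) ζ + ((-1 * D.T * D.q₀ ^ 2 - -1 * D.T * ‖D.q x‖ ^ 2 : ℝ) : ℂ) := by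
      simp only [hc, z]; push_cast; ring
    rw [this, add_im, ofReal_im, add_zero]
  set w : ℝ → ℝ := fun x => (conj (y x 0) * D.q x * y x 1).re with hw
  have hX : ∀ x, D.X (-1) ζ x 1 0 = conj (D.q x) := fun x => by simp [X]
  have d0 : ∀ x, HasDerivAt (fun x => ‖y x 0‖ ^ 2) (2 * κi * ‖y x 0‖ ^ 2 + 2 * w x) x := fun x => by
    refine (hydi x 0).norm_sq.congr_deriv ?_
    rw [Complex.inner, mulVec_fin_two, show D.X (-1) ζ x 0 0 = -I * c x from rfl,
      show D.X (-1) ζ x 0 1 = D.q x from rfl, ← hcim x, ← normSq_eq_norm_sq, Complex.normSq_apply]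
    simp [hw]
    ring
  have d1 : ∀ x, HasDerivAt (fun x => ‖y x 1‖ ^ 2) (-2 * κi * ‖y x 1‖ ^ 2 + 2 * w x) x := fun x => by
    refine (hydi x 1).norm_sq.congr_deriv ?_
    rw [Complex.inner, mulVec_fin_two, show D.X (-1) ζ x 1 1 = I * c x from rfl, hX,
      ← hcim x, ← normSq_eq_norm_sq, Complex.normSq_apply]
    simp [hw]
    ring
  have hwle : ∀ x, 2 * |w x| ≤ Q * (‖y x 0‖ ^ 2 + ‖y x 1‖ ^ 2) := fun x => by
    have h1 : |w x| ≤ ‖y x 0‖ * Q * ‖y x 1‖ := by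
      refine (Complex.abs_re_le_norm _).trans ?_
      rw [norm_mul, norm_mul, norm_conj]
      gcongr
      exact hq x
    nlinarith [mul_nonneg hQ.le (sq_nonneg (‖y x 0‖ - ‖y x 1‖))]
  set E : ℝ → ℝ := fun x => ‖y x 0‖ ^ 2 - ‖y x 1‖ ^ 2 with hE
  set n : ℝ → ℝ := fun x => ‖y x 0‖ ^ 2 + ‖y x 1‖ ^ 2 with hn
  have hn0 : ∀ x, 0 ≤ n x := fun x => by positivity
  have hEd : ∀ x, HasDerivAt E (2 * κi * n x) x := fun x =>
    ((d0 x).sub (d1 x)).congr_deriv (by simp only [hn]; ring)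
  have hnd : ∀ x, HasDerivAt n (2 * κi * E x + 4 * w x) x := fun x =>
    ((d0 x).add (d1 x)).congr_deriv (by simp only [hE]; ring)
  set C := 2 * κi + 2 * Q with hC
  have hC0 : 0 ≤ C := by positivity
  have hEn : ∀ x, E x ≤ n x := fun x => by simp only [hE, hn]; linarith [sq_nonneg ‖y x 1‖]
  have hanti : Antitone fun x => Real.exp (-C * x) * n x := by
    refine antitone_of_hasDerivAt_nonpos (f' := fun x => Real.exp (-C * x) *
      (2 * κi * E x + 4 * w x - C * n x)) (fun x => ?_) fun x => ?_
    · refine ((((hasDerivAt_id x).const_mul (-C)).exp).mul (hnd x)).congr_deriv ?_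
      simp only [id, mul_one]; ring
    · refine mul_nonpos_of_nonneg_of_nonpos (exp_pos _).le ?_
      have h1 := hwle x
      have h2 := le_abs_self (w x)
      have h3 := mul_le_mul_of_nonneg_left (hEn x) hk
      have h4 : C * n x = 2 * (κi * n x) + 2 * (Q * (‖y x 0‖ ^ 2 + ‖y x 1‖ ^ 2)) := by
        simp only [hC, hn]; ring
      rw [h4]
      linarith
  have hmono : Monotone E := monotone_of_hasDerivAt_nonneg hEd fun x => by have := hn0 x; positivity
  have hlim : Tendsto E atBot (𝓝 0) := by
    have t1 := tendsto_pi_nhds.1 (tendsto_mu h hup)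
    have t4 : Tendsto (fun x : ℝ => Real.exp ((D.lam (-1) ζ).im * x)) atBot (𝓝 0) :=
      tendsto_exp_atBot.comp (tendsto_id.const_mul_atBot hl)
    have hyn : ∀ i x, ‖y x i‖ = Real.exp ((D.lam (-1) ζ).im * x) * ‖D.mu (-1) ζ x i‖ := by
      intro i x
      simp only [hy, Pi.smul_apply, smul_eq_mul, norm_mul, norm_exp]
      rw [re_mul_ofReal]
      simp
    have t5 : ∀ i, Tendsto (fun x => ‖y x i‖) atBot (𝓝 0) := fun i => by
      simp only [hyn]
      simpa using t4.mul (t1 i).norm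
    simpa using ((t5 0).pow 2).sub ((t5 1).pow 2)
  have hEm : 0 ≤ E (-1) := hmono.le_of_tendsto hlim _
  have hstep : E (-1) - 2 * κi * Real.exp (-C) * n 0 * (-1) ≤
      E 0 - 2 * κi * Real.exp (-C) * n 0 * 0 := by
    have hd : ∀ x, HasDerivAt (fun x => E x - 2 * κi * Real.exp (-C) * n 0 * x)
        (2 * κi * n x - 2 * κi * Real.exp (-C) * n 0) x := fun x => by
      simpa using (hEd x).fun_sub ((hasDerivAt_id x).const_mul (2 * κi * Real.exp (-C) * n 0))
    refine monotoneOn_of_deriv_nonneg (convex_Icc (-1 : ℝ) 0) (fun x _ =>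
      (hd x).continuousAt.continuousWithinAt) (fun x _ => (hd x).differentiableAt.differentiableWithinAt)
      (fun x hx => ?_) (by simp) (by simp) (by norm_num)
    rw [interior_Icc] at hx
    rw [(hd x).deriv]
    have h1 : Real.exp (-C * 0) * n 0 ≤ Real.exp (-C * x) * n x := hanti hx.2.le
    rw [mul_zero, Real.exp_zero, one_mul] at h1
    have h2 : Real.exp (-C) * n 0 ≤ n x := by
      have h3 : Real.exp (-C) * Real.exp (-C * x) ≤ 1 := by
        rw [← Real.exp_add, Real.exp_le_one_iff]
        nlinarith [hx.1]
      calc _ ≤ Real.exp (-C) * (Real.exp (-C * x) * n x) := by gcongr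
        _ = Real.exp (-C) * Real.exp (-C * x) * n x := by ring
        _ ≤ 1 * n x := by gcongr
        _ = _ := one_mul _
    have := mul_le_mul_of_nonneg_left h2 hk
    linarith
  rw [← hy0]
  linarith

theorem mu_zero_zero_ne_zero (h : D.Decays 1) {ζ : ℂ} (hl : 0 < (D.lam (-1) ζ).im)
    (hk : 0 ≤ (D.k (-1) ζ).im) : D.mu (-1) ζ 0 0 ≠ 0 := by
  obtain ⟨Q, hQ, hle⟩ := exists_energy_le h
  have h1 := hle ζ hl hk
  have h2 := mu_zero_ne_zero h (mem_upper_of_im hl)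
  intro h0
  rw [h0] at h1
  have h3 : 0 ≤ 2 * (D.k (-1) ζ).im * Real.exp (-(2 * (D.k (-1) ζ).im + 2 * Q)) *
      (‖(0 : ℂ)‖ ^ 2 + ‖D.mu (-1) ζ 0 1‖ ^ 2) := by positivity
  have h4 : ‖D.mu (-1) ζ 0 1‖ ^ 2 ≤ 0 := by
    have := h3.trans h1
    simp at this ⊢
    exact this
  have h5 : D.mu (-1) ζ 0 1 = 0 := by rw [← norm_eq_zero]; nlinarith [norm_nonneg (D.mu (-1) ζ 0 1)]
  exact h2 (by ext i; fin_cases i; exacts [h0, h5])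

theorem abs_neg_one : |(-1 : ℝ)| = 1 := by simp

theorem exists_norm_wron_ge (h : D.Decays 1) : ∃ Q, 0 < Q ∧ ∀ ζ : ℂ, 0 < (D.lam (-1) ζ).im →
    0 ≤ (D.k (-1) ζ).im → (D.k (-1) ζ).im * Real.exp (-(2 * (D.k (-1) ζ).im + 2 * Q)) *
      (‖D.mu (-1) ζ 0 0‖ * ‖(D.refl (-1) abs_neg_one).mu (-1) ζ 0 0‖) ≤
      ‖D.wron (-1) abs_neg_one ζ‖ := by
  obtain ⟨Q, hQ, h1⟩ := exists_energy_le h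
  obtain ⟨Q', hQ', h1'⟩ := exists_energy_le (h.refl abs_neg_one)
  refine ⟨Q, hQ, fun ζ hl hk => ?_⟩
  have e1 := h1 ζ hl hk
  have e2 := h1' ζ hl hk
  have hk' : (D.refl (-1) abs_neg_one).k (-1) ζ = D.k (-1) ζ := rfl
  rw [hk'] at e2
  set c := (D.k (-1) ζ).im * Real.exp (-(2 * (D.k (-1) ζ).im + 2 * Q)) with hc
  have hc0 : 0 ≤ c := by positivity
  set c' := 2 * (D.k (-1) ζ).im * Real.exp (-(2 * (D.k (-1) ζ).im + 2 * Q')) with hc'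
  have hc0' : 0 ≤ c' := by positivity
  set u0 := D.mu (-1) ζ 0 0
  set u1 := D.mu (-1) ζ 0 1
  set w0 := (D.refl (-1) abs_neg_one).mu (-1) ζ 0 0
  set w1 := (D.refl (-1) abs_neg_one).mu (-1) ζ 0 1
  have hW : D.wron (-1) abs_neg_one ζ = u0 * w0 - u1 * w1 := rfl
  have hw : ‖w1‖ ≤ ‖w0‖ := by
    have : 0 ≤ c' * (‖w0‖ ^ 2 + ‖w1‖ ^ 2) := by positivity
    exact (pow_le_pow_iff_left₀ (norm_nonneg _) (norm_nonneg _) two_ne_zero).1 (by linarith)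
  have e1' : 2 * c * (‖u0‖ ^ 2 + ‖u1‖ ^ 2) ≤ ‖u0‖ ^ 2 - ‖u1‖ ^ 2 := by
    refine le_trans (le_of_eq ?_) e1
    rw [hc]; ring
  have hu : ‖u1‖ ≤ ‖u0‖ := by
    have : 0 ≤ 2 * c * (‖u0‖ ^ 2 + ‖u1‖ ^ 2) := by positivity
    exact (pow_le_pow_iff_left₀ (norm_nonneg _) (norm_nonneg _) two_ne_zero).1 (by linarith)
  have hu0 : 0 < ‖u0‖ := norm_pos_iff.2 (mu_zero_zero_ne_zero h hl hk)
  have h3 : c * ‖u0‖ ≤ ‖u0‖ - ‖u1‖ := by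
    have h4 : (c * ‖u0‖) * (2 * ‖u0‖) ≤ (‖u0‖ - ‖u1‖) * (2 * ‖u0‖) := by
      have : 0 ≤ c * ‖u1‖ ^ 2 := by positivity
      nlinarith [norm_nonneg u1]
    exact le_of_mul_le_mul_right h4 (by positivity)
  rw [hW]
  have h5 := norm_sub_norm_le (u0 * w0) (u1 * w1)
  rw [norm_mul, norm_mul] at h5
  have h6 : ‖u1‖ * ‖w1‖ ≤ ‖u1‖ * ‖w0‖ := by gcongr
  have h7 := mul_le_mul_of_nonneg_right h3 (norm_nonneg w0)
  nlinarith

theorem wron_ne_zero (h : D.Decays 1) {ζ : ℂ} (hl : 0 < (D.lam (-1) ζ).im)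
    (hk : 0 < (D.k (-1) ζ).im) : D.wron (-1) abs_neg_one ζ ≠ 0 := by
  obtain ⟨Q, hQ, h1⟩ := exists_norm_wron_ge h
  have h2 := h1 ζ hl hk.le
  have h3 := mu_zero_zero_ne_zero h hl hk.le
  have h4 := mu_zero_zero_ne_zero (h.refl abs_neg_one) (D := D.refl (-1) abs_neg_one) hl hk.le
  rw [← norm_pos_iff]
  refine lt_of_lt_of_le ?_ h2
  have := norm_pos_iff.2 h3
  have := norm_pos_iff.2 h4
  positivity

/-- In the defocusing case the zeros of `a` lie on the circle of radius `q₀`. -/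
theorem norm_eq_of_a_eq_zero (h : D.Decays 1) {ζ : ℂ} (hζ : 0 < ζ.im) (ha : D.a (-1) ζ = 0) :
    ‖ζ‖ = D.q₀ := by
  have hq := D.q₀_pos
  have key : ∀ ζ : ℂ, 0 < ζ.im → D.a (-1) ζ = 0 → ‖ζ‖ ≤ D.q₀ := fun ζ hζ ha => by
    by_contra hlt
    push Not at hlt
    have hl := lam_im_pos_iff (D := D).2 hζ
    have hk : 0 < (D.k (-1) ζ).im := by
      rw [k_im_neg_one, normSq_eq_norm_sq]
      have h1 : D.q₀ ^ 2 / ‖ζ‖ ^ 2 < 1 := by rw [div_lt_one (by nlinarith)]; gcongr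
      have : 0 < 1 - D.q₀ ^ 2 / ‖ζ‖ ^ 2 := by linarith
      positivity
    rw [a_eq h abs_neg_one (mem_upper_of_im hl), div_eq_zero_iff, mul_eq_zero] at ha
    rcases ha with (h1 | h1) | h1
    · exact wron_ne_zero h hl hk h1
    · exact (mem_upper_of_im hl).1 h1
    · exact mul_ne_zero two_ne_zero (lam_ne_zero_of_im hl) h1
  refine le_antisymm (key ζ hζ ha) ?_
  have hl := lam_im_pos_iff (D := D).2 hζ
  have hz := (mem_upper_of_im hl).1
  have h1 := a_inv_conj h abs_neg_one (mem_upper_of_im hl)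
  rw [ha, map_zero, mul_zero] at h1
  have hi : D.inv (-1) (conj ζ) = ((D.q₀ ^ 2 / ‖ζ‖ ^ 2 : ℝ) : ℂ) * ζ := by
    rw [inv, Complex.inv_def, conj_conj, Complex.normSq_conj, normSq_eq_norm_sq]
    push_cast; ring
  have hp : 0 < D.q₀ ^ 2 / ‖ζ‖ ^ 2 := by have := norm_pos_iff.2 hz; positivity
  have h2 := key (D.inv (-1) (conj ζ)) (by rw [hi, im_ofReal_mul]; positivity) h1
  rw [hi, norm_mul, norm_real, norm_of_nonneg hp.le] at h2
  have hz' := norm_pos_iff.2 hz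
  have h3 : D.q₀ ^ 2 / ‖ζ‖ ^ 2 * ‖ζ‖ = D.q₀ ^ 2 / ‖ζ‖ := by field_simp
  rw [h3, div_le_iff₀ hz'] at h2
  nlinarith

/-- In the defocusing case the zeros of `a` are simple. -/
theorem deriv_a_ne_zero (h : D.Decays 1) {ζ : ℂ} (hζ : 0 < ζ.im) (ha : D.a (-1) ζ = 0) :
    deriv (D.a (-1)) ζ ≠ 0 := fun hd => by
  have hq := D.q₀_pos
  have hn := norm_eq_of_a_eq_zero h hζ ha
  have hl := lam_im_pos_iff (D := D).2 hζ
  have hda : HasDerivAt (D.a (-1)) 0 ζ := by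
    rw [← hd]
    exact ((differentiableOn_a h abs_neg_one).differentiableAt
      ((D.isOpen_upper (-1)).mem_nhds hl)).hasDerivAt
  have hγ : ∀ s : ℝ, HasDerivAt (fun s : ℝ => (1 + (s : ℂ)) * ζ) ζ s := fun s => by
    simpa using (((hasDerivAt_id s).ofReal_comp).const_add (1 : ℂ)).mul_const ζ
  have hcomp : HasDerivAt (fun s : ℝ => D.a (-1) ((1 + (s : ℂ)) * ζ)) 0 0 := by
    have := HasDerivAt.scomp (0 : ℝ) (g₁ := D.a (-1)) (h := fun s : ℝ => (1 + (s : ℂ)) * ζ)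
      (by simpa using hda) (hγ 0)
    simpa [Function.comp_def] using this
  have hslope := hcomp.tendsto_slope_zero_right
  simp only [zero_add, ofReal_zero, add_zero, one_mul, ha, sub_zero] at hslope
  obtain ⟨Q, hQ, hW⟩ := exists_norm_wron_ge h
  have hk0 : (D.k (-1) ζ).im = 0 := by
    rw [k_im_neg_one, normSq_eq_norm_sq, hn, div_self (by positivity)]; ring
  set G : ℂ → ℝ := fun w => ζ.im / 2 * Real.exp (-(2 * (D.k (-1) w).im + 2 * Q)) *
      (‖D.mu (-1) w 0 0‖ * ‖(D.refl (-1) abs_neg_one).mu (-1) w 0 0‖) * (‖w‖ /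
        (2 * ‖D.lam (-1) w‖)) with hG
  have hz := (mem_upper_of_im hl).1
  have hup : ∀ᶠ w in 𝓝 ζ, 0 < (D.lam (-1) w).im := (D.isOpen_upper (-1)).mem_nhds hl
  have hGc : ContinuousAt G ζ := by
    have c1 := (differentiableOn_pi.1 (differentiableOn_mu (κ := -1) h 0) 0).continuousOn.continuousAt
      ((D.isOpen_upper (-1)).mem_nhds hl)
    have c2 := (differentiableOn_pi.1 (differentiableOn_mu (κ := -1)
      (h.refl abs_neg_one) 0) 0).continuousOn.continuousAt ((D.isOpen_upper (-1)).mem_nhds hl)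
    have c3 : ContinuousAt (D.lam (-1)) ζ :=
      (D.continuousOn_lam (-1)).continuousAt (isOpen_compl_singleton.mem_nhds hz)
    have c4 : ContinuousAt (fun w => (D.k (-1) w).im) ζ := by
      unfold k
      exact continuous_im.continuousAt.comp
        ((continuousAt_id.sub (continuousAt_const.mul (continuousAt_id.inv₀ hz))).div_const _)
    have c5 : 2 * ‖D.lam (-1) ζ‖ ≠ 0 :=
      mul_ne_zero two_ne_zero (norm_ne_zero_iff.2 (lam_ne_zero_of_im hl))
    refine ((continuousAt_const.mul ?_).mul (c1.norm.mul c2.norm)).mul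
      (continuousAt_id.norm.div (continuousAt_const.mul c3.norm) c5)
    exact Real.continuous_exp.continuousAt.comp ((c4.const_mul 2).add continuousAt_const).neg
  have hGpos : 0 < G ζ := by
    have h3 := norm_pos_iff.2 (mu_zero_zero_ne_zero h hl hk0.ge)
    have h4 := norm_pos_iff.2 (mu_zero_zero_ne_zero (h.refl abs_neg_one)
      (D := D.refl (-1) abs_neg_one) hl hk0.ge)
    have h5 := norm_pos_iff.2 hz
    have h6 := norm_pos_iff.2 (lam_ne_zero_of_im hl)
    simp only [hG]; positivity
  have hγt : Tendsto (fun s : ℝ => (1 + (s : ℂ)) * ζ) (𝓝[>] 0) (𝓝 ζ) := by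
    have := (hγ 0).continuousAt.tendsto
    simp only [ofReal_zero, add_zero, one_mul] at this
    exact this.mono_left nhdsWithin_le_nhds
  have hGt : Tendsto (fun s : ℝ => G ((1 + (s : ℂ)) * ζ)) (𝓝[>] 0) (𝓝 (G ζ)) := hGc.tendsto.comp hγt
  have hle : ∀ᶠ s : ℝ in 𝓝[>] 0, G ((1 + (s : ℂ)) * ζ) ≤ ‖s⁻¹ • D.a (-1) ((1 + (s : ℂ)) * ζ)‖ := by
    filter_upwards [hγt.eventually hup, self_mem_nhdsWithin] with s hs hs0
    have hs0 : 0 < s := hs0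
    set w := (1 + (s : ℂ)) * ζ with hw
    have hw' : w = ((1 + s : ℝ) : ℂ) * ζ := by rw [hw]; push_cast; rfl
    have hwn : normSq w = (1 + s) ^ 2 * D.q₀ ^ 2 := by
      rw [hw', Complex.normSq_mul, Complex.normSq_ofReal, normSq_eq_norm_sq, hn]; ring
    clear_value w
    have hki : s * (ζ.im / 2) ≤ (D.k (-1) w).im := by
      rw [k_im_neg_one, hwn, hw', im_ofReal_mul]
      have h1 : D.q₀ ^ 2 / ((1 + s) ^ 2 * D.q₀ ^ 2) = 1 / (1 + s) ^ 2 := by field_simp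
      rw [h1]
      have h2 : (1 + s) * ζ.im * (1 - 1 / (1 + s) ^ 2) / 2 =
          ζ.im / 2 * (s + s / (1 + s)) := by field_simp; ring
      rw [h2]
      have : 0 ≤ s / (1 + s) := by positivity
      nlinarith
    have hk : 0 ≤ (D.k (-1) w).im := le_trans (by positivity) hki
    have h1 := hW w hs hk
    rw [a_eq h abs_neg_one (mem_upper_of_im hs), norm_smul, norm_div, norm_mul, norm_mul,
      norm_ofNat, norm_inv, norm_of_nonneg hs0.le, inv_mul_eq_div, le_div_iff₀ hs0,
      mul_div_assoc]
    simp only [hG]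
    calc _ = (s * (ζ.im / 2)) * Real.exp (-(2 * (D.k (-1) w).im + 2 * Q)) *
          (‖D.mu (-1) w 0 0‖ * ‖(D.refl (-1) abs_neg_one).mu (-1) w 0 0‖) * (‖w‖ /
            (2 * ‖D.lam (-1) w‖)) := by ring
      _ ≤ (D.k (-1) w).im * Real.exp (-(2 * (D.k (-1) w).im + 2 * Q)) *
          (‖D.mu (-1) w 0 0‖ * ‖(D.refl (-1) abs_neg_one).mu (-1) w 0 0‖) * (‖w‖ /
            (2 * ‖D.lam (-1) w‖)) := by gcongr
      _ ≤ _ := by gcongr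
  have := le_of_tendsto_of_tendsto hGt hslope.norm hle
  rw [norm_zero] at this
  linarith

end NZProfile

/-- Two continuous logarithms on a preconnected set differ by a constant. -/
theorem exists_eq_add_const {X : Type*} [TopologicalSpace X] {C : Set X} (hC : IsPreconnected C)
    {G H : X → ℂ} (hG : ContinuousOn G C) (hH : ContinuousOn H C) {c : ℂ}
    (h : ∀ w ∈ C, exp (G w) = c * exp (H w)) (hne : C.Nonempty) :
    ∃ K, exp K = c ∧ ∀ w ∈ C, G w = H w + K := by
  obtain ⟨w₀, hw₀⟩ := hne
  have hexp : ∀ w ∈ C, exp (G w - H w) = c := fun w hw => by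
    rw [exp_sub, h w hw, mul_div_cancel_right₀ _ (exp_ne_zero _)]
  have hcount : {z | exp z = c}.Countable := by
    refine (Set.countable_range fun n : ℤ => (G w₀ - H w₀) + n * (2 * π * I)).mono fun z hz => ?_
    obtain ⟨n, hn⟩ := Complex.exp_eq_exp_iff_exists_int.1
      ((show exp z = c from hz).trans (hexp w₀ hw₀).symm)
    exact ⟨n, hn.symm⟩
  have hsub := hcount.isTotallyDisconnected _ (Set.image_subset_iff.2 fun w hw => hexp w hw)
    (hC.image _ (hG.sub hH))
  refine ⟨G w₀ - H w₀, hexp _ hw₀, fun w hw => ?_⟩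
  have := hsub (Set.mem_image_of_mem _ hw) (Set.mem_image_of_mem _ hw₀)
  rw [← show (G - H) w = G w₀ - H w₀ from this, Pi.sub_apply]; ring

/-- A logarithm of `F` converges along a filter with a basis of preconnected sets if `F` has a
non-zero limit. -/
theorem exists_tendsto_log {X : Type*} [TopologicalSpace X] {l : Filter X} [l.NeBot] {U : Set X}
    (hl : ∀ s ∈ l, ∃ t ∈ l, t ⊆ s ∧ t ⊆ U ∧ IsPreconnected t) {F G : X → ℂ}
    (hG : ContinuousOn G U) (hF : ContinuousOn F U) (hGF : ∀ w ∈ U, exp (G w) = F w)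
    {c : ℂ} (hc : c ≠ 0) (hlim : Tendsto F l (𝓝 c)) :
    ∃ K, exp K = c ∧ Tendsto G l (𝓝 K) := by
  have h1 : Tendsto (fun w => F w / c) l (𝓝 1) := by simpa [hc] using hlim.div_const c
  have hs : ∀ᶠ w in l, F w / c ∈ slitPlane :=
    h1.eventually (Complex.isOpen_slitPlane.mem_nhds Complex.one_mem_slitPlane)
  obtain ⟨t, htl, hts, htU, htc⟩ := hl _ hs
  obtain ⟨K, hK, hKt⟩ := exists_eq_add_const htc (hG.mono htU) (H := fun w => Complex.log (F w / c))
    (((hF.mono htU).div_const c).clog fun w hw => hts hw)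
    (c := c) (fun w hw => by
      rw [exp_log (Complex.slitPlane_ne_zero (hts hw)), hGF w (htU hw)]
      field_simp) (l.nonempty_of_mem htl)
  refine ⟨K, hK, ?_⟩
  have h2 : Tendsto (fun w => Complex.log (F w / c) + K) l (𝓝 (Complex.log 1 + K)) :=
    (h1.clog Complex.one_mem_slitPlane).add_const K
  rw [Complex.log_one, zero_add] at h2
  exact h2.congr' (by filter_upwards [htl] with w hw using (hKt w hw).symm)

theorem exists_preconnected_nhdsWithin {U : Set ℂ} (hU : Convex ℝ U) (q : ℂ) :
    ∀ s ∈ 𝓝[U] q, ∃ t ∈ 𝓝[U] q, t ⊆ s ∧ t ⊆ U ∧ IsPreconnected t := fun s hs => by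
  obtain ⟨ε, hε, h⟩ := Metric.mem_nhdsWithin_iff.1 hs
  exact ⟨ball q ε ∩ U, inter_mem (mem_nhdsWithin_of_mem_nhds (ball_mem_nhds q hε))
    self_mem_nhdsWithin, h, Set.inter_subset_right, ((convex_ball q ε).inter hU).isPreconnected⟩

/-- A holomorphic logarithm on a convex open set. -/
theorem exists_log {U : Set ℂ} (hU : Convex ℝ U) (hUo : IsOpen U) (hne : U.Nonempty)
    {F : ℂ → ℂ} (hF : DifferentiableOn ℂ F U) (h0 : ∀ w ∈ U, F w ≠ 0) :
    ∃ G : ℂ → ℂ, DifferentiableOn ℂ G U ∧ ∀ w ∈ U, exp (G w) = F w := by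
  have hsc : IsSimplyConnected U := by
    have := hU.contractibleSpace hne
    rw [IsSimplyConnected]; infer_instance
  obtain ⟨G, hGc, hG⟩ := Complex.exists_continuousOn_eqOn_exp_comp hsc hUo hF.continuousOn
    (by rintro ⟨w, hw, h⟩; exact h0 w hw h)
  refine ⟨G, fun w hw => ?_, fun w hw => hG hw⟩
  have hFd := hF.differentiableAt (hUo.mem_nhds hw)
  have hlim : Tendsto (fun v => F v / F w) (𝓝 w) (𝓝 1) := by
    simpa [h0 w hw] using hFd.continuousAt.tendsto.div_const (F w)
  obtain ⟨ε, hε, hb⟩ := Metric.mem_nhds_iff.1 (inter_mem (hUo.mem_nhds hw)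
    (hlim (Complex.isOpen_slitPlane.mem_nhds Complex.one_mem_slitPlane)))
  have hbU : ball w ε ⊆ U := fun v hv => (hb hv).1
  obtain ⟨K, -, hK⟩ := exists_eq_add_const (convex_ball w ε).isPreconnected (hGc.mono hbU)
    (H := fun v => Complex.log (F v / F w))
    (((hF.continuousOn.mono hbU).div_const _).clog fun v hv => (hb hv).2)
    (c := F w) (fun v hv => by
      rw [exp_log (Complex.slitPlane_ne_zero (hb hv).2), show exp (G v) = F v from
        hG (hbU hv)]
      have := h0 w hw
      field_simp) ⟨w, Metric.mem_ball_self hε⟩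
  have hd : DifferentiableAt ℂ (fun v => Complex.log (F v / F w) + K) w :=
    ((hFd.div_const _).clog (by simp [h0 w hw])).add_const K
  exact (hd.congr_of_eventuallyEq (by
    filter_upwards [ball_mem_nhds w hε] with v hv using hK v hv)).differentiableWithinAt

theorem norm_log_le_abs_log (z : ℂ) : ‖Complex.log z‖ ≤ |log ‖z‖| + π := by
  refine (Complex.norm_le_abs_re_add_abs_im _).trans ?_
  rw [log_re, log_im]
  gcongr
  exact Complex.abs_arg_le_pi z

/-- `F` has no zeros in the convex open set `U`, a non-zero limit at the boundary points outside
`P`, and at most a simple pole at those in `P`. -/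
structure LogExtends (F : ℂ → ℂ) (U : Set ℂ) (P : Finset ℂ) : Prop where
  convex : Convex ℝ U
  isOpen : IsOpen U
  diff : DifferentiableOn ℂ F U
  ne_zero : ∀ w ∈ U, F w ≠ 0
  lim : ∀ q ∈ closure U, q ∉ P → ∃ c ≠ 0, Tendsto F (𝓝[U] q) (𝓝 c)
  sing : ∀ p ∈ P, p ∈ closure U ∧ (∃ d ≠ 0, ∀ w ∈ U, (w - p) / d ∈ slitPlane) ∧
    ((∃ c ≠ 0, Tendsto F (𝓝[U] p) (𝓝 c)) ∨ ∃ c ≠ 0, Tendsto (fun w => (w - p) * F w) (𝓝[U] p) (𝓝 c))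

namespace LogExtends

variable {F : ℂ → ℂ} {U : Set ℂ} {P : Finset ℂ}

theorem notMem (h : LogExtends F U P) {w : ℂ} (hw : w ∈ U) : w ∉ P := fun hp => by
  obtain ⟨d, -, hd⟩ := (h.sing w hp).2.1
  simpa using hd w hw

/-- A holomorphic logarithm on a convex open set, extended to the boundary. -/
theorem exists_log_boundary (h : LogExtends F U P) (hne : U.Nonempty) :
    ∃ G : ℂ → ℂ, DifferentiableOn ℂ G U ∧ ContinuousOn G (closure U \ P) ∧
      (∀ w ∈ U, exp (G w) = F w) ∧
      ∀ p ∈ P, ∃ C, ∀ᶠ w in 𝓝[closure U \ P] p, ‖G w‖ ≤ C + |log ‖w - p‖| := by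
  obtain ⟨hU, hUo, hF, h0, hlim, hP⟩ := id h
  obtain ⟨G, hGd, hG⟩ := exists_log hU hUo hne hF h0
  have hUB : U ⊆ closure U \ P := fun w hw => ⟨subset_closure hw, h.notMem hw⟩
  have hex : ∀ q ∈ closure U \ P, ∃ K, Tendsto G (𝓝[U] q) (𝓝 K) := fun q hq => by
    obtain ⟨c, hc, hl⟩ := hlim q hq.1 hq.2
    have := mem_closure_iff_nhdsWithin_neBot.1 hq.1
    obtain ⟨K, -, hK⟩ := exists_tendsto_log (exists_preconnected_nhdsWithin hU q)
      hGd.continuousOn hF.continuousOn hG hc hl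
    exact ⟨K, hK⟩
  have heq : ∀ w ∈ U, extendFrom U G w = G w := fun w hw =>
    extendFrom_eq (subset_closure hw) (hGd.continuousOn w hw)
  have hcont : ContinuousOn (extendFrom U G) (closure U \ P) :=
    continuousOn_extendFrom Set.sdiff_subset hex
  refine ⟨extendFrom U G, hGd.congr heq, hcont, fun w hw => by rw [heq w hw, hG w hw],
    fun p hp => ?_⟩
  obtain ⟨hpU, ⟨d, hd0, hd⟩, hcase⟩ := hP p hp
  have := mem_closure_iff_nhdsWithin_neBot.1 hpU
  -- the bound inside `U`
  have hin : ∃ C, ∀ᶠ w in 𝓝[U] p, ‖G w‖ ≤ C + |log ‖w - p‖| := by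
    rcases hcase with ⟨c, hc, hl⟩ | ⟨c, hc, hl⟩
    · obtain ⟨K, -, hK⟩ := exists_tendsto_log (exists_preconnected_nhdsWithin hU p)
        hGd.continuousOn hF.continuousOn hG hc hl
      refine ⟨‖K‖ + 1, ?_⟩
      filter_upwards [hK.norm.eventually (gt_mem_nhds (lt_add_one ‖K‖))] with w hw
      linarith [abs_nonneg (log ‖w - p‖)]
    · have hlogc : ContinuousOn (fun w => Complex.log ((w - p) / d)) U :=
        ((continuousOn_id.sub continuousOn_const).div_const d).clog hd
      have hl' : Tendsto (fun w => (w - p) / d * F w) (𝓝[U] p) (𝓝 (c / d)) := by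
        refine (hl.div_const d).congr fun w => ?_
        ring
      obtain ⟨K, -, hK⟩ := exists_tendsto_log (exists_preconnected_nhdsWithin hU p)
        (G := fun w => Complex.log ((w - p) / d) + G w)
        (hlogc.add hGd.continuousOn)
        (((continuousOn_id.sub continuousOn_const).div_const d).mul hF.continuousOn)
        (fun w hw => by
          rw [exp_add, exp_log (Complex.slitPlane_ne_zero (hd w hw)), hG w hw]
          rfl)
        (div_ne_zero hc hd0) hl'
      refine ⟨‖K‖ + 1 + π + |log ‖d‖|, ?_⟩
      filter_upwards [hK.norm.eventually (gt_mem_nhds (lt_add_one ‖K‖)), self_mem_nhdsWithin]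
        with w hw hwU
      have hne : w - p ≠ 0 := fun h => by
        have := hd w hwU
        simp [h] at this
      have h1 := norm_log_le_abs_log ((w - p) / d)
      rw [norm_div, Real.log_div (norm_ne_zero_iff.2 hne) (norm_ne_zero_iff.2 hd0)] at h1
      have h2 := abs_sub (log ‖w - p‖) (log ‖d‖)
      have h3 : ‖G w‖ ≤ ‖Complex.log ((w - p) / d) + G w‖ + ‖Complex.log ((w - p) / d)‖ := by
        simpa using norm_sub_le (Complex.log ((w - p) / d) + G w) (Complex.log ((w - p) / d))
      linarith
  obtain ⟨C, hC⟩ := hin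
  refine ⟨C, ?_⟩
  obtain ⟨O, hO, hpO, hOU⟩ := mem_nhdsWithin.1 hC
  refine mem_nhdsWithin.2 ⟨O, hO, hpO, fun w hw => ?_⟩
  have hwp : w ≠ p := fun h => hw.2.2 (h ▸ hp)
  have := mem_closure_iff_nhdsWithin_neBot.1 hw.2.1
  have hlimw : Tendsto (extendFrom U G) (𝓝[U] w) (𝓝 (extendFrom U G w)) := (hcont w hw.2).mono hUB
  have hlog : Tendsto (fun v => C + |log ‖v - p‖|) (𝓝[U] w) (𝓝 (C + |log ‖w - p‖|)) := by
    have : ContinuousAt (fun v : ℂ => C + |log ‖v - p‖|) w := by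
      have h4 : ‖w - p‖ ≠ 0 := norm_ne_zero_iff.2 (sub_ne_zero.2 hwp)
      have : ContinuousAt (fun v : ℂ => ‖v - p‖) w := by fun_prop
      exact continuousAt_const.add (this.log h4).abs
    exact this.tendsto.mono_left nhdsWithin_le_nhds
  refine le_of_tendsto_of_tendsto hlimw.norm hlog ?_
  filter_upwards [mem_nhdsWithin_of_mem_nhds (hO.mem_nhds hw.1), self_mem_nhdsWithin] with v hv hvU
  rw [heq v hvU]
  exact hOU ⟨hv, hvU⟩

end LogExtends

theorem intervalIntegrable_of_log_bound {g : ℝ → ℂ} {a b : ℝ} (hab : a ≤ b) {Q : Set ℝ}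
    (hQ : Q.Finite) (hc : ContinuousOn g (Icc a b \ Q))
    (hb : ∀ q ∈ Q, ∃ C, ∀ᶠ x in 𝓝[Icc a b \ Q] q, ‖g x‖ ≤ C * (1 + |log ‖x - q‖|)) :
    IntervalIntegrable g volume a b := by
  set S : Set ℝ := Icc a b \ Q with hS
  have hSm : MeasurableSet S := measurableSet_Icc.diff hQ.measurableSet
  have hbd : ∀ x ∈ Icc a b, ∃ C, 0 ≤ C ∧
      ∀ᶠ y in 𝓝[S] x, ‖g y‖ ≤ C * (1 + |log ‖y - x‖|) := fun x hx => by
    by_cases hxQ : x ∈ Q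
    · obtain ⟨C, hC⟩ := hb x hxQ
      refine ⟨|C|, abs_nonneg _, ?_⟩
      filter_upwards [hC] with y hy
      exact hy.trans (mul_le_mul_of_nonneg_right (le_abs_self C) (by positivity))
    · refine ⟨‖g x‖ + 1, by positivity, ?_⟩
      filter_upwards [(hc x ⟨hx, hxQ⟩).norm.eventually (gt_mem_nhds (lt_add_one ‖g x‖))] with y hy
      nlinarith [abs_nonneg (log ‖y - x‖), norm_nonneg (g x)]
  have hmeas : AEStronglyMeasurable (S.indicator g) volume :=
    (aestronglyMeasurable_indicator_iff hSm).2 (hc.aestronglyMeasurable hSm)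
  have hloc : LocallyIntegrableOn (S.indicator g) (Icc a b) volume := fun x hx => by
    obtain ⟨C, hC0, hC⟩ := hbd x hx
    rw [eventually_nhdsWithin_iff] at hC
    obtain ⟨δ, hδ, h⟩ := Metric.eventually_nhds_iff_ball.1 hC
    refine ⟨ball x δ, mem_nhdsWithin_of_mem_nhds (ball_mem_nhds x hδ), ?_⟩
    have hlog : IntegrableOn (fun y => C * (1 + |log ‖y - x‖|)) (ball x δ) := by
      have h1 : IntervalIntegrable (fun y => log (y - x)) volume (x - δ) (x + δ) := by
        have := (intervalIntegral.intervalIntegrable_log' (a := -δ) (b := δ)).comp_sub_right x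
        simpa [sub_eq_neg_add, add_comm] using this
      have h2 : IntervalIntegrable (fun y => C * (1 + |log ‖y - x‖|)) volume (x - δ) (x + δ) := by
        have := ((intervalIntegrable_const (c := (1 : ℝ))).add h1.abs).const_mul C
        simpa using this
      rw [Real.ball_eq_Ioo]
      exact ((intervalIntegrable_iff_integrableOn_Ioc_of_le (by linarith)).1 h2).mono_set
        Set.Ioo_subset_Ioc_self
    refine hlog.mono' hmeas.restrict ?_
    refine (ae_restrict_iff' Metric.isOpen_ball.measurableSet).2 (Eventually.of_forall fun y hy => ?_)
    by_cases hyS : y ∈ S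
    · rw [indicator_of_mem hyS]; exact h y hy hyS
    · rw [Set.indicator_of_notMem hyS, norm_zero]; positivity
  have h1 := hloc.integrableOn_isCompact isCompact_Icc
  rw [intervalIntegrable_iff_integrableOn_Icc_of_le hab]
  refine h1.congr_fun_ae ?_
  have hQ0 : ∀ᵐ y ∂(volume.restrict (Icc a b)), y ∉ Q :=
    ae_restrict_of_ae (hQ.measure_zero volume |> measure_eq_zero_iff_ae_notMem.1)
  filter_upwards [hQ0, ae_restrict_mem measurableSet_Icc] with y hy hyI
  exact indicator_of_mem (show y ∈ S from ⟨hyI, hy⟩) g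

/-- The boundary integral over the rectangle `[a, b] × [s, t]`. -/
def rectInt (f : ℂ → ℂ) (a b s t : ℝ) : ℂ :=
  (∫ x in a..b, f (x + s * I)) - (∫ x in a..b, f (x + t * I)) + I * (∫ y in s..t, f (b + y * I))
    - I * (∫ y in s..t, f (a + y * I))

/-- The closed rectangle `[a, b] × [s, t]`. -/
def rect (a b s t : ℝ) : Set ℂ := Icc a b ×ℂ Icc s t

theorem tendsto_mul_log_bound (C : ℝ) (p : ℂ) :
    Tendsto (fun w : ℂ => C * (‖w - p‖ * (1 + |log ‖w - p‖|))) (𝓝 p) (𝓝 0) := by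
  have h1 : Tendsto (fun w : ℂ => ‖w - p‖) (𝓝 p) (𝓝 0) := by
    have : ContinuousAt (fun w : ℂ => ‖w - p‖) p := by fun_prop
    simpa using this.tendsto
  have h2 : Tendsto (fun x : ℝ => C * (x + |x * log x|)) (𝓝 0) (𝓝 0) := by
    have : Continuous fun x : ℝ => C * (x + |x * log x|) :=
      continuous_const.mul (continuous_id.add Real.continuous_mul_log.abs)
    simpa using this.tendsto 0
  refine (h2.comp h1).congr fun w => ?_
  simp only [Function.comp]
  rw [abs_mul, abs_of_nonneg (norm_nonneg _)]; ring

/-- The factor removing logarithmic singularities on the boundary. -/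
def cutoff (P : Finset ℂ) (n : ℂ → ℂ) (ε : ℝ) (w : ℂ) : ℂ := ∏ p ∈ P, (w - p) / (w - p + ε * n p)

section cutoff

variable {P : Finset ℂ} {n : ℂ → ℂ} {R : Set ℂ} (hn : ∀ p ∈ P, n p ≠ 0)
  (hR : ∀ p ∈ P, ∀ w ∈ R, 0 ≤ ((w - p) / n p).re)
include hn hR

theorem norm_cutoff_factor {ε : ℝ} (hε : 0 < ε) {p : ℂ} (hp : p ∈ P) {w : ℂ} (hw : w ∈ R) :
    ‖w - p‖ ≤ ‖w - p + ε * n p‖ ∧ ε * ‖n p‖ ≤ ‖w - p + ε * n p‖ := by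
  have h1 : w - p + ε * n p = ((w - p) / n p + ε) * n p := by
    have := hn p hp
    field_simp
  have h0 := hR p hp w hw
  set v := (w - p) / n p with hv
  have h2 : w - p = v * n p := by rw [hv, div_mul_cancel₀ _ (hn p hp)]
  constructor
  · rw [h1, h2, norm_mul, norm_mul]
    gcongr
    refine (sq_le_sq₀ (norm_nonneg _) (norm_nonneg _)).1 ?_
    rw [← normSq_eq_norm_sq, ← normSq_eq_norm_sq]
    simp only [Complex.normSq_apply, add_re, add_im, ofReal_re, ofReal_im]; nlinarith
  · rw [h1, norm_mul]
    gcongr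
    refine le_trans ?_ (Complex.re_le_norm _)
    simp only [add_re, ofReal_re]; linarith

theorem cutoff_den_ne_zero {ε : ℝ} (hε : 0 < ε) {p : ℂ} (hp : p ∈ P) {w : ℂ} (hw : w ∈ R) :
    w - p + ε * n p ≠ 0 := fun h => by
  have := (norm_cutoff_factor hn hR hε hp hw).2
  rw [h, norm_zero] at this
  have := mul_pos hε (norm_pos_iff.2 (hn p hp))
  linarith

theorem norm_cutoff_le {ε : ℝ} (hε : 0 < ε) {w : ℂ} (hw : w ∈ R) : ‖cutoff P n ε w‖ ≤ 1 := by
  rw [cutoff, norm_prod]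
  refine Finset.prod_le_one (fun _ _ => norm_nonneg _) fun p hp => ?_
  rw [norm_div]
  exact div_le_one_of_le₀ (norm_cutoff_factor hn hR hε hp hw).1 (norm_nonneg _)

theorem norm_cutoff_le' {ε : ℝ} (hε : 0 < ε) {p : ℂ} (hp : p ∈ P) {w : ℂ} (hw : w ∈ R) :
    ‖cutoff P n ε w‖ ≤ ‖w - p‖ / (ε * ‖n p‖) := by
  rw [cutoff, norm_prod, ← Finset.mul_prod_erase _ _ hp]
  have h1 : ∏ q ∈ P.erase p, ‖(w - q) / (w - q + ε * n q)‖ ≤ 1 := by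
    refine Finset.prod_le_one (fun _ _ => norm_nonneg _) fun q hq => ?_
    rw [norm_div]
    exact div_le_one_of_le₀ (norm_cutoff_factor hn hR hε (Finset.mem_of_mem_erase hq) hw).1
      (norm_nonneg _)
  refine (mul_le_of_le_one_right (norm_nonneg _) h1).trans ?_
  rw [norm_div]
  have := mul_pos hε (norm_pos_iff.2 (hn p hp))
  exact div_le_div_of_nonneg_left (norm_nonneg _) this (norm_cutoff_factor hn hR hε hp hw).2

theorem differentiableOn_cutoff {ε : ℝ} (hε : 0 < ε) : DifferentiableOn ℂ (cutoff P n ε) R := by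
  unfold cutoff
  refine DifferentiableOn.fun_finsetProd fun p hp => ?_
  exact (differentiableOn_id.sub_const p).div ((differentiableOn_id.sub_const p).add_const _)
    fun w hw => cutoff_den_ne_zero hn hR hε hp hw

omit hn hR in
theorem tendsto_cutoff {w : ℂ} (hw : w ∉ P) :
    Tendsto (fun ε : ℝ => cutoff P n ε w) (𝓝 0) (𝓝 1) := by
  have : ∀ p ∈ P, Tendsto (fun ε : ℝ => (w - p) / (w - p + ε * n p)) (𝓝 0) (𝓝 1) := fun p hp => by
    have hne : w - p ≠ 0 := sub_ne_zero.2 fun h => hw (h ▸ hp)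
    have hc : ContinuousAt (fun ε : ℝ => (w - p) / (w - p + ε * n p)) 0 := by
      refine ContinuousAt.div (by fun_prop) (by fun_prop) (by simpa using hne)
    simpa [hne] using hc.tendsto
  simpa [cutoff] using tendsto_finsetProd P this

end cutoff

theorem edge_tendsto {f : ℂ → ℂ} {R : Set ℂ} {P : Finset ℂ} {n : ℂ → ℂ} (hn : ∀ p ∈ P, n p ≠ 0)
    (hR : ∀ p ∈ P, ∀ w ∈ R, 0 ≤ ((w - p) / n p).re) (hc : ContinuousOn f (R \ P))
    (hlog : ∀ p ∈ P, ∃ C, ∀ᶠ w in 𝓝[R \ P] p, ‖f w‖ ≤ C * (1 + |log ‖w - p‖|))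
    (hcont : ∀ ε > 0, ContinuousOn (fun w => cutoff P n ε w * f w) R)
    {γ : ℝ → ℂ} {a b : ℝ} (hab : a ≤ b) (hγ : Isometry γ) (hmaps : ∀ x ∈ Icc a b, γ x ∈ R) :
    IntervalIntegrable (fun x => f (γ x)) volume a b ∧
    Tendsto (fun ε : ℝ => ∫ x in a..b, cutoff P n ε (γ x) * f (γ x)) (𝓝[>] 0)
      (𝓝 (∫ x in a..b, f (γ x))) := by
  have hQ : (γ ⁻¹' (P : Set ℂ)).Finite := P.finite_toSet.preimage hγ.injective.injOn
  have hm : Set.MapsTo γ (Icc a b \ γ ⁻¹' P) (R \ P) := fun x hx => ⟨hmaps x hx.1, hx.2⟩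
  have hint : IntervalIntegrable (fun x => f (γ x)) volume a b := by
    refine intervalIntegrable_of_log_bound hab hQ (hc.comp hγ.continuous.continuousOn hm)
      fun q hq => ?_
    obtain ⟨C, hC⟩ := hlog (γ q) hq
    refine ⟨C, ?_⟩
    filter_upwards [(hγ.continuous.continuousWithinAt.tendsto_nhdsWithin hm).eventually hC] with x hx
    rwa [← dist_eq_norm, hγ.dist_eq, dist_eq_norm] at hx
  refine ⟨hint, ?_⟩
  refine intervalIntegral.tendsto_integral_filter_of_dominated_convergence (fun x => ‖f (γ x)‖)
    ?_ ?_ hint.norm ?_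
  · filter_upwards [self_mem_nhdsWithin] with ε hε
    refine ContinuousOn.aestronglyMeasurable ?_ measurableSet_uIoc
    refine ((hcont ε hε).comp hγ.continuous.continuousOn fun x hx => hmaps x hx).mono ?_
    rw [uIoc_of_le hab]
    exact Set.Ioc_subset_Icc_self
  · filter_upwards [self_mem_nhdsWithin] with ε hε
    refine Eventually.of_forall fun x hx => ?_
    rw [uIoc_of_le hab] at hx
    rw [norm_mul]
    exact mul_le_of_le_one_left (norm_nonneg _)
      (norm_cutoff_le hn hR hε (hmaps x (Set.Ioc_subset_Icc_self hx)))
  · filter_upwards [measure_eq_zero_iff_ae_notMem.1 (hQ.measure_zero volume)] with x hx _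
    simpa using ((tendsto_cutoff hx).mono_left nhdsWithin_le_nhds).mul_const (f (γ x))

theorem isometry_horizontal (s : ℝ) : Isometry fun x : ℝ => (x : ℂ) + s * I :=
  Isometry.of_dist_eq fun x y => by
    rw [dist_add_right, dist_eq, ← ofReal_sub, norm_real, Real.dist_eq, norm_eq_abs]

theorem isometry_vertical (b : ℝ) : Isometry fun y : ℝ => (b : ℂ) + y * I :=
  Isometry.of_dist_eq fun x y => by
    rw [dist_add_left, dist_eq, ← sub_mul, ← ofReal_sub, norm_mul, norm_I,
      mul_one, norm_real, Real.dist_eq, norm_eq_abs]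

theorem mem_rect {a b s t x y : ℝ} :
    (x : ℂ) + y * I ∈ rect a b s t ↔ (a ≤ x ∧ x ≤ b) ∧ (s ≤ y ∧ y ≤ t) := by
  simp [rect, mem_reProdIm]

/-- Cauchy's theorem on a rectangle for functions with at most logarithmic singularities on the
boundary. -/
theorem rectInt_eq_zero {f : ℂ → ℂ} {a b s t : ℝ} (hab : a ≤ b) (hst : s ≤ t) {P : Finset ℂ}
    (hd : DifferentiableOn ℂ f (Ioo a b ×ℂ Ioo s t))
    (hc : ContinuousOn f (rect a b s t \ P))
    (hP : ∀ p ∈ P, ∃ n ≠ 0, ∀ w ∈ rect a b s t, 0 ≤ ((w - p) / n).re)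
    (hlog : ∀ p ∈ P, ∃ C, ∀ᶠ w in 𝓝[rect a b s t \ P] p, ‖f w‖ ≤ C * (1 + |log ‖w - p‖|)) :
    rectInt f a b s t = 0 ∧
    IntervalIntegrable (fun x : ℝ => f (x + s * I)) volume a b ∧
    IntervalIntegrable (fun x : ℝ => f (x + t * I)) volume a b ∧
    IntervalIntegrable (fun y : ℝ => f (b + y * I)) volume s t ∧
    IntervalIntegrable (fun y : ℝ => f (a + y * I)) volume s t := by
  choose! n hn hR using hP
  have hcont : ∀ ε > 0, ContinuousOn (fun w => cutoff P n ε w * f w) (rect a b s t) :=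
    fun ε hε w hw => by
      by_cases hwP : w ∈ P
      · obtain ⟨C, hC⟩ := hlog w hwP
        have h0 : cutoff P n ε w * f w = 0 := by rw [cutoff, prod_eq_zero hwP (by simp), zero_mul]
        rw [ContinuousWithinAt, h0]
        refine squeeze_zero_norm' (a := fun v => C / (ε * ‖n w‖) *
          (‖v - w‖ * (1 + |log ‖v - w‖|))) ?_
          ((tendsto_mul_log_bound _ w).mono_left nhdsWithin_le_nhds)
        have hCa := hC
        rw [eventually_nhdsWithin_iff] at hCa ⊢
        have herase : ∀ᶠ v in 𝓝 w, v ∉ P.erase w :=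
          (P.erase w).finite_toSet.isClosed.isOpen_compl.mem_nhds (by simp)
        filter_upwards [hCa, herase] with v hv hve hvR
        by_cases hvP : v ∈ P
        · have : v = w := by
            by_contra hvw
            exact hve (Finset.mem_erase.2 ⟨hvw, hvP⟩)
          subst this
          simp [h0]
        · have h1 := norm_cutoff_le' hn hR hε hwP hvR
          have h2 := hv ⟨hvR, hvP⟩
          rw [norm_mul]
          calc ‖cutoff P n ε v‖ * ‖f v‖ ≤ ‖v - w‖ / (ε * ‖n w‖) * (C * (1 + |log ‖v - w‖|)) := by
                gcongr
            _ = _ := by ring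
      · have h1 : ContinuousWithinAt f (rect a b s t) w := by
          refine (hc w ⟨hw, hwP⟩).mono_of_mem_nhdsWithin ?_
          exact inter_mem self_mem_nhdsWithin (mem_nhdsWithin_of_mem_nhds
              (P.finite_toSet.isClosed.isOpen_compl.mem_nhds hwP))
        exact ((differentiableOn_cutoff hn hR hε).continuousOn w hw).mul h1
  have hIoo : Ioo a b ×ℂ Ioo s t ⊆ rect a b s t := fun w hw =>
    ⟨Ioo_subset_Icc_self hw.1, Ioo_subset_Icc_self hw.2⟩
  have hzero : ∀ ε > 0, rectInt (fun w => cutoff P n ε w * f w) a b s t = 0 := fun ε hε => by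
    have := Complex.integral_boundary_rect_eq_zero_of_continuousOn_of_differentiableOn
      (fun w => cutoff P n ε w * f w) (a + s * I) (b + t * I)
      (by simpa [uIcc_of_le hab, uIcc_of_le hst, rect] using hcont ε hε)
      (by simpa [hab, hst] using ((differentiableOn_cutoff hn hR hε).mono hIoo).fun_mul hd)
    simpa [rectInt, smul_eq_mul] using this
  have e1 := edge_tendsto hn hR hc hlog hcont hab (isometry_horizontal s)
    (fun x hx => mem_rect.2 ⟨hx, le_rfl, hst⟩)
  have e2 := edge_tendsto hn hR hc hlog hcont hab (isometry_horizontal t)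
    (fun x hx => mem_rect.2 ⟨hx, hst, le_rfl⟩)
  have e3 := edge_tendsto hn hR hc hlog hcont hst (isometry_vertical b)
    (fun y hy => mem_rect.2 ⟨⟨hab, le_rfl⟩, hy⟩)
  have e4 := edge_tendsto hn hR hc hlog hcont hst (isometry_vertical a)
    (fun y hy => mem_rect.2 ⟨⟨le_rfl, hab⟩, hy⟩)
  refine ⟨?_, e1.1, e2.1, e3.1, e4.1⟩
  have hlim : Tendsto (fun ε => rectInt (fun w => cutoff P n ε w * f w) a b s t) (𝓝[>] 0)
      (𝓝 (rectInt f a b s t)) :=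
    ((e1.2.sub e2.2).add (e3.2.const_mul _)).sub (e4.2.const_mul _)
  refine tendsto_nhds_unique hlim (tendsto_const_nhds.congr' ?_)
  filter_upwards [self_mem_nhdsWithin] with ε hε using (hzero ε hε).symm

theorem intervalIntegral_conj (f : ℝ → ℂ) (a b : ℝ) :
    ∫ x in a..b, conj (f x) = conj (∫ x in a..b, f x) := by
  simp only [intervalIntegral, map_sub, integral_conj]

/-- The Cauchy kernel `dη/(η - ξ)` in the coordinate `w = log η`. -/
def cker (ξ w : ℂ) : ℂ := exp w / (exp w - ξ)

@[simp] theorem cker_zero (w : ℂ) : cker 0 w = 1 := by simp [cker, exp_ne_zero]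

theorem conj_cker (ξ w : ℂ) : conj (cker ξ w) = cker (conj ξ) (conj w) := by simp [cker, exp_conj]

theorem cker_add_two_pi (ξ w : ℂ) : cker ξ (w + 2 * π * I) = cker ξ w := by
  rw [cker, Complex.exp_periodic w, cker]

theorem norm_cker_le {ξ w : ℂ} {δ : ℝ} (hδ : 0 < δ) (h : δ ≤ ‖exp w - ξ‖) :
    ‖cker ξ w‖ ≤ 1 + ‖ξ‖ / δ := by
  have h0 : exp w - ξ ≠ 0 := norm_pos_iff.1 (hδ.trans_le h)
  have : cker ξ w = 1 + ξ / (exp w - ξ) := by rw [cker]; field_simp; ring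
  rw [this]
  refine (norm_add_le _ _).trans ?_
  rw [norm_one, norm_div]
  gcongr

theorem continuousAt_cker {ξ w : ℂ} (h : exp w ≠ ξ) : ContinuousAt (cker ξ) w := by
  unfold cker
  exact ContinuousAt.div (by fun_prop) (by fun_prop) (sub_ne_zero.2 h)

theorem differentiableAt_cker {ξ w : ℂ} (h : exp w ≠ ξ) : DifferentiableAt ℂ (cker ξ) w := by
  unfold cker
  exact DifferentiableAt.div (by fun_prop) (by fun_prop) (sub_ne_zero.2 h)

/-- The integral of the Cauchy kernel over a circle. -/
theorem integral_cker (ξ : ℂ) {c : ℝ} (hc : ‖ξ‖ ≠ Real.exp c) :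
    ∫ y in (-π)..π, cker ξ (c + y * I) = if ‖ξ‖ < Real.exp c then (2 * π : ℂ) else 0 := by
  have hper : Function.Periodic (fun y : ℝ => cker ξ (c + y * I)) (2 * π) := fun y => by
    have := cker_add_two_pi ξ (c + y * I)
    simp only at this ⊢
    rw [← this]; push_cast; ring_nf
  have h1 : ∫ y in (-π)..π, cker ξ (c + y * I) = ∫ y in (0 : ℝ)..2 * π, cker ξ (c + y * I) := by
    have := hper.intervalIntegral_add_eq (-π) 0
    rwa [zero_add, show -π + 2 * π = π by ring] at this
  have h2 : (∮ z in C(0, Real.exp c), (z - ξ)⁻¹) =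
      I * ∫ y in (0 : ℝ)..2 * π, cker ξ (c + y * I) := by
    rw [circleIntegral, ← intervalIntegral.integral_const_mul]
    congr 1
    ext y
    have : circleMap 0 (Real.exp c) y = exp (c + y * I) := by
      rw [circleMap, exp_add, ofReal_exp, zero_add]
    rw [deriv_circleMap, this, cker, smul_eq_mul]
    ring
  rw [h1]
  split_ifs with h
  · rw [circleIntegral.integral_sub_inv_of_mem_ball (by simpa using h)] at h2
    have := mul_left_cancel₀ I_ne_zero ((mul_comm _ _).trans h2)
    rw [← this]
  · rw [DiffContOnCl.circleIntegral_eq_zero (exp_pos c).le] at h2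
    · simpa using h2.symm
    · refine DifferentiableOn.diffContOnCl fun z hz => ?_
      rw [closure_ball _ (exp_pos c).ne', Metric.mem_closedBall, dist_zero_right] at hz
      refine ((differentiableAt_id.sub_const ξ).inv ?_).differentiableWithinAt
      refine sub_ne_zero.2 fun h3 => h ?_
      rw [← h3] at hc ⊢
      exact lt_of_le_of_ne hz hc

/-- The open half strip over which `exp` covers the part of the upper half plane outside the
circle of radius `exp c`. -/
def strip (c : ℝ) : Set ℂ := {w | c < w.re ∧ 0 < w.im ∧ w.im < π}

/-- The closed half strip. -/
def cstrip (c : ℝ) : Set ℂ := {w | c ≤ w.re ∧ 0 ≤ w.im ∧ w.im ≤ π}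

/-- Functions on the half strip that vanish at infinity and have at most logarithmic singularities
on the boundary, at the points of `P`. -/
structure StripLog (G : ℂ → ℂ) (c : ℝ) (P : Finset ℂ) : Prop where
  diff : DifferentiableOn ℂ G (strip c)
  cont : ContinuousOn G (cstrip c \ P)
  normal : ∀ p ∈ P, ∃ n ≠ 0, ∀ w ∈ cstrip c, 0 ≤ ((w - p) / n).re
  notMem : ∀ p ∈ P, p ∉ strip c
  bound : ∀ p ∈ P, ∃ C, ∀ᶠ w in 𝓝[cstrip c \ P] p, ‖G w‖ ≤ C + |log ‖w - p‖|
  zero : Tendsto G (comap re atTop ⊓ 𝓟 (cstrip c \ P)) (𝓝 0)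

theorem rect_subset_cstrip {a b s t c : ℝ} (ha : c ≤ a) (hs : 0 ≤ s) (ht : t ≤ π) :
    rect a b s t ⊆ cstrip c := fun _ hw =>
  ⟨ha.trans hw.1.1, hs.trans hw.2.1, hw.2.2.trans ht⟩

theorem Ioo_subset_strip {a b s t c : ℝ} (ha : c ≤ a) (hs : 0 ≤ s) (ht : t ≤ π) :
    Ioo a b ×ℂ Ioo s t ⊆ strip c := fun _ hw =>
  ⟨ha.trans_lt hw.1.1, hs.trans_lt hw.2.1, hw.2.2.trans_le ht⟩

/-- Integrability on the edges of a rectangle. -/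
def EdgeIntegrable (f : ℂ → ℂ) (a b s t : ℝ) : Prop :=
  IntervalIntegrable (fun x : ℝ => f (x + s * I)) volume a b ∧
  IntervalIntegrable (fun x : ℝ => f (x + t * I)) volume a b ∧
  IntervalIntegrable (fun y : ℝ => f (b + y * I)) volume s t ∧
  IntervalIntegrable (fun y : ℝ => f (a + y * I)) volume s t

namespace StripLog

variable {G : ℂ → ℂ} {c : ℝ} {P : Finset ℂ}

/-- Cauchy's theorem for `f = O(1 + |G|)`. -/
theorem rectInt_eq_zero (hG : StripLog G c P) {f : ℂ → ℂ} {a b s t : ℝ} (hca : c ≤ a) (hs : 0 ≤ s)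
    (ht : t ≤ π) (hab : a ≤ b) (hst : s ≤ t)
    (hd : DifferentiableOn ℂ f (Ioo a b ×ℂ Ioo s t))
    (hc : ContinuousOn f (rect a b s t \ P))
    (hb : ∀ p ∈ P, p ∈ rect a b s t →
      ∃ A B, ∀ᶠ w in 𝓝[rect a b s t \ P] p, ‖f w‖ ≤ B * (A + ‖G w‖)) :
    rectInt f a b s t = 0 ∧ EdgeIntegrable f a b s t := by
  have hsub := rect_subset_cstrip (b := b) hca hs ht
  refine KE.rectInt_eq_zero hab hst hd hc (fun p hp => ?_) fun p hp => ?_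
  · obtain ⟨n, hn, h⟩ := hG.normal p hp
    exact ⟨n, hn, fun w hw => h w (hsub hw)⟩
  · by_cases hpr : p ∈ rect a b s t
    · obtain ⟨A, B, hAB⟩ := hb p hp hpr
      obtain ⟨C, hC⟩ := hG.bound p hp
      have hC' := hC.filter_mono (nhdsWithin_mono p (Set.sdiff_subset_sdiff_left hsub))
      refine ⟨|B| * (|A| + |C| + 1), ?_⟩
      filter_upwards [hAB, hC'] with w h1 h2
      have h3 : ‖f w‖ ≤ |B| * (|A| + ‖G w‖) := by
        refine h1.trans ((le_abs_self _).trans ?_)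
        rw [abs_mul]
        refine mul_le_mul_of_nonneg_left ((abs_add_le _ _).trans ?_) (abs_nonneg _)
        rw [abs_of_nonneg (norm_nonneg _)]
      refine h3.trans ?_
      rw [mul_assoc]
      refine mul_le_mul_of_nonneg_left ?_ (abs_nonneg _)
      nlinarith [abs_nonneg A, abs_nonneg C, abs_nonneg (log ‖w - p‖), le_abs_self C]
    · refine ⟨0, ?_⟩
      have hcl : IsClosed (rect a b s t) := isClosed_Icc.reProdIm isClosed_Icc
      have : 𝓝[rect a b s t \ P] p = ⊥ := by
        rw [← not_neBot, ← mem_closure_iff_nhdsWithin_neBot]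
        exact fun h => hpr (closure_minimal Set.sdiff_subset hcl h)
      rw [this]
      exact eventually_bot

/-- Cauchy's theorem for the product with a kernel without poles. -/
theorem rectInt_mul_eq_zero (hG : StripLog G c P) {K : ℂ → ℂ} {a b s t : ℝ} (hca : c ≤ a)
    (hs : 0 ≤ s) (ht : t ≤ π) (hab : a ≤ b) (hst : s ≤ t)
    (hK : ∀ w ∈ rect a b s t, DifferentiableAt ℂ K w) :
    rectInt (fun w => G w * K w) a b s t = 0 ∧ EdgeIntegrable (fun w => G w * K w) a b s t := by
  have hIoo : Ioo a b ×ℂ Ioo s t ⊆ rect a b s t := fun w hw =>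
    ⟨Ioo_subset_Icc_self hw.1, Ioo_subset_Icc_self hw.2⟩
  refine hG.rectInt_eq_zero hca hs ht hab hst
    ((hG.diff.mono (Ioo_subset_strip hca hs ht)).fun_mul fun w hw =>
      (hK w (hIoo hw)).differentiableWithinAt)
    ((hG.cont.mono (Set.sdiff_subset_sdiff_left (rect_subset_cstrip hca hs ht))).fun_mul fun w hw =>
      (hK w hw.1).continuousAt.continuousWithinAt) fun p hp hpr => ?_
  refine ⟨0, ‖K p‖ + 1, ?_⟩
  filter_upwards [((hK p hpr).continuousAt.norm.mono_left nhdsWithin_le_nhds).eventually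
    (gt_mem_nhds (lt_add_one ‖K p‖))] with w hw
  rw [norm_mul, zero_add, mul_comm]
  gcongr

end StripLog

theorem rectInt_cker {ξ : ℂ} {c R : ℝ} (hcR : c ≤ R) (hξ : 0 < ξ.im) (hc : Real.exp c < ‖ξ‖)
    (hR : ‖ξ‖ < Real.exp R) : rectInt (cker ξ) c R 0 π = 2 * π * I := by
  have hnp : ∀ w ∈ rect c R (-π) 0, exp w ≠ ξ := fun w hw h => by
    have h1 := exp_im w
    rw [h] at h1
    have h2 : Real.sin w.im ≤ 0 := Real.sin_nonpos_of_nonpos_of_neg_pi_le hw.2.2 hw.2.1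
    nlinarith [exp_pos w.re]
  have hlow := Complex.integral_boundary_rect_eq_zero_of_differentiableOn (cker ξ)
      (c + (-π : ℝ) * I) (R + (0 : ℝ) * I)
      (by
        intro w hw
        refine (differentiableAt_cker (hnp w ?_)).differentiableWithinAt
        simpa [uIcc_of_le hcR, uIcc_of_le (neg_nonpos.2 pi_pos.le), rect] using hw)
  have hlow' : rectInt (cker ξ) c R (-π) 0 = 0 := by simpa [rectInt, smul_eq_mul] using hlow
  have hII : ∀ (b : ℝ) (_ : ‖ξ‖ ≠ Real.exp b) (s t : ℝ),
      IntervalIntegrable (fun y : ℝ => cker ξ (b + y * I)) volume s t := fun b hb s t => by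
    refine Continuous.intervalIntegrable (continuous_iff_continuousAt.2 fun y => ?_) _ _
    have : ContinuousAt (cker ξ) (b + y * I) := continuousAt_cker fun h => hb (by
      rw [← h, norm_exp]; simp)
    exact ContinuousAt.comp (f := fun y : ℝ => (b : ℂ) + y * I) this (by fun_prop)
  have hR1 := integral_add_adjacent_intervals (hII R hR.ne (-π) 0) (hII R hR.ne 0 π)
  have hc1 := integral_add_adjacent_intervals (hII c hc.ne' (-π) 0) (hII c hc.ne' 0 π)
  rw [integral_cker ξ hR.ne, if_pos hR] at hR1
  rw [integral_cker ξ hc.ne', if_neg hc.le.not_gt] at hc1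
  have hper : (fun x : ℝ => cker ξ (x + (π : ℝ) * I)) = fun x : ℝ => cker ξ (x + (-π : ℝ) * I) := by
    ext x
    rw [← cker_add_two_pi ξ (x + (-π : ℝ) * I)]
    push_cast; ring_nf
  rw [rectInt] at hlow' ⊢
  rw [show (∫ x in c..R, cker ξ (x + (π : ℝ) * I)) =
    ∫ x in c..R, cker ξ (x + (-π : ℝ) * I) from congrArg (fun f => ∫ x in c..R, f x) hper]
  linear_combination (-1 : ℂ) * hlow' + I * hR1 - I * hc1

open Classical in
/-- The residue contribution of the pole of the Cauchy kernel. -/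
def res (G : ℂ → ℂ) (c : ℝ) (ξ : ℂ) : ℂ :=
  if Real.exp c < ‖ξ‖ ∧ 0 < ξ.im then G (Complex.log ξ) else 0

/-- The kernel has no pole on the boundary of the half strip. -/
def Admissible (c : ℝ) (ξ : ℂ) : Prop := ‖ξ‖ < Real.exp c ∨ Real.exp c < ‖ξ‖ ∧ ξ.im ≠ 0

theorem log_mem_strip {c : ℝ} {ξ : ℂ} (hc : Real.exp c < ‖ξ‖) (hξ : 0 < ξ.im) :
    Complex.log ξ ∈ strip c := by
  refine ⟨?_, ?_, ?_⟩
  · rw [log_re]; exact (Real.lt_log_iff_exp_lt ((exp_pos c).trans hc)).2 hc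
  · rw [log_im]
    refine lt_of_le_of_ne (Complex.arg_nonneg_iff.2 hξ.le) fun h => ?_
    exact hξ.ne' (Complex.arg_eq_zero_iff.1 h.symm).2
  · rw [log_im]
    refine lt_of_le_of_ne (Complex.arg_le_pi ξ) fun h => ?_
    exact hξ.ne' (Complex.arg_eq_pi_iff.1 h).2

namespace StripLog

variable {G : ℂ → ℂ} {c : ℝ} {P : Finset ℂ}

theorem rectInt_mul_cker (hG : StripLog G c P) {ξ : ℂ} (hξ : Admissible c ξ) {R : ℝ} (hcR : c ≤ R)
    (hR : ‖ξ‖ < Real.exp R) :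
    rectInt (fun w => G w * cker ξ w) c R 0 π = 2 * π * I * res G c ξ ∧
      EdgeIntegrable (fun w => G w * cker ξ w) c R 0 π := by
  by_cases hres : Real.exp c < ‖ξ‖ ∧ 0 < ξ.im
  · obtain ⟨hc, him⟩ := hres
    rw [res, if_pos ⟨hc, him⟩]
    have hξ0 : ξ ≠ 0 := fun h => by simp [h] at him
    set w₀ := Complex.log ξ with hw₀
    have hexp : exp w₀ = ξ := exp_log hξ0
    have hw₀s : w₀ ∈ strip c := log_mem_strip hc him
    have hw₀R : w₀.re < R := by
      rw [hw₀, log_re]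
      exact (Real.log_lt_iff_lt_exp (norm_pos_iff.2 hξ0)).2 hR
    have hinj : ∀ w ∈ rect c R 0 π, w ≠ w₀ → exp w ≠ ξ := fun w hw hne h => hne (by
      rw [← hexp] at h
      have := pi_pos
      exact Complex.exp_inj_of_neg_pi_lt_of_le_pi (by linarith [hw.2.1]) hw.2.2
        (by linarith [hw₀s.2.1]) hw₀s.2.2.le h)
    have hO : IsOpen (Ioo c R ×ℂ Ioo 0 π) := isOpen_Ioo.reProdIm isOpen_Ioo
    have hw₀O : w₀ ∈ Ioo c R ×ℂ Ioo 0 π := ⟨⟨hw₀s.1, hw₀R⟩, hw₀s.2⟩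
    have hIoo : Ioo c R ×ℂ Ioo 0 π ⊆ rect c R 0 π := fun w hw =>
      ⟨Ioo_subset_Icc_self hw.1, Ioo_subset_Icc_self hw.2⟩
    have hstrip : Ioo c R ×ℂ Ioo 0 π ⊆ strip c := Ioo_subset_strip le_rfl le_rfl le_rfl
    have hw₀P : w₀ ∉ P := fun h => hG.notMem _ h hw₀s
    have hnhd : rect c R 0 π \ P ∈ 𝓝 w₀ :=
      inter_mem (mem_of_superset (hO.mem_nhds hw₀O) hIoo)
        (P.finite_toSet.isClosed.isOpen_compl.mem_nhds hw₀P)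
    have hGd : DifferentiableAt ℂ G w₀ := (hG.diff.mono hstrip).differentiableAt (hO.mem_nhds hw₀O)
    have hed : ∀ w ∈ rect c R 0 π, dslope exp w₀ w ≠ 0 := fun w hw => by
      by_cases h : w = w₀
      · rw [h, dslope_same, Complex.deriv_exp]; exact exp_ne_zero _
      · rw [dslope_of_ne _ h, slope_def_field]
        exact div_ne_zero (sub_ne_zero.2 (by rw [hexp]; exact hinj w hw h)) (sub_ne_zero.2 h)
    have hexpd : Differentiable ℂ (dslope exp w₀) := by
      rw [← differentiableOn_univ, Complex.differentiableOn_dslope univ_mem]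
      exact differentiable_exp.differentiableOn
    set f : ℂ → ℂ := fun w => dslope G w₀ w * (exp w / dslope exp w₀ w) with hf
    have hfeq : ∀ w ∈ rect c R 0 π, w ≠ w₀ → f w = G w * cker ξ w - G w₀ * cker ξ w :=
      fun w hw hne => by
        have h1 := sub_ne_zero.2 (hinj w hw hne)
        have h2 := sub_ne_zero.2 hne
        simp only [hf, dslope_of_ne _ hne, slope_def_field, hexp, cker]
        field_simp
    have hcG : ContinuousOn G (rect c R 0 π \ P) :=
      hG.cont.mono (Set.sdiff_subset_sdiff_left (rect_subset_cstrip le_rfl le_rfl le_rfl))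
    have hf0 := hG.rectInt_eq_zero (f := f) le_rfl le_rfl le_rfl hcR pi_pos.le
      (((Complex.differentiableOn_dslope (hO.mem_nhds hw₀O)).2 (hG.diff.mono hstrip)).fun_mul
        (differentiable_exp.differentiableOn.fun_div hexpd.differentiableOn
          fun w hw => hed w (hIoo hw)))
      (((continuousOn_dslope hnhd).2 ⟨hcG, hGd⟩).fun_mul
        (continuous_exp.continuousOn.div hexpd.continuous.continuousOn
          fun w hw => hed w hw.1))
      fun p hp hpr => by
        have hpw : p ≠ w₀ := fun h => hw₀P (h ▸ hp)
        refine ⟨‖G w₀‖, ‖cker ξ p‖ + 1, ?_⟩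
        filter_upwards [((continuousAt_cker (hinj p hpr hpw)).norm.mono_left
          nhdsWithin_le_nhds).eventually (gt_mem_nhds (lt_add_one ‖cker ξ p‖)),
          mem_nhdsWithin_of_mem_nhds (isOpen_compl_singleton.mem_nhds hpw),
          self_mem_nhdsWithin] with w h1 h2 h3
        rw [hfeq w h3.1 h2, ← sub_mul, norm_mul, mul_comm]
        have := norm_sub_le (G w) (G w₀)
        gcongr
        linarith
    have edge : ∀ {γ : ℝ → ℂ} {s t : ℝ}, s ≤ t → Continuous γ →
        (∀ x ∈ Icc s t, γ x ∈ rect c R 0 π) → (∀ x, γ x ≠ w₀) →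
        IntervalIntegrable (fun x => f (γ x)) volume s t →
        IntervalIntegrable (fun x => G (γ x) * cker ξ (γ x)) volume s t ∧
        ∫ x in s..t, G (γ x) * cker ξ (γ x) =
          (∫ x in s..t, f (γ x)) + G w₀ * ∫ x in s..t, cker ξ (γ x) :=
      fun {γ s t} hst hγ hm hne h1 => by
        have h2 : IntervalIntegrable (fun x => G w₀ * cker ξ (γ x)) volume s t := by
          refine ContinuousOn.intervalIntegrable fun x hx => ?_
          rw [uIcc_of_le hst] at hx
          exact (continuousAt_const.mul (ContinuousAt.comp (continuousAt_cker
            (hinj _ (hm x hx) (hne x))) hγ.continuousAt)).continuousWithinAt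
        have heq : ∀ x ∈ uIcc s t, f (γ x) + G w₀ * cker ξ (γ x) = G (γ x) * cker ξ (γ x) :=
          fun x hx => by
            rw [uIcc_of_le hst] at hx
            rw [hfeq _ (hm x hx) (hne x)]; ring
        refine ⟨(h1.add h2).congr fun x hx => heq x (Set.uIoc_subset_uIcc hx), ?_⟩
        rw [← intervalIntegral.integral_const_mul, ← intervalIntegral.integral_add h1 h2]
        exact (intervalIntegral.integral_congr heq).symm
    have hp := pi_pos.le
    have e1 := edge hcR (by fun_prop) (fun x hx => mem_rect.2 ⟨hx, le_rfl, hp⟩)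
      (fun x h => by simpa [← h] using hw₀s.2.1) hf0.2.1
    have e2 := edge hcR (by fun_prop) (fun x hx => mem_rect.2 ⟨hx, hp, le_rfl⟩)
      (fun x h => by simpa [← h] using hw₀s.2.2) hf0.2.2.1
    have e3 := edge hp (by fun_prop) (fun x hx => mem_rect.2 ⟨⟨hcR, le_rfl⟩, hx⟩)
      (fun x h => by simp [← h] at hw₀R) hf0.2.2.2.1
    have e4 := edge hp (by fun_prop) (fun x hx => mem_rect.2 ⟨⟨le_rfl, hcR⟩, hx⟩)
      (fun x h => by simpa [← h] using hw₀s.1) hf0.2.2.2.2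
    refine ⟨?_, e1.1, e2.1, e3.1, e4.1⟩
    have h1 := hf0.1
    have h2 := rectInt_cker hcR him hc hR
    rw [rectInt] at h1 h2 ⊢
    rw [e1.2, e2.2, e3.2, e4.2]
    linear_combination h1 + G w₀ * h2
  · rw [res, if_neg hres, mul_zero]
    refine hG.rectInt_mul_eq_zero le_rfl le_rfl le_rfl hcR pi_pos.le fun w hw =>
      differentiableAt_cker fun h => ?_
    rcases hξ with h1 | ⟨h1, h2⟩
    · rw [← h, norm_exp] at h1
      exact absurd hw.1.1 (not_le.2 (Real.exp_lt_exp.1 h1))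
    · have h3 : ξ.im < 0 := lt_of_le_of_ne (not_lt.1 fun h4 => hres ⟨h1, h4⟩) h2
      rw [← h, exp_im] at h3
      exact absurd (mul_nonneg (exp_pos w.re).le (Real.sin_nonneg_of_nonneg_of_le_pi hw.2.1
        hw.2.2)) (not_le.2 h3)

end StripLog

theorem intervalIntegrable_conj {f : ℝ → ℂ} {a b : ℝ} (h : IntervalIntegrable f volume a b) :
    IntervalIntegrable (fun x => conj (f x)) volume a b :=
  ⟨(conjCLE : ℂ →L[ℝ] ℂ).integrable_comp h.1, (conjCLE : ℂ →L[ℝ] ℂ).integrable_comp h.2⟩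

theorem intervalIntegrable_re {f : ℝ → ℂ} {a b : ℝ} (h : IntervalIntegrable f volume a b) :
    IntervalIntegrable (fun x => (f x).re) volume a b :=
  ⟨reCLM.integrable_comp h.1, reCLM.integrable_comp h.2⟩

theorem intervalIntegral_re {f : ℝ → ℂ} {a b : ℝ} (h : IntervalIntegrable f volume a b) :
    ∫ x in a..b, (f x).re = (∫ x in a..b, f x).re := by
  have := reCLM.intervalIntegral_comp_comm h
  simpa using this

theorem Admissible.conj {c : ℝ} {ξ : ℂ} (h : Admissible c ξ) : Admissible c (conj ξ) := by
  simpa [Admissible] using h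

theorem integrableOn_re_of_bound {g : ℝ → ℂ} {A M s : ℝ} (hs : |s| = 1)
    (hint : ∀ R, A ≤ R → IntervalIntegrable g volume A R)
    (hb : ∀ R, A ≤ R → ‖∫ u in A..R, g u‖ ≤ M) (hsign : ∀ u, A ≤ u → 0 ≤ s * (g u).re) :
    IntegrableOn (fun u => (g u).re) (Ioi A) := by
  refine integrableOn_Ioi_of_intervalIntegral_norm_bounded (l := atTop) (b := fun R : ℝ => max A R)
    M A (fun R => ?_) (tendsto_atTop_mono (fun R => le_max_right A R) tendsto_id)
    (Eventually.of_forall fun R => ?_)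
  · exact (intervalIntegrable_iff_integrableOn_Ioc_of_le (le_max_left _ _)).1
      (intervalIntegrable_re (hint _ (le_max_left _ _)))
  · have hle := le_max_left A R
    have h1 : ∫ u in A..max A R, ‖(g u).re‖ = s * ∫ u in A..max A R, (g u).re := by
      rw [← intervalIntegral.integral_const_mul]
      refine intervalIntegral.integral_congr fun u hu => ?_
      rw [uIcc_of_le hle] at hu
      rw [← abs_of_nonneg (hsign u hu.1), abs_mul, hs, one_mul, norm_eq_abs]
    rw [h1, intervalIntegral_re (hint _ hle)]
    refine (le_abs_self _).trans ?_
    rw [abs_mul, hs, one_mul]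
    exact (Complex.abs_re_le_norm _).trans (hb _ hle)

namespace StripLog

variable {G : ℂ → ℂ} {c : ℝ} {P : Finset ℂ}

theorem exists_norm_le (hG : StripLog G c P) {ε : ℝ} (hε : 0 < ε) :
    ∃ R₀, c ≤ R₀ ∧ ∀ w ∈ cstrip c, R₀ ≤ w.re → ‖G w‖ ≤ ε := by
  have h := hG.zero.norm.eventually (gt_mem_nhds (show ‖(0 : ℂ)‖ < ε by simpa using hε))
  rw [eventually_inf_principal, eventually_comap] at h
  obtain ⟨R₁, h1⟩ := eventually_atTop.1 h
  obtain ⟨R₂, h2⟩ := (P.finite_toSet.image re).bddAbove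
  refine ⟨max c (max R₁ (R₂ + 1)), le_max_left _ _, fun w hw hR => ?_⟩
  have hwP : w ∉ P := fun hp => by
    have h3 := h2 (Set.mem_image_of_mem re hp)
    have h4 : R₂ + 1 ≤ w.re := (le_max_right _ _).trans ((le_max_right _ _).trans hR)
    linarith
  exact (h1 w.re ((le_max_left _ _).trans ((le_max_right _ _).trans hR)) w rfl ⟨hw, hwP⟩).le

theorem edgeIntegrable (hG : StripLog G c P) {a b s t : ℝ} (hca : c ≤ a) (hs : 0 ≤ s)
    (ht : t ≤ π) (hab : a ≤ b) (hst : s ≤ t) : EdgeIntegrable G a b s t := by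
  simpa using (hG.rectInt_mul_eq_zero (K := fun _ => 1) hca hs ht hab hst
    fun _ _ => differentiableAt_const _).2

theorem rectInt_eq (hG : StripLog G c P) {a b s t : ℝ} (hca : c ≤ a) (hs : 0 ≤ s)
    (ht : t ≤ π) (hab : a ≤ b) (hst : s ≤ t) : rectInt G a b s t = 0 := by
  simpa using (hG.rectInt_mul_eq_zero (K := fun _ => 1) hca hs ht hab hst
    fun _ _ => differentiableAt_const _).1

theorem norm_vertical_le {A s t : ℝ} (hs : 0 ≤ s) (ht : t ≤ π) (hst : s ≤ t) (hcA : c ≤ A)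
    (h : ∀ w ∈ cstrip c, A ≤ w.re → ‖G w‖ ≤ 1) {b : ℝ} (hb : A ≤ b) :
    ‖∫ y in s..t, G (b + y * I)‖ ≤ π := by
  refine (intervalIntegral.norm_integral_le_of_norm_le_const (C := 1) fun y hy => ?_).trans ?_
  · rw [uIoc_of_le hst] at hy
    refine h _ ⟨?_, ?_, ?_⟩ ?_ <;> simp
    · exact hcA.trans hb
    · exact hs.trans hy.1.le
    · exact hy.2.trans ht
    · exact hb
  · rw [one_mul, abs_of_nonneg (by linarith)]; linarith

theorem norm_edge_sub_le (hG : StripLog G c P) {A s t : ℝ} (hs : 0 ≤ s) (ht : t ≤ π) (hst : s ≤ t)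
    (hcA : c ≤ A) (h : ∀ w ∈ cstrip c, A ≤ w.re → ‖G w‖ ≤ 1) {R : ℝ} (hR : A ≤ R) :
    ‖(∫ u in A..R, G (u + s * I)) - ∫ u in A..R, G (u + t * I)‖ ≤ 2 * π := by
  have h1 := hG.rectInt_eq hcA hs ht hR hst
  rw [rectInt, sub_eq_zero, ← eq_sub_iff_add_eq] at h1
  rw [h1]
  refine (norm_sub_le _ _).trans ?_
  rw [norm_mul, norm_mul, norm_I, one_mul, one_mul]
  linarith [norm_vertical_le hs ht hst hcA h hR, norm_vertical_le hs ht hst hcA h le_rfl]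

theorem norm_middle_le {A C : ℝ} (hC : ∀ u : ℝ, A ≤ u →
    ‖G (u + (π / 2 : ℝ) * I)‖ ≤ C * Real.exp (-u)) {R : ℝ} (hR : A ≤ R) :
    ‖∫ u in A..R, G (u + (π / 2 : ℝ) * I)‖ ≤ C * Real.exp (-A) := by
  have h1 : IntervalIntegrable (fun u : ℝ => C * Real.exp (-u)) volume A R :=
    Continuous.intervalIntegrable (by fun_prop) _ _
  refine (intervalIntegral.norm_integral_le_of_norm_le hR (Eventually.of_forall fun u hu =>
    hC u hu.1.le) h1).trans ?_
  have hd : ∀ u ∈ uIcc A R, HasDerivAt (fun u : ℝ => -(C * Real.exp (-u)))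
      (C * Real.exp (-u)) u := fun u _ => by
    have := (((hasDerivAt_id u).fun_neg.exp).const_mul C).fun_neg
    simpa using this
  rw [intervalIntegral.integral_eq_sub_of_hasDerivAt hd h1]
  have hC0 : 0 ≤ C := by
    have := (norm_nonneg _).trans (hC A le_rfl)
    exact nonneg_of_mul_nonneg_left this (exp_pos _)
  have := mul_nonneg hC0 (exp_pos (-R)).le
  linarith

/-- The real part is integrable along both horizontal edges if it has a sign there and `G` decays
exponentially along the middle line. -/
theorem integrableOn_re (hG : StripLog G c P) {s : ℝ} (hs : |s| = 1)
    (h0 : ∀ u : ℝ, c < u → 0 ≤ s * (G u).re)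
    (h1 : ∀ u : ℝ, c < u → 0 ≤ s * (G (u + π * I)).re)
    (hmid : ∃ C B : ℝ, ∀ u : ℝ, B ≤ u → ‖G (u + (π / 2 : ℝ) * I)‖ ≤ C * Real.exp (-u)) :
    IntegrableOn (fun u : ℝ => (G u).re) (Ioi c) ∧
    IntegrableOn (fun u : ℝ => (G (u + π * I)).re) (Ioi c) := by
  obtain ⟨C, B, hC⟩ := hmid
  obtain ⟨R₀, hcR, hR₀⟩ := hG.exists_norm_le one_pos
  have hpi := pi_pos
  set A := max (c + 1) (max R₀ B) with hA
  have hcA : c < A := (lt_add_one c).trans_le (le_max_left _ _)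
  have hRA : R₀ ≤ A := (le_max_left _ _).trans (le_max_right _ _)
  have hBA : B ≤ A := (le_max_right _ _).trans (le_max_right _ _)
  have hG1 : ∀ w ∈ cstrip c, A ≤ w.re → ‖G w‖ ≤ 1 := fun w hw h => hR₀ w hw (hRA.trans h)
  have hCA : ∀ u : ℝ, A ≤ u → ‖G (u + (π / 2 : ℝ) * I)‖ ≤ C * Real.exp (-u) :=
    fun u hu => hC u (hBA.trans hu)
  have hsplit : Ioi c = Set.Ioc c A ∪ Ioi A := (Set.Ioc_union_Ioi_eq_Ioi hcA.le).symm
  have e := hG.edgeIntegrable le_rfl le_rfl le_rfl hcA.le hpi.le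
  constructor
  · rw [hsplit]
    refine IntegrableOn.union ?_ (integrableOn_re_of_bound (g := fun u : ℝ => G u)
      (M := C * Real.exp (-A) + 2 * π) hs
      (fun R hR => ?_) (fun R hR => ?_) fun u hu => h0 u (hcA.trans_le hu))
    · have := (intervalIntegrable_iff_integrableOn_Ioc_of_le hcA.le).1 (intervalIntegrable_re e.1)
      simpa using this
    · simpa using (hG.edgeIntegrable hcA.le le_rfl (half_le_self hpi.le) hR (half_pos hpi).le).1
    · have h := hG.norm_edge_sub_le le_rfl (half_le_self hpi.le) (half_pos hpi).le hcA.le hG1 hR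
      have := norm_le_insert' (∫ u in A..R, G (u + (0 : ℝ) * I)) (∫ u in A..R, G (u + (π / 2 : ℝ) * I))
      simp only [ofReal_zero, zero_mul, add_zero] at h this
      linarith [norm_middle_le hCA hR]
  · rw [hsplit]
    refine IntegrableOn.union ?_ (integrableOn_re_of_bound (g := fun u : ℝ => G (u + π * I))
      (M := C * Real.exp (-A) + 2 * π) hs
      (fun R hR => ?_) (fun R hR => ?_) fun u hu => h1 u (hcA.trans_le hu))
    · exact (intervalIntegrable_iff_integrableOn_Ioc_of_le hcA.le).1 (intervalIntegrable_re e.2.1)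
    · exact (hG.edgeIntegrable hcA.le (half_pos hpi).le le_rfl hR (half_le_self hpi.le)).2.1
    · have h := hG.norm_edge_sub_le (half_pos hpi).le le_rfl (half_le_self hpi.le) hcA.le hG1 hR
      have := norm_le_insert (∫ u in A..R, G (u + (π / 2 : ℝ) * I)) (∫ u in A..R, G (u + (π : ℝ) * I))
      linarith [norm_middle_le hCA hR]

end StripLog

theorem exists_norm_cker_le {c : ℝ} {ξ : ℂ} (hξ : Admissible c ξ) :
    ∃ B, 0 ≤ B ∧ ∀ w : ℂ, c ≤ w.re → (exp w).im = 0 → exp w ≠ ξ ∧ ‖cker ξ w‖ ≤ B := by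
  rcases hξ with h | ⟨-, h⟩
  · refine ⟨1 + ‖ξ‖ / (Real.exp c - ‖ξ‖), by have := sub_pos.2 h; positivity, fun w hw _ => ?_⟩
    have h1 : Real.exp c - ‖ξ‖ ≤ ‖exp w - ξ‖ := by
      have h2 := norm_sub_norm_le (exp w) ξ
      rw [norm_exp] at h2
      have := Real.exp_le_exp.2 hw
      linarith
    refine ⟨fun h3 => ?_, norm_cker_le (sub_pos.2 h) h1⟩
    rw [h3, sub_self, norm_zero] at h1
    linarith
  · refine ⟨1 + ‖ξ‖ / |ξ.im|, by positivity, fun w _ hw => ?_⟩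
    refine ⟨fun h3 => h (h3 ▸ hw), norm_cker_le (abs_pos.2 h) ?_⟩
    have := Complex.abs_im_le_norm (exp w - ξ)
    rwa [sub_im, hw, zero_sub, abs_neg] at this

theorem exp_real_im (u : ℝ) : (exp u).im = 0 := by rw [← ofReal_exp, ofReal_im]

theorem exp_add_pi_mul_I (w : ℂ) : exp (w + π * I) = -exp w := by
  rw [exp_add, Complex.exp_pi_mul_I, mul_neg_one]

theorem exp_real_add_pi_im (u : ℝ) : (exp (u + π * I)).im = 0 := by
  rw [exp_add_pi_mul_I, neg_im, exp_real_im, neg_zero]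

theorem norm_cker_le_two {ξ w : ℂ} (h : 2 * ‖ξ‖ + 1 ≤ Real.exp w.re) : ‖cker ξ w‖ ≤ 2 := by
  have h1 : ‖ξ‖ + 1 ≤ ‖exp w - ξ‖ := by
    have h2 := norm_sub_norm_le (exp w) ξ
    rw [norm_exp] at h2
    linarith
  refine (norm_cker_le (by positivity) h1).trans ?_
  have : ‖ξ‖ / (‖ξ‖ + 1) ≤ 1 := div_le_one_of_le₀ (by linarith) (by positivity)
  linarith

namespace StripLog

variable {G : ℂ → ℂ} {c : ℝ} {P : Finset ℂ}

/-- The integrand of the boundary identity is integrable. -/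
theorem integrable_mul_cker {g : ℝ → ℝ} (hg : IntegrableOn g (Ioi c)) {ξ : ℂ}
    (hξ : Admissible c ξ) {v : ℝ → ℂ} (hv : Continuous v) (hvre : ∀ u, c < u → c ≤ (v u).re)
    (hvim : ∀ u, (exp (v u)).im = 0) :
    IntegrableOn (fun u : ℝ => (g u : ℂ) * cker ξ (v u)) (Ioi c) := by
  obtain ⟨B, -, hB⟩ := exists_norm_cker_le hξ
  refine Integrable.mul_bdd (c := B) hg.ofReal ?_ ?_
  · refine ContinuousOn.aestronglyMeasurable (fun u hu => ?_) measurableSet_Ioi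
    exact (ContinuousAt.comp (continuousAt_cker (hB _ (hvre u hu) (hvim u)).1)
      hv.continuousAt).continuousWithinAt
  · exact (ae_restrict_iff' measurableSet_Ioi).2 (Eventually.of_forall fun u hu =>
      (hB _ (hvre u hu) (hvim u)).2)

theorem tendsto_edge (hG : StripLog G c P) (ξ : ℂ) :
    Tendsto (fun R : ℝ => ∫ y in 0..π, G (R + y * I) * cker ξ (R + y * I))
      atTop (𝓝 0) ∧
    Tendsto (fun R : ℝ =>
      ∫ y in 0..π, conj (G (R + y * I)) * cker ξ (R - y * I))
      atTop (𝓝 0) := by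
  have key : ∀ ε > 0, ∀ᶠ R : ℝ in atTop, ∀ y ∈ Set.uIoc 0 π,
      ‖G (R + y * I)‖ * 2 ≤ ε / (2 * π) ∧ ‖cker ξ (R + y * I)‖ ≤ 2 ∧
      ‖cker ξ (R - y * I)‖ ≤ 2 := fun ε hε => by
    obtain ⟨R₀, hc, hR₀⟩ := hG.exists_norm_le (ε := ε / (2 * π) / 2) (by have := pi_pos; positivity)
    filter_upwards [eventually_ge_atTop R₀,
      tendsto_exp_atTop.eventually_ge_atTop (2 * ‖ξ‖ + 1)] with R h1 h2 y hy
    rw [uIoc_of_le pi_pos.le] at hy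
    refine ⟨?_, norm_cker_le_two (by simpa using h2), norm_cker_le_two (by simpa using h2)⟩
    have := hR₀ (R + y * I) ⟨by simpa using hc.trans h1, by simpa using hy.1.le,
      by simpa using hy.2⟩ (by simpa using h1)
    linarith
  have hpi := pi_pos
  constructor <;>
  · rw [Metric.tendsto_nhds]
    intro ε hε
    filter_upwards [key ε hε] with R hR
    rw [dist_zero_right]
    refine (intervalIntegral.norm_integral_le_of_norm_le_const (C := ε / (2 * π))
      fun y hy => ?_).trans_lt ?_
    · obtain ⟨h1, h2, h3⟩ := hR y hy
      rw [norm_mul]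
      try rw [norm_conj]
      refine le_trans ?_ h1
      gcongr
    · rw [sub_zero, abs_of_pos hpi, div_mul_eq_mul_div, div_lt_iff₀ (by positivity)]
      nlinarith

theorem integrableOn_boundary {ξ : ℂ} (hξ : Admissible c ξ)
    (h0 : IntegrableOn (fun u : ℝ => (G u).re) (Ioi c))
    (h1 : IntegrableOn (fun u : ℝ => (G (u + π * I)).re) (Ioi c)) :
    IntegrableOn (fun u : ℝ => 2 * ((G u).re : ℂ) * cker ξ u
      - 2 * ((G (u + π * I)).re : ℂ) * cker ξ (u + π * I))
      (Ioi c) := by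
  have i0 := integrable_mul_cker h0 hξ (v := fun u : ℝ => (u : ℂ)) (by fun_prop)
    (fun u hu => by simpa using hu.le) exp_real_im
  have i1 := integrable_mul_cker h1 hξ (v := fun u : ℝ => (u : ℂ) + π * I)
    (by fun_prop) (fun u hu => by simpa using hu.le) exp_real_add_pi_im
  refine ((i0.const_mul 2).sub (i1.const_mul 2)).congr (Eventually.of_forall fun u => ?_)
  simp only [Pi.sub_apply]; ring

/-- The boundary identity on the half strip and its mirror image. -/
theorem identity (hG : StripLog G c P) {ξ : ℂ} (hξ : Admissible c ξ)
    (h0 : IntegrableOn (fun u : ℝ => (G u).re) (Ioi c))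
    (h1 : IntegrableOn (fun u : ℝ => (G (u + π * I)).re) (Ioi c)) :
    (∫ u in Ioi c, (2 * ((G (u : ℝ)).re : ℂ) * cker ξ u
        - 2 * ((G ((u : ℝ) + π * I)).re : ℂ) * cker ξ (u + π * I))) =
      I * ((∫ y in 0..π, G (c + y * I) * cker ξ (c + y * I))
        - ∫ y in 0..π, conj (G (c + y * I)) * cker ξ (c - y * I))
      + 2 * π * I * (res G c ξ - conj (res G c (conj ξ))) := by
  have hint := integrableOn_boundary hξ h0 h1
  have hlim := intervalIntegral_tendsto_integral_Ioi c hint tendsto_id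
  refine tendsto_nhds_unique hlim ?_
  obtain ⟨t1, t2⟩ := hG.tendsto_edge ξ
  have hlim2 := (((t1.sub t2).const_mul (-I)).const_add
    (I * ((∫ y in 0..π, G (c + y * I) * cker ξ (c + y * I))
        - ∫ y in 0..π, conj (G (c + y * I)) * cker ξ (c - y * I))
      + 2 * π * I * (res G c ξ - conj (res G c (conj ξ)))))
  rw [sub_zero, mul_zero, add_zero] at hlim2
  refine hlim2.congr' ?_
  filter_upwards [eventually_ge_atTop c, tendsto_exp_atTop.eventually_gt_atTop ‖ξ‖]
    with R hcR hR
  obtain ⟨e1, i1, i2, i3, i4⟩ := hG.rectInt_mul_cker hξ hcR hR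
  obtain ⟨e2, j1, j2, j3, j4⟩ := hG.rectInt_mul_cker hξ.conj hcR (by simpa using hR)
  replace e2 := congrArg conj e2
  rw [rectInt] at e1 e2
  simp only [map_sub, map_add, map_mul, ← intervalIntegral_conj, conj_cker, conj_conj,
    conj_ofReal, conj_I, map_ofNat] at e2
  have hpi : ∀ x : ℝ, cker ξ (x + π * -I) = cker ξ (x + π * I) :=
    fun x => by
      rw [← cker_add_two_pi ξ (x + π * -I)]
      ring_nf
  have hneg : ∀ b y : ℝ, cker ξ (b + y * -I) = cker ξ (b - y * I) := fun b y => by ring_nf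
  simp only [hpi, ofReal_zero, zero_mul, add_zero] at e1 e2
  simp only [hneg] at e2
  simp only [ofReal_zero, zero_mul, add_zero] at i1 j1
  have j1' := intervalIntegrable_conj j1
  have j2' := intervalIntegrable_conj j2
  simp only [map_add, map_mul, conj_cker, conj_conj, conj_ofReal, conj_I, hpi] at j1' j2'
  have hsum : ∫ u in c..R, (2 * ((G (u : ℝ)).re : ℂ) * cker ξ u
        - 2 * ((G ((u : ℝ) + π * I)).re : ℂ) * cker ξ (u + π * I)) =
      ((∫ u in c..R, G u * cker ξ u) + ∫ u in c..R, conj (G u) * cker ξ u)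
      - ((∫ u in c..R, G (u + π * I) * cker ξ (u + π * I))
        + ∫ u in c..R, conj (G (u + π * I)) * cker ξ (u + π * I)) := by
    rw [← intervalIntegral.integral_add i1 j1', ← intervalIntegral.integral_add i2 j2',
      ← intervalIntegral.integral_sub (i1.add j1') (i2.add j2')]
    refine intervalIntegral.integral_congr fun u _ => ?_
    simp only
    have c0 := add_conj (G u)
    have c1 := add_conj (G (u + π * I))
    push_cast at c0 c1
    rw [← c0, ← c1]
    ring
  simp only [id] 
  rw [hsum]
  linear_combination -e1 - e2

end StripLog

/-! ### Division by the zeros -/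

theorem exists_eq_prod_pow_mul {V : Set ℂ} (hV : IsOpen V) {a : ℂ → ℂ}
    (ha : DifferentiableOn ℂ a V) {N : ℕ} {z : Fin N → ℂ} (hinj : Function.Injective z) (p : ℕ)
    (hord : ∀ j, ∃ g, AnalyticAt ℂ g (z j) ∧ g (z j) ≠ 0 ∧
      ∀ᶠ w in 𝓝 (z j), a w = (w - z j) ^ p * g w)
    (hne : ∀ w ∈ V, (∀ j, w ≠ z j) → a w ≠ 0) :
    ∃ f, DifferentiableOn ℂ f V ∧ (∀ w ∈ V, f w ≠ 0) ∧
      ∀ w ∈ V, (∀ j, w ≠ z j) → a w = (∏ j, (w - z j) ^ p) * f w := by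
  classical
  choose g hg hg0 hgeq using hord
  set f : ℂ → ℂ := fun w => if h : ∃ j, w = z j then
    g h.choose w / ∏ i ∈ univ.erase h.choose, (w - z i) ^ p else
    a w / ∏ j, (w - z j) ^ p with hf
  have hfz : ∀ j, f (z j) = g j (z j) / ∏ i ∈ univ.erase j, (z j - z i) ^ p := fun j => by
    have h : ∃ i, z j = z i := ⟨j, rfl⟩
    have hj : h.choose = j := (hinj h.choose_spec).symm
    simp only [hf, dif_pos h, hj]
  have hfn : ∀ w, (∀ j, w ≠ z j) → f w = a w / ∏ j, (w - z j) ^ p := fun w hw => by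
    have h : ¬∃ j, w = z j := fun ⟨j, hj⟩ => hw j hj
    simp only [hf, dif_neg h]
  have hprod : ∀ w, (∀ j, w ≠ z j) → ∏ j, (w - z j) ^ p ≠ 0 := fun w hw =>
    prod_ne_zero_iff.2 fun j _ => pow_ne_zero _ (sub_ne_zero.2 (hw j))
  have herase : ∀ j, ∏ i ∈ univ.erase j, (z j - z i) ^ p ≠ 0 := fun j =>
    prod_ne_zero_iff.2 fun i hi => pow_ne_zero _ (sub_ne_zero.2 fun h =>
      (Finset.mem_erase.1 hi).1 (hinj h).symm)
  have hfin : ∀ s : Set (Fin N), IsOpen (z '' s)ᶜ := fun s =>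
    (s.toFinite.image z).isClosed.isOpen_compl
  refine ⟨f, fun w hw => ?_, fun w hw => ?_, fun w hw h => ?_⟩
  · by_cases h : ∃ j, w = z j
    · obtain ⟨j, rfl⟩ := h
      have hd : DifferentiableAt ℂ (fun w => g j w / ∏ i ∈ univ.erase j, (w - z i) ^ p)
          (z j) := (hg j).differentiableAt.fun_div (by fun_prop) (herase j)
      refine (hd.congr_of_eventuallyEq ?_).differentiableWithinAt
      have hmem : (z '' {i | i ≠ j})ᶜ ∈ 𝓝 (z j) := (hfin _).mem_nhds (by
        rintro ⟨i, hi, h⟩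
        exact hi (hinj h))
      filter_upwards [hgeq j, hmem] with v hv hvm
      by_cases hvj : v = z j
      · rw [hvj, hfz j]
      · have hvn : ∀ i, v ≠ z i := fun i h => by
          by_cases hij : i = j
          · exact hvj (hij ▸ h)
          · exact hvm ⟨i, hij, h.symm⟩
        rw [hfn v hvn, hv, ← Finset.mul_prod_erase _ _ (mem_univ j)]
        exact mul_div_mul_left _ _ (pow_ne_zero _ (sub_ne_zero.2 hvj))
    · have hwn : ∀ j, w ≠ z j := fun j hj => h ⟨j, hj⟩
      have hd : DifferentiableAt ℂ (fun w => a w / ∏ j, (w - z j) ^ p) w :=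
        (ha.differentiableAt (hV.mem_nhds hw)).fun_div (by fun_prop) (hprod w hwn)
      refine (hd.congr_of_eventuallyEq ?_).differentiableWithinAt
      have hmem : (z '' Set.univ)ᶜ ∈ 𝓝 w := (hfin _).mem_nhds (by
        rintro ⟨i, -, h⟩
        exact hwn i h.symm)
      filter_upwards [hmem] with v hv
      exact hfn v fun i h => hv ⟨i, trivial, h.symm⟩
  · by_cases h : ∃ j, w = z j
    · obtain ⟨j, rfl⟩ := h
      rw [hfz j]
      exact div_ne_zero (hg0 j) (herase j)
    · have hwn : ∀ j, w ≠ z j := fun j hj => h ⟨j, hj⟩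
      rw [hfn w hwn]
      exact div_ne_zero (hne w hw hwn) (hprod w hwn)
  · rw [hfn w h, mul_div_cancel₀ _ (hprod w h)]

theorem analyticAt_dslope {f : ℂ → ℂ} {z : ℂ} (hf : AnalyticAt ℂ f z) :
    AnalyticAt ℂ (dslope f z) z := by
  obtain ⟨s, hs, hd⟩ := hf.exists_mem_nhds_analyticOnNhd
  exact DifferentiableOn.analyticAt ((Complex.differentiableOn_dslope hs).2 hd.differentiableOn) hs

theorem exists_factor_of_deriv_ne_zero {a : ℂ → ℂ} {z : ℂ} (ha : AnalyticAt ℂ a z) (h0 : a z = 0)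
    (h1 : deriv a z ≠ 0) : ∃ g, AnalyticAt ℂ g z ∧ g z ≠ 0 ∧ ∀ᶠ w in 𝓝 z, a w = (w - z) ^ 1 * g w := by
  refine ⟨dslope a z, analyticAt_dslope ha, by rwa [dslope_same], Eventually.of_forall fun w => ?_⟩
  have := sub_smul_dslope a z w
  rw [h0, sub_zero, smul_eq_mul] at this
  rw [pow_one, this]

theorem exists_factor_of_deriv_two_ne_zero {a : ℂ → ℂ} {z : ℂ} (ha : AnalyticAt ℂ a z)
    (h0 : a z = 0) (h1 : deriv a z = 0) (h2 : iteratedDeriv 2 a z ≠ 0) :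
    ∃ g, AnalyticAt ℂ g z ∧ g z ≠ 0 ∧ ∀ᶠ w in 𝓝 z, a w = (w - z) ^ 2 * g w := by
  have hb := analyticAt_dslope ha
  have e1 : ∀ w, a w = (w - z) * dslope a z w := fun w => by
    have := sub_smul_dslope a z w
    rw [h0, sub_zero, smul_eq_mul] at this
    exact this.symm
  have e2 : ∀ w, dslope a z w = (w - z) * dslope (dslope a z) z w := fun w => by
    have := sub_smul_dslope (dslope a z) z w
    rw [dslope_same a z, h1, sub_zero, smul_eq_mul] at this
    exact this.symm
  refine ⟨dslope (dslope a z) z, analyticAt_dslope hb, fun hz => h2 ?_,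
    Eventually.of_forall fun w => by rw [e1, e2]; ring⟩
  have hg := analyticAt_dslope hb
  set g := dslope (dslope a z) z with hgdef
  have ed : deriv a =ᶠ[𝓝 z] fun w => 2 * (w - z) * g w + (w - z) ^ 2 * deriv g w := by
    filter_upwards [hg.eventually_analyticAt] with w hw
    have hfun : a = fun w => (w - z) ^ 2 * g w := by ext w; rw [e1, e2]; ring
    have hd : HasDerivAt (fun w => (w - z) ^ 2 * g w)
        (2 * (w - z) * g w + (w - z) ^ 2 * deriv g w) w := by
      have h3 : HasDerivAt (fun w : ℂ => (w - z) ^ 2) (2 * (w - z)) w := by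
        simpa using ((hasDerivAt_id w).sub_const z).fun_pow 2
      exact h3.fun_mul hw.differentiableAt.hasDerivAt
    rw [hfun]
    exact hd.deriv
  rw [iteratedDeriv_succ, iteratedDeriv_one, ed.deriv_eq]
  have h4 : HasDerivAt (fun w : ℂ => 2 * (w - z)) 2 z := by
    simpa using ((hasDerivAt_id z).sub_const z).const_mul 2
  have h5 : HasDerivAt (fun w : ℂ => (w - z) ^ 2) 0 z := by
    simpa using ((hasDerivAt_id z).sub_const z).fun_pow 2
  have h6 := (h4.fun_mul hg.differentiableAt.hasDerivAt).fun_add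
    (h5.fun_mul hg.deriv.differentiableAt.hasDerivAt)
  rw [h6.deriv, show g z = 0 from hz]
  ring

/-! ### Functions that are `1 + O(1/ζ)` at infinity -/

/-- `h(ζ)` is a differentiable function of `1/ζ` near infinity, with the value `1` there. -/
def RegInf (h : ℂ → ℂ) : Prop :=
  ∃ m : ℂ → ℂ, DifferentiableAt ℂ m 0 ∧ m 0 = 1 ∧ ∀ ζ ≠ 0, h ζ = m ζ⁻¹

namespace RegInf

theorem sub_div_sub (α β : ℂ) : RegInf fun ζ => (ζ - α) / (ζ - β) := by
  refine ⟨fun s => (1 - α * s) / (1 - β * s), ?_, by simp, fun ζ hζ => ?_⟩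
  · exact DifferentiableAt.fun_div (by fun_prop) (by fun_prop) (by simp)
  · simp only
    rw [← mul_div_mul_left (ζ - α) (ζ - β) (inv_ne_zero hζ)]
    congr 1 <;> field_simp

theorem mul {f g : ℂ → ℂ} (hf : RegInf f) (hg : RegInf g) : RegInf fun ζ => f ζ * g ζ := by
  obtain ⟨m, hm, hm0, hmf⟩ := hf
  obtain ⟨n, hn, hn0, hng⟩ := hg
  exact ⟨fun s => m s * n s, hm.fun_mul hn, by simp [hm0, hn0], fun ζ hζ => by
    simp only [hmf ζ hζ, hng ζ hζ]⟩

theorem pow {f : ℂ → ℂ} (hf : RegInf f) (p : ℕ) : RegInf fun ζ => f ζ ^ p := by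
  obtain ⟨m, hm, hm0, hmf⟩ := hf
  exact ⟨fun s => m s ^ p, hm.fun_pow p, by simp [hm0], fun ζ hζ => by simp only [hmf ζ hζ]⟩

theorem prod {N : ℕ} {f : Fin N → ℂ → ℂ} (hf : ∀ j, RegInf (f j)) : RegInf fun ζ => ∏ j, f j ζ := by
  choose m hm hm0 hmf using hf
  exact ⟨fun s => ∏ j, m j s, DifferentiableAt.fun_finsetProd fun j _ => hm j, by simp [hm0],
    fun ζ hζ => prod_congr rfl fun j _ => hmf j ζ hζ⟩

theorem bound {h : ℂ → ℂ} (hh : RegInf h) :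
    ∃ C, ∀ᶠ ζ in Bornology.cobounded ℂ, ‖h ζ - 1‖ ≤ C * ‖ζ‖⁻¹ := by
  obtain ⟨m, hm, hm0, hmf⟩ := hh
  obtain ⟨C, hC⟩ := hm.isBigO_sub.bound
  refine ⟨C, ?_⟩
  filter_upwards [tendsto_inv₀_cobounded.eventually hC, Bornology.eventually_ne_cobounded (0 : ℂ)]
    with ζ h1 h2
  rw [hmf ζ h2, ← hm0]
  simpa using h1

theorem tendsto {h : ℂ → ℂ} (hh : RegInf h) : Tendsto h (Bornology.cobounded ℂ) (𝓝 1) := by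
  obtain ⟨m, hm, hm0, hmf⟩ := hh
  rw [← hm0]
  refine (hm.continuousAt.tendsto.comp tendsto_inv₀_cobounded).congr' ?_
  filter_upwards [Bornology.eventually_ne_cobounded (0 : ℂ)] with ζ h2 using (hmf ζ h2).symm

end RegInf

/-! ### Normalized logarithms -/

theorem exists_open_convex_atTop {s : Set ℝ} (hs : s ∈ atTop) :
    ∃ t ∈ (atTop : Filter ℝ), IsOpen t ∧ Convex ℝ t ∧ t ⊆ s := by
  obtain ⟨a, ha⟩ := mem_atTop_sets.1 hs
  exact ⟨Ioi a, Ioi_mem_atTop a, isOpen_Ioi, convex_Ioi a, fun x hx => ha x (le_of_lt hx)⟩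

theorem exists_open_convex_atBot {s : Set ℝ} (hs : s ∈ atBot) :
    ∃ t ∈ (atBot : Filter ℝ), IsOpen t ∧ Convex ℝ t ∧ t ⊆ s := by
  obtain ⟨a, ha⟩ := mem_atBot_sets.1 hs
  exact ⟨Iio a, Iio_mem_atBot a, isOpen_Iio, convex_Iio a, fun x hx => ha x (le_of_lt hx)⟩

theorem tendsto_comap_re_closure {l₀ : Filter ℝ} {U : Set ℂ} {P : Finset ℂ} {G : ℂ → ℂ}
    (hl₀ : ∀ {s}, s ∈ l₀ → ∃ t ∈ l₀, IsOpen t ∧ Convex ℝ t ∧ t ⊆ s) (hUP : ∀ w ∈ U, w ∉ P)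
    (hG : ContinuousOn G (closure U \ P)) {K : ℂ} (h : Tendsto G (comap re l₀ ⊓ 𝓟 U) (𝓝 K)) :
    Tendsto G (comap re l₀ ⊓ 𝓟 (closure U \ P)) (𝓝 K) := by
  rw [Metric.nhds_basis_closedBall.tendsto_right_iff] at h ⊢
  intro ε hε
  have h1 := h ε hε
  rw [eventually_inf_principal, eventually_comap] at h1 ⊢
  obtain ⟨t, ht, hto, -, hts⟩ := hl₀ h1
  filter_upwards [ht] with r hr w hw hwU
  have := mem_closure_iff_nhdsWithin_neBot.1 hwU.1
  have hlim : Tendsto G (𝓝[U] w) (𝓝 (G w)) :=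
    (hG w hwU).mono fun v hv => ⟨subset_closure hv, hUP v hv⟩
  refine Metric.isClosed_closedBall.mem_of_tendsto hlim ?_
  have h2 : re ⁻¹' t ∈ 𝓝 w :=
    (hto.preimage Complex.continuous_re).mem_nhds (by rw [Set.mem_preimage, hw]; exact hr)
  filter_upwards [mem_nhdsWithin_of_mem_nhds h2, self_mem_nhdsWithin] with v hv hvU
  exact hts hv v rfl hvU

theorem exists_preconnected_comap_re {l₀ : Filter ℝ} {U : Set ℂ} (hU : Convex ℝ U)
    (hl₀ : ∀ {s}, s ∈ l₀ → ∃ t ∈ l₀, IsOpen t ∧ Convex ℝ t ∧ t ⊆ s) :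
    ∀ s ∈ comap re l₀ ⊓ 𝓟 U, ∃ t ∈ comap re l₀ ⊓ 𝓟 U, t ⊆ s ∧ t ⊆ U ∧ IsPreconnected t :=
  fun s hs => by
  rw [mem_inf_principal, mem_comap] at hs
  obtain ⟨r, hr, hrs⟩ := hs
  obtain ⟨t, ht, -, htc, htr⟩ := hl₀ hr
  refine ⟨re ⁻¹' t ∩ U, inter_mem (mem_inf_of_left (preimage_mem_comap ht))
    (mem_inf_of_right (mem_principal_self U)), fun w hw => hrs (htr hw.1) hw.2,
    Set.inter_subset_right, Convex.isPreconnected ?_⟩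
  exact (htc.linear_preimage reLm).inter hU

/-- The boundary logarithm normalized to vanish as `Re w → ∞`. -/
theorem LogExtends.exists_log_normalized {F : ℂ → ℂ} {U : Set ℂ} {P : Finset ℂ}
    (h : LogExtends F U P) [hne : (comap re atTop ⊓ 𝓟 U).NeBot]
    (hinf : Tendsto F (comap re atTop ⊓ 𝓟 U) (𝓝 1)) :
    ∃ G : ℂ → ℂ, DifferentiableOn ℂ G U ∧ ContinuousOn G (closure U \ P) ∧
      (∀ w ∈ U, exp (G w) = F w) ∧
      (∀ p ∈ P, ∃ C, ∀ᶠ w in 𝓝[closure U \ P] p, ‖G w‖ ≤ C + |log ‖w - p‖|) ∧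
      Tendsto G (comap re atTop ⊓ 𝓟 (closure U \ P)) (𝓝 0) := by
  obtain ⟨G, hGd, hGc, hG, hGb⟩ := h.exists_log_boundary
    (hne.nonempty_of_mem (mem_inf_of_right (mem_principal_self U)))
  obtain ⟨K, hK, hGK⟩ := exists_tendsto_log (exists_preconnected_comap_re h.convex
    exists_open_convex_atTop) hGd.continuousOn h.diff.continuousOn hG one_ne_zero hinf
  refine ⟨fun w => G w - K, hGd.sub_const K, hGc.sub continuousOn_const, fun w hw => ?_,
    fun p hp => ?_, ?_⟩
  · rw [exp_sub, hK, div_one, hG w hw]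
  · obtain ⟨C, hC⟩ := hGb p hp
    refine ⟨C + ‖K‖, ?_⟩
    filter_upwards [hC] with w hw
    have := norm_sub_le (G w) K
    linarith
  · refine tendsto_comap_re_closure exists_open_convex_atTop (fun _ => h.notMem) (hGc.fun_sub continuousOn_const) ?_
    simpa using hGK.sub_const K

/-- The exponential of the extended logarithm is the boundary value of `F`. -/
theorem exp_eq_of_tendsto {U : Set ℂ} {P : Finset ℂ} {F G : ℂ → ℂ} (hUP : ∀ w ∈ U, w ∉ P)
    (hGc : ContinuousOn G (closure U \ P)) (hG : ∀ w ∈ U, exp (G w) = F w) {q c : ℂ}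
    (hq : q ∈ closure U \ P) (hc : Tendsto F (𝓝[U] q) (𝓝 c)) : exp (G q) = c := by
  have := mem_closure_iff_nhdsWithin_neBot.1 hq.1
  have hlim : Tendsto G (𝓝[U] q) (𝓝 (G q)) :=
    (hGc q hq).mono fun v hv => ⟨subset_closure hv, hUP v hv⟩
  refine tendsto_nhds_unique (hlim.cexp.congr' ?_) hc
  filter_upwards [self_mem_nhdsWithin] with w hw using hG w hw

theorem norm_le_two_mul {z : ℂ} (hz : ‖z‖ ≤ 1 / 2) : ‖z‖ ≤ 2 * ‖exp z - 1‖ := by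
  have h1 := Complex.norm_exp_sub_one_sub_id_le (x := z) (by linarith)
  have h2 : ‖z‖ ≤ ‖exp z - 1‖ + ‖exp z - 1 - z‖ := by
    have := norm_sub_le (exp z - 1) (exp z - 1 - z)
    rwa [sub_sub_cancel] at this
  nlinarith [norm_nonneg z]

/-! ### The real line in logarithmic coordinates -/

theorem exp_image_univ : Real.exp '' Set.univ = Ioi 0 := by rw [Set.image_univ, Real.range_exp]

section logcoord

variable {F : Type*} [NormedAddCommGroup F] [NormedSpace ℝ F] {S : Set ℝ}

theorem integrableOn_exp_image (hS : MeasurableSet S) (g : ℝ → F) :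
    IntegrableOn g (Real.exp '' S) ↔ IntegrableOn (fun u => Real.exp u • g (Real.exp u)) S := by
  have := integrableOn_image_iff_integrableOn_abs_deriv_smul hS
    (fun x _ => (Real.hasDerivAt_exp x).hasDerivWithinAt) Real.exp_injective.injOn g
  simpa [abs_exp] using this

theorem integral_exp_image (hS : MeasurableSet S) (g : ℝ → F) :
    ∫ x in Real.exp '' S, g x = ∫ u in S, Real.exp u • g (Real.exp u) := by
  have := integral_image_eq_integral_abs_deriv_smul hS
    (fun x _ => (Real.hasDerivAt_exp x).hasDerivWithinAt) Real.exp_injective.injOn g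
  simpa [abs_exp] using this

theorem integrableOn_neg_exp_image (hS : MeasurableSet S) (g : ℝ → F) :
    IntegrableOn g ((fun u => -Real.exp u) '' S) ↔
      IntegrableOn (fun u => Real.exp u • g (-Real.exp u)) S := by
  have := integrableOn_image_iff_integrableOn_abs_deriv_smul hS
    (fun x _ => (Real.hasDerivAt_exp x).fun_neg.hasDerivWithinAt)
    (neg_injective.comp Real.exp_injective).injOn g
  simpa [abs_exp] using this

theorem integral_neg_exp_image (hS : MeasurableSet S) (g : ℝ → F) :
    ∫ x in (fun u => -Real.exp u) '' S, g x = ∫ u in S, Real.exp u • g (-Real.exp u) := by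
  have := integral_image_eq_integral_abs_deriv_smul hS
    (fun x _ => (Real.hasDerivAt_exp x).fun_neg.hasDerivWithinAt)
    (neg_injective.comp Real.exp_injective).injOn g
  simpa [abs_exp] using this

end logcoord

theorem exp_smul_div (ξ φ : ℂ) (u : ℝ) :
    Real.exp u • (φ / ((Real.exp u : ℝ) - ξ)) = φ * cker ξ u := by
  rw [real_smul, cker, ofReal_exp]
  ring

theorem exp_smul_neg_div (ξ φ : ℂ) (u : ℝ) :
    Real.exp u • (φ / ((-Real.exp u : ℝ) - ξ)) = -(φ * cker ξ (u + π * I)) := by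
  rw [real_smul, cker, exp_add_pi_mul_I, Complex.ofReal_neg, ofReal_exp]
  ring

theorem StripLog.of_log {U : Set ℂ} {P : Finset ℂ} {G : ℂ → ℂ} (hGd : DifferentiableOn ℂ G U)
    (hGc : ContinuousOn G (closure U \ P))
    (hGb : ∀ p ∈ P, ∃ C, ∀ᶠ w in 𝓝[closure U \ P] p, ‖G w‖ ≤ C + |log ‖w - p‖|)
    (hG0 : Tendsto G (comap re atTop ⊓ 𝓟 (closure U \ P)) (𝓝 0))
    (hUP : ∀ w ∈ U, w ∉ P) {c : ℝ} (hs : strip c ⊆ U) (hcs : cstrip c ⊆ closure U)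
    (hn : ∀ p ∈ P, ∃ n ≠ 0, ∀ w ∈ cstrip c, 0 ≤ ((w - p) / n).re) : StripLog G c P where
  diff := hGd.mono hs
  cont := hGc.mono (Set.sdiff_subset_sdiff_left hcs)
  normal := hn
  notMem := fun p hp hps => hUP p (hs hps) hp
  bound := fun p hp => by
    obtain ⟨C, hC⟩ := hGb p hp
    exact ⟨C, hC.filter_mono (nhdsWithin_mono p (Set.sdiff_subset_sdiff_left hcs))⟩
  zero := hG0.mono_left (inf_le_inf_left _ (principal_mono.2 (Set.sdiff_subset_sdiff_left hcs)))

theorem cobounded_eq : Bornology.cobounded ℂ = comap norm atTop := comap_norm_atTop.symm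

theorem tendsto_exp_cobounded {U : Set ℂ} :
    Tendsto exp (comap re atTop ⊓ 𝓟 U) (Bornology.cobounded ℂ) :=
  Complex.tendsto_exp_comap_re_atTop.mono_left inf_le_left

namespace NZProfile

variable {κ : ℝ} {D : NZProfile}

theorem hasDerivAt_lam_exp (w : ℂ) : HasDerivAt (fun w => D.lam κ (exp w)) (D.k κ (exp w)) w := by
  have h0 := exp_ne_zero w
  have h1 := ((Complex.hasDerivAt_exp w).fun_add
    (((Complex.hasDerivAt_exp w).fun_inv h0).const_mul ((κ : ℂ) * D.q₀ ^ 2))).div_const 2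
  refine (h1.congr_deriv ?_)
  rw [k]
  field_simp; ring

/-- The behaviour of `a m` at a branch point in logarithmic coordinates. -/
theorem exists_tendsto_branch (h : D.Decays 1) (hκ : |κ| = 1) {U : Set ℂ} {p : ℂ}
    (hp : D.lam κ (exp p) = 0) (hU : ∀ w ∈ U, 0 < (D.lam κ (exp w)).im)
    {m F : ℂ → ℂ} (hm : ContinuousAt m (exp p)) (hm0 : m (exp p) ≠ 0)
    (hF : ∀ᶠ w in 𝓝[U] p, F w = D.a κ (exp w) * m (exp w))
    (ha0 : ¬Tendsto (D.a κ) (𝓝[{ζ | 0 < (D.lam κ ζ).im}] exp p) (𝓝 0)) :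
    (∃ c ≠ 0, Tendsto F (𝓝[U] p) (𝓝 c)) ∨
      ∃ c ≠ 0, Tendsto (fun w => (w - p) * F w) (𝓝[U] p) (𝓝 c) := by
  have hexp : Tendsto exp (𝓝[U] p) (𝓝[{ζ | 0 < (D.lam κ ζ).im}] exp p) :=
    continuous_exp.continuousWithinAt.tendsto_nhdsWithin hU
  have hmt : Tendsto (fun w => m (exp w)) (𝓝[U] p) (𝓝 (m (exp p))) :=
    (hm.tendsto.comp continuous_exp.continuousAt.tendsto).mono_left nhdsWithin_le_nhds
  rcases exists_tendsto_a_branch h hκ (exp_ne_zero p) hp with ⟨c, hc, hl⟩ | ⟨c, hl⟩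
  · right
    have hk := k_ne_zero_of_lam_eq_zero (exp_ne_zero p) hp
    refine ⟨(D.k κ (exp p))⁻¹ * c * m (exp p),
      mul_ne_zero (mul_ne_zero (_root_.inv_ne_zero hk) hc) hm0, ?_⟩
    have hs := hasDerivAt_iff_tendsto_slope.1 (D.hasDerivAt_lam_exp (κ := κ) p)
    have hpU : U ⊆ {p}ᶜ := fun w hw hwp => by
      have h1 := hU w hw
      rw [show w = p from hwp, hp, zero_im] at h1
      exact lt_irrefl _ h1
    have hs' := (hs.mono_left (nhdsWithin_mono p hpU)).inv₀ hk
    refine ((hs'.mul (hl.comp hexp)).mul hmt).congr' ?_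
    filter_upwards [hF, self_mem_nhdsWithin] with w hw hwU
    have h1 : D.lam κ (exp w) ≠ 0 := fun h0 => by
      have := hU w hwU
      rw [h0, zero_im] at this
      exact lt_irrefl _ this
    have h2 : w - p ≠ 0 := sub_ne_zero.2 (hpU hwU)
    simp only [Function.comp, slope_def_field, hp, sub_zero]
    rw [hw]
    field_simp
  · left
    have hc : c ≠ 0 := fun h0 => ha0 (h0 ▸ hl)
    refine ⟨c * m (exp p), mul_ne_zero hc hm0, ?_⟩
    exact ((hl.comp hexp).mul hmt).congr' (by filter_upwards [hF] with w hw using hw.symm)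

/-- The boundary values of `a m` at regular points in logarithmic coordinates. -/
theorem tendsto_regular (h : D.Decays 1) (hκ : |κ| = 1) {U : Set ℂ} {q : ℂ}
    (hq : exp q ∈ D.upper κ) (hl : D.lam κ (exp q) ≠ 0)
    (hU : ∀ w ∈ U, 0 < (D.lam κ (exp w)).im)
    {m F : ℂ → ℂ} (hm : ContinuousAt m (exp q))
    (hF : ∀ᶠ w in 𝓝[U] q, F w = D.a κ (exp w) * m (exp w)) :
    Tendsto F (𝓝[U] q) (𝓝 (D.a κ (exp q) * m (exp q))) := by
  have hexp : Tendsto exp (𝓝[U] q) (𝓝[D.upper κ ∩ {ζ | D.lam κ ζ ≠ 0}] exp q) :=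
    continuous_exp.continuousWithinAt.tendsto_nhdsWithin fun w hw =>
      ⟨mem_upper_of_im (hU w hw), lam_ne_zero_of_im (hU w hw)⟩
  have h1 : Tendsto (D.a κ) (𝓝[D.upper κ ∩ {ζ | D.lam κ ζ ≠ 0}] exp q) _ :=
    continuousOn_a h hκ (exp q) ⟨hq, hl⟩
  have h2 : Tendsto (fun w => m (exp w)) (𝓝[U] q) (𝓝 (m (exp q))) :=
    (hm.tendsto.comp continuous_exp.continuousAt.tendsto).mono_left nhdsWithin_le_nhds
  exact ((h1.comp hexp).mul h2).congr' (by filter_upwards [hF] with w hw using hw.symm)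

theorem lam_ofReal_im (x : ℝ) : (D.lam κ x).im = 0 := by
  rw [← Complex.conj_eq_iff_im, ← lam_conj, conj_ofReal]

theorem ofReal_mem_upper {x : ℝ} (hx : x ≠ 0) : (x : ℂ) ∈ D.upper κ :=
  ⟨by exact_mod_cast hx, (D.lam_ofReal_im x).ge⟩

theorem normSq_a_add (h : D.Decays 1) (hκ : |κ| = 1) {x : ℝ} (hx : x ≠ 0) (hl : D.lam κ x ≠ 0) :
    ‖D.a κ x‖ ^ 2 + κ * ‖D.b κ x‖ ^ 2 = 1 := by
  have := a_mul_add_b_mul h hκ (ζ := x) (by exact_mod_cast hx) (D.lam_ofReal_im x) hl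
  rw [conj_ofReal, mul_conj, mul_conj, normSq_eq_norm_sq, normSq_eq_norm_sq] at this
  exact_mod_cast this

theorem norm_a_inv (h : D.Decays 1) (hκ : |κ| = 1) {x : ℝ} (hx : x ≠ 0) :
    ‖D.a κ ((-κ * D.q₀ ^ 2 / x : ℝ) : ℂ)‖ = ‖D.a κ x‖ := by
  have := a_inv_conj h hκ (ofReal_mem_upper (D := D) (κ := κ) hx)
  rw [conj_ofReal, inv] at this
  rw [show ((-κ * D.q₀ ^ 2 / x : ℝ) : ℂ) = -κ * D.q₀ ^ 2 * (x : ℂ)⁻¹ by push_cast; ring, this,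
    norm_mul, norm_div, D.norm_qp, D.norm_qm, div_self D.q₀_pos.ne', one_mul, norm_conj]

theorem lam_neg_one_ne_zero {x : ℝ} (hx : x ≠ 0) (h1 : |x| ≠ D.q₀) : D.lam (-1) x ≠ 0 := fun h => by
  have h2 := D.lam_mul (κ := -1) (ζ := x) (by exact_mod_cast hx)
  rw [h] at h2
  have h3 : ((x ^ 2 - D.q₀ ^ 2 : ℝ) : ℂ) = 0 := by
    push_cast at h2 ⊢
    linear_combination -h2
  have h4 : x ^ 2 = D.q₀ ^ 2 := by
    have := Complex.ofReal_eq_zero.1 h3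
    linarith
  rcases sq_eq_sq_iff_abs_eq_abs _ _ |>.1 h4 with h5
  rw [abs_of_pos D.q₀_pos] at h5
  exact h1 h5

theorem one_le_norm_a (h : D.Decays 1) {x : ℝ} (hx : x ≠ 0) (h1 : |x| ≠ D.q₀) :
    1 ≤ ‖D.a (-1) x‖ := by
  have := normSq_a_add h abs_neg_one hx (lam_neg_one_ne_zero hx h1)
  nlinarith [sq_nonneg ‖D.b (-1) x‖, norm_nonneg (D.a (-1) x)]

/-- `a` does not vanish at the branch points `±q₀` in the defocusing case. -/
theorem not_tendsto_a_zero (h : D.Decays 1) {x₀ : ℝ} (hx₀ : |x₀| = D.q₀) :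
    ¬Tendsto (D.a (-1)) (𝓝[{ζ | 0 < (D.lam (-1) ζ).im}] (x₀ : ℂ)) (𝓝 0) := fun hl => by
  have h1 := hl.norm.eventually (gt_mem_nhds (show ‖(0 : ℂ)‖ < 1 / 2 by simp))
  obtain ⟨O, hO, hxO, hOs⟩ := mem_nhdsWithin.1 h1
  have hx0 : x₀ ≠ 0 := fun h0 => by
    rw [h0, abs_zero] at hx₀
    exact D.q₀_pos.ne hx₀
  obtain ⟨ε, hε, hb⟩ := Metric.isOpen_iff.1 hO _ hxO
  set y : ℝ := x₀ * (1 + ε / (2 * (D.q₀ + ε))) with hy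
  have hq := D.q₀_pos
  have hr : 0 < ε / (2 * (D.q₀ + ε)) := by positivity
  have hyabs : |y| = D.q₀ * (1 + ε / (2 * (D.q₀ + ε))) := by
    rw [hy, abs_mul, hx₀, abs_of_pos (by positivity)]
  have hy1 : |y| ≠ D.q₀ := fun h0 => by rw [hyabs] at h0; nlinarith
  have hy0 : y ≠ 0 := mul_ne_zero hx0 (by positivity)
  have hyO : (y : ℂ) ∈ O := hb (by
    rw [mem_ball, dist_eq, ← ofReal_sub, norm_real,
      norm_eq_abs, hy, mul_add, mul_one, add_sub_cancel_left, abs_mul, hx₀, abs_of_pos hr,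
      mul_div_assoc', div_lt_iff₀ (by positivity)]
    nlinarith)
  have hc : Tendsto (D.a (-1)) (𝓝[{ζ | 0 < (D.lam (-1) ζ).im}] (y : ℂ)) (𝓝 (D.a (-1) y)) :=
    (continuousOn_a h abs_neg_one (y : ℂ) ⟨ofReal_mem_upper hy0, lam_neg_one_ne_zero hy0 hy1⟩).mono
      fun w hw => ⟨mem_upper_of_im hw, lam_ne_zero_of_im hw⟩
  have hcl : (y : ℂ) ∈ closure {ζ | 0 < (D.lam (-1) ζ).im} := by
    have : {ζ | 0 < (D.lam (-1) ζ).im} = {ζ : ℂ | 0 < ζ.im} := by ext ζ; exact lam_im_pos_iff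
    rw [this, Complex.closure_setOfPred_lt_im]
    simp
  have := mem_closure_iff_nhdsWithin_neBot.1 hcl
  have h2 : ‖D.a (-1) y‖ ≤ 1 / 2 := by
    refine le_of_tendsto hc.norm ?_
    filter_upwards [mem_nhdsWithin_of_mem_nhds (hO.mem_nhds hyO), self_mem_nhdsWithin] with w hw hwU
    exact le_of_lt (hOs ⟨hw, hwU⟩)
  have := one_le_norm_a h hy0 hy1
  linarith

end NZProfile

/-- The full strip `0 < Im w < π`. -/
def fstrip : Set ℂ := {w | 0 < w.im ∧ w.im < π}

theorem fstrip_eq : fstrip = Set.univ ×ℂ Ioo 0 π := by ext w; simp [fstrip, mem_reProdIm]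

theorem closure_fstrip : closure fstrip = {w | 0 ≤ w.im ∧ w.im ≤ π} := by
  rw [fstrip_eq, Complex.closure_reProdIm, closure_univ, closure_Ioo pi_pos.ne]
  ext w; simp [mem_reProdIm]

theorem isOpen_fstrip : IsOpen fstrip := by rw [fstrip_eq]; exact isOpen_univ.reProdIm isOpen_Ioo

theorem convex_fstrip : Convex ℝ fstrip := (convex_Ioo 0 π).linear_preimage imLm

theorem strip_eq (c : ℝ) : strip c = Ioi c ×ℂ Ioo 0 π := by ext w; simp [strip, mem_reProdIm]

theorem closure_strip (c : ℝ) : closure (strip c) = cstrip c := by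
  rw [strip_eq, Complex.closure_reProdIm, closure_Ioi, closure_Ioo pi_pos.ne]
  ext w; simp [cstrip, mem_reProdIm]

theorem exp_im_pos {w : ℂ} (hw : w ∈ fstrip) : 0 < (exp w).im := by
  rw [exp_im]
  exact mul_pos (exp_pos _) (Real.sin_pos_of_pos_of_lt_pi hw.1 hw.2)

theorem exp_of_im_eq_zero {q : ℂ} (h : q.im = 0) : exp q = (Real.exp q.re : ℝ) := by
  conv_lhs => rw [← Complex.re_add_im q, h]
  simp

theorem exp_of_im_eq_pi {q : ℂ} (h : q.im = π) : exp q = ((-Real.exp q.re : ℝ) : ℂ) := by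
  conv_lhs => rw [← Complex.re_add_im q, h]
  rw [exp_add_pi_mul_I]
  simp

instance {l : Filter ℝ} [l.NeBot] : (comap re l ⊓ 𝓟 fstrip).NeBot := by
  rw [inf_principal_neBot_iff]
  intro s hs
  obtain ⟨t, ht, hts⟩ := mem_comap.1 hs
  obtain ⟨r, hr⟩ := nonempty_of_mem ht
  refine ⟨r + (π / 2 : ℝ) * I, hts (by simpa using hr), ?_⟩
  have := pi_pos
  constructor <;> simp <;> linarith

/-- The Blaschke product with zeros `zs` in the upper half plane. -/
def blaschke {N : ℕ} (zs : Fin N → ℂ) (ζ : ℂ) : ℂ := ∏ j, (ζ - zs j) / (ζ - conj (zs j))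

theorem norm_blaschke_ofReal {N : ℕ} {zs : Fin N → ℂ} {x : ℝ} (h : ∀ j, (x : ℂ) ≠ zs j) :
    ‖blaschke zs x‖ = 1 := by
  rw [blaschke, norm_prod]
  refine Finset.prod_eq_one fun j _ => ?_
  have h1 : (x : ℂ) - conj (zs j) = conj (x - zs j) := by simp
  rw [h1, norm_div, norm_conj, div_self (norm_ne_zero_iff.2 (sub_ne_zero.2 (h j)))]

theorem blaschke_ne_zero {N : ℕ} {zs : Fin N → ℂ} {ζ : ℂ} (h : ∀ j, ζ ≠ zs j)
    (h' : ∀ j, ζ ≠ conj (zs j)) : blaschke zs ζ ≠ 0 := prod_ne_zero_iff.2 fun j _ =>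
  div_ne_zero (sub_ne_zero.2 (h j)) (sub_ne_zero.2 (h' j))

theorem ne_conj_of_im {z ζ : ℂ} (hz : 0 < z.im) (hζ : 0 ≤ ζ.im) : ζ ≠ conj z := fun h => by
  rw [h, conj_im] at hζ
  linarith

theorem inv_blaschke {N : ℕ} (zs : Fin N → ℂ) (ζ : ℂ) :
    (blaschke zs ζ)⁻¹ = ∏ j, (ζ - conj (zs j)) / (ζ - zs j) := by
  rw [blaschke, ← Finset.prod_inv_distrib]
  exact prod_congr rfl fun j _ => inv_div _ _

theorem continuousAt_inv_blaschke {N : ℕ} {zs : Fin N → ℂ} {ζ : ℂ} (h : ∀ j, ζ ≠ zs j) :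
    ContinuousAt (fun ζ => (blaschke zs ζ)⁻¹) ζ := by
  simp only [inv_blaschke]
  exact tendsto_finsetProd _ fun j _ => ContinuousAt.div (f := fun ζ : ℂ => ζ - conj (zs j))
    (by fun_prop) (by fun_prop) (sub_ne_zero.2 (h j))

theorem regInf_inv_blaschke {N : ℕ} (zs : Fin N → ℂ) : RegInf fun ζ => (blaschke zs ζ)⁻¹ := by
  simp only [inv_blaschke]
  exact RegInf.prod fun j => RegInf.sub_div_sub _ _

theorem eventually_forall_ne_cobounded {N : ℕ} (zs : Fin N → ℂ) :
    ∀ᶠ ζ in Bornology.cobounded ℂ, ∀ j, ζ ≠ zs j :=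
  eventually_all.2 fun j => Bornology.eventually_ne_cobounded (zs j)

theorem eventually_exp_ne {N : ℕ} {zs : Fin N → ℂ} {q : ℂ} (h : ∀ j, exp q ≠ zs j) :
    ∀ᶠ w in 𝓝 q, ∀ j, exp w ≠ zs j :=
  eventually_all.2 fun j => continuous_exp.continuousAt.eventually_ne (h j)

/-- Exponential decay along the middle line of the strip, from a rate of decay of `a`. -/
theorem exists_norm_middle_le {G A B : ℂ → ℂ} {s : ℂ} (hs : ‖s‖ = 1) (hB : RegInf fun ζ => (B ζ)⁻¹)
    (hA : ∃ C R : ℝ, ∀ y : ℝ, R ≤ y → ‖A (I * y) - s‖ ≤ C / y)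
    (hG : ∀ᶠ w in comap re atTop ⊓ 𝓟 fstrip, exp (G w) = A (exp w) * (s⁻¹ * (B (exp w))⁻¹))
    (h0 : Tendsto G (comap re atTop ⊓ 𝓟 fstrip) (𝓝 0)) :
    ∃ C B : ℝ, ∀ u : ℝ, B ≤ u → ‖G (u + (π / 2 : ℝ) * I)‖ ≤ C * Real.exp (-u) := by
  obtain ⟨C, R, hC⟩ := hA
  obtain ⟨C', hC'⟩ := hB.bound
  have hs0 : s ≠ 0 := fun h => by rw [h, norm_zero] at hs; exact zero_ne_one hs
  have hmid : Tendsto (fun u : ℝ => (u : ℂ) + (π / 2 : ℝ) * I) atTop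
      (comap re atTop ⊓ 𝓟 fstrip) := by
    refine tendsto_inf.2 ⟨tendsto_comap_iff.2 ?_, tendsto_principal.2 (Eventually.of_forall fun u => ?_)⟩
    · refine tendsto_id.congr fun u => ?_
      simp
    · have := pi_pos
      constructor <;> simp <;> linarith
  have h1 := (hmid.eventually ((tendsto_exp_cobounded (U := fstrip)).eventually hC'))
  have h2 := hmid.eventually hG
  have h3 := hmid.eventually (h0.norm.eventually (ge_mem_nhds (show ‖(0 : ℂ)‖ < 1 / 2 by simp)))
  have h4 : ∀ᶠ u : ℝ in atTop, C / Real.exp u ≤ 1 := by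
    have : Tendsto (fun u : ℝ => C / Real.exp u) atTop (𝓝 0) :=
      tendsto_const_nhds.div_atTop tendsto_exp_atTop
    exact this.eventually (ge_mem_nhds zero_lt_one)
  have hall := ((h1.and h2).and (h3.and h4)).and (tendsto_exp_atTop.eventually_ge_atTop R)
  obtain ⟨B₀, hB₀⟩ := eventually_atTop.1 hall
  refine ⟨2 * (|C| + 2 * |C'|), B₀, fun u hu => ?_⟩
  obtain ⟨⟨⟨k1, k2⟩, ⟨k3, k4⟩⟩, k5⟩ := hB₀ u hu
  have he : exp (u + (π / 2 : ℝ) * I) = I * (Real.exp u : ℝ) := by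
    rw [exp_add]
    push_cast
    rw [Complex.exp_pi_div_two_mul_I, mul_comm]
  rw [he] at k1 k2
  have hn : ‖I * (Real.exp u : ℝ)‖⁻¹ = Real.exp (-u) := by
    rw [norm_mul, norm_I, one_mul, norm_real, norm_eq_abs, abs_exp, Real.exp_neg]
  rw [hn] at k1
  have k6 := hC (Real.exp u) k5
  set α := A (I * (Real.exp u : ℝ))
  set β := (B (I * (Real.exp u : ℝ)))⁻¹
  refine (norm_le_two_mul k3).trans ?_
  rw [k2]
  have e1 : α * (s⁻¹ * β) - 1 = s⁻¹ * (α - s) + (s⁻¹ * α) * (β - 1) := by field_simp; ring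
  have e2 : ‖α‖ ≤ 2 := by
    have := norm_sub_norm_le α s
    linarith
  have e3 : C / Real.exp u ≤ |C| * Real.exp (-u) := by
    rw [Real.exp_neg, div_eq_mul_inv]
    gcongr
    exact le_abs_self C
  rw [e1]
  have e4 : ‖s⁻¹ * (α - s) + (s⁻¹ * α) * (β - 1)‖ ≤ ‖α - s‖ + ‖α‖ * ‖β - 1‖ := by
    refine (norm_add_le _ _).trans ?_
    rw [norm_mul, norm_mul, norm_mul, norm_inv, hs, inv_one, one_mul, one_mul]
  have e5 : ‖β - 1‖ ≤ |C'| * Real.exp (-u) :=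
    k1.trans (mul_le_mul_of_nonneg_right (le_abs_self _) (exp_pos _).le)
  have e6 : ‖α‖ * ‖β - 1‖ ≤ 2 * (|C'| * Real.exp (-u)) := by gcongr
  nlinarith

namespace NZProfile

variable {D : NZProfile}

theorem exists_bound_a_I_mul {κ : ℝ} (h : D.Decays 1) (hκ : |κ| = 1) : ∃ C R : ℝ, ∀ y : ℝ, R ≤ y →
    ‖D.a κ (I * y) - exp (I * D.omega0 κ)‖ ≤ C / y := by
  obtain ⟨C, -, hC⟩ := exists_norm_a_I_mul_sub_le h hκ
  exact ⟨C, _, hC⟩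

theorem norm_exp_omega0 (κ : ℝ) : ‖exp (I * D.omega0 κ)‖ = 1 := by
  rw [mul_comm]; exact Complex.norm_exp_ofReal_mul_I _

/-- The logarithm of `a` without its zeros, in logarithmic coordinates. -/
theorem exists_log_of_zeros {κ : ℝ} (h : D.Decays 1) (hκ : |κ| = 1) {U V : Set ℂ}
    (hU : Convex ℝ U) (hUo : IsOpen U)
    (hle : comap re atTop ⊓ 𝓟 fstrip ≤ comap re atTop ⊓ 𝓟 U) (hV : IsOpen V)
    (hUV : ∀ w ∈ U, exp w ∈ V) (hVl : ∀ ζ ∈ V, 0 < (D.lam κ ζ).im) {N p : ℕ} (hp : p ≠ 0)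
    {zs : Fin N → ℂ} (hinj : Function.Injective zs)
    (hord : ∀ j, ∃ g, AnalyticAt ℂ g (zs j) ∧ g (zs j) ≠ 0 ∧
      ∀ᶠ w in 𝓝 (zs j), D.a κ w = (w - zs j) ^ p * g w)
    (hall : ∀ w ∈ V, D.a κ w = 0 → ∃ j, zs j = w) {B E : ℂ → ℂ} (hB : RegInf fun ζ => (B ζ)⁻¹)
    (hE : DifferentiableOn ℂ E V) (hE0 : ∀ ζ ∈ V, E ζ ≠ 0)
    (hBE : ∀ ζ ∈ V, B ζ * E ζ = ∏ j, (ζ - zs j) ^ p) {P : Finset ℂ}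
    (hP : ∀ q ∈ P, q ∈ closure U ∧ (∃ d ≠ 0, ∀ w ∈ U, 0 < ((w - q) / d).re) ∧
      D.lam κ (exp q) = 0 ∧ ¬Tendsto (D.a κ) (𝓝[{ζ | 0 < (D.lam κ ζ).im}] exp q) (𝓝 0))
    (hbd : ∀ q ∈ closure U, q ∉ U → (∀ j, exp q ≠ zs j) ∧ B (exp q) ≠ 0 ∧
      ContinuousAt (fun ζ => (B ζ)⁻¹) (exp q))
    (hreg : ∀ q ∈ closure U, q ∉ U → q ∉ P → D.lam κ (exp q) ≠ 0 ∧ D.a κ (exp q) ≠ 0) :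
    ∃ G : ℂ → ℂ, (∀ c, strip c ⊆ U → StripLog G c P) ∧ ContinuousOn G (closure U \ P) ∧
      (∀ w ∈ closure U \ P, D.a κ (exp w) = exp (G w) * B (exp w) * exp (I * D.omega0 κ)) ∧
      ∃ C B : ℝ, ∀ u : ℝ, B ≤ u → ‖G (u + (π / 2 : ℝ) * I)‖ ≤ C * Real.exp (-u) := by
  set s := exp (I * D.omega0 κ)
  have hs0 : s ≠ 0 := exp_ne_zero _
  have hs1 : ‖s‖ = 1 := norm_exp_omega0 _
  have had : DifferentiableOn ℂ (D.a κ) V := (differentiableOn_a h hκ).mono hVl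
  obtain ⟨f, hfd, hf0, hfa⟩ := exists_eq_prod_pow_mul hV had hinj p hord (fun w hw hne ha => by
    obtain ⟨j, hj⟩ := hall w hw ha
    exact hne j hj.symm)
  set m : ℂ → ℂ := fun ζ => s⁻¹ * (B ζ)⁻¹ with hm
  set F : ℂ → ℂ := fun w => f (exp w) * (E (exp w) * s⁻¹) with hF
  have haF : ∀ w ∈ U, D.a κ (exp w) = F w * B (exp w) * s := fun w hw => by
    have h1 := hBE _ (hUV w hw)
    by_cases hne : ∀ j, exp w ≠ zs j
    · rw [hfa _ (hUV w hw) hne, ← h1]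
      simp only [hF]
      field_simp
    · push Not at hne
      obtain ⟨j, hj⟩ := hne
      obtain ⟨g, -, -, hg⟩ := hord j
      rw [prod_eq_zero (mem_univ j) (by rw [hj, sub_self, zero_pow hp])] at h1
      rw [(mul_eq_zero.1 h1).resolve_right (hE0 _ (hUV w hw)), hj, hg.self_of_nhds, sub_self,
        zero_pow hp]
      ring
  have hFm : ∀ w ∈ U, (∀ j, exp w ≠ zs j) → F w = D.a κ (exp w) * m (exp w) := fun w hw hne => by
    have h1 : B (exp w) ≠ 0 := left_ne_zero_of_mul (hBE _ (hUV w hw) ▸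
      prod_ne_zero_iff.2 fun j _ => pow_ne_zero p (sub_ne_zero.2 (hne j)))
    rw [haF w hw]
    simp only [hm]
    field_simp
  have hFd : DifferentiableOn ℂ F U := (hfd.comp differentiable_exp.differentiableOn hUV).fun_mul
    ((hE.comp differentiable_exp.differentiableOn hUV).mul_const _)
  have hF0 : ∀ w ∈ U, F w ≠ 0 := fun w hw => mul_ne_zero (hf0 _ (hUV w hw))
    (mul_ne_zero (hE0 _ (hUV w hw)) (_root_.inv_ne_zero hs0))
  have hUl : ∀ w ∈ U, 0 < (D.lam κ (exp w)).im := fun w hw => hVl _ (hUV w hw)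
  have hUP : ∀ w ∈ U, w ∉ P := fun w hw hwP => by
    obtain ⟨-, ⟨d, -, hd⟩, -⟩ := hP w hwP
    simpa using hd w hw
  have hev : ∀ q ∈ closure U, q ∉ U → ∀ᶠ w in 𝓝[U] q, F w = D.a κ (exp w) * m (exp w) :=
    fun q hq hqU => by
      filter_upwards [mem_nhdsWithin_of_mem_nhds (eventually_exp_ne (hbd q hq hqU).1),
        self_mem_nhdsWithin] with w hw hwU using hFm w hwU hw
  have hm0 : ∀ q ∈ closure U, q ∉ U → m (exp q) ≠ 0 := fun q hq hqU =>
    mul_ne_zero (_root_.inv_ne_zero hs0) (_root_.inv_ne_zero (hbd q hq hqU).2.1)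
  have hmc : ∀ q ∈ closure U, q ∉ U → ContinuousAt m (exp q) := fun q hq hqU =>
    (hbd q hq hqU).2.2.const_mul _
  have hlim : ∀ q ∈ closure U, q ∉ U → q ∉ P →
      Tendsto F (𝓝[U] q) (𝓝 (D.a κ (exp q) * m (exp q))) := fun q hq hqU hqP => by
    have hc : Continuous fun w => (D.lam κ (exp w)).im := continuous_im.comp
      (continuous_iff_continuousAt.2 fun w => (hasDerivAt_lam_exp w).continuousAt)
    exact tendsto_regular h hκ ⟨exp_ne_zero q, (isClosed_le continuous_const hc).closure_subset_iff.2
      (fun w hw => (hUl w hw).le) hq⟩ (hreg q hq hqU hqP).1 hUl (hmc q hq hqU) (hev q hq hqU)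
  have hinf : Tendsto F (comap re atTop ⊓ 𝓟 U) (𝓝 1) := by
    have hcob := tendsto_exp_cobounded (U := U)
    have h1 : Tendsto exp (comap re atTop ⊓ 𝓟 U) (comap norm atTop ⊓ 𝓟 (D.upper κ)) := by
      refine tendsto_inf.2 ⟨by rwa [← cobounded_eq], tendsto_principal.2 ?_⟩
      exact mem_inf_of_right fun w hw => mem_upper_of_im (hUl w hw)
    have h2 := ((tendsto_a h hκ).comp h1).mul ((hB.tendsto.comp hcob).const_mul s⁻¹)
    rw [mul_one, mul_inv_cancel₀ hs0] at h2
    refine h2.congr' ?_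
    filter_upwards [hcob.eventually (eventually_forall_ne_cobounded zs),
      mem_inf_of_right (mem_principal_self _)] with w hw hwU using (hFm w hwU hw).symm
  have := NeBot.mono inferInstance hle
  have hext : LogExtends F U P := ⟨hU, hUo, hFd, hF0, fun q hq hqP => by
      by_cases hqU : q ∈ U
      · exact ⟨F q, hF0 q hqU, hFd.continuousOn q hqU⟩
      · exact ⟨_, mul_ne_zero (hreg q hq hqU hqP).2 (hm0 q hq hqU), hlim q hq hqU hqP⟩, fun q hq => by
      obtain ⟨h1, ⟨d, hd0, hd⟩, h2, h3⟩ := hP q hq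
      have hqU : q ∉ U := fun hqU => hUP q hqU hq
      exact ⟨h1, ⟨d, hd0, fun w hw => Or.inl (hd w hw)⟩,
        exists_tendsto_branch h hκ h2 hUl (hmc q h1 hqU) (hm0 q h1 hqU) (hev q h1 hqU) h3⟩⟩
  obtain ⟨G, hGd, hGc, hG, hGb, hG0⟩ := hext.exists_log_normalized hinf
  refine ⟨G, fun c hc => ?_, hGc, fun w hw => ?_, ?_⟩
  · have hcU : cstrip c ⊆ closure U := closure_strip c ▸ closure_mono hc
    refine StripLog.of_log hGd hGc hGb hG0 hUP hc hcU fun q hq => ?_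
    obtain ⟨-, ⟨d, hd0, hd⟩, -⟩ := hP q hq
    have hc : Continuous fun w => ((w - q) / d).re := Complex.continuous_re.comp (by fun_prop)
    exact ⟨d, hd0, fun w hw => (isClosed_le continuous_const hc).closure_subset_iff.2
      (fun w hw => (hd w hw).le) (hcU hw)⟩
  · by_cases hwU : w ∈ U
    · rw [hG w hwU, haF w hwU]
    · have := (hbd w hw.1 hwU).2.1
      rw [exp_eq_of_tendsto hUP hGc hG hw (hlim w hw.1 hwU hw.2)]
      simp only [hm]
      field_simp
  · refine exists_norm_middle_le hs1 hB (exists_bound_a_I_mul h hκ) (hle ?_)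
      ((hG0.mono_left (inf_le_inf_left _ (principal_mono.2 fun w hw =>
        ⟨subset_closure hw, hUP w hw⟩))).mono_left hle)
    filter_upwards [(tendsto_exp_cobounded (U := U)).eventually
      (eventually_forall_ne_cobounded zs), mem_inf_of_right (mem_principal_self _)] with w hw hwU
    rw [hG w hwU, hFm w hwU hw]

/-- The logarithm of `a` without its zeros, in the defocusing case. -/
theorem exists_defocusing_log (h : D.Decays 1) {N : ℕ} {ζs : Fin N → ℂ}
    (hinj : Function.Injective ζs) (hrange : range ζs = {ζ : ℂ | 0 < ζ.im ∧ D.a (-1) ζ = 0}) :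
    ∃ (G : ℂ → ℂ) (P : Finset ℂ), (∀ c, StripLog G c P) ∧
      (∀ w ∈ fstrip, D.a (-1) (exp w) = exp (G w) * blaschke ζs (exp w) * exp (I * D.omega0 (-1))) ∧
      (∀ u : ℝ, u ≠ log D.q₀ → (G u).re = log ‖D.a (-1) (Real.exp u : ℝ)‖ ∧
        (G (u + π * I)).re = log ‖D.a (-1) (-Real.exp u : ℝ)‖) ∧
      (∃ g₀, exp g₀ = D.qp / D.qm * (exp (I * D.omega0 (-1)))⁻¹ ^ 2 * ∏ j, conj (ζs j) / ζs j ∧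
        ∀ ε > 0, ∃ R : ℝ, ∀ w : ℂ, w.re < R → 0 ≤ w.im → w.im ≤ π → ‖G w - g₀‖ ≤ ε) ∧
      ∃ C B : ℝ, ∀ u : ℝ, B ≤ u → ‖G (u + (π / 2 : ℝ) * I)‖ ≤ C * Real.exp (-u) := by
  set s := exp (I * D.omega0 (-1))
  have hs0 : s ≠ 0 := exp_ne_zero _
  have hs1 : ‖s‖ = 1 := norm_exp_omega0 _
  have hz : ∀ j, 0 < (ζs j).im ∧ D.a (-1) (ζs j) = 0 := fun j => by
    have : ζs j ∈ range ζs := ⟨j, rfl⟩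
    rwa [hrange] at this
  have hV : {ζ | 0 < (D.lam (-1) ζ).im} = {ζ : ℂ | 0 < ζ.im} := by ext ζ; exact lam_im_pos_iff
  have hVo : IsOpen {ζ : ℂ | 0 < ζ.im} := hV ▸ D.isOpen_upper (-1)
  have hne : ∀ x : ℝ, ∀ j, (x : ℂ) ≠ ζs j := fun x j hj => by
    have := (hz j).1
    rw [← hj] at this
    simp at this
  set p₀ : ℂ := ((log D.q₀ : ℝ) : ℂ) with hp₀
  set P : Finset ℂ := {p₀, p₀ + π * I} with hP
  have hq0 := D.q₀_pos
  have hpi := pi_pos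
  have hep₀ : exp p₀ = (D.q₀ : ℝ) := by rw [hp₀, ← ofReal_exp, Real.exp_log hq0]
  have hep₁ : exp (p₀ + π * I) = ((-D.q₀ : ℝ) : ℂ) := by rw [exp_add_pi_mul_I, hep₀]; simp
  have hlp : ∀ x : ℝ, |x| = D.q₀ → D.lam (-1) x = 0 := fun x hx => by
    have hx0 : (x : ℂ) ≠ 0 := fun h0 => by
      rw [Complex.ofReal_eq_zero.1 h0, abs_zero] at hx
      exact hq0.ne hx
    have h1 := D.lam_mul (κ := -1) hx0
    rw [← hx, ← Complex.ofReal_pow |x|, sq_abs] at h1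
    simpa [hx0] using h1
  have hbd : ∀ q ∈ closure fstrip, q ∉ fstrip → ∃ x : ℝ, exp q = x ∧ x ≠ 0 ∧
      (q ∉ P → |x| ≠ D.q₀) := fun q hq hqU => by
    rw [closure_fstrip] at hq
    rcases eq_or_lt_of_le hq.1 with h0 | h0
    · refine ⟨_, exp_of_im_eq_zero h0.symm, (exp_pos _).ne', fun hqP h1 => hqP ?_⟩
      rw [abs_exp] at h1
      have : q = p₀ := ext (by simp [hp₀, ← h1]) (by simp [hp₀, ← h0])
      simp [hP, this]
    · have h3 : q.im = π := hq.2.antisymm (not_lt.1 fun h3 => hqU ⟨h0, h3⟩)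
      refine ⟨_, exp_of_im_eq_pi h3, neg_ne_zero.2 (exp_pos _).ne', fun hqP h1 => hqP ?_⟩
      rw [abs_neg, abs_exp] at h1
      have : q = p₀ + π * I := ext (by simp [hp₀, ← h1]) (by simp [hp₀, h3])
      simp [hP, this]
  obtain ⟨G, hGs, hGc, hG, hmid⟩ := exists_log_of_zeros h abs_neg_one convex_fstrip isOpen_fstrip
    le_rfl hVo (fun w hw => exp_im_pos hw) (fun ζ hζ => lam_im_pos_iff.2 hζ) one_ne_zero hinj
    (fun j => exists_factor_of_deriv_ne_zero
      ((hV ▸ differentiableOn_a h abs_neg_one).analyticAt (hVo.mem_nhds (hz j).1)) (hz j).2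
      (deriv_a_ne_zero h (hz j).1 (hz j).2))
    (fun w hw ha => by
      have : w ∈ range ζs := by rw [hrange]; exact ⟨hw, ha⟩
      exact this) (regInf_inv_blaschke ζs) (E := fun ζ => ∏ j, (ζ - conj (ζs j)))
    (Differentiable.differentiableOn (by fun_prop))
    (fun ζ hζ => prod_ne_zero_iff.2 fun j _ => sub_ne_zero.2 (ne_conj_of_im (hz j).1 (le_of_lt hζ)))
    (fun ζ hζ => by
      rw [blaschke, ← prod_mul_distrib]
      exact prod_congr rfl fun j _ => by
        rw [pow_one, div_mul_cancel₀ _ (sub_ne_zero.2 (ne_conj_of_im (hz j).1 (le_of_lt hζ)))])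
    (P := P) (fun p hp => by
      rw [closure_fstrip]
      rcases mem_insert.1 hp with rfl | hp
      · refine ⟨by simp [hp₀, hpi.le], ⟨I, I_ne_zero, fun w hw => ?_⟩, ?_⟩
        · simpa [div_I, hp₀] using hw.1
        · rw [hep₀]; exact ⟨hlp _ (abs_of_pos hq0), not_tendsto_a_zero h (abs_of_pos hq0)⟩
      · rw [mem_singleton] at hp
        subst hp
        have h1 : |-D.q₀| = D.q₀ := by rw [abs_neg, abs_of_pos hq0]
        refine ⟨by simp [hp₀, hpi.le], ⟨-I, neg_ne_zero.2 I_ne_zero, fun w hw => ?_⟩, ?_⟩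
        · simpa [div_I, hp₀, div_neg] using hw.2
        · rw [hep₁]; exact ⟨hlp _ h1, not_tendsto_a_zero h h1⟩)
    (fun q hq hqU => by
      obtain ⟨x, hx, -⟩ := hbd q hq hqU
      rw [hx]
      exact ⟨hne x, norm_ne_zero_iff.1 (by rw [norm_blaschke_ofReal (hne x)]; exact one_ne_zero),
        continuousAt_inv_blaschke (hne x)⟩)
    (fun q hq hqU hqP => by
      obtain ⟨x, hx, hx0, hx1⟩ := hbd q hq hqU
      rw [hx]
      exact ⟨lam_neg_one_ne_zero hx0 (hx1 hqP), norm_pos_iff.1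
        (zero_lt_one.trans_le (one_le_norm_a h hx0 (hx1 hqP)))⟩)
  have hGs' : ∀ c, StripLog G c P := fun c => hGs c fun w hw => hw.2
  have hUP : ∀ w ∈ fstrip, w ∉ P := fun w hw hwP => (hGs' (w.re - 1)).notMem w hwP ⟨by linarith, hw⟩
  refine ⟨G, P, hGs', fun w hw => hG w ⟨subset_closure hw, hUP w hw⟩, fun u hu => ?_, ?_, hmid⟩
  · have key : ∀ (q : ℂ) (x : ℝ), q ∈ closure fstrip \ P → exp q = x →
        (G q).re = log ‖D.a (-1) x‖ := fun q x hq hqx => by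
      rw [← hqx, hG q hq, norm_mul, norm_mul, hs1, hqx, norm_blaschke_ofReal (hne x), norm_exp,
        mul_one, mul_one, log_exp]
    refine ⟨key _ _ ⟨?_, ?_⟩ (by simp), key _ _ ⟨?_, ?_⟩ (by rw [exp_add_pi_mul_I]; simp)⟩
    · rw [closure_fstrip]; simp [hpi.le]
    · intro hp
      rcases mem_insert.1 hp with h1 | h1
      · exact hu (Complex.ofReal_injective h1)
      · have := congrArg im (mem_singleton.1 h1)
        simp [hp₀, hpi.ne] at this
    · rw [closure_fstrip]; simp [hpi.le]
    · intro hp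
      rcases mem_insert.1 hp with h1 | h1
      · have := congrArg im h1
        simp [hp₀, hpi.ne'] at this
      · exact hu (Complex.ofReal_injective (add_right_cancel (mem_singleton.1 h1)))
  · -- the limit at `-∞`
    have hz0 : ∀ j, (0 : ℂ) ≠ ζs j := by simpa using hne 0
    have hexp0 : Tendsto exp (comap re atBot ⊓ 𝓟 fstrip) (𝓝 0) :=
      (Complex.tendsto_exp_comap_re_atBot).mono_left inf_le_left
    have hmem : ∀ w ∈ fstrip, (D.q₀ : ℂ) ^ 2 * exp (-conj w) ∈ D.upper (-1) := fun w hw => by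
      refine mem_upper_of_im (lam_im_pos_iff.2 ?_)
      rw [← Complex.ofReal_pow, im_ofReal_mul, exp_im]
      have := Real.sin_pos_of_pos_of_lt_pi hw.1 hw.2
      simp; positivity
    have hζ' : Tendsto (fun w : ℂ => (D.q₀ : ℂ) ^ 2 * exp (-conj w))
        (comap re atBot ⊓ 𝓟 fstrip) (comap norm atTop ⊓ 𝓟 (D.upper (-1))) := by
      refine tendsto_inf.2 ⟨tendsto_comap_iff.2 ?_, tendsto_principal.2 (mem_inf_of_right hmem)⟩
      have h1 : Tendsto (fun w : ℂ => D.q₀ ^ 2 * Real.exp (-w.re)) (comap re atBot ⊓ 𝓟 fstrip)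
          atTop := (tendsto_exp_atTop.comp (tendsto_neg_atBot_atTop.comp
            (tendsto_comap.mono_left inf_le_left))).const_mul_atTop (by positivity)
      refine h1.congr fun w => ?_
      simp [norm_exp]
    have hGd : ContinuousOn G fstrip := hGc.mono fun w hw => ⟨subset_closure hw, hUP w hw⟩
    have hainv : ∀ w ∈ fstrip, D.a (-1) (exp w) =
        D.qp / D.qm * conj (D.a (-1) ((D.q₀ : ℂ) ^ 2 * exp (-conj w))) := fun w hw => by
      rw [← a_inv_conj h abs_neg_one (hmem w hw), inv]
      congr 1
      have := D.q₀_ne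
      simp [exp_neg, ← exp_conj]
      field_simp
    have hB0 : (blaschke ζs 0)⁻¹ = ∏ j, conj (ζs j) / ζs j := by
      simp only [inv_blaschke, zero_sub, neg_div_neg_eq]
    have hlim : Tendsto (fun w => exp (G w)) (comap re atBot ⊓ 𝓟 fstrip)
        (𝓝 (D.qp / D.qm * conj s * (s⁻¹ * (blaschke ζs 0)⁻¹))) := by
      have h1 := (((continuous_conj.tendsto _).comp
        ((tendsto_a h abs_neg_one).comp hζ')).const_mul (D.qp / D.qm)).mul
        (((continuousAt_inv_blaschke hz0).tendsto.comp hexp0).const_mul s⁻¹)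
      refine h1.congr' ?_
      have hev : ∀ᶠ w in comap re atBot ⊓ 𝓟 fstrip, ∀ j, exp w ≠ ζs j :=
        eventually_all.2 fun j => hexp0.eventually_ne (hz0 j)
      filter_upwards [hev, mem_inf_of_right (mem_principal_self _)] with w hw hwU
      have hb := blaschke_ne_zero hw fun j => ne_conj_of_im (hz j).1 (exp_im_pos hwU).le
      change D.qp / D.qm * conj _ * (s⁻¹ * (blaschke ζs (exp w))⁻¹) = _
      rw [Function.comp, ← hainv w hwU, hG w ⟨subset_closure hwU, hUP w hwU⟩]
      field_simp; rfl
    have hne : D.qp / D.qm * conj s * (s⁻¹ * (blaschke ζs 0)⁻¹) ≠ 0 := by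
      rw [hB0]
      refine mul_ne_zero (mul_ne_zero (div_ne_zero D.qp_ne D.qm_ne) (by simpa using hs0))
        (mul_ne_zero (_root_.inv_ne_zero hs0) (prod_ne_zero_iff.2 fun j _ =>
          div_ne_zero (by simpa using (hz0 j).symm) (hz0 j).symm))
    obtain ⟨g₀, hg₀, hlg⟩ := exists_tendsto_log
      (exists_preconnected_comap_re convex_fstrip exists_open_convex_atBot)
      hGd hGd.cexp (fun w _ => rfl) hne hlim
    refine ⟨g₀, ?_, fun ε hε => ?_⟩
    · rw [hg₀, hB0]
      have : conj s = s⁻¹ := (Complex.inv_eq_conj hs1).symm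
      rw [this]; ring
    · have h2 := tendsto_comap_re_closure exists_open_convex_atBot hUP hGc hlg
      have h3 := (Metric.nhds_basis_closedBall.tendsto_right_iff.1 h2) ε hε
      rw [eventually_inf_principal, eventually_comap] at h3
      obtain ⟨R, hR⟩ := eventually_atBot.1 h3
      refine ⟨min R (log D.q₀), fun w hw h4 h5 => ?_⟩
      have h6 := hR w.re (hw.le.trans (min_le_left _ _)) w rfl ⟨by
        rw [closure_fstrip]; exact ⟨h4, h5⟩, fun hp => ?_⟩
      · rwa [mem_closedBall_iff_norm] at h6
      · have h7 : w.re = log D.q₀ := by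
          rcases mem_insert.1 hp with h1 | h1
          · rw [h1, hp₀, ofReal_re]
          · rw [mem_singleton.1 h1]; simp [hp₀]
        exact absurd (hw.trans_le (min_le_right _ _)) (by rw [h7]; exact lt_irrefl _)

end NZProfile

theorem exists_norm_cker_le' {ξ : ℂ} (hξ : ξ = 0 ∨ ξ.im ≠ 0) :
    ∃ B, ∀ w : ℂ, (exp w).im = 0 → exp w ≠ ξ ∧ ‖cker ξ w‖ ≤ B := by
  rcases hξ with rfl | h
  · exact ⟨1, fun w _ => ⟨exp_ne_zero w, by simp⟩⟩
  · refine ⟨1 + ‖ξ‖ / |ξ.im|, fun w hw => ?_⟩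
    refine ⟨fun h3 => h (h3 ▸ hw), norm_cker_le (abs_pos.2 h) ?_⟩
    have := Complex.abs_im_le_norm (exp w - ξ)
    rwa [sub_im, hw, zero_sub, abs_neg] at this

theorem integrable_mul_cker_of_real {g : ℝ → ℝ} (hg : Integrable g) {ξ : ℂ}
    (hξ : ξ = 0 ∨ ξ.im ≠ 0) {v : ℝ → ℂ} (hv : Continuous v)
    (hvim : ∀ u, (exp (v u)).im = 0) :
    Integrable fun u : ℝ => (g u : ℂ) * cker ξ (v u) := by
  obtain ⟨B, hB⟩ := exists_norm_cker_le' hξ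
  refine Integrable.mul_bdd (c := B) hg.ofReal ?_ (Eventually.of_forall fun u => (hB _ (hvim u)).2)
  exact (continuous_iff_continuousAt.2 fun u => ContinuousAt.comp
    (continuousAt_cker (hB _ (hvim u)).1) hv.continuousAt).aestronglyMeasurable

/-- Integrals over the real line in logarithmic coordinates. -/
theorem integrable_and_integral_real_line {f : ℝ → ℂ}
    (h1 : Integrable fun u : ℝ => Real.exp u • f (Real.exp u))
    (h2 : Integrable fun u : ℝ => Real.exp u • f (-Real.exp u)) :
    Integrable f ∧ ∫ x, f x =
      ∫ u : ℝ, (Real.exp u • f (Real.exp u) + Real.exp u • f (-Real.exp u)) := by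
  have himg : (fun u => -Real.exp u) '' Set.univ = Iio 0 := by
    rw [show (fun u => -Real.exp u) = Neg.neg ∘ Real.exp from rfl, Set.image_comp, exp_image_univ]
    simp
  have i1 : IntegrableOn f (Ioi 0) := by
    rw [← exp_image_univ, integrableOn_exp_image MeasurableSet.univ, integrableOn_univ]
    exact h1
  have i2 : IntegrableOn f (Iio 0) := by
    rw [← himg, integrableOn_neg_exp_image MeasurableSet.univ, integrableOn_univ]
    exact h2
  have i2' : IntegrableOn f (Iic 0) := (integrableOn_Iic_iff_integrableOn_Iio (hb := by simp)).2 i2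
  refine ⟨?_, ?_⟩
  · rw [← integrableOn_univ, ← Set.Iic_union_Ioi (a := (0 : ℝ))]
    exact i2'.union i1
  · rw [← integral_Iic_add_Ioi i2' i1, integral_Iic_eq_integral_Iio, ← himg,
      integral_neg_exp_image MeasurableSet.univ, ← exp_image_univ,
      integral_exp_image MeasurableSet.univ, Measure.restrict_univ, integral_add h1 h2, add_comm]

theorem integrable_of_reflection {ρ ρ' : ℝ → ℝ} {c : ℝ} (h : IntegrableOn ρ (Ioi c))
    (h' : IntegrableOn ρ' (Ioi c)) (hsymm : ∀ u, u ≠ c → ρ' (2 * c - u) = ρ u) :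
    Integrable ρ := by
  have h1 : IntegrableOn (fun u => ρ' (2 * c - u)) (Iio c) := by
    have h2 := ((Measure.measurePreserving_sub_left volume (2 * c)).integrableOn_comp_preimage
      (MeasurableEquiv.subLeft (2 * c)).measurableEmbedding (f := ρ') (s := Ioi c)).2 h'
    rw [Set.preimage_const_sub_Ioi] at h2
    have : 2 * c - c = c := by ring
    rwa [this] at h2
  have h3 : IntegrableOn ρ (Iio c) := h1.congr_fun (fun u hu => hsymm u (ne_of_lt hu))
    measurableSet_Iio
  rw [← integrableOn_univ, ← Set.Iic_union_Ioi (a := c)]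
  exact ((integrableOn_Iic_iff_integrableOn_Iio (hb := by simp)).2 h3).union h

theorem res_of_im_pos {G : ℂ → ℂ} {c : ℝ} {ξ : ℂ} (hc : Real.exp c < ‖ξ‖) (h : 0 < ξ.im) :
    res G c ξ = G (Complex.log ξ) := if_pos ⟨hc, h⟩

theorem res_of_im_nonpos {G : ℂ → ℂ} {c : ℝ} {ξ : ℂ} (h : ξ.im ≤ 0) : res G c ξ = 0 :=
  if_neg fun h1 => h.not_gt h1.2

theorem res_of_norm_le {G : ℂ → ℂ} {c : ℝ} {ξ : ℂ} (h : ‖ξ‖ ≤ Real.exp c) : res G c ξ = 0 :=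
  if_neg fun h1 => h.not_gt h1.1

theorem tendsto_left_edge {G : ℂ → ℂ} {P : Finset ℂ} (hG : ∀ c, StripLog G c P) {g₀ : ℂ}
    (hg : ∀ ε > 0, ∃ R : ℝ, ∀ w : ℂ, w.re < R → 0 ≤ w.im → w.im ≤ π → ‖G w - g₀‖ ≤ ε)
    (ξ : ℂ) :
    Tendsto (fun c : ℝ => ∫ y in 0..π, G (c + y * I) * cker ξ (c + y * I))
      atBot (𝓝 (if ξ = 0 then π * g₀ else 0)) := by
  have hpi := pi_pos
  have hgy : ∀ ε > 0, ∃ R : ℝ, ∀ c < R, ∀ y ∈ Set.uIoc 0 π,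
      ‖G (c + y * I) - g₀‖ ≤ ε := fun ε hε => by
    obtain ⟨R, hR⟩ := hg ε hε
    refine ⟨R, fun c hc y hy => ?_⟩
    rw [uIoc_of_le hpi.le] at hy
    exact hR _ (by simpa using hc) (by simpa using hy.1.le) (by simpa using hy.2)
  split_ifs with h0
  · subst h0
    simp only [cker_zero, mul_one]
    rw [Metric.tendsto_nhds]
    intro ε hε
    obtain ⟨R, hR⟩ := hgy (ε / (2 * π)) (by positivity)
    filter_upwards [Iio_mem_atBot R] with c hc
    have hi : IntervalIntegrable (fun y : ℝ => G (c + y * I)) volume 0 π :=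
      ((hG c).edgeIntegrable le_rfl le_rfl le_rfl (le_refl c) hpi.le).2.2.2
    have h1 : (∫ y in 0..π, G (c + y * I)) - π * g₀ = ∫ y in 0..π, (G (c + y * I) - g₀) := by
      rw [intervalIntegral.integral_sub hi intervalIntegrable_const, intervalIntegral.integral_const,
        sub_zero, real_smul]
    rw [dist_eq_norm, h1]
    refine (intervalIntegral.norm_integral_le_of_norm_le_const (hR c hc)).trans_lt ?_
    rw [sub_zero, abs_of_pos hpi, div_mul_eq_mul_div, div_lt_iff₀ (by positivity)]
    nlinarith
  · have hξ : 0 < ‖ξ‖ := norm_pos_iff.2 h0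
    obtain ⟨R, hR⟩ := hgy 1 one_pos
    have hlim : Tendsto (fun c : ℝ => (‖g₀‖ + 1) * (2 * Real.exp c / ‖ξ‖) * π) atBot (𝓝 0) := by
      have := ((((tendsto_exp_atBot.const_mul 2).div_const ‖ξ‖).const_mul (‖g₀‖ + 1)).mul_const π)
      simpa using this
    refine squeeze_zero_norm' ?_ hlim
    filter_upwards [Iio_mem_atBot R, tendsto_exp_atBot.eventually
      (ge_mem_nhds (half_pos hξ))] with c hc hc2
    refine (intervalIntegral.norm_integral_le_of_norm_le_const
      (C := (‖g₀‖ + 1) * (2 * Real.exp c / ‖ξ‖)) fun y hy => ?_).trans ?_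
    · rw [norm_mul]
      have h1 := hR c hc y hy
      have h2 : ‖G (c + y * I)‖ ≤ ‖g₀‖ + 1 := by
        have := norm_sub_norm_le (G (c + y * I)) g₀
        linarith
      have h3 : ‖exp (c + y * I)‖ = Real.exp c := by simp [norm_exp]
      have h4 : ‖ξ‖ / 2 ≤ ‖exp (c + y * I) - ξ‖ := by
        have := norm_sub_norm_le ξ (exp (c + y * I))
        rw [norm_sub_rev] at this
        linarith
      have h5 : ‖cker ξ (c + y * I)‖ ≤ 2 * Real.exp c / ‖ξ‖ := by
        rw [cker, norm_div, h3]
        refine (div_le_div_of_nonneg_left (exp_pos c).le (half_pos hξ) h4).trans (le_of_eq ?_)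
        field_simp
      gcongr
    · rw [sub_zero, abs_of_pos hpi]

/-- The boundary identity on the full strip. -/
theorem full_identity {G : ℂ → ℂ} {P : Finset ℂ} (hG : ∀ c, StripLog G c P) {g₀ : ℂ}
    (hg : ∀ ε > 0, ∃ R : ℝ, ∀ w : ℂ, w.re < R → 0 ≤ w.im → w.im ≤ π → ‖G w - g₀‖ ≤ ε)
    (h0 : Integrable fun u : ℝ => (G u).re)
    (h1 : Integrable fun u : ℝ => (G (u + π * I)).re) {ξ : ℂ}
    (hξ : ξ = 0 ∨ ξ.im ≠ 0) :
    Integrable (fun u : ℝ => 2 * ((G u).re : ℂ) * cker ξ u) ∧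
    Integrable (fun u : ℝ => 2 * ((G (u + π * I)).re : ℂ) * cker ξ (u + π * I)) ∧
    (∫ u : ℝ, (2 * ((G (u : ℝ)).re : ℂ) * cker ξ u
        - 2 * ((G ((u : ℝ) + π * I)).re : ℂ) * cker ξ (u + π * I))) =
      (if ξ = 0 then ((-2 * π * g₀.im : ℝ) : ℂ) else 0)
      + 2 * π * I * ((if 0 < ξ.im then G (Complex.log ξ) else 0)
        - conj (if ξ.im < 0 then G (Complex.log (conj ξ)) else 0)) := by
  have i0 := (integrable_mul_cker_of_real h0 hξ (v := fun u : ℝ => (u : ℂ)) (by fun_prop)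
      exp_real_im).const_mul 2
  have i1 := (integrable_mul_cker_of_real h1 hξ (v := fun u : ℝ => (u : ℂ) + π * I)
      (by fun_prop) exp_real_add_pi_im).const_mul 2
  simp only [← mul_assoc] at i0 i1
  refine ⟨i0, i1, ?_⟩
  have hl := (aecover_Ioi (μ := volume) (tendsto_id : Tendsto (fun c : ℝ => c) atBot
    atBot)).integral_tendsto_of_countably_generated (i0.sub i1)
  refine tendsto_nhds_unique hl ?_
  have e1 := tendsto_left_edge hG hg ξ
  have e2 := (continuous_conj.tendsto _).comp (tendsto_left_edge hG hg (conj ξ))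
  have e3 := ((e1.sub e2).const_mul I).add_const
    (2 * π * I * ((if 0 < ξ.im then G (Complex.log ξ) else 0)
        - conj (if ξ.im < 0 then G (Complex.log (conj ξ)) else 0)))
  have hval : I * ((if ξ = 0 then π * g₀ else 0) - conj (if conj ξ = 0 then π * g₀ else 0)) =
      if ξ = 0 then ((-2 * π * g₀.im : ℝ) : ℂ) else 0 := by
    by_cases h : ξ = 0
    · simp only [h, map_zero, if_true, map_mul, conj_ofReal]
      apply ext <;> simp
      ring
    · simp [h]
  rw [hval] at e3
  refine e3.congr' ?_
  have hc : ∀ᶠ c : ℝ in atBot, Admissible c ξ ∧ (ξ = 0 ∨ Real.exp c < ‖ξ‖) := by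
    rcases hξ with rfl | h
    · exact Eventually.of_forall fun c => ⟨Or.inl (by simpa using exp_pos c), Or.inl rfl⟩
    · have h2 : 0 < ‖ξ‖ := norm_pos_iff.2 fun h3 => h (by simp [h3])
      filter_upwards [tendsto_exp_atBot.eventually (gt_mem_nhds h2)] with c hc
      exact ⟨Or.inr ⟨hc, h⟩, Or.inr hc⟩
  filter_upwards [hc] with c ⟨hadm, hcξ⟩
  have hid := (hG c).identity hadm h0.integrableOn h1.integrableOn
  have hconj : (∫ y in 0..π, conj (G (c + y * I)) * cker ξ (c - y * I)) =
      conj (∫ y in 0..π, G (c + y * I) * cker (conj ξ) (c + y * I)) := by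
    rw [← intervalIntegral_conj]
    refine intervalIntegral.integral_congr fun y _ => ?_
    simp only [map_mul, conj_cker, conj_conj, map_add, conj_ofReal, conj_I,
      mul_neg, ← sub_eq_add_neg]
  have hr1 : res G c ξ = if 0 < ξ.im then G (Complex.log ξ) else 0 := by
    split_ifs with h
    · rcases hcξ with rfl | h2
      · simp at h
      · exact res_of_im_pos h2 h
    · exact res_of_im_nonpos (not_lt.1 h)
  have hr2 : res G c (conj ξ) = if ξ.im < 0 then G (Complex.log (conj ξ)) else 0 := by
    split_ifs with h
    · rcases hcξ with rfl | h2
      · simp at h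
      · exact res_of_im_pos (by simpa using h2) (by simpa using h)
    · exact res_of_im_nonpos (by simpa using h)
  rw [hconj, hr1, hr2] at hid
  simp only [Pi.sub_apply]
  exact hid.symm

theorem exp_log_arg {z : ℂ} (h : ‖z‖ = 1) : exp (arg z * I) = z := by
  have := Complex.norm_mul_exp_arg_mul_I z
  rwa [h, Complex.ofReal_one, one_mul] at this

theorem conj_div_self_eq {z : ℂ} (hz : z ≠ 0) : conj z / z = exp (-(2 * arg z) * I) := by
  have h1 := Complex.norm_mul_exp_arg_mul_I z
  have hn : (‖z‖ : ℂ) ≠ 0 := by exact_mod_cast norm_ne_zero_iff.2 hz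
  rw [div_eq_iff hz]
  generalize arg z = θ at h1 ⊢
  rw [← h1, map_mul, ← exp_conj, conj_ofReal, map_mul, conj_I,
    conj_ofReal, mul_left_comm, ← exp_add]
  congr 2
  ring

namespace NZProfile

variable {D : NZProfile}

theorem norm_qp_div_qm : ‖D.qp / D.qm‖ = 1 := by
  rw [norm_div, D.norm_qp, D.norm_qm, div_self D.q₀_pos.ne']

theorem Decays.one (h : D.Decays 2) : D.Decays 1 := by
  have key : ∀ {S : Set ℝ} {v : ℂ}, IntegrableOn (fun x : ℝ => (1 + |x|) ^ 2 * ‖D.q x - v‖) S →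
      IntegrableOn (fun x : ℝ => (1 + |x|) ^ 1 * ‖D.q x - v‖) S := fun {S v} hi => by
    refine hi.mono' ?_ (Eventually.of_forall fun x => ?_)
    · have := D.continuous_q
      exact Continuous.aestronglyMeasurable (by fun_prop)
    · rw [norm_mul, norm_norm, norm_eq_abs, abs_of_nonneg (by positivity)]
      gcongr
      · linarith [abs_nonneg x]
      · norm_num
  exact ⟨key h.1, key h.2⟩

variable (D) in
/-- The logarithm of the jump on the real line in the defocusing case. -/
def logR (x : ℝ) : ℝ := log (1 - ‖D.r (-1) x‖ ^ 2)

theorem logR_eq (h : D.Decays 1) {x : ℝ} (hx : x ≠ 0) (h1 : |x| ≠ D.q₀) :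
    D.logR x = -2 * log ‖D.a (-1) x‖ := by
  have h2 := normSq_a_add h abs_neg_one hx (lam_neg_one_ne_zero hx h1)
  have h3 := one_le_norm_a h hx h1
  have h4 : ‖D.a (-1) x‖ ≠ 0 := by linarith
  have : 1 - ‖D.r (-1) x‖ ^ 2 = (‖D.a (-1) x‖ ^ 2)⁻¹ := by
    rw [r, norm_div]
    field_simp; linarith
  rw [logR, this, Real.log_inv, Real.log_pow]
  push_cast; ring

theorem defocusing (h : D.Decays 1) {N : ℕ} {ζs : Fin N → ℂ}
    (hinj : Function.Injective ζs) (hrange : range ζs = {ζ : ℂ | 0 < ζ.im ∧ D.a (-1) ζ = 0}) :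
    (∀ ζ : ℂ, ζ.im ≠ 0 → Integrable (fun η : ℝ => (D.logR η : ℂ) / (η - ζ))) ∧
      Integrable (fun η : ℝ => D.logR η / η) ∧
      (∀ ζ : ℂ, 0 < ζ.im → D.a (-1) ζ = exp (-(1 / (2 * π * I)) * ∫ η : ℝ, (D.logR η : ℂ) / (η - ζ))
            * (∏ j, (ζ - ζs j) / (ζ - conj (ζs j)))
            * exp (I * D.omega0 (-1))) ∧
      (∀ ζ : ℂ, ζ.im < 0 → D.aTilde (-1) ζ = exp ((1 / (2 * π * I)) *
              ∫ η : ℝ, (D.logR η : ℂ) / (η - ζ))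
            * (∏ j, (ζ - conj (ζs j)) / (ζ - ζs j))
            * exp (-(I * D.omega0 (-1)))) ∧
      ∃ n : ℤ, arg (D.qp / D.qm) - 2 * D.omega0 (-1) = 2 * (∑ j, arg (ζs j))
          + 1 / (2 * π) * (∫ η : ℝ, D.logR η / η)
          + 2 * π * n := by
  obtain ⟨G, P, hG, haG, hre, ⟨g₀, hg₀, hg⟩, hmid⟩ := exists_defocusing_log h hinj hrange
  have hq0 := D.q₀_pos
  have hpi := pi_pos
  set c := log D.q₀ with hc
  have hexpc : Real.exp c = D.q₀ := Real.exp_log hq0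
  have habs : ∀ u, u ≠ c → |Real.exp u| ≠ D.q₀ := fun u hu h1 => hu (by
    rw [abs_exp] at h1; rw [hc, ← h1, log_exp])
  have habs' : ∀ u, u ≠ c → |-Real.exp u| ≠ D.q₀ := fun u hu => by rw [abs_neg]; exact habs u hu
  have hpos := fun u hu => one_le_norm_a h (exp_pos u).ne' (habs u hu)
  have hpos' := fun u hu => one_le_norm_a h (neg_ne_zero.2 (exp_pos u).ne') (habs' u hu)
  have hcexp : ∀ u, Real.exp (2 * c - u) = D.q₀ ^ 2 / Real.exp u := fun u => by
    rw [Real.exp_sub, two_mul, Real.exp_add, hexpc, sq]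
  obtain ⟨j0, j1⟩ := (hG c).integrableOn_re (s := 1) (by simp)
    (fun u hu => by rw [one_mul, (hre u hu.ne').1]; exact Real.log_nonneg (hpos u hu.ne'))
    (fun u hu => by rw [one_mul, (hre u hu.ne').2]; exact Real.log_nonneg (hpos' u hu.ne')) hmid
  have h0 : Integrable fun u : ℝ => (G u).re := integrable_of_reflection j0 j0 fun u hu => by
    rw [(hre u hu).1, (hre (2 * c - u) fun h2 => hu (by linarith)).1, hcexp,
      ← norm_a_inv h abs_neg_one (exp_pos u).ne']
    simp
  have h1 : Integrable fun u : ℝ => (G (u + π * I)).re :=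
    integrable_of_reflection j1 j1 fun u hu => by
      rw [(hre u hu).2, (hre (2 * c - u) fun h2 => hu (by linarith)).2, hcexp,
        ← norm_a_inv h abs_neg_one (neg_ne_zero.2 (exp_pos u).ne')]
      simp [div_neg]
  have hae : ∀ᵐ u : ℝ, u ≠ c := Measure.ae_ne volume c
  have key : ∀ ξ : ℂ, (ξ = 0 ∨ ξ.im ≠ 0) → Integrable (fun η : ℝ => (D.logR η : ℂ) / (η - ξ)) ∧
      ∫ η : ℝ, (D.logR η : ℂ) / (η - ξ) =
      -((if ξ = 0 then ((-2 * π * g₀.im : ℝ) : ℂ) else 0)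
      + 2 * π * I * ((if 0 < ξ.im then G (Complex.log ξ) else 0)
        - conj (if ξ.im < 0 then G (Complex.log (conj ξ)) else 0))) := fun ξ hξ => by
    obtain ⟨i0, i1, hid⟩ := full_identity hG hg h0 h1 hξ
    have k0 : ∀ᵐ u : ℝ, Real.exp u • ((D.logR (Real.exp u) : ℂ)
        / ((Real.exp u : ℝ) - ξ)) = -(2 * ((G u).re : ℂ) * cker ξ u) := by
      filter_upwards [hae] with u hu
      rw [exp_smul_div, (hre u hu).1, logR_eq h (exp_pos u).ne' (habs u hu)]
      push_cast; ring
    have k1 : ∀ᵐ u : ℝ, Real.exp u • ((D.logR (-Real.exp u) : ℂ) / ((-Real.exp u : ℝ) - ξ)) =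
        2 * ((G (u + π * I)).re : ℂ) * cker ξ (u + π * I) := by
      filter_upwards [hae] with u hu
      rw [exp_smul_neg_div, (hre u hu).2, logR_eq h (neg_ne_zero.2 (exp_pos u).ne') (habs' u hu)]
      push_cast; ring
    obtain ⟨r1, r2⟩ := integrable_and_integral_real_line
      (f := fun η : ℝ => (D.logR η : ℂ) / (η - ξ))
      (i0.neg.congr (by filter_upwards [k0] with u hu using hu.symm))
      (i1.congr (by filter_upwards [k1] with u hu using hu.symm))
    refine ⟨r1, r2.trans ?_⟩
    rw [← hid, ← integral_neg]
    refine integral_congr_ae ?_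
    filter_upwards [k0, k1] with u hu0 hu1
    rw [hu0, hu1]
    ring
  have h2pi : (2 * π * I : ℂ) ≠ 0 := Complex.two_pi_I_ne_zero
  have hup : ∀ ζ : ℂ, 0 < ζ.im → D.a (-1) ζ = exp (G (Complex.log ζ)) * blaschke ζs ζ
      * exp (I * D.omega0 (-1)) := fun ζ hζ => by
    have hζ0 : ζ ≠ 0 := fun h2 => by simp [h2] at hζ
    have hmem := log_mem_strip (c := log ‖ζ‖ - 1) (ξ := ζ) (by
      rw [← Real.lt_log_iff_exp_lt (norm_pos_iff.2 hζ0)]; linarith) hζ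
    have := haG (Complex.log ζ) hmem.2
    rwa [exp_log hζ0] at this
  have hreal : Integrable (fun η : ℝ => D.logR η / η) ∧ ∫ η : ℝ, D.logR η / η = 2 * π * g₀.im := by
    obtain ⟨k1, k2⟩ := key 0 (Or.inl rfl)
    have heq : (fun η : ℝ => (D.logR η : ℂ) / (η - 0)) = fun η : ℝ => ((D.logR η / η : ℝ) : ℂ) := by
      ext η; push_cast; rw [sub_zero]
    rw [heq] at k1 k2
    refine ⟨by simpa using k1.re, ?_⟩
    rw [integral_complex_ofReal] at k2
    simp only [if_true, zero_im, lt_irrefl, if_false, map_zero, sub_zero, mul_zero, add_zero] at k2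
    have := congrArg re k2
    rw [ofReal_re, Complex.neg_re, ofReal_re] at this
    rw [this]; ring
  refine ⟨fun ζ hζ => (key ζ (Or.inr hζ)).1, hreal.1, fun ζ hζ => ?_, fun ζ hζ => ?_, ?_⟩
  · have hζ0 : ζ ≠ 0 := fun h2 => by simp [h2] at hζ
    rw [(key ζ (Or.inr hζ.ne')).2, if_neg hζ0, if_pos hζ, if_neg hζ.le.not_gt, hup ζ hζ, blaschke]
    congr 3
    rw [map_zero, sub_zero, zero_add]
    field_simp
  · have hζ0 : ζ ≠ 0 := fun h2 => by simp [h2] at hζ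
    have hl : (D.lam (-1) ζ).im ≤ 0 := not_lt.1 fun h2 => hζ.le.not_gt (lam_im_pos_iff.1 h2)
    rw [(key ζ (Or.inr hζ.ne)).2, if_neg hζ0, if_neg hζ.le.not_gt, if_pos hζ,
      aTilde_eq abs_neg_one h hζ0 hl, hup (conj ζ) (by simpa using hζ), blaschke]
    simp only [map_mul, map_prod, map_div₀, map_sub, conj_conj, ← exp_conj,
      conj_I, conj_ofReal, neg_mul]
    congr 3
    field_simp; ring
  · rw [hreal.2]
    have hz : ∀ j, ζs j ≠ 0 := fun j hj => by
      have : ζs j ∈ range ζs := ⟨j, rfl⟩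
      rw [hrange] at this
      have := this.1
      simp [hj] at this
    have hE : exp g₀ = exp (((arg (D.qp / D.qm) - 2 * D.omega0 (-1)
        - 2 * ∑ j, arg (ζs j) : ℝ) : ℂ) * I) := by
      rw [hg₀]
      conv_lhs => rw [← exp_log_arg norm_qp_div_qm]
      simp only [conj_div_self_eq (hz _)]
      rw [← exp_sum, ← exp_neg, ← exp_nat_mul, ← exp_add, ← exp_add]
      congr 1
      push_cast
      rw [← Finset.sum_mul, Finset.sum_neg_distrib, ← Finset.mul_sum]
      ring
    obtain ⟨n, hn⟩ := Complex.exp_eq_exp_iff_exists_int.1 hE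
    refine ⟨-n, ?_⟩
    have := congrArg im hn
    simp only [add_im, mul_im, ofReal_re, ofReal_im, Complex.I_re,
      Complex.I_im, mul_one, mul_zero, mul_re, Complex.intCast_re, Complex.intCast_im,
      zero_mul, add_zero, sub_zero, Complex.re_ofNat, Complex.im_ofNat] at this
    rw [this]
    push_cast
    field_simp; ring

end NZProfile

theorem isOpen_strip (c : ℝ) : IsOpen (strip c) := by
  rw [strip_eq]; exact isOpen_Ioi.reProdIm isOpen_Ioo

theorem convex_strip (c : ℝ) : Convex ℝ (strip c) :=
  ((convex_Ioi c).linear_preimage reLm).inter ((convex_Ioo 0 π).linear_preimage imLm)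

theorem comap_re_inf_le (c : ℝ) : comap re atTop ⊓ 𝓟 fstrip ≤ comap re atTop ⊓ 𝓟 (strip c) := by
  refine le_inf inf_le_left (le_principal_iff.2 ?_)
  filter_upwards [mem_inf_of_left (preimage_mem_comap (Ioi_mem_atTop c)),
    mem_inf_of_right (mem_principal_self fstrip)] with w h1 h2 using ⟨h1, h2⟩

theorem norm_neg_sq_mul_inv (q : ℝ) (ζ : ℂ) : ‖-(q : ℂ) ^ 2 * ζ⁻¹‖ = q ^ 2 / ‖ζ‖ := by
  rw [norm_mul, norm_neg, norm_pow, norm_inv, norm_real, norm_eq_abs, sq_abs, div_eq_mul_inv]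

theorem im_neg_sq_mul_inv (q : ℝ) (ζ : ℂ) : (-(q : ℂ) ^ 2 * ζ⁻¹).im = q ^ 2 * ζ.im / ‖ζ‖ ^ 2 := by
  rw [show -(q : ℂ) ^ 2 * ζ⁻¹ = ((-q ^ 2 : ℝ) : ℂ) * ζ⁻¹ by push_cast; ring,
    im_ofReal_mul, inv_im, normSq_eq_norm_sq]
  ring

/-- The images `-q²/z̄` of the points `z`. -/
def zrefl {N : ℕ} (q : ℝ) (zs : Fin N → ℂ) (j : Fin N) : ℂ := -(q : ℂ) ^ 2 * (conj (zs j))⁻¹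

/-- The product of the Blaschke factors for zeros `z` and `-q²/z̄` of multiplicity `p`. -/
def blaschkeF {N : ℕ} (q : ℝ) (p : ℕ) (zs : Fin N → ℂ) (ζ : ℂ) : ℂ :=
  (blaschke zs ζ * blaschke (zrefl q zs) ζ) ^ p

theorem conj_blaschke {N : ℕ} (zs : Fin N → ℂ) (ζ : ℂ) :
    conj (blaschke zs ζ) = (blaschke zs (conj ζ))⁻¹ := by
  rw [inv_blaschke, blaschke]
  simp

theorem conj_blaschkeF {N : ℕ} (q : ℝ) (p : ℕ) (zs : Fin N → ℂ) (ζ : ℂ) :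
    conj (blaschkeF q p zs ζ) = (blaschkeF q p zs (conj ζ))⁻¹ := by
  rw [blaschkeF, blaschkeF, map_pow, map_mul, conj_blaschke, conj_blaschke, ← mul_inv, inv_pow]

theorem blaschkeF_inv {N : ℕ} {q : ℝ} (hq : q ≠ 0) (p : ℕ) {zs : Fin N → ℂ} (hz : ∀ j, zs j ≠ 0)
    {ζ : ℂ} (hζ : ζ ≠ 0) : blaschkeF q p zs (-(q : ℂ) ^ 2 * ζ⁻¹) =
      (∏ j, (zs j / conj (zs j))) ^ (2 * p) * (blaschkeF q p zs ζ)⁻¹ := by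
  have hqc : (q : ℂ) ≠ 0 := by exact_mod_cast hq
  rw [blaschkeF, blaschkeF, pow_mul, ← inv_pow, ← mul_pow]
  congr 1
  rw [mul_inv, inv_blaschke, inv_blaschke, blaschke, blaschke, ← prod_mul_distrib,
    ← prod_mul_distrib, ← prod_pow, ← prod_mul_distrib]
  refine prod_congr rfl fun j _ => ?_
  have h1 := hz j
  have h2 : conj (zs j) ≠ 0 := by simpa using h1
  have e1 : -(q : ℂ) ^ 2 * ζ⁻¹ - zs j = -(zs j / ζ) * (ζ - conj (zrefl q zs j)) := by
    simp only [zrefl, map_mul, map_neg, map_pow, conj_ofReal, map_inv₀, conj_conj]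
    field_simp; ring
  have e2 : -(q : ℂ) ^ 2 * ζ⁻¹ - conj (zs j) = -(conj (zs j) / ζ) * (ζ - zrefl q zs j) := by
    simp only [zrefl]
    field_simp; ring
  have e3 : -(q : ℂ) ^ 2 * ζ⁻¹ - zrefl q zs j =
      (q ^ 2 / (ζ * conj (zs j))) * (ζ - conj (zs j)) := by
    simp only [zrefl]
    field_simp; ring
  have e4 : -(q : ℂ) ^ 2 * ζ⁻¹ - conj (zrefl q zs j) = (q ^ 2 / (ζ * zs j)) * (ζ - zs j) := by
    simp only [zrefl, map_mul, map_neg, map_pow, conj_ofReal, map_inv₀, conj_conj]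
    field_simp; ring
  rw [e1, e2, e3, e4, mul_div_mul_comm, mul_div_mul_comm]
  field_simp

theorem norm_blaschkeF_ofReal {N : ℕ} (q : ℝ) (p : ℕ) {zs : Fin N → ℂ}
    {x : ℝ} (h : ∀ j, (x : ℂ) ≠ zs j) (h' : ∀ j, (x : ℂ) ≠ zrefl q zs j) :
    ‖blaschkeF q p zs x‖ = 1 := by
  rw [blaschkeF, norm_pow, norm_mul, norm_blaschke_ofReal h, norm_blaschke_ofReal h', one_mul,
    one_pow]

theorem inv_blaschkeF {N : ℕ} (q : ℝ) (p : ℕ) (zs : Fin N → ℂ) (ζ : ℂ) :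
    (blaschkeF q p zs ζ)⁻¹ = ((blaschke zs ζ)⁻¹ * (blaschke (zrefl q zs) ζ)⁻¹) ^ p := by
  rw [blaschkeF, ← mul_inv, inv_pow]

theorem continuousAt_inv_blaschkeF {N : ℕ} {q : ℝ} {p : ℕ} {zs : Fin N → ℂ} {ζ : ℂ}
    (h : ∀ j, ζ ≠ zs j) (h' : ∀ j, ζ ≠ zrefl q zs j) :
    ContinuousAt (fun ζ => (blaschkeF q p zs ζ)⁻¹) ζ := by
  simp only [inv_blaschkeF]
  exact ((continuousAt_inv_blaschke h).mul (continuousAt_inv_blaschke h')).pow p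

theorem regInf_inv_blaschkeF {N : ℕ} (q : ℝ) (p : ℕ) (zs : Fin N → ℂ) :
    RegInf fun ζ => (blaschkeF q p zs ζ)⁻¹ := by
  simp only [inv_blaschkeF]
  exact ((regInf_inv_blaschke _).mul (regInf_inv_blaschke _)).pow p

namespace NZProfile

variable {D : NZProfile}

theorem lam_im_one (ζ : ℂ) : (D.lam 1 ζ).im = ζ.im * (‖ζ‖ ^ 2 - D.q₀ ^ 2) / (2 * ‖ζ‖ ^ 2) := by
  rcases eq_or_ne ζ 0 with rfl | h
  · simp [lam]
  have h1 : ‖ζ‖ ^ 2 ≠ 0 := by positivity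
  have : D.lam 1 ζ = (ζ + ((D.q₀ ^ 2 : ℝ) : ℂ) * ζ⁻¹) / 2 := by rw [lam]; push_cast; ring
  rw [this, div_ofNat_im, add_im, im_ofReal_mul, inv_im, normSq_eq_norm_sq]
  field_simp; ring

theorem D₁_eq : D.D₁ = {ζ | 0 < (D.lam 1 ζ).im} := by
  ext ζ
  simp only [D₁, Set.mem_ofPred_eq, lam_im_one]
  rcases eq_or_ne ζ 0 with rfl | h
  · simp
  · have h1 : 0 < 2 * ‖ζ‖ ^ 2 := by positivity
    rw [div_pos_iff_of_pos_right h1, mul_comm]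

theorem mem_upper_one {ζ : ℂ} (h : D.q₀ ≤ ‖ζ‖) (hi : 0 ≤ ζ.im) : ζ ∈ D.upper 1 := by
  have h1 : 0 < ‖ζ‖ := D.q₀_pos.trans_le h
  refine ⟨norm_pos_iff.1 h1, ?_⟩
  rw [lam_im_one]
  have : D.q₀ ^ 2 ≤ ‖ζ‖ ^ 2 := pow_le_pow_left₀ D.q₀_pos.le h 2
  exact div_nonneg (mul_nonneg hi (sub_nonneg.2 this)) (by positivity)

theorem lam_im_one_pos {ζ : ℂ} (h : D.q₀ < ‖ζ‖) (hi : 0 < ζ.im) : 0 < (D.lam 1 ζ).im := by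
  have h1 : 0 < ‖ζ‖ := D.q₀_pos.trans h
  rw [lam_im_one]
  have : D.q₀ ^ 2 < ‖ζ‖ ^ 2 := pow_lt_pow_left₀ h D.q₀_pos.le two_ne_zero
  exact div_pos (mul_pos hi (sub_pos.2 this)) (by positivity)

theorem lam_one_eq_zero_iff {ζ : ℂ} (hζ : ζ ≠ 0) :
    D.lam 1 ζ = 0 ↔ ζ = I * D.q₀ ∨ ζ = -(I * D.q₀) := by
  have h1 := D.lam_mul (κ := 1) hζ
  have h2 : 2 * D.lam 1 ζ * ζ = (ζ - I * D.q₀) * (ζ + I * D.q₀) := by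
    rw [h1]
    push_cast
    linear_combination (D.q₀ : ℂ) ^ 2 * I_sq
  constructor
  · intro h
    rw [h, mul_zero, zero_mul, eq_comm, mul_eq_zero] at h2
    exact h2.imp sub_eq_zero.1 eq_neg_of_add_eq_zero_left
  · rintro (h | h)
    all_goals
      have h3 : 2 * D.lam 1 ζ * ζ = 0 := by rw [h2, h]; ring
      simpa [hζ] using h3

/-- The logarithm of `a` without its zeros, in the focusing case. -/
theorem exists_focusing_log (h : D.Decays 1) (hns : D.NoSpectralSingularity) {N p : ℕ} (hp : p ≠ 0)
    {ζs : Fin N → ℂ} (henum : D.EnumeratesZeros ζs)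
    (hord : ∀ j, ∃ g, AnalyticAt ℂ g (ζs j) ∧ g (ζs j) ≠ 0 ∧
      ∀ᶠ w in 𝓝 (ζs j), D.a 1 w = (w - ζs j) ^ p * g w) :
    ∃ G : ℂ → ℂ, StripLog G (log D.q₀) {(log D.q₀ : ℂ) + (π / 2 : ℝ) * I} ∧
      (∀ w ∈ cstrip (log D.q₀), w ≠ (log D.q₀ : ℂ) + (π / 2 : ℝ) * I →
        D.a 1 (exp w) = exp (G w) * blaschkeF D.q₀ p ζs (exp w) * exp (I * D.omega0 1)) ∧
      (∀ w ∈ cstrip (log D.q₀), w ∉ strip (log D.q₀) → blaschkeF D.q₀ p ζs (exp w) ≠ 0) ∧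
      ∃ C B : ℝ, ∀ u : ℝ, B ≤ u → ‖G (u + (π / 2 : ℝ) * I)‖ ≤ C * Real.exp (-u) := by
  obtain ⟨hinj, hrange⟩ := henum
  set c := log D.q₀ with hc
  have hq0 := D.q₀_pos
  have hpi := pi_pos
  have hexpc : Real.exp c = D.q₀ := Real.exp_log hq0
  have hz : ∀ j, D.q₀ < ‖ζs j‖ ∧ 0 < (ζs j).im ∧ D.a 1 (ζs j) = 0 := fun j => by
    have : ζs j ∈ range ζs := ⟨j, rfl⟩
    rwa [hrange] at this
  have hznorm : ∀ j, ‖zrefl D.q₀ ζs j‖ < D.q₀ := fun j => by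
    have h1 := (hz j).1
    rw [zrefl, norm_neg_sq_mul_inv, norm_conj, div_lt_iff₀ (hq0.trans h1)]
    nlinarith
  have hne' : ∀ ζ : ℂ, D.q₀ ≤ ‖ζ‖ → ∀ j, ζ ≠ zrefl D.q₀ ζs j := fun ζ h1 j h2 =>
    (hznorm j).not_ge (h2 ▸ h1)
  have hbr0 : ∀ ζ : ℂ, D.q₀ ≤ ‖ζ‖ → blaschke (zrefl D.q₀ ζs) ζ ≠ 0 := fun ζ h1 =>
    blaschke_ne_zero (hne' ζ h1) fun j h2 => (hznorm j).not_ge (by rwa [← norm_conj, ← h2])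
  set V : Set ℂ := {ζ | D.q₀ < ‖ζ‖ ∧ 0 < ζ.im}
  have hVo : IsOpen V := (isOpen_lt continuous_const continuous_norm).inter
    (isOpen_lt continuous_const continuous_im)
  have hVl : ∀ ζ ∈ V, 0 < (D.lam 1 ζ).im := fun ζ hζ => lam_im_one_pos hζ.1 hζ.2
  have hexpV : ∀ w ∈ strip c, exp w ∈ V := fun w hw => by
    refine ⟨?_, exp_im_pos hw.2⟩
    rw [norm_exp, ← hexpc]
    exact Real.exp_lt_exp.2 hw.1
  -- boundary points
  have hbd : ∀ q ∈ cstrip c, q ∉ strip c → D.q₀ ≤ ‖exp q‖ ∧ 0 ≤ (exp q).im ∧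
      exp q ∈ D.contour ∧ (∀ j, exp q ≠ ζs j) := fun q hq hqs => by
    have h1 : D.q₀ ≤ ‖exp q‖ := by rw [norm_exp, ← hexpc]; exact Real.exp_le_exp.2 hq.1
    have h2 : 0 ≤ (exp q).im := by
      rw [exp_im]
      exact mul_nonneg (exp_pos _).le (Real.sin_nonneg_of_nonneg_of_le_pi hq.2.1 hq.2.2)
    have h3 : (exp q).im = 0 ∨ ‖exp q‖ = D.q₀ := by
      by_contra h4
      push Not at h4
      refine hqs ⟨lt_of_le_of_ne hq.1 fun h5 => h4.2 ?_, lt_of_le_of_ne hq.2.1 fun h5 => h4.1 ?_,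
        lt_of_le_of_ne hq.2.2 fun h5 => h4.1 ?_⟩
      · rw [norm_exp, ← h5, hexpc]
      · rw [exp_im, ← h5, Real.sin_zero, mul_zero]
      · rw [exp_im, h5, Real.sin_pi, mul_zero]
    refine ⟨h1, h2, h3, fun j hj => ?_⟩
    rw [hj] at h3
    exact h3.elim (hz j).2.1.ne' (hz j).1.ne'
  have hbF0 : ∀ q ∈ cstrip c, q ∉ strip c → blaschkeF D.q₀ p ζs (exp q) ≠ 0 := fun q hq hqs => by
    obtain ⟨h1, h2, -, h4⟩ := hbd q hq hqs
    exact pow_ne_zero _ (mul_ne_zero (blaschke_ne_zero h4 fun j => ne_conj_of_im (hz j).2.1 h2)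
      (hbr0 _ h1))
  have hnb : ∀ q ∈ cstrip c, (𝓝[D.D₁] exp q).NeBot := fun q hq => by
    rw [← closure_strip] at hq
    have := mem_closure_iff_nhdsWithin_neBot.1 hq
    have hexp : Tendsto exp (𝓝[strip c] q) (𝓝[D.D₁] exp q) :=
      continuous_exp.continuousWithinAt.tendsto_nhdsWithin fun w hw => by
        rw [D₁_eq]; exact hVl _ (hexpV w hw)
    exact NeBot.mono inferInstance hexp
  set p₀ : ℂ := (c : ℂ) + (π / 2 : ℝ) * I with hp₀
  have hp₀c : p₀ ∈ cstrip c := by refine ⟨?_, ?_, ?_⟩ <;> simp [hp₀] <;> linarith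
  have hp₀s : p₀ ∉ strip c := fun h1 => by simpa [hp₀] using h1.1
  have hep₀ : exp p₀ = I * D.q₀ := by
    rw [hp₀, exp_add]
    push_cast
    rw [Complex.exp_pi_div_two_mul_I, ← ofReal_exp, hexpc, mul_comm]
  obtain ⟨G, hGs, -, hG, hmid⟩ := exists_log_of_zeros h abs_one (convex_strip c) (isOpen_strip c)
    (comap_re_inf_le c) hVo hexpV hVl hp hinj hord (fun w hw ha => by
      have : w ∈ range ζs := by rw [hrange]; exact ⟨hw.1, hw.2, ha⟩
      exact this) (regInf_inv_blaschkeF D.q₀ p ζs)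
    (E := fun ζ => (∏ j, (ζ - conj (ζs j))) ^ p * (blaschke (zrefl D.q₀ ζs) ζ)⁻¹ ^ p)
    (DifferentiableOn.fun_mul (Differentiable.differentiableOn (by fun_prop)) (by
      simp only [inv_blaschke]
      refine DifferentiableOn.fun_pow (DifferentiableOn.fun_finsetProd fun j _ => ?_) p
      exact DifferentiableOn.fun_div (Differentiable.differentiableOn (by fun_prop))
        (Differentiable.differentiableOn (by fun_prop)) fun ζ hζ =>
          sub_ne_zero.2 (hne' ζ hζ.1.le j)))
    (fun ζ hζ => mul_ne_zero (pow_ne_zero _ (prod_ne_zero_iff.2 fun j _ =>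
      sub_ne_zero.2 (ne_conj_of_im (hz j).2.1 hζ.2.le)))
      (pow_ne_zero _ (_root_.inv_ne_zero (hbr0 ζ hζ.1.le))))
    (fun ζ hζ => by
      have h1 := hbr0 ζ hζ.1.le
      have h2 : ∏ j, (ζ - conj (ζs j)) ≠ 0 := prod_ne_zero_iff.2 fun j _ =>
        sub_ne_zero.2 (ne_conj_of_im (hz j).2.1 hζ.2.le)
      rw [blaschkeF, ← mul_pow, ← mul_pow, prod_pow, blaschke, Finset.prod_div_distrib]
      congr 1
      field_simp)
    (P := {p₀}) (fun q hq => by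
      rw [mem_singleton] at hq
      subst hq
      rw [closure_strip]
      refine ⟨hp₀c, ⟨1, one_ne_zero, fun w hw => by simpa [hp₀] using hw.1⟩,
        (lam_one_eq_zero_iff (exp_ne_zero _)).2 (Or.inl hep₀), fun ht => ?_⟩
      have := hnb _ hp₀c
      rw [← D₁_eq] at ht
      exact hns _ (hbd _ hp₀c hp₀s).2.2.1 ht.mapClusterPt)
    (fun q hq hqs => by
      rw [closure_strip] at hq
      obtain ⟨h1, -, -, h4⟩ := hbd q hq hqs
      exact ⟨h4, hbF0 q hq hqs, continuousAt_inv_blaschkeF h4 (hne' _ h1)⟩)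
    (fun q hq hqs hqp => by
      rw [closure_strip] at hq
      obtain ⟨h1, h2, h3, -⟩ := hbd q hq hqs
      have hl : D.lam 1 (exp q) ≠ 0 := fun h0 => by
        rcases (lam_one_eq_zero_iff (exp_ne_zero q)).1 h0 with h5 | h5
        · rw [← hep₀] at h5
          exact hqp (mem_singleton.2 (Complex.exp_inj_of_neg_pi_lt_of_le_pi (by linarith [hq.2.1])
            hq.2.2 (by linarith [hp₀c.2.1]) hp₀c.2.2 h5))
        · rw [h5] at h2
          simp at h2
          linarith
      refine ⟨hl, fun ha => hns _ h3 ?_⟩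
      have := hnb q hq
      have ht : Tendsto (D.a 1) (𝓝[D.D₁] exp q) (𝓝 (D.a 1 (exp q))) :=
        (continuousOn_a h abs_one _ ⟨mem_upper_one h1 h2, hl⟩).mono fun w hw => by
          rw [D₁_eq] at hw
          exact ⟨mem_upper_of_im hw, lam_ne_zero_of_im hw⟩
      rw [ha] at ht
      exact ht.mapClusterPt)
  exact ⟨G, hGs c le_rfl, fun w hw hwp => hG w (by
    rw [closure_strip]; exact ⟨hw, by simpa using hwp⟩), hbF0, hmid⟩

end NZProfile

/-- The Cauchy kernel at the point `-e^{2c} e^{-w}`. -/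
def rker (c : ℝ) (ξ w : ℂ) : ℂ := cker ξ (2 * c - w + π * I)

theorem rker_zero (c : ℝ) (w : ℂ) : rker c 0 w = 1 := cker_zero _

theorem rker_eq {c : ℝ} {ξ w : ℂ} (hξ : ξ ≠ 0) (hw : exp w ≠ -(Real.exp c : ℂ) ^ 2 * ξ⁻¹) :
    rker c ξ w = cker 0 w - cker (-(Real.exp c : ℂ) ^ 2 * ξ⁻¹) w := by
  have h1 : exp w - -(Real.exp c : ℂ) ^ 2 * ξ⁻¹ ≠ 0 := sub_ne_zero.2 hw
  have h3 : (Real.exp c : ℂ) ≠ 0 := by exact_mod_cast (exp_pos c).ne'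
  have h4 := exp_ne_zero w
  have h5 : exp w * ξ + (Real.exp c : ℂ) ^ 2 ≠ 0 := fun h => h1 (by
    field_simp
    linear_combination h)
  have e : exp (2 * c - w + π * I) = -((Real.exp c : ℂ) ^ 2 / exp w) := by
    rw [exp_add_pi_mul_I, exp_sub, two_mul, exp_add, ← ofReal_exp, sq]
  rw [rker, cker_zero, cker, cker, e]
  have h6 : exp w - -(Real.exp c : ℂ) ^ 2 * ξ⁻¹ =
      (exp w * ξ + (Real.exp c : ℂ) ^ 2) / ξ := by field_simp; ring
  have h7 : -((Real.exp c : ℂ) ^ 2 / exp w) - ξ =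
      -(exp w * ξ + (Real.exp c : ℂ) ^ 2) / exp w := by field_simp; ring
  rw [h6, h7]
  field_simp; ring

theorem Admissible.refl {c : ℝ} {ξ : ℂ} (h : Admissible c ξ) (h0 : ξ.im ≠ 0) :
    Admissible c (-(Real.exp c : ℂ) ^ 2 * ξ⁻¹) := by
  have hc := exp_pos c
  have hξ : 0 < ‖ξ‖ := norm_pos_iff.2 fun h3 => h0 (by simp [h3])
  rw [Admissible, norm_neg_sq_mul_inv, lt_div_iff₀ hξ, div_lt_iff₀ hξ]
  rcases h with h | h
  · refine Or.inr ⟨by nlinarith, ?_⟩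
    rw [im_neg_sq_mul_inv]
    exact div_ne_zero (mul_ne_zero (by positivity) h0) (by positivity)
  · exact Or.inl (by nlinarith [h.1])

theorem exp_add_mul_I_ne {c y : ℝ} {ξ : ℂ} (h : ‖ξ‖ ≠ Real.exp c) :
    exp (c + y * I) ≠ ξ := fun h1 => h (by
  rw [← h1, norm_exp]; simp)

theorem continuous_cker_edge {c : ℝ} {ξ : ℂ} (h : ‖ξ‖ ≠ Real.exp c) :
    Continuous fun y : ℝ => cker ξ (c + y * I) :=
  continuous_iff_continuousAt.2 fun y =>
    (continuousAt_cker (exp_add_mul_I_ne h)).comp (f := fun y : ℝ => (c : ℂ) + y * I) (by fun_prop)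

theorem Admissible.norm_ne {c : ℝ} {ξ : ℂ} (h : Admissible c ξ) : ‖ξ‖ ≠ Real.exp c :=
  h.elim (fun h => h.ne) fun h => h.1.ne'

namespace StripLog

variable {G : ℂ → ℂ} {c : ℝ} {P : Finset ℂ}

theorem intervalIntegrable_edge (hG : StripLog G c P) :
    IntervalIntegrable (fun y : ℝ => G (c + y * I)) volume 0 π :=
  (hG.edgeIntegrable le_rfl le_rfl le_rfl (le_refl c) pi_pos.le).2.2.2

theorem intervalIntegrable_edge_mul (hG : StripLog G c P) {ξ : ℂ} (h : ‖ξ‖ ≠ Real.exp c) :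
    IntervalIntegrable (fun y : ℝ => G (c + y * I) * cker ξ (c + y * I))
      volume 0 π ∧
    IntervalIntegrable (fun y : ℝ => conj (G (c + y * I)) * cker ξ (c - y * I))
      volume 0 π := by
  refine ⟨hG.intervalIntegrable_edge.mul_continuousOn (continuous_cker_edge h).continuousOn,
    (intervalIntegrable_conj hG.intervalIntegrable_edge).mul_continuousOn
      (Continuous.continuousOn ?_)⟩
  have := (continuous_cker_edge h).comp continuous_neg
  refine this.congr fun y => ?_
  simp [sub_eq_add_neg]

/-- The boundary identity for the reflected kernel. -/
theorem identity_refl (hG : StripLog G c P) {ξ : ℂ} (hξ : Admissible c ξ) (hξ' : ξ = 0 ∨ ξ.im ≠ 0)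
    (h0 : IntegrableOn (fun u : ℝ => (G u).re) (Ioi c))
    (h1 : IntegrableOn (fun u : ℝ => (G (u + π * I)).re) (Ioi c)) :
    IntegrableOn (fun u : ℝ => 2 * ((G u).re : ℂ) * rker c ξ u
      - 2 * ((G (u + π * I)).re : ℂ) * rker c ξ (u + π * I))
      (Ioi c) ∧
    (∫ u in Ioi c, (2 * ((G (u : ℝ)).re : ℂ) * rker c ξ u
        - 2 * ((G ((u : ℝ) + π * I)).re : ℂ) * rker c ξ (u + π * I))) =
      I * ((∫ y in 0..π, G (c + y * I) * rker c ξ (c + y * I))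
        - ∫ y in 0..π, conj (G (c + y * I)) * rker c ξ (c - y * I))
      - 2 * π * I * (res G c (-(Real.exp c : ℂ) ^ 2 * ξ⁻¹)
        - conj (res G c (conj (-(Real.exp c : ℂ) ^ 2 * ξ⁻¹)))) := by
  have ha0 : Admissible c 0 := Or.inl (by simpa using exp_pos c)
  have j0 := integrableOn_boundary ha0 h0 h1
  have id0 := hG.identity ha0 h0 h1
  have hr : res G c 0 = 0 := res_of_im_nonpos (by simp)
  rcases eq_or_ne ξ 0 with rfl | hne
  · simp only [map_zero, hr, inv_zero, mul_zero, sub_zero, add_zero, cker_zero, rker_zero] at *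
    exact ⟨j0, id0⟩
  set η : ℂ := -(Real.exp c : ℂ) ^ 2 * ξ⁻¹ with hη
  have him : ξ.im ≠ 0 := hξ'.resolve_left hne
  have hη' : Admissible c η := hξ.refl him
  obtain ⟨B, -, hB⟩ := exists_norm_cker_le hη'
  have hn := hη'.norm_ne
  have e1 : ∀ u : ℝ, c < u → rker c ξ u = cker 0 u - cker η u := fun u hu =>
    rker_eq hne (hB u (by simpa using hu.le) (exp_real_im u)).1
  have e2 : ∀ u : ℝ, c < u → rker c ξ (u + π * I) =
      cker 0 (u + π * I) - cker η (u + π * I) := fun u hu =>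
    rker_eq hne (hB _ (by simpa using hu.le) (exp_real_add_pi_im u)).1
  have e3 : ∀ y : ℝ, rker c ξ (c + y * I) = cker 0 (c + y * I) - cker η (c + y * I) := fun y =>
    rker_eq hne (exp_add_mul_I_ne hn)
  have e4 : ∀ y : ℝ, rker c ξ (c - y * I) = cker 0 (c - y * I) - cker η (c - y * I) := fun y => by
    have := e3 (-y)
    push_cast at this
    rwa [neg_mul, ← sub_eq_add_neg] at this
  have j1 := integrableOn_boundary hη' h0 h1
  have id1 := hG.identity hη' h0 h1
  obtain ⟨k1, k2⟩ := hG.intervalIntegrable_edge_mul hn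
  obtain ⟨k3, k4⟩ := hG.intervalIntegrable_edge_mul ha0.norm_ne
  have heq : ∀ u ∈ Ioi c, 2 * ((G (u : ℝ)).re : ℂ) * rker c ξ u
        - 2 * ((G ((u : ℝ) + π * I)).re : ℂ) * rker c ξ (u + π * I) =
      (2 * ((G u).re : ℂ) * cker 0 u - 2 * ((G (u + π * I)).re : ℂ) * cker 0 (u + π * I)) -
      (2 * ((G u).re : ℂ) * cker η u - 2 * ((G (u + π * I)).re : ℂ) * cker η (u + π * I)) :=
    fun u hu => by rw [e1 u hu, e2 u hu]; ring
  refine ⟨(j0.sub j1).congr_fun (fun u hu => (heq u hu).symm) measurableSet_Ioi, ?_⟩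
  rw [setIntegral_congr_fun measurableSet_Ioi heq, integral_sub j0 j1, id0, id1]
  simp only [e3, e4, mul_sub]
  rw [intervalIntegral.integral_sub k3 k1, intervalIntegral.integral_sub k4 k2, map_zero, hr,
    map_zero]
  ring

end StripLog

theorem rker_edge (c : ℝ) (ξ : ℂ) (y : ℝ) : rker c ξ (c + y * I) = cker ξ (c + (π - y : ℝ) * I) ∧
    rker c ξ (c - y * I) = cker ξ (c - (π - y : ℝ) * I) := by
  constructor
  · rw [rker]
    congr 1
    push_cast; ring
  · rw [rker, ← cker_add_two_pi ξ (c - (π - y : ℝ) * I)]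
    congr 1
    push_cast; ring

theorem setIntegral_Iio_reflect {F : Type*} [NormedAddCommGroup F] [NormedSpace ℝ F] (H : ℝ → F)
    (c : ℝ) : ∫ u in Iio c, H u = ∫ u in Ioi c, H (2 * c - u) := by
  have := (Measure.measurePreserving_sub_left volume (2 * c)).setIntegral_preimage_emb
    (MeasurableEquiv.subLeft (2 * c)).measurableEmbedding H (Iio c)
  rw [Set.preimage_const_sub_Iio] at this
  rw [← this]
  congr 3
  ring

theorem exp_image_Ioi (c : ℝ) : Real.exp '' Ioi c = Ioi (Real.exp c) := by
  ext x
  refine ⟨fun ⟨u, hu, h⟩ => h ▸ Real.exp_lt_exp.2 hu, fun h => ?_⟩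
  have hx : 0 < x := (exp_pos c).trans h
  exact ⟨log x, (Real.lt_log_iff_exp_lt hx).2 h, Real.exp_log hx⟩

theorem neg_exp_image_Ioi (c : ℝ) : (fun u => -Real.exp u) '' Ioi c = Iio (-Real.exp c) := by
  rw [show (fun u => -Real.exp u) = Neg.neg ∘ Real.exp from rfl, Set.image_comp, exp_image_Ioi]
  simp

theorem StripLog.arc_integrals {G : ℂ → ℂ} {c : ℝ} {P : Finset ℂ} (hG : StripLog G c P) (C : ℂ)
    {ξ : ℂ} (hn : ‖ξ‖ ≠ Real.exp c) :
    (∫ y in 0..π, (C - (G (c + y * I) + G (c + (π - y : ℝ) * I))) * cker ξ (c + y * I)) =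
      C * (∫ y in 0..π, cker ξ (c + y * I)) - (∫ y in 0..π, G (c + y * I) * cker ξ (c + y * I))
        - ∫ y in 0..π, G (c + y * I) * rker c ξ (c + y * I) := by
  have hg := hG.intervalIntegrable_edge
  have hg' := hg.comp_sub_left π
  rw [sub_zero, sub_self] at hg'
  have hk := (continuous_cker_edge hn).continuousOn (s := uIcc 0 π)
  have i1 := hg.mul_continuousOn hk
  have i2 := hg'.symm.mul_continuousOn hk
  have i3 := ((continuous_cker_edge hn).const_mul C).intervalIntegrable (μ := volume) 0 π
  have e : ∫ y in 0..π, G (c + y * I) * rker c ξ (c + y * I) = ∫ y in 0..π,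
        G (c + (π - y : ℝ) * I) * cker ξ (c + y * I) := by
    have := intervalIntegral.integral_comp_sub_left (a := 0) (b := π) (fun y : ℝ =>
      G (c + y * I) * rker c ξ (c + y * I)) π
    rw [sub_zero, sub_self] at this
    rw [← this]
    simp only [(rker_edge c ξ _).1, sub_sub_cancel]
  rw [e, ← intervalIntegral.integral_const_mul, ← intervalIntegral.integral_sub i3 i1,
    ← intervalIntegral.integral_sub (i3.sub i1) i2]
  exact intervalIntegral.integral_congr fun y _ => by ring

namespace NZProfile

variable {D : NZProfile}

/-- The Cauchy integral along the contour of a function that is built from a logarithm on the half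
strip. -/
theorem contourIntegral_eq {G : ℂ → ℂ} {P : Finset ℂ} (hG : StripLog G (log D.q₀) P)
    {ρ : ℝ → ℝ} {ℓ : ℂ → ℂ} {C : ℂ} (hℓ : ∀ x : ℝ, ℓ x = ((-2 * ρ x : ℝ) : ℂ))
    (h0 : IntegrableOn (fun u : ℝ => (G u).re) (Ioi (log D.q₀)))
    (h1 : IntegrableOn (fun u : ℝ => (G (u + π * I)).re) (Ioi (log D.q₀)))
    (hρ0 : ∀ u : ℝ, log D.q₀ < u → ρ (Real.exp u) = (G u).re)
    (hρ1 : ∀ u : ℝ, log D.q₀ < u → ρ (-Real.exp u) = (G (u + π * I)).re)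
    (hsym : ∀ x : ℝ, x ≠ 0 → ρ (-(D.q₀ ^ 2 / x)) = ρ x) (hC : conj C = -C)
    (harc : ∀ y ∈ Icc 0 π, ℓ (exp (log D.q₀ + y * I)) =
      C - (G (log D.q₀ + y * I) + G (log D.q₀ + (π - y : ℝ) * I)))
    (hconj : ∀ η, ℓ (conj η) = conj (ℓ η))
    {ξ : ℂ} (hξ : ξ = 0 ∨ ξ.im ≠ 0) (hadm : Admissible (log D.q₀) ξ) :
    D.ContourIntegrable (fun η => ℓ η / (η - ξ)) ∧
    D.contourIntegral (fun η => ℓ η / (η - ξ)) = 2 * π * I * (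
        res G (log D.q₀) (-(D.q₀ : ℂ) ^ 2 * ξ⁻¹)
        - conj (res G (log D.q₀) (conj (-(D.q₀ : ℂ) ^ 2 * ξ⁻¹)))
        - res G (log D.q₀) ξ + conj (res G (log D.q₀) (conj ξ))
        - if ‖ξ‖ < D.q₀ then C else 0) := by
  have hexpc : Real.exp (log D.q₀) = D.q₀ := Real.exp_log D.q₀_pos
  set c := log D.q₀ with hc
  have hpi := pi_pos
  have hn := hadm.norm_ne
  have hcexp : ∀ u, Real.exp (2 * c - u) = D.q₀ ^ 2 / Real.exp u := fun u => by
    rw [Real.exp_sub, two_mul, Real.exp_add, hexpc, sq]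
  set f : ℂ → ℂ := fun η => ℓ η / (η - ξ) with hf
  have s0 : ∀ u, ρ (-Real.exp (2 * c - u)) = ρ (Real.exp u) := fun u => by
    rw [hcexp, hsym _ (exp_pos u).ne']
  have s1 : ∀ u, ρ (Real.exp (2 * c - u)) = ρ (-Real.exp u) := fun u => by
    rw [hcexp, ← hsym _ (neg_ne_zero.2 (exp_pos u).ne'), div_neg, neg_neg]
  have g0 := h0.congr_fun (fun u hu => (hρ0 u hu).symm) measurableSet_Ioi
  have g1 := h1.congr_fun (fun u hu => (hρ1 u hu).symm) measurableSet_Ioi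
  have i0 := integrable_mul_cker_of_real (integrable_of_reflection g0 g1 fun u _ => s0 u) hξ
    (v := fun u : ℝ => (u : ℂ)) (by fun_prop) exp_real_im
  have i1 := integrable_mul_cker_of_real (integrable_of_reflection g1 g0 fun u _ => s1 u) hξ
    (v := fun u : ℝ => (u : ℂ) + π * I) (by fun_prop) exp_real_add_pi_im
  have k0 : ∀ u : ℝ, Real.exp u • f (Real.exp u : ℝ) =
      -2 * ((ρ (Real.exp u) : ℂ) * cker ξ u) := fun u => by
    simp only [hf]
    rw [exp_smul_div, hℓ]
    push_cast; ring
  have k1 : ∀ u : ℝ, Real.exp u • f (-Real.exp u : ℝ) =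
      2 * ((ρ (-Real.exp u) : ℂ) * cker ξ (u + π * I)) := fun u => by
    simp only [hf]
    rw [exp_smul_neg_div, hℓ]
    push_cast; ring
  have j0 : Integrable fun u : ℝ => Real.exp u • f (Real.exp u : ℝ) := by
    simp only [k0]; exact i0.const_mul _
  have j1 : Integrable fun u : ℝ => Real.exp u • f (-Real.exp u : ℝ) := by
    simp only [k1]; exact i1.const_mul _
  obtain ⟨r1, r2⟩ := integrable_and_integral_real_line (f := fun x : ℝ => f x) j0 j1
  set H : ℝ → ℂ := fun u => Real.exp u • f (Real.exp u : ℝ) + Real.exp u • f (-Real.exp u : ℝ) with hH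
  have hHi : Integrable H := j0.add j1
  have hreal : (∫ x in Iic (-D.q₀), f (x : ℂ)) + (∫ x in Ici D.q₀, f (x : ℂ))
      - (∫ x in (-D.q₀)..D.q₀, f (x : ℂ)) = ∫ u in Ioi c, (H u - H (2 * c - u)) := by
    have a1 : ∫ x in Ici D.q₀, f (x : ℂ) = ∫ u in Ioi c, Real.exp u • f (Real.exp u : ℝ) := by
      rw [integral_Ici_eq_integral_Ioi, ← hexpc, ← exp_image_Ioi,
        integral_exp_image measurableSet_Ioi fun x : ℝ => f x]
    have a2 : ∫ x in Iic (-D.q₀), f (x : ℂ) = ∫ u in Ioi c, Real.exp u • f (-Real.exp u : ℝ) := by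
      rw [integral_Iic_eq_integral_Iio, ← hexpc, ← neg_exp_image_Ioi,
        integral_neg_exp_image measurableSet_Ioi fun x : ℝ => f x]
    have a3 := integral_Iic_sub_Iic (a := -D.q₀) (b := D.q₀) r1.integrableOn
      r1.integrableOn
    have a4 := integral_Iic_add_Ioi (b := D.q₀) r1.integrableOn r1.integrableOn
    rw [← integral_Ici_eq_integral_Ioi, r2] at a4
    have a5 := integral_Iic_add_Ioi (b := c) hHi.integrableOn hHi.integrableOn
    have a6 : ∫ u in Ioi c, H u = (∫ u in Ioi c, Real.exp u • f (Real.exp u : ℝ)) +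
        ∫ u in Ioi c, Real.exp u • f (-Real.exp u : ℝ) :=
      integral_add j0.integrableOn j1.integrableOn
    have a7 := integral_sub (hHi.integrableOn (s := Ioi c)) (hHi.comp_sub_left (2 * c)).integrableOn
    rw [integral_Iic_eq_integral_Iio, setIntegral_Iio_reflect] at a5
    rw [a7, ← a3]
    rw [← a1, ← a2] at a6
    linear_combination -a4 + a5 - 2 * a6
  have e0 := StripLog.integrableOn_boundary hadm h0 h1
  have d0 := hG.identity hadm h0 h1
  obtain ⟨e1, d1⟩ := hG.identity_refl hadm hξ h0 h1
  have hreal2 : ∫ u in Ioi c, (H u - H (2 * c - u)) = -((∫ u in Ioi c,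
      (2 * ((G (u : ℝ)).re : ℂ) * cker ξ u
        - 2 * ((G ((u : ℝ) + π * I)).re : ℂ) * cker ξ (u + π * I)))
      + ∫ u in Ioi c, (2 * ((G (u : ℝ)).re : ℂ) * rker c ξ u
        - 2 * ((G ((u : ℝ) + π * I)).re : ℂ) * rker c ξ (u + π * I))) := by
    rw [← integral_add e0 e1, ← integral_neg]
    refine setIntegral_congr_fun measurableSet_Ioi fun u hu => ?_
    have t1 : rker c ξ u = cker ξ ((2 * c - u : ℝ) + π * I) := by rw [rker]; push_cast; rfl
    have t2 : rker c ξ (u + π * I) = cker ξ (2 * c - u : ℝ) := by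
      rw [rker]; congr 1; push_cast; ring
    simp only [hH, k0, k1]
    rw [t1, t2, s0, s1, hρ0 u hu, hρ1 u hu]
    ring
  have hcirc : ∀ φ : ℝ, circleMap 0 D.q₀ φ = exp (c + φ * I) := fun φ => by
    rw [circleMap_zero, exp_add, ← ofReal_exp, hexpc]
  have harc' : ∀ y ∈ Icc 0 π, ℓ (exp (c + (-y : ℝ) * I)) =
      conj (C - (G (c + y * I) + G (c + (π - y : ℝ) * I))) := fun y hy => by
    rw [← harc y hy, ← hconj, ← exp_conj]
    simp
  have hker : ∀ y : ℝ, cker ξ (c + (-y : ℝ) * I) = conj (cker (conj ξ) (c + y * I)) := fun y => by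
    rw [conj_cker, conj_conj]; simp
  have hint : ∀ φ : ℝ, f (circleMap 0 D.q₀ φ) * (I * circleMap 0 D.q₀ φ) =
      I * (ℓ (exp (c + φ * I)) * cker ξ (c + φ * I)) := fun φ => by
    simp only [hf, hcirc, cker]; ring
  have hn' : ‖conj ξ‖ ≠ Real.exp c := by rwa [norm_conj]
  have c1 : ∫ φ in (0 : ℝ)..π, f (circleMap 0 D.q₀ φ) * (I * circleMap 0 D.q₀ φ) =
      I * ∫ y in 0..π, (C - (G (c + y * I) + G (c + (π - y : ℝ) * I))) * cker ξ (c + y * I) := by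
    simp only [hint]
    rw [intervalIntegral.integral_const_mul]
    congr 1
    refine intervalIntegral.integral_congr fun y hy => ?_
    rw [uIcc_of_le hpi.le] at hy
    rw [harc y hy]
  have c2 : ∫ φ in (-π)..(0 : ℝ), f (circleMap 0 D.q₀ φ) * (I * circleMap 0 D.q₀ φ) =
      I * conj (∫ y in 0..π, (C - (G (c + y * I)
        + G (c + (π - y : ℝ) * I))) * cker (conj ξ) (c + y * I)) := by
    have := intervalIntegral.integral_comp_neg (a := 0) (b := π) fun φ : ℝ =>
      f (circleMap 0 D.q₀ φ) * (I * circleMap 0 D.q₀ φ)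
    rw [neg_zero] at this
    rw [← this]
    simp only [hint]
    rw [intervalIntegral.integral_const_mul, ← intervalIntegral_conj]
    congr 1
    refine intervalIntegral.integral_congr fun y hy => ?_
    rw [uIcc_of_le hpi.le] at hy
    rw [harc' y hy, hker, map_mul]
  have b3 : (∫ y in 0..π, cker ξ (c + y * I)) + conj (∫ y in 0..π, cker (conj ξ) (c + y * I)) =
      if ‖ξ‖ < D.q₀ then (2 * π : ℂ) else 0 := by
    rw [← hexpc, ← integral_cker ξ hn, ← intervalIntegral_conj]
    have := intervalIntegral.integral_comp_neg (a := 0) (b := π) fun y : ℝ => cker ξ (c + y * I)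
    rw [neg_zero] at this
    simp only [← hker]
    rw [this, add_comm]
    exact integral_add_adjacent_intervals ((continuous_cker_edge hn).intervalIntegrable _ _)
      ((continuous_cker_edge hn).intervalIntegrable _ _)
  have hrk : ∀ y : ℝ, conj (rker c (conj ξ) (c + y * I)) = rker c ξ (c - y * I) :=
    fun y => by
      rw [(rker_edge c _ y).1, (rker_edge c ξ y).2, conj_cker, conj_conj]
      simp [sub_eq_add_neg]
  have hck : ∀ y : ℝ, conj (cker (conj ξ) (c + y * I)) = cker ξ (c - y * I) :=
    fun y => by rw [← hker]; push_cast; rw [neg_mul, sub_eq_add_neg]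
  refine ⟨⟨r1, ?_⟩, ?_⟩
  · have hm : IntervalIntegrable (fun y : ℝ => C - (G (c + y * I)
        + G (c + (π - y : ℝ) * I))) volume 0 π := by
      have hg := hG.intervalIntegrable_edge
      have hg' := hg.comp_sub_left π
      rw [sub_zero, sub_self] at hg'
      exact intervalIntegrable_const.sub (hg.add hg'.symm)
    have n1 : IntervalIntegrable (fun y : ℝ => ℓ (exp (c + y * I))) volume 0
        π := hm.congr_uIoo fun y hy => by
      rw [Set.uIoo_of_le hpi.le] at hy
      exact (harc y (Ioo_subset_Icc_self hy)).symm
    have n2 : IntervalIntegrable (fun y : ℝ => ℓ (exp (c + y * I))) volume (-π) 0 := by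
      have := (intervalIntegrable_conj n1).comp_sub_left 0
      rw [sub_zero, zero_sub] at this
      refine this.symm.congr_uIoo fun y _ => ?_
      simp only
      rw [← hconj, ← exp_conj]
      simp
    refine ((n2.trans n1).mul_continuousOn (g := fun φ : ℝ => (circleMap 0 D.q₀ φ - ξ)⁻¹) ?_).congr_uIoo
      fun φ _ => ?_
    · refine Continuous.continuousOn (Continuous.inv₀ (by fun_prop) fun φ => sub_ne_zero.2 ?_)
      rw [hcirc]
      exact exp_add_mul_I_ne hn
    · simp only [hf, hcirc, div_eq_mul_inv]
  · rw [contourIntegral, hreal, hreal2, c1, c2, hG.arc_integrals C hn, hG.arc_integrals C hn', d0,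
      d1, hexpc]
    generalize conj (res G c (conj (-(D.q₀ : ℂ) ^ 2 * ξ⁻¹))) = R
    simp only [map_sub, map_mul, ← intervalIntegral_conj, hC, hrk, hck] at b3 ⊢
    have b4 : (if ‖ξ‖ < D.q₀ then (2 * π : ℂ) else 0) * C =
        2 * π * if ‖ξ‖ < D.q₀ then C else 0 := by split_ifs <;> ring
    linear_combination -I * C * b3 - I * b4

end NZProfile

theorem continuousOn_log_of_im_nonneg : ContinuousOn Complex.log {η | η ≠ 0 ∧ 0 ≤ η.im} := by
  rintro η ⟨h1, h2⟩
  by_cases hs : η ∈ slitPlane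
  · exact (continuousAt_clog hs).continuousWithinAt
  · rw [mem_slitPlane_iff] at hs
    push Not at hs
    refine (Complex.continuousWithinAt_log_of_re_neg_of_im_zero (lt_of_le_of_ne hs.1 fun h => h1
      (ext h hs.2)) hs.2).mono fun _ h => h.2

theorem log_exp_edge (c : ℝ) {y : ℝ} (hy : y ∈ Icc 0 π) :
    Complex.log (exp (c + y * I)) = c + y * I := by
  have := pi_pos
  exact Complex.log_exp (by simpa using by linarith [hy.1]) (by simpa using hy.2)

theorem neg_conj_exp_edge (c y : ℝ) : -conj (exp (c + y * I)) = exp (c + (π - y : ℝ) * I) := by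
  rw [← exp_conj, ← exp_add_pi_mul_I]
  congr 1; simp
  ring

theorem exp_edge_im_nonneg (c : ℝ) {y : ℝ} (hy : y ∈ Icc 0 π) : 0 ≤ (exp (c + y * I)).im := by
  rw [exp_im]
  exact mul_nonneg (exp_pos _).le
    (Real.sin_nonneg_of_nonneg_of_le_pi (by simpa using hy.1) (by simpa using hy.2))

theorem norm_exp_edge (c y : ℝ) : ‖exp (c + y * I)‖ = Real.exp c := by simp [norm_exp]

theorem log_eq_edge {c : ℝ} {η : ℂ} (hn : ‖η‖ = Real.exp c) (hi : 0 ≤ η.im) :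
    arg η ∈ Icc 0 π ∧ Complex.log η = c + (arg η) * I ∧ η = exp (c + (arg η) * I) := by
  have h : Complex.log η = c + (arg η) * I := by rw [Complex.log, hn, log_exp]
  have h0 : η ≠ 0 := norm_pos_iff.1 (hn ▸ exp_pos c)
  exact ⟨⟨Complex.arg_nonneg_iff.2 hi, Complex.arg_le_pi η⟩, h, by rw [← h, exp_log h0]⟩

/-- The values `C - G(log η) - G(log (-η̄))` on the upper semicircle. -/
def arcLog (G : ℂ → ℂ) (C η : ℂ) : ℂ := C - (G (Complex.log η) + G (Complex.log (-conj η)))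

theorem arcLog_exp (G : ℂ → ℂ) (C : ℂ) (c : ℝ) {y : ℝ} (hy : y ∈ Icc 0 π) :
    arcLog G C (exp (c + y * I)) = C - (G (c + y * I) + G (c + (π - y : ℝ) * I)) := by
  have hy' : π - y ∈ Icc 0 π := ⟨by linarith [hy.2], by linarith [hy.1]⟩
  rw [arcLog, neg_conj_exp_edge, log_exp_edge c hy, log_exp_edge c hy']

namespace NZProfile

/-- The logarithm of `1 + r(η) conj(r(η̄))` along the contour, built from a logarithm `G` of `a`
without its zeros. -/
def contourLog (D : NZProfile) (G : ℂ → ℂ) (C η : ℂ) : ℂ :=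
  if η.im = 0 then ((-2 * log ‖D.a 1 η‖ : ℝ) : ℂ)
  else if 0 < η.im then arcLog G C η else conj (arcLog G C (conj η))

variable {D : NZProfile}

theorem contourLog_conj (G : ℂ → ℂ) (C η : ℂ) :
    D.contourLog G C (conj η) = conj (D.contourLog G C η) := by
  unfold contourLog
  rcases lt_trichotomy η.im 0 with h | h | h
  · have h1 : 0 < (conj η).im := by simpa using h
    rw [if_neg h1.ne', if_pos h1, if_neg h.ne, if_neg h.le.not_gt, conj_conj]
  · simp only [Complex.conj_eq_iff_im.2 h, if_pos h, conj_ofReal]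
  · have h1 : (conj η).im < 0 := by simpa using h
    rw [if_neg h1.ne, if_neg h1.le.not_gt, if_neg h.ne', if_pos h, conj_conj]

theorem continuousOn_puncturedContour {ℓ : ℂ → ℂ} (hconj : ∀ η, ℓ (conj η) = conj (ℓ η))
    (h1 : ContinuousOn ℓ {η | η ≠ 0 ∧ η.im = 0})
    (h2 : ContinuousOn ℓ {η | η ≠ I * D.q₀ ∧ ‖η‖ = D.q₀ ∧ 0 ≤ η.im}) :
    ContinuousOn ℓ D.puncturedContour := by
  set S := {η : ℂ | η ≠ I * D.q₀ ∧ ‖η‖ = D.q₀ ∧ 0 ≤ η.im} with hS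
  have h3 : ContinuousOn ℓ (conj ⁻¹' S) := by
    refine ((continuous_conj.comp_continuousOn (h2.comp
      continuous_conj.continuousOn fun η hη => hη))).congr fun η _ => ?_
    simp only [Function.comp_apply, hconj, conj_conj]
  have hcl : IsClosed {η : ℂ | ‖η‖ = D.q₀ ∧ 0 ≤ η.im} :=
    (isClosed_eq continuous_norm continuous_const).inter
      (isClosed_le continuous_const continuous_im)
  intro η hη
  obtain ⟨hc, h0⟩ := hη
  simp only [mem_insert_iff, mem_singleton_iff, not_or] at h0
  have hsub : D.puncturedContour ⊆ {η | η ≠ 0 ∧ η.im = 0} ∪ (S ∪ conj ⁻¹' S) := by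
    rintro w ⟨hc, h0⟩
    simp only [mem_insert_iff, mem_singleton_iff, not_or] at h0
    rcases hc with hc | hc
    · exact Or.inl ⟨h0.1, hc⟩
    rcases le_total 0 w.im with hi | hi
    · exact Or.inr (Or.inl ⟨h0.2.1, hc, hi⟩)
    · refine Or.inr (Or.inr ⟨fun h => h0.2.2 ?_, by simpa using hc, by simpa using hi⟩)
      rw [← conj_conj w, h]
      simp
  refine ContinuousWithinAt.mono (ContinuousWithinAt.union ?_ (ContinuousWithinAt.union ?_ ?_)) hsub
  · by_cases h : η.im = 0
    · exact h1 η ⟨h0.1, h⟩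
    · exact continuousWithinAt_of_notMem_closure fun hm => h (closure_minimal (fun w hw => hw.2)
        (isClosed_eq continuous_im continuous_const) hm)
  · by_cases h : ‖η‖ = D.q₀ ∧ 0 ≤ η.im
    · exact h2 η ⟨h0.2.1, h⟩
    · exact continuousWithinAt_of_notMem_closure fun hm => h (closure_minimal (fun w hw => hw.2)
        hcl hm)
  · by_cases h : ‖conj η‖ = D.q₀ ∧ 0 ≤ (conj η).im
    · refine h3 η ⟨fun h4 => h0.2.2 ?_, h⟩
      rw [← conj_conj η, h4]
      simp
    · exact continuousWithinAt_of_notMem_closure fun hm => h (closure_minimal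
        (t := conj ⁻¹' {η : ℂ | ‖η‖ = D.q₀ ∧ 0 ≤ η.im}) (fun w hw => hw.2)
        (hcl.preimage continuous_conj) hm)

theorem lam_one_of_mem_puncturedContour {η : ℂ} (hη : η ∈ D.puncturedContour) :
    η ≠ 0 ∧ (D.lam 1 η).im = 0 ∧ D.lam 1 η ≠ 0 := by
  obtain ⟨hc, h0⟩ := hη
  simp only [mem_insert_iff, mem_singleton_iff, not_or] at h0
  refine ⟨h0.1, ?_, fun h => ((lam_one_eq_zero_iff h0.1).1 h).elim h0.2.1 h0.2.2⟩
  rw [lam_im_one]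
  rcases hc with h | h <;> simp [h]

theorem exp_eq_one_add_r (h : D.Decays 1) {η l : ℂ} (hη : η ∈ D.puncturedContour)
    (hl : exp l * (D.a 1 η * conj (D.a 1 (conj η))) = 1) :
    exp l = 1 + D.r 1 η * conj (D.r 1 (conj η)) := by
  obtain ⟨h0, h1, h2⟩ := lam_one_of_mem_puncturedContour hη
  have h3 := a_mul_add_b_mul h abs_one h0 h1 h2
  have h4 : D.a 1 η * conj (D.a 1 (conj η)) ≠ 0 := right_ne_zero_of_mul (hl ▸ one_ne_zero)
  have h5 := left_ne_zero_of_mul h4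
  have h6 := right_ne_zero_of_mul h4
  rw [r, r, map_div₀]
  refine mul_right_cancel₀ h4 (hl.trans ?_)
  field_simp
  rw [← h3]
  push_cast; ring

end NZProfile

namespace NZProfile

variable {D : NZProfile}

theorem focusing (h : D.Decays 1) (hns : D.NoSpectralSingularity) {N p : ℕ} (hp : p ≠ 0)
    {ζs : Fin N → ℂ} (henum : D.EnumeratesZeros ζs)
    (hord : ∀ j, ∃ g, AnalyticAt ℂ g (ζs j) ∧ g (ζs j) ≠ 0 ∧
      ∀ᶠ w in 𝓝 (ζs j), D.a 1 w = (w - ζs j) ^ p * g w) :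
    ∃ ℓ : ℂ → ℂ, D.IsContourLog ℓ ∧
      (∀ ζ ∈ D.D₁ ∪ D.D₂, D.ContourIntegrable (fun η => ℓ η / (η - ζ))) ∧
      D.ContourIntegrable (fun η => ℓ η / η) ∧
      (∀ ζ ∈ D.D₁, D.a 1 ζ = exp (-(1 / (2 * π * I)) * D.contourIntegral (fun η => ℓ η / (η - ζ)))
            * blaschkeF D.q₀ p ζs ζ * exp (I * D.omega0 1)) ∧
      (∀ ζ ∈ D.D₂, D.aTilde 1 ζ = exp ((1 / (2 * π * I)) *
              D.contourIntegral (fun η => ℓ η / (η - ζ)))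
            * (blaschkeF D.q₀ p ζs ζ)⁻¹ * exp (-(I * D.omega0 1))) ∧
      ∃ n : ℤ, ((arg (D.qp / D.qm) - 2 * D.omega0 1 : ℝ) : ℂ) = ((4 * p * ∑ j, arg (ζs j) : ℝ) : ℂ)
          + 1 / (2 * π) * D.contourIntegral (fun η => ℓ η / η)
          + 2 * π * n := by
  obtain ⟨G, hG, haG, hbl, hmid⟩ := exists_focusing_log h hns hp henum hord
  have hq0 := D.q₀_pos
  have hpi := pi_pos
  have hexpc : Real.exp (log D.q₀) = D.q₀ := Real.exp_log hq0
  set c := log D.q₀ with hc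
  set s := exp (I * D.omega0 1) with hs
  have hs0 : s ≠ 0 := exp_ne_zero _
  have hs1 : ‖s‖ = 1 := norm_exp_omega0 _
  have hss : s * conj s = 1 := by rw [mul_conj, normSq_eq_norm_sq, hs1]; simp
  have hz : ∀ j, D.q₀ < ‖ζs j‖ ∧ 0 < (ζs j).im := fun j => by
    have : ζs j ∈ range ζs := ⟨j, rfl⟩
    rw [henum.2] at this
    exact ⟨this.1, this.2.1⟩
  have hz0 : ∀ j, ζs j ≠ 0 := fun j => norm_pos_iff.1 (hq0.trans (hz j).1)
  set W : ℂ := (∏ j, (ζs j / conj (ζs j))) ^ (2 * p) with hW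
  have hW0 : W ≠ 0 := pow_ne_zero _ (prod_ne_zero_iff.2 fun j _ =>
    div_ne_zero (hz0 j) (by simpa using hz0 j))
  -- the real axis
  have hbreal : ∀ x : ℝ, ‖blaschkeF D.q₀ p ζs x‖ = 1 := fun x => by
    refine norm_blaschkeF_ofReal _ _ (fun j hj => ?_) fun j hj => ?_
    · have := congrArg im hj
      rw [ofReal_im] at this
      exact (hz j).2.ne this
    · have := congrArg im hj
      have h1 := norm_pos_iff.2 (hz0 j)
      rw [ofReal_im, zrefl, im_neg_sq_mul_inv, norm_conj, conj_im] at this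
      have h2 := (hz j).2
      have h3 : D.q₀ ^ 2 * (ζs j).im / ‖ζs j‖ ^ 2 > 0 := by positivity
      rw [mul_neg, neg_div] at this
      linarith
  have hnorm : ∀ (x : ℝ) (w : ℂ), exp w = x → w ∈ cstrip c →
      w ≠ (c : ℂ) + (π / 2 : ℝ) * I → ‖D.a 1 x‖ = Real.exp (G w).re :=
    fun x w hx hw hwp => by
      rw [← hx, haG w hw hwp, norm_mul, norm_mul, hs1, hx, hbreal, mul_one, mul_one, norm_exp]
  have hre0 : ∀ u : ℝ, c ≤ u → ‖D.a 1 (Real.exp u : ℝ)‖ = Real.exp (G u).re := fun u hu =>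
    hnorm _ u (by simp) ⟨by simpa using hu, by simp, by simpa using hpi.le⟩ fun h1 => by
      have := congrArg im h1
      simp at this
      linarith
  have hre1 : ∀ u : ℝ, c ≤ u →
      ‖D.a 1 (-Real.exp u : ℝ)‖ = Real.exp (G (u + π * I)).re := fun u hu =>
    hnorm _ (u + π * I) (by rw [exp_add_pi_mul_I]; simp)
      ⟨by simpa using hu, by simpa using hpi.le, by simp⟩ fun h1 => by
        have := congrArg im h1
        simp at this
        linarith
  have hsymn : ∀ x : ℝ, x ≠ 0 → ‖D.a 1 (-(D.q₀ ^ 2 / x) : ℝ)‖ = ‖D.a 1 x‖ := fun x hx => by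
    rw [← norm_a_inv h abs_one hx]
    congr 4
    ring
  have ha0 : ∀ x : ℝ, x ≠ 0 → D.a 1 x ≠ 0 := by
    have key : ∀ x : ℝ, D.q₀ ≤ |x| → D.a 1 x ≠ 0 := fun x hx => by
      have h1 : 0 < |x| := hq0.trans_le hx
      have h2 : c ≤ log |x| := Real.log_le_log hq0 hx
      rw [← norm_pos_iff]
      rcases abs_choice x with h3 | h3
      · have := hre0 _ h2
        rw [Real.exp_log h1, h3] at this
        rw [this]; positivity
      · have := hre1 _ h2
        rw [Real.exp_log h1, h3, neg_neg] at this
        rw [this]; positivity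
    intro x hx
    rcases le_total D.q₀ |x| with h1 | h1
    · exact key x h1
    · rw [← norm_ne_zero_iff, ← hsymn x hx, norm_ne_zero_iff]
      refine key _ ?_
      have h2 : 0 < |x| := abs_pos.2 hx
      rw [abs_neg, abs_div, abs_of_pos (by positivity : 0 < D.q₀ ^ 2), le_div_iff₀ h2]
      nlinarith
  have ha1 : ∀ x : ℝ, x ≠ 0 → log ‖D.a 1 x‖ ≤ 0 := fun x hx => by
    have hx' : (x : ℂ) ≠ 0 := by exact_mod_cast hx
    have hl : D.lam 1 x ≠ 0 := fun h1 => by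
      rcases (lam_one_eq_zero_iff hx').1 h1 with h1 | h1 <;>
      · have := congrArg im h1
        simp at this
        linarith
    have := normSq_a_add h abs_one hx hl
    exact Real.log_nonpos (norm_nonneg _) (by nlinarith [sq_nonneg ‖D.b 1 x‖])
  have hρ0 : ∀ u : ℝ, c ≤ u → log ‖D.a 1 (Real.exp u : ℝ)‖ = (G u).re := fun u hu => by
    rw [hre0 u hu, log_exp]
  have hρ1 : ∀ u : ℝ, c ≤ u → log ‖D.a 1 (-Real.exp u : ℝ)‖ = (G (u + π * I)).re := fun u hu => by
    rw [hre1 u hu, log_exp]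
  obtain ⟨h0, h1⟩ := hG.integrableOn_re (s := -1) (by simp) (fun u hu => by
      rw [← hρ0 u hu.le]
      linarith [ha1 _ (exp_pos u).ne'])
    (fun u hu => by
      rw [← hρ1 u hu.le]
      linarith [ha1 _ (neg_ne_zero.2 (exp_pos u).ne')]) hmid
  -- the upper semicircle
  have hqq : conj (D.qp / D.qm) * (D.qp / D.qm) = 1 := by
    rw [conj_mul', norm_qp_div_qm]; simp
  have hedge : ∀ y ∈ Icc 0 π, (c : ℂ) + y * I ∈ cstrip c ∧ (c : ℂ) + y * I ∉ strip c := fun y hy =>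
    ⟨⟨by simp, by simpa using hy.1, by simpa using hy.2⟩, fun h2 => by simpa using h2.1⟩
  have hne : ∀ y : ℝ, y ≠ π / 2 → (c : ℂ) + y * I ≠ c + (π / 2 : ℝ) * I := fun y hy h2 => hy (by
    have := congrArg im h2
    simpa using this)
  have hE : ∀ y ∈ Icc 0 π, y ≠ π / 2 →
      D.a 1 (exp (c + y * I)) * conj (D.a 1 (conj (exp (c + y * I)))) * (D.qp / D.qm) = W * s ^ 2 *
        exp (G (c + y * I) + G (c + (π - y : ℝ) * I)) :=
    fun y hy hy2 => by
      have hy' : π - y ∈ Icc 0 π := ⟨by linarith [hy.2], by linarith [hy.1]⟩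
      have e1 := haG _ (hedge y hy).1 (hne y hy2)
      have e2 := haG _ (hedge _ hy').1 (hne _ fun h2 => hy2 (by linarith))
      have hb := hbl _ (hedge y hy).1 (hedge y hy).2
      have hn := norm_exp_edge c y
      have hup : exp (c + (π - y : ℝ) * I) ∈ D.upper 1 :=
        mem_upper_one (by rw [norm_exp_edge, hexpc]) (exp_edge_im_nonneg c hy')
      have h3 := a_inv_conj h abs_one hup
      rw [← neg_conj_exp_edge] at e2 h3
      set η := exp (c + y * I) with hη
      have hη0 : η ≠ 0 := exp_ne_zero _
      have hcη : conj η = (D.q₀ : ℂ) ^ 2 * η⁻¹ := by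
        have := mul_conj η
        rw [normSq_eq_norm_sq, hn, hexpc] at this
        field_simp
        rw [mul_comm, this]
        push_cast; rfl
      have h4 : D.inv 1 (conj (-conj η)) = conj η := by
        rw [inv, map_neg, conj_conj, hcη, inv_neg]
        push_cast; ring
      rw [h4] at h3
      have h5 : blaschkeF D.q₀ p ζs (-conj η) = W * (blaschkeF D.q₀ p ζs η)⁻¹ := by
        rw [← blaschkeF_inv hq0.ne' p hz0 hη0, hcη, neg_mul]
      rw [h3, map_mul, conj_conj, e1, e2, h5, exp_add]
      field_simp
      linear_combination hqq
  set C : ℂ := ((((G c).im + (G (c + π * I)).im : ℝ)) : ℂ) * I with hCdef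
  have hC : conj C = -C := by rw [hCdef, map_mul, conj_ofReal, conj_I, mul_neg]
  have hGre : (G (c + π * I)).re = (G c).re := by
    rw [← hρ0 c le_rfl, ← hρ1 c le_rfl, hexpc, ← hsymn _ hq0.ne', sq, mul_div_cancel_right₀ _ hq0.ne']
  have hsum : G c + G (c + π * I) = ((2 * (G c).re : ℝ) : ℂ) + C := by
    apply ext <;> simp [hCdef, hGre]
    ring
  have hCE : D.qp / D.qm = W * s ^ 2 * exp C := by
    have h2 := hE 0 ⟨le_rfl, hpi.le⟩ (by positivity)
    have h3 : exp (c + (0 : ℝ) * I) = (Real.exp c : ℝ) := by simp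
    rw [h3, conj_ofReal, mul_conj, normSq_eq_norm_sq, hre0 c le_rfl,
      ofReal_zero, zero_mul, add_zero, sub_zero, hsum, exp_add,
      ← ofReal_exp, sq, ← Real.exp_add, ← two_mul] at h2
    refine mul_left_cancel₀ (a := ((Real.exp (2 * (G c).re) : ℝ) : ℂ)) ?_ (h2.trans (by ring))
    exact_mod_cast (exp_pos _).ne'
  have harcv : ∀ y ∈ Icc 0 π, D.contourLog G C (exp (c + y * I)) =
      arcLog G C (exp (c + y * I)) := fun y hy => by
    have hend : C - (G c + G (c + π * I)) = ((-2 * (G c).re : ℝ) : ℂ) := by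
      rw [hsum]; push_cast; ring
    rcases hy.1.eq_or_lt with rfl | hy0
    · rw [arcLog_exp G C c hy, ofReal_zero, zero_mul, add_zero, sub_zero, hend, contourLog,
        if_pos (exp_real_im c), ← ofReal_exp, hρ0 c le_rfl]
    rcases hy.2.eq_or_lt with rfl | hy1
    · rw [arcLog_exp G C c hy, sub_self, ofReal_zero, zero_mul, add_zero,
        add_comm (G _), hend, contourLog, if_pos (exp_real_add_pi_im c), exp_add_pi_mul_I,
        ← ofReal_exp, ← Complex.ofReal_neg, hρ1 c le_rfl, hGre]
    · have h2 : 0 < (exp (c + y * I)).im :=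
        exp_im_pos ⟨by simpa using hy0, by simpa using hy1⟩
      rw [contourLog, if_neg h2.ne', if_pos h2]
  have hreal : ∀ x : ℝ, D.contourLog G C x = ((-2 * log ‖D.a 1 x‖ : ℝ) : ℂ) := fun x =>
    if_pos (ofReal_im x)
  have hlog : D.IsContourLog (D.contourLog G C) := by
    have hS : ∀ η ∈ {η : ℂ | η ≠ I * D.q₀ ∧ ‖η‖ = D.q₀ ∧ 0 ≤ η.im},
        ∃ y ∈ Icc 0 π, y ≠ π / 2 ∧ η = exp (c + y * I) ∧ Complex.log η = c + y * I := fun η hη => by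
      obtain ⟨h2, h3, h4⟩ := log_eq_edge (c := c) (hη.2.1.trans hexpc.symm) hη.2.2
      refine ⟨_, h2, fun h5 => hη.1 ?_, h4, h3⟩
      rw [h4, h5, exp_add]
      push_cast
      rw [Complex.exp_pi_div_two_mul_I, ← ofReal_exp, hexpc, mul_comm]
    have hup : ∀ η ∈ D.puncturedContour, 0 ≤ η.im →
        exp (D.contourLog G C η) * (D.a 1 η * conj (D.a 1 (conj η))) = 1 := by
      rintro η ⟨hc, hη⟩ hi
      simp only [mem_insert_iff, mem_singleton_iff, not_or] at hη
      rcases hc with hc | hc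
      · have hx : (η.re : ℂ) = η := ext rfl (by simpa using hc.symm)
        have hx0 : η.re ≠ 0 := fun h2 => hη.1 (by rw [← hx, h2, ofReal_zero])
        rw [← hx, hreal, conj_ofReal, mul_conj, normSq_eq_norm_sq,
          ← ofReal_exp, neg_mul, Real.exp_neg, ← Nat.cast_ofNat (R := ℝ), Real.exp_nat_mul,
          Real.exp_log (norm_pos_iff.2 (ha0 _ hx0))]
        have := norm_ne_zero_iff.2 (ha0 _ hx0)
        rw [← Complex.ofReal_mul, inv_mul_cancel₀ (pow_ne_zero _ this), Complex.ofReal_one]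
      · obtain ⟨y, hy, hy2, rfl, -⟩ := hS η ⟨hη.2.1, hc, hi⟩
        have h2 := hE y hy hy2
        rw [harcv y hy, arcLog_exp G C c hy, exp_sub]
        rw [hCE] at h2
        have h3 : W * s ^ 2 ≠ 0 := mul_ne_zero hW0 (pow_ne_zero _ hs0)
        have h4 := exp_ne_zero (G (c + y * I) + G (c + (π - y : ℝ) * I))
        rw [div_mul_eq_mul_div, div_eq_one_iff_eq h4]
        refine mul_left_cancel₀ h3 (Eq.trans ?_ h2)
        ring
    refine ⟨continuousOn_puncturedContour (contourLog_conj G C) ?_ ?_, fun η hη =>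
      exp_eq_one_add_r h hη ?_, fun x _ => by rw [hreal, ofReal_im]⟩
    · have h2 : ContinuousOn (fun η => (log ‖D.a 1 η‖ : ℝ)) {η | η ≠ 0 ∧ η.im = 0} := by
        refine ContinuousOn.log (ContinuousOn.norm ((continuousOn_a h abs_one).mono
          fun η hη => ⟨⟨hη.1, ?_⟩, fun h3 => ?_⟩)) fun η hη => norm_ne_zero_iff.2 ?_
        · rw [lam_im_one, hη.2]; simp
        · rcases (lam_one_eq_zero_iff hη.1).1 h3 with h4 | h4 <;>
          · have := hη.2
            rw [h4] at this
            simp at this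
            linarith
        · have hx : (η.re : ℂ) = η := ext rfl (by simpa using hη.2.symm)
          rw [← hx]
          exact ha0 _ fun h3 => hη.1 (by rw [← hx, h3, ofReal_zero])
      refine (Complex.continuous_ofReal.comp_continuousOn (h2.const_mul (-2))).congr fun η hη => ?_
      exact if_pos hη.2
    · set S := {η : ℂ | η ≠ I * D.q₀ ∧ ‖η‖ = D.q₀ ∧ 0 ≤ η.im} with hSdef
      have h2 : ContinuousOn (fun η => G (Complex.log η)) S := by
        refine hG.cont.comp (continuousOn_log_of_im_nonneg.mono fun η hη =>
          ⟨norm_pos_iff.1 (hη.2.1 ▸ hq0), hη.2.2⟩) fun η hη => ?_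
        obtain ⟨y, hy, hy2, -, h3⟩ := hS η hη
        rw [h3]
        exact ⟨(hedge y hy).1, by simpa using hne y hy2⟩
      have h3 : Set.MapsTo (fun η : ℂ => -conj η) S S := fun η hη => by
        refine ⟨fun h4 => hη.1 ?_, by simpa using hη.2.1, by simpa using hη.2.2⟩
        have := congrArg conj h4
        simpa using this
      refine ((continuousOn_const (c := C)).sub (h2.add (h2.comp
        continuous_conj.neg.continuousOn h3))).congr fun η hη => ?_
      obtain ⟨y, hy, -, rfl, -⟩ := hS η hη
      exact harcv y hy
    · rcases le_total 0 η.im with hi | hi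
      · exact hup η hη hi
      · have hη' : conj η ∈ D.puncturedContour := by
          obtain ⟨h2, h3⟩ := hη
          simp only [mem_insert_iff, mem_singleton_iff, not_or] at h3
          refine ⟨by simpa [contour] using h2, ?_⟩
          simp only [mem_insert_iff, mem_singleton_iff, not_or]
          refine ⟨by simpa using h3.1, fun h4 => h3.2.2 ?_, fun h4 => h3.2.1 ?_⟩ <;>
          · rw [← conj_conj η, h4]; simp
        have := congrArg conj (hup _ hη' (by simpa using hi))
        rwa [contourLog_conj, map_mul, ← exp_conj, map_mul, conj_conj,
          conj_conj, conj_conj, map_one, mul_comm (conj (D.a 1 (conj η)))] at this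
  -- the integrals
  have key : ∀ {ξ : ℂ}, (ξ = 0 ∨ ξ.im ≠ 0) → Admissible c ξ → _ := fun hξ hadm =>
    D.contourIntegral_eq hG (ρ := fun x => log ‖D.a 1 x‖) hreal h0 h1
      (fun u hu => hρ0 u hu.le) (fun u hu => hρ1 u hu.le)
      (fun x hx => by simp only [hsymn x hx]) hC
      (fun y hy => (harcv y hy).trans (arcLog_exp G C c hy)) (contourLog_conj G C) hξ hadm
  rw [← hc] at key
  set S : ℂ → ℂ := fun ξ => res G c (-(D.q₀ : ℂ) ^ 2 * ξ⁻¹)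
    - conj (res G c (conj (-(D.q₀ : ℂ) ^ 2 * ξ⁻¹))) - res G c ξ + conj (res G c (conj ξ))
    - if ‖ξ‖ < D.q₀ then C else 0 with hSdef
  have hadm : ∀ ζ ∈ D.D₁ ∪ D.D₂, ζ.im ≠ 0 ∧ Admissible c ζ := fun ζ hζ => by
    have h2 : (‖ζ‖ ^ 2 - D.q₀ ^ 2) * ζ.im ≠ 0 := hζ.elim (fun h => ne_of_gt h) fun h => ne_of_lt h
    have h3 := right_ne_zero_of_mul h2
    refine ⟨h3, ?_⟩
    rcases lt_trichotomy ‖ζ‖ D.q₀ with h4 | h4 | h4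
    · exact Or.inl (hexpc.symm ▸ h4)
    · rw [h4, sub_self, zero_mul] at h2
      exact (h2 rfl).elim
    · exact Or.inr ⟨hexpc.symm ▸ h4, h3⟩
  have hlogG : ∀ ζ : ℂ, Real.exp c < ‖ζ‖ → 0 < ζ.im →
      D.a 1 ζ = exp (G (Complex.log ζ)) * blaschkeF D.q₀ p ζs ζ * s := fun ζ hn hi => by
    have h6 := log_mem_strip hn hi
    have h7 := haG _ ⟨h6.1.le, h6.2.1.le, h6.2.2.le⟩ fun h8 => by simpa [h8] using h6.1
    rwa [exp_log (norm_pos_iff.1 ((exp_pos c).trans hn))] at h7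
  have hform : ∀ ζ ∈ D.D₁, D.a 1 ζ = exp (-S ζ) * blaschkeF D.q₀ p ζs ζ * s := fun ζ hζ => by
    have hζ0 : ζ ≠ 0 := fun h2 => by simp [h2, D₁] at hζ
    have hζn := norm_pos_iff.2 hζ0
    have hn := norm_neg_sq_mul_inv D.q₀ ζ
    have hi := im_neg_sq_mul_inv D.q₀ ζ
    rcases pos_and_pos_or_neg_and_neg_of_mul_pos
      (show 0 < (‖ζ‖ ^ 2 - D.q₀ ^ 2) * ζ.im from hζ) with ⟨h2, h3⟩ | ⟨h2, h3⟩
    · have h4 : D.q₀ < ‖ζ‖ := lt_of_pow_lt_pow_left₀ 2 hζn.le (by linarith)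
      have h5 : ‖-(D.q₀ : ℂ) ^ 2 * ζ⁻¹‖ ≤ Real.exp c := by
        rw [hn, hexpc, div_le_iff₀ hζn]; nlinarith
      have h7 := hlogG ζ (by rwa [hexpc]) h3
      have h8 : S ζ = -G (Complex.log ζ) := by
        simp only [hSdef]
        rw [res_of_norm_le h5, res_of_norm_le (by rwa [norm_conj]),
          res_of_im_pos (by rwa [hexpc]) h3, res_of_im_nonpos (by simpa using h3.le),
          if_neg h4.not_gt]
        simp
      rw [h8, neg_neg, h7]
    · have h4 : ‖ζ‖ < D.q₀ := lt_of_pow_lt_pow_left₀ 2 hq0.le (by linarith)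
      have h5 : Real.exp c < ‖conj (-(D.q₀ : ℂ) ^ 2 * ζ⁻¹)‖ := by
        rw [norm_conj, hn, hexpc, lt_div_iff₀ hζn]; nlinarith
      have h6 : (-(D.q₀ : ℂ) ^ 2 * ζ⁻¹).im < 0 := by
        rw [hi]; exact div_neg_of_neg_of_pos (mul_neg_of_pos_of_neg (by positivity) h3) (by positivity)
      have h7 : 0 < (conj (-(D.q₀ : ℂ) ^ 2 * ζ⁻¹)).im := by simpa only [conj_im, neg_pos]
      have h8 : S ζ = -conj (G (Complex.log (conj (-(D.q₀ : ℂ) ^ 2 * ζ⁻¹)))) - C := by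
        simp only [hSdef]
        rw [res_of_im_nonpos h6.le, res_of_im_pos h5 h7,
          res_of_norm_le (by rw [hexpc]; exact h4.le),
          res_of_norm_le (by rw [norm_conj, hexpc]; exact h4.le), if_pos h4]
        simp
      have h11 := a_inv_conj h abs_one (mem_upper_one (hexpc ▸ h5.le) h7.le)
      have h12 : D.inv 1 (conj (conj (-(D.q₀ : ℂ) ^ 2 * ζ⁻¹))) = ζ := by
        have : (D.q₀ : ℂ) ≠ 0 := D.q₀_ne
        rw [inv, conj_conj]
        push_cast
        field_simp
      rw [h12, hlogG _ h5 h7, hCE, map_mul, map_mul, conj_blaschkeF, conj_conj,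
        blaschkeF_inv hq0.ne' p hz0 hζ0, ← hW, mul_inv, inv_inv, ← exp_conj] at h11
      rw [h8, h11, neg_sub, sub_neg_eq_add, exp_add]
      field_simp
      linear_combination blaschkeF D.q₀ p ζs ζ * hss
  have h2pi := Complex.two_pi_I_ne_zero
  have hval : ∀ ζ ∈ D.D₁ ∪ D.D₂, 1 / (2 * π * I) *
      D.contourIntegral (fun η => D.contourLog G C η / (η - ζ)) = S ζ := fun ζ hζ => by
    rw [(key (Or.inr (hadm ζ hζ).1) (hadm ζ hζ).2).2, ← mul_assoc, one_div_mul_cancel h2pi, one_mul]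
  obtain ⟨hz1, hz2⟩ := key (ξ := 0) (Or.inl rfl) (Or.inl (by simpa using exp_pos c))
  simp only [sub_zero] at hz1 hz2
  refine ⟨D.contourLog G C, hlog, fun ζ hζ => (key (Or.inr (hadm ζ hζ).1) (hadm ζ hζ).2).1, hz1,
    fun ζ hζ => ?_, fun ζ hζ => ?_, ?_⟩
  · rw [neg_mul, hval ζ (Or.inl hζ)]
    exact hform ζ hζ
  · have hζ' : conj ζ ∈ D.D₁ := by
      have : (‖ζ‖ ^ 2 - D.q₀ ^ 2) * ζ.im < 0 := hζ
      show 0 < (‖conj ζ‖ ^ 2 - D.q₀ ^ 2) * (conj ζ).im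
      rw [norm_conj, conj_im]
      linarith
    have hζ0 : ζ ≠ 0 := fun h2 => by simp [h2, D₂] at hζ
    have hl : (D.lam 1 ζ).im ≤ 0 := by
      rw [D₁_eq] at hζ'
      have : 0 < (D.lam 1 (conj ζ)).im := hζ'
      rw [lam_conj, conj_im] at this
      linarith
    have hSc : conj (S (conj ζ)) = -S ζ := by
      have : conj (-(D.q₀ : ℂ) ^ 2 * (conj ζ)⁻¹) = -(D.q₀ : ℂ) ^ 2 * ζ⁻¹ := by simp
      have h3 : -(D.q₀ : ℂ) ^ 2 * (conj ζ)⁻¹ = conj (-(D.q₀ : ℂ) ^ 2 * ζ⁻¹) := by simp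
      simp only [hSdef]
      rw [this, h3, norm_conj, conj_conj]
      simp only [map_sub, map_add, conj_conj, apply_ite conj, hC, map_zero]
      split_ifs <;> ring
    rw [hval ζ (Or.inr hζ), aTilde_eq abs_one h hζ0 hl, hform _ hζ', map_mul, map_mul, conj_blaschkeF,
      conj_conj, ← exp_conj, map_neg, hSc, neg_neg, hs, ← exp_conj, map_mul,
      conj_I, conj_ofReal, neg_mul]
  · have hr : res G c 0 = 0 := res_of_im_nonpos (by simp)
    simp only [inv_zero, mul_zero, map_zero, hr, norm_zero, hq0, if_true, sub_zero, add_zero,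
      zero_sub] at hz2
    set θ := (G c).im + (G (c + π * I)).im with hθ
    have hEq : exp (((arg (D.qp / D.qm) : ℝ) : ℂ) * I) =
        exp (((4 * p * ∑ j, arg (ζs j) + 2 * D.omega0 1 + θ : ℝ) : ℂ) * I) := by
      have h2 : ∀ j, ζs j / conj (ζs j) = exp ((2 * arg (ζs j)) * I) :=
        fun j => by
          rw [← inv_div, conj_div_self_eq (hz0 j), ← exp_neg]
          congr 1; ring
      rw [exp_log_arg norm_qp_div_qm, hCE, hW, hs, hCdef]
      simp only [h2]
      rw [← exp_sum, ← exp_nat_mul, ← exp_nat_mul, ← exp_add, ← exp_add]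
      congr 1
      push_cast
      rw [← Finset.sum_mul, ← Finset.mul_sum]
      ring
    obtain ⟨n, hn⟩ := Complex.exp_eq_exp_iff_exists_int.1 hEq
    refine ⟨n, ?_⟩
    have h3 : ((arg (D.qp / D.qm) : ℝ) : ℂ) =
        ((4 * p * ∑ j, arg (ζs j) + 2 * D.omega0 1 + θ : ℝ) : ℂ) + n * (2 * π) :=
      mul_right_cancel₀ I_ne_zero (hn.trans (by ring))
    have h4 : (π : ℂ) ≠ 0 := by exact_mod_cast hpi.ne'
    rw [ofReal_sub, h3, hz2, hCdef]
    push_cast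
    field_simp
    linear_combination (θ : ℂ) * I_sq

end NZProfile

theorem blaschkeF_eq_prod {N : ℕ} (q : ℝ) (p : ℕ) (zs : Fin N → ℂ) (ζ : ℂ) :
    blaschkeF q p zs ζ = ∏ j, ((ζ - zs j) ^ p * (ζ + q ^ 2 * (conj (zs j))⁻¹) ^ p) /
      ((ζ - conj (zs j)) ^ p * (ζ + q ^ 2 * (zs j)⁻¹) ^ p) := by
  rw [blaschkeF, blaschke, blaschke, ← prod_mul_distrib, ← prod_pow]
  refine prod_congr rfl fun j _ => ?_
  rw [mul_pow, div_pow, div_pow, div_mul_div_comm]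
  simp [zrefl]

theorem inv_blaschkeF_eq_prod {N : ℕ} (q : ℝ) (p : ℕ) (zs : Fin N → ℂ) (ζ : ℂ) :
    (blaschkeF q p zs ζ)⁻¹ = ∏ j, ((ζ - conj (zs j)) ^ p * (ζ + q ^ 2 * (zs j)⁻¹) ^ p) /
      ((ζ - zs j) ^ p * (ζ + q ^ 2 * (conj (zs j))⁻¹) ^ p) := by
  rw [blaschkeF_eq_prod, ← Finset.prod_inv_distrib]
  exact prod_congr rfl fun j _ => inv_div _ _

namespace NZProfile

theorem analyticAt_zero {D : NZProfile} (h : D.Decays 1) {N : ℕ} {ζs : Fin N → ℂ}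
    (henum : D.EnumeratesZeros ζs) (j : Fin N) :
    AnalyticAt ℂ (D.a 1) (ζs j) ∧ D.a 1 (ζs j) = 0 := by
  have : ζs j ∈ range ζs := ⟨j, rfl⟩
  rw [henum.2] at this
  exact ⟨(differentiableOn_a h abs_one).analyticAt
    ((D.isOpen_upper 1).mem_nhds (lam_im_one_pos this.1 this.2.1)), this.2.2⟩

end NZProfile

end KE

end

theorem mainTheorem9 :
    -- the defocusing equation
    (∀ (D : KE.NZProfile), D.Decays 2 →
      ∀ (N : ℕ) (ζs : Fin N → ℂ), Function.Injective ζs →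
      Set.range ζs = {ζ : ℂ | 0 < ζ.im ∧ D.a (-1) ζ = 0} →
      Integrable (fun x : ℝ => ‖D.q x‖ ^ 2 - D.q₀ ^ 2) ∧
      (∀ ζ : ℂ, ζ.im ≠ 0 →
        Integrable (fun η : ℝ => (Real.log (1 - ‖D.r (-1) η‖ ^ 2) : ℂ) / (η - ζ))) ∧
      Integrable (fun η : ℝ => Real.log (1 - ‖D.r (-1) η‖ ^ 2) / η) ∧
      (∀ ζ : ℂ, 0 < ζ.im →
        D.a (-1) ζ =
          Complex.exp (-(1 / (2 * Real.pi * Complex.I)) *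
              ∫ η : ℝ, (Real.log (1 - ‖D.r (-1) η‖ ^ 2) : ℂ) / (η - ζ))
            * (∏ j, (ζ - ζs j) / (ζ - conj (ζs j)))
            * Complex.exp (Complex.I * D.omega0 (-1))) ∧
      (∀ ζ : ℂ, ζ.im < 0 →
        D.aTilde (-1) ζ =
          Complex.exp ((1 / (2 * Real.pi * Complex.I)) *
              ∫ η : ℝ, (Real.log (1 - ‖D.r (-1) η‖ ^ 2) : ℂ) / (η - ζ))
            * (∏ j, (ζ - conj (ζs j)) / (ζ - ζs j))
            * Complex.exp (-(Complex.I * D.omega0 (-1)))) ∧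
      ∃ n : ℤ, Complex.arg (D.qp / D.qm) - 2 * D.omega0 (-1) =
        2 * (∑ j, Complex.arg (ζs j))
          + 1 / (2 * Real.pi) * (∫ η : ℝ, Real.log (1 - ‖D.r (-1) η‖ ^ 2) / η)
          + 2 * Real.pi * n) ∧
    -- the focusing equation, simple zeros
    (∀ (D : KE.NZProfile), D.Decays 1 → D.NoSpectralSingularity →
      ∀ (N : ℕ) (ζs : Fin N → ℂ), D.EnumeratesZeros ζs →
      (∀ j, deriv (D.a 1) (ζs j) ≠ 0) →
      Integrable (fun x : ℝ => ‖D.q x‖ ^ 2 - D.q₀ ^ 2) ∧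
      ∃ ℓ : ℂ → ℂ, D.IsContourLog ℓ ∧
      (∀ ζ ∈ D.D₁ ∪ D.D₂, D.ContourIntegrable (fun η => ℓ η / (η - ζ))) ∧
      D.ContourIntegrable (fun η => ℓ η / η) ∧
      (∀ ζ ∈ D.D₁,
        D.a 1 ζ =
          Complex.exp (-(1 / (2 * Real.pi * Complex.I)) *
              D.contourIntegral (fun η => ℓ η / (η - ζ)))
            * (∏ j, ((ζ - ζs j) * (ζ + D.q₀ ^ 2 * (conj (ζs j))⁻¹)) /
                ((ζ - conj (ζs j)) * (ζ + D.q₀ ^ 2 * (ζs j)⁻¹)))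
            * Complex.exp (Complex.I * D.omega0 1)) ∧
      (∀ ζ ∈ D.D₂,
        D.aTilde 1 ζ =
          Complex.exp ((1 / (2 * Real.pi * Complex.I)) *
              D.contourIntegral (fun η => ℓ η / (η - ζ)))
            * (∏ j, ((ζ - conj (ζs j)) * (ζ + D.q₀ ^ 2 * (ζs j)⁻¹)) /
                ((ζ - ζs j) * (ζ + D.q₀ ^ 2 * (conj (ζs j))⁻¹)))
            * Complex.exp (-(Complex.I * D.omega0 1))) ∧
      ∃ n : ℤ, ((Complex.arg (D.qp / D.qm) - 2 * D.omega0 1 : ℝ) : ℂ) =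
        ((4 * ∑ j, Complex.arg (ζs j) : ℝ) : ℂ)
          + 1 / (2 * Real.pi) * D.contourIntegral (fun η => ℓ η / η)
          + 2 * Real.pi * n) ∧
    -- the focusing equation, double zeros
    (∀ (D : KE.NZProfile), D.Decays 1 → D.NoSpectralSingularity →
      ∀ (N : ℕ) (ζs : Fin N → ℂ), D.EnumeratesZeros ζs →
      (∀ j, deriv (D.a 1) (ζs j) = 0 ∧ iteratedDeriv 2 (D.a 1) (ζs j) ≠ 0) →
      Integrable (fun x : ℝ => ‖D.q x‖ ^ 2 - D.q₀ ^ 2) ∧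
      ∃ ℓ : ℂ → ℂ, D.IsContourLog ℓ ∧
      (∀ ζ ∈ D.D₁ ∪ D.D₂, D.ContourIntegrable (fun η => ℓ η / (η - ζ))) ∧
      D.ContourIntegrable (fun η => ℓ η / η) ∧
      (∀ ζ ∈ D.D₁,
        D.a 1 ζ =
          Complex.exp (-(1 / (2 * Real.pi * Complex.I)) *
              D.contourIntegral (fun η => ℓ η / (η - ζ)))
            * (∏ j, ((ζ - ζs j) ^ 2 * (ζ + D.q₀ ^ 2 * (conj (ζs j))⁻¹) ^ 2) /
                ((ζ - conj (ζs j)) ^ 2 * (ζ + D.q₀ ^ 2 * (ζs j)⁻¹) ^ 2))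
            * Complex.exp (Complex.I * D.omega0 1)) ∧
      (∀ ζ ∈ D.D₂,
        D.aTilde 1 ζ =
          Complex.exp ((1 / (2 * Real.pi * Complex.I)) *
              D.contourIntegral (fun η => ℓ η / (η - ζ)))
            * (∏ j, ((ζ - conj (ζs j)) ^ 2 * (ζ + D.q₀ ^ 2 * (ζs j)⁻¹) ^ 2) /
                ((ζ - ζs j) ^ 2 * (ζ + D.q₀ ^ 2 * (conj (ζs j))⁻¹) ^ 2))
            * Complex.exp (-(Complex.I * D.omega0 1))) ∧
      ∃ n : ℤ, ((Complex.arg (D.qp / D.qm) - 2 * D.omega0 1 : ℝ) : ℂ) =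
        ((8 * ∑ j, Complex.arg (ζs j) : ℝ) : ℂ)
          + 1 / (2 * Real.pi) * D.contourIntegral (fun η => ℓ η / η)
          + 2 * Real.pi * n) := by
  refine ⟨fun D h N ζs hinj hrange => ⟨KE.NZProfile.integrable_normSq_sub h.one,
    KE.NZProfile.defocusing h.one hinj hrange⟩, fun D h hns N ζs henum hz => ?_,
    fun D h hns N ζs henum hz => ?_⟩
  · obtain ⟨ℓ, h1, h2, h3, h4, h5, h6⟩ := KE.NZProfile.focusing h hns one_ne_zero henum fun j =>
      KE.exists_factor_of_deriv_ne_zero (KE.NZProfile.analyticAt_zero h henum j).1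
        (KE.NZProfile.analyticAt_zero h henum j).2 (hz j)
    refine ⟨KE.NZProfile.integrable_normSq_sub h, ℓ, h1, h2, h3, fun ζ hζ => ?_, fun ζ hζ => ?_, ?_⟩
    · rw [h4 ζ hζ, KE.blaschkeF_eq_prod]
      simp only [pow_one]
    · rw [h5 ζ hζ, KE.inv_blaschkeF_eq_prod]
      simp only [pow_one]
    · simpa using h6
  · obtain ⟨ℓ, h1, h2, h3, h4, h5, h6⟩ := KE.NZProfile.focusing h hns two_ne_zero henum fun j =>
      KE.exists_factor_of_deriv_two_ne_zero (KE.NZProfile.analyticAt_zero h henum j).1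
        (KE.NZProfile.analyticAt_zero h henum j).2 (hz j).1 (hz j).2
    refine ⟨KE.NZProfile.integrable_normSq_sub h, ℓ, h1, h2, h3, fun ζ hζ => ?_, fun ζ hζ => ?_, ?_⟩
    · rw [h4 ζ hζ, KE.blaschkeF_eq_prod]
    · rw [h5 ζ hζ, KE.inv_blaschkeF_eq_prod]
    · have e : (4 * (2 : ℕ) : ℝ) = 8 := by norm_num
      rwa [e] at h6
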